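/- **Setting.** A circuit over a finite gate set $\mathcal G$ of unitary gates is a finite sequence of *locations*: preparations of a fresh qubit $|0\rangle$, applications of gates of $\mathcal G$ (a resting qubit is acted upon by identity gates), and measurements of single qubits in the computational basis. Every qubit is prepared before it is used, and nothing happens to a qubit after it has been measured. Let $C:\mathbb C^2\to(\mathbb C^2)^{\otimes m}$ be a code (an isometry) encoding one qubit into a *block* of $m$ qubits. Suppose we are given the following circuits, built from locations over $\mathcal G$ and using ancilla qubits that are freshly prepared and finally discarded: an error correction circuit (*1-EC*) acting on one block; for each gate $U\in\mathcal G$ on $n$ qubits a circuit (*1-Ga*) acting on $n$ blocks; a circuit preparing a block; and a circuit measuring some qubits of a block and ancillas, followed by a perfect classical computation of a logical outcome. Only the last of these contains measurements. We regard the preparation circuit as a 1-Ga without input blocks, for the preparation of $|0\rangle$, and the measurement circuit as a 1-Ga without output blocks, for the measurement in the computational basis. A location hit by a *fault* performs its ideal operation followed (for a measurement: preceded) by an arbitrary quantum channel on the qubits of the location. An encoded state *with at most one error* (respectively *with at most one error in each block*) is obtained from the encoded state by an operator that acts nontrivially on at most one qubit (respectively at most one qubit of each block), or by a linear combination of such operators;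 mixed outputs have a property if they are mixtures of pure states with the property. A state of a single block has at most one error if it lies in the span of the vectors $E\,C\psi$, where $E$ acts on one qubit and $\psi\in\mathbb C^2$. Without faults, the 1-Ga of a gate $U$ maps $C^{\otimes n}\psi$ to $C^{\otimes n}U\psi$ for all $\psi$, and the preparation circuit outputs $C|0\rangle$. In addition, assume: 1. a 1-EC without faults takes any pure state input to an output in the code space, and a 1-EC with at most one fault takes any pure state input to an output with at most one error; 2. a 1-EC without faults takes $C\psi$ with at most one error to $C\psi$ without errors; 3. a 1-EC with at most one fault takes $C\psi$ to $C\psi$ with at most one error; 4. a 1-Ga without faults for a gate $U$ takes $C^{\otimes n}\psi$ with at most one error to $C^{\otimes n}U\psi$ with at most one error in each output block; 5. a 1-Ga with at most one fault for a gate $U$ takes $C^{\otimes n}\psi$ to $C^{\otimes n}U\psi$ with at most one error in each output block. For the preparation circuit, 5 means that with at most one fault it outputs $C|0\rangle$ with at most one error. For the measurement circuit, 4 and 5 mean that on $C\psi$ with at most one error and no faults, and on $C\psi$ without errors and at most one fault, the logical outcome has the distribution of a measurement of $\psi$. The *1-Rec* of a gate is its 1-Ga followed by a 1-EC on every output block,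 the 1-Rec of a preparation is the preparation circuit followed by a 1-EC, and the 1-Rec of a measurement is the measurement circuit. A *1-exRec* is a 1-Rec together with the 1-ECs immediately preceding it, one on each input block. Given a circuit $M_0$, let $M_{k+1}$ be the circuit obtained from $M_k$ by replacing every location by its 1-Rec; the outcomes of $M_k$ are decoded recursively to outcomes of $M_0$. The *computation error* of $M_k$ is the $L_1$-distance between the distribution of its decoded outcomes and the outcome distribution of the ideal (fault-free) circuit $M_0$. **Theorem.** Let $A$ be the largest number of (unordered) pairs of locations in a 1-exRec. Let each location be hit by a fault with probability $\varepsilon$, independently of the others, where $0\le\varepsilon<1/A$. Then for every circuit $M_0$ and every $\delta>0$ there is a level $k$ such that $M_k$ simulates $M_0$ with computation error at most $\delta$, whatever the error channels of the faulty locations are. -/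

import Mathlib

open Matrix

namespace FTQC

/-! ### Qubits, operators and error channels

The qubits of a system are labelled by a finite type `W`; the state space is spanned by the
computational basis states `|x⟩`, `x : W → Bool`, so that (unnormalised) pure states are vectors
`(W → Bool) → ℂ` and density operators are matrices indexed by `W → Bool`. -/

/-- Vectors in the state space of a system of qubits labelled by `W`. -/
abbrev Vec (W : Type) : Type := (W → Bool) → ℂ

/-- Operators on the state space of a system of qubits labelled by `W`. -/
abbrev Op (W : Type) : Type := Matrix (W → Bool) (W → Bool) ℂ

/-- `A ⊗ 1`: the operator `A` acting on the qubits `e 0, e 1, …` of the system `W`. -/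
def embed {W : Type} [Fintype W] [DecidableEq W] {n : ℕ} (e : Fin n ↪ W) (A : Op (Fin n)) :
    Op W :=
  Matrix.of fun x y =>
    if ∀ w, (∀ i, e i ≠ w) → x w = y w then A (fun i => x (e i)) (fun i => y (e i)) else 0

/-- The operator `|a⟩⟨b|` of one qubit. -/
def ketBra (a b : Bool) : Op (Fin 1) :=
  Matrix.of fun x y => if x 0 = a ∧ y 0 = b then 1 else 0

/-- The single qubit `w` of `W`, as a one-term list of qubits. -/
def oneWire {W : Type} (w : W) : Fin 1 ↪ W :=
  ⟨fun _ => w, fun _ _ _ => Subsingleton.elim _ _⟩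

/-- `|v⟩⟨v|`. -/
def pureState {X : Type} (v : X → ℂ) : Matrix X X ℂ := Matrix.vecMulVec v (star v)

/-- `ρ` is the density operator of a mixture of pure states from `V`. -/
def IsMixture {X : Type} (V : Set (X → ℂ)) (ρ : Matrix X X ℂ) : Prop :=
  ∃ (r : ℕ) (v : Fin r → X → ℂ), (∀ j, v j ∈ V) ∧ ρ = ∑ j, pureState (v j)

/-- The computational basis state `|0 ⋯ 0⟩`. -/
def zeroVec (W : Type) [Fintype W] : Vec W := fun x => if ∀ w, x w = false then 1 else 0

/-- A quantum channel (completely positive trace preserving map) on `n` qubits, given by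
Kraus operators. -/
structure Channel (n : ℕ) where
  r : ℕ
  kraus : Fin r → Op (Fin n)
  complete : ∑ j, (kraus j)ᴴ * kraus j = 1

/-- The channel `E`, applied to the qubits `e 0, e 1, …` of the system `W`. -/
def Channel.on {W : Type} [Fintype W] [DecidableEq W] {n : ℕ} (E : Channel n) (e : Fin n ↪ W)
    (ρ : Op W) : Op W :=
  ∑ j, embed e (E.kraus j) * ρ * (embed e (E.kraus j))ᴴ

/-! ### Circuits -/

/-- A finite set of quantum gates: unitary operations, each on a fixed number of qubits. -/
structure GateSet where
  Gate : Type
  [fintypeGate : Fintype Gate]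
  arity : Gate → ℕ
  U : (g : Gate) → Matrix.unitaryGroup (Fin (arity g) → Bool) ℂ

attribute [instance] GateSet.fintypeGate

/-- A location of a circuit: the preparation of a fresh qubit `|0⟩` on the wire `w` (anything the
wire carried before is discarded), the application of a gate, or the measurement of the wire `w`
in the computational basis. A resting qubit is acted upon by explicit identity gates. -/
inductive Loc (𝒢 : GateSet) (W : Type) : Type
  | prep (w : W) : Loc 𝒢 W
  | gate (g : 𝒢.Gate) (e : Fin (𝒢.arity g) ↪ W) : Loc 𝒢 W
  | meas (w : W) : Loc 𝒢 W

namespace Loc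

variable {𝒢 : GateSet} {W W' : Type}

/-- The number of qubits on which a location acts. -/
def arity : Loc 𝒢 W → ℕ
  | prep _ => 1
  | gate g _ => 𝒢.arity g
  | meas _ => 1

/-- The qubits on which a location acts. -/
def wires : (l : Loc 𝒢 W) → Fin l.arity ↪ W
  | prep w => oneWire w
  | gate _ e => e
  | meas w => oneWire w

/-- Renaming of wires. -/
def map (f : W ↪ W') : Loc 𝒢 W → Loc 𝒢 W'
  | prep w => prep (f w)
  | gate g e => gate g (e.trans f)
  | meas w => meas (f w)

variable [Fintype W] [DecidableEq W]

/-- The fault-free effect of a location on the density operator. After a measurement the wire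
holds the (classical) outcome, hence a measurement is the complete dephasing of the wire. -/
noncomputable def ideal : Loc 𝒢 W → Op W → Op W
  | prep w, ρ =>
      ∑ b : Bool, embed (oneWire w) (ketBra false b) * ρ * (embed (oneWire w) (ketBra false b))ᴴ
  | gate g e, ρ =>
      embed e (𝒢.U g : Op (Fin (𝒢.arity g))) * ρ * (embed e (𝒢.U g : Op (Fin (𝒢.arity g))))ᴴ
  | meas w, ρ => ∑ b : Bool, embed (oneWire w) (ketBra b b) * ρ * (embed (oneWire w) (ketBra b b))ᴴ

/-- The effect of a location that is hit by a fault with error channel `E`: a faulty preparation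
or gate is the ideal one followed by `E` on the qubits of the location, a faulty measurement is
the ideal one preceded by `E`. -/
noncomputable def faulty : (l : Loc 𝒢 W) → Channel l.arity → Op W → Op W
  | prep w, E, ρ => E.on (oneWire w) ((prep w : Loc 𝒢 W).ideal ρ)
  | gate g e, E, ρ => E.on e ((gate g e).ideal ρ)
  | meas w, E, ρ => (meas w : Loc 𝒢 W).ideal (E.on (oneWire w) ρ)

end Loc

/-- A choice of an error channel for a location, whatever the number `n` of its qubits is. -/
abbrev ErrorChoice : Type := (n : ℕ) → Channel n

/-- A list of locations executed in order, on the initial density operator `ρ`: `F i = none` means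
that there is no fault at the `i`-th location (counted from `0`), `F i = some E` means that it is
faulty with error channel `E n`, where `n` is its number of qubits. -/
noncomputable def run {𝒢 : GateSet} {W : Type} [Fintype W] [DecidableEq W] :
    List (Loc 𝒢 W) → (ℕ → Option ErrorChoice) → Op W → Op W
  | [], _, ρ => ρ
  | l :: ls, F, ρ =>
      run ls (fun i => F (i + 1)) (match F 0 with
        | none => l.ideal ρ
        | some E => l.faulty (E l.arity) ρ)

/-- No faults. -/
def noFault : ℕ → Option ErrorChoice := fun _ => none

/-- Faults at exactly the locations whose number is in `S`, with error channels `err`. -/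
def faultsAt (S : Finset ℕ) (err : ℕ → ErrorChoice) : ℕ → Option ErrorChoice :=
  fun i => if i ∈ S then some (err i) else none

/-- The list of locations is executable when the wires in `live` carry a qubit at the start:
gates and measurements act on wires that carry a qubit, and nothing happens to a wire after it
has been measured. (A wire on which nothing more happens without a measurement is discarded.) -/
def WellFormed {𝒢 : GateSet} {W : Type} : Set W → List (Loc 𝒢 W) → Prop
  | _, [] => True
  | live, Loc.prep w :: ls => WellFormed (insert w live) ls
  | live, Loc.gate _ e :: ls => (∀ i, e i ∈ live) ∧ WellFormed live ls
  | live, Loc.meas w :: ls => w ∈ live ∧ (∀ l ∈ ls, ∀ i, l.wires i ≠ w) ∧ WellFormed live ls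

/-- The set of measured wires. -/
def measured {𝒢 : GateSet} {W : Type} [DecidableEq W] : List (Loc 𝒢 W) → Finset W
  | [] => ∅
  | Loc.prep _ :: ls => measured ls
  | Loc.gate _ _ :: ls => measured ls
  | Loc.meas w :: ls => insert w (measured ls)

/-- A quantum circuit on the wires `W`: every qubit is prepared before it is used. -/
structure Circuit (𝒢 : GateSet) (W : Type) where
  locs : List (Loc 𝒢 W)
  wf : WellFormed ∅ locs

/-! ### Codes and rectangles -/

/-- A code that encodes one qubit into `m` qubits (a 1-block), given by an isometry `enc`, with
circuits (built over the gate set `𝒢` itself) for the 1-EC, for the 1-Ga of every gate, for the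
preparation of an encoded `|0⟩` and for the measurement of a 1-block. These circuits act on
1-blocks, each of which comes with a workspace of `a` ancilla qubits: wire `(i, Sum.inl j)` is the
`j`-th qubit of the `i`-th block, wire `(i, Sum.inr j)` the `j`-th ancilla of the `i`-th block. An
ancilla has to be prepared before it is used; what is left of it afterwards is discarded.
The measurement circuit measures some of its qubits and computes the logical outcome from these
outcomes by the classical (and perfect) function `dec`. -/
structure Scheme (𝒢 : GateSet) where
  m : ℕ
  a : ℕ
  enc : Matrix (Fin m → Bool) Bool ℂ
  isometry_enc : encᴴ * enc = 1
  ec : List (Loc 𝒢 (Fin 1 × (Fin m ⊕ Fin a)))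
  ga : (g : 𝒢.Gate) → List (Loc 𝒢 (Fin (𝒢.arity g) × (Fin m ⊕ Fin a)))
  prepGa : List (Loc 𝒢 (Fin 1 × (Fin m ⊕ Fin a)))
  measGa : List (Loc 𝒢 (Fin 1 × (Fin m ⊕ Fin a)))
  dec : (Fin m ⊕ Fin a → Bool) → Bool
  ec_wf : WellFormed {p | p.2.isLeft} ec
  ga_wf : ∀ g, WellFormed {p | p.2.isLeft} (ga g)
  prepGa_wf : WellFormed ∅ prepGa
  measGa_wf : WellFormed {p | p.2.isLeft} measGa
  /-- Measurements occur only at the end of a computation. -/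
  ec_measured : measured ec = ∅
  ga_measured : ∀ g, measured (ga g) = ∅
  prepGa_measured : measured prepGa = ∅
  /-- The preparation circuit delivers all qubits of the block. -/
  prepGa_complete : ∀ j, Loc.prep (0, Sum.inl j) ∈ prepGa
  /-- The logical outcome is a function of the outcomes of the measured qubits. -/
  dec_measured : ∀ y y' : Fin m ⊕ Fin a → Bool,
    (∀ q, (0, q) ∈ measured measGa → y q = y' q) → dec y = dec y'

namespace Scheme

variable {𝒢 : GateSet} (s : Scheme 𝒢)

/-- The labels of the qubits that belong to one block, ancillas included. -/
abbrev Q : Type := Fin s.m ⊕ Fin s.a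

/-- Replace the logical qubits `0, 1, …` of a rectangle by the qubits `e 0, e 1, …` of `W`. -/
def place {W : Type} {n : ℕ} (e : Fin n ↪ W) (ls : List (Loc 𝒢 (Fin n × s.Q))) :
    List (Loc 𝒢 (W × s.Q)) :=
  ls.map (Loc.map (e.prodMap (Function.Embedding.refl s.Q)))

/-- A 1-EC on each of `n` blocks. -/
def ecs (n : ℕ) : List (Loc 𝒢 (Fin n × s.Q)) :=
  (List.finRange n).flatMap fun i => s.place (oneWire i) s.ec

/-- The 1-Recs: a gate or preparation rectangle ends with a 1-EC on every output block, a
measurement rectangle has no 1-EC. -/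
def recPrep : List (Loc 𝒢 (Fin 1 × s.Q)) := s.prepGa ++ s.ecs 1

/-- See `recPrep`. -/
def recGate (g : 𝒢.Gate) : List (Loc 𝒢 (Fin (𝒢.arity g) × s.Q)) :=
  s.ga g ++ s.ecs (𝒢.arity g)

/-- See `recPrep`. -/
def recMeas : List (Loc 𝒢 (Fin 1 × s.Q)) := s.measGa

/-- The 1-exRecs: a 1-Rec together with the 1-ECs that immediately precede it, one on each input
block. -/
def exRecPrep : List (Loc 𝒢 (Fin 1 × s.Q)) := s.recPrep

/-- See `exRecPrep`. -/
def exRecGate (g : 𝒢.Gate) : List (Loc 𝒢 (Fin (𝒢.arity g) × s.Q)) :=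
  s.ecs (𝒢.arity g) ++ s.recGate g

/-- See `exRecPrep`. -/
def exRecMeas : List (Loc 𝒢 (Fin 1 × s.Q)) := s.ecs 1 ++ s.recMeas

/-- `A`: the largest number of (unordered) pairs of locations in a 1-exRec. -/
def maxPairs : ℕ :=
  max (s.exRecPrep.length.choose 2)
    (max (s.exRecMeas.length.choose 2)
      (Finset.univ.sup fun g => (s.exRecGate g).length.choose 2))

/-! ### Concatenation -/

/-- The 1-Rec by which a location is replaced. -/
def encodeLoc {W : Type} : Loc 𝒢 W → List (Loc 𝒢 (W × s.Q))
  | Loc.prep w => s.place (oneWire w) s.recPrep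
  | Loc.gate g e => s.place e (s.recGate g)
  | Loc.meas w => s.place (oneWire w) s.recMeas

/-- Replace every location of a circuit by its 1-Rec. -/
def encode {W : Type} (ls : List (Loc 𝒢 W)) : List (Loc 𝒢 (W × s.Q)) :=
  ls.flatMap s.encodeLoc

/-- The wires of the circuit at level `k`. -/
def LevelWire (W : Type) : ℕ → Type
  | 0 => W
  | k + 1 => LevelWire W k × s.Q

instance instFintypeLevelWire (W : Type) [Fintype W] : (k : ℕ) → Fintype (s.LevelWire W k)
  | 0 => inferInstanceAs (Fintype W)
  | k + 1 =>
    haveI := instFintypeLevelWire W k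
    inferInstanceAs (Fintype (s.LevelWire W k × s.Q))

instance instDecidableEqLevelWire (W : Type) [DecidableEq W] :
    (k : ℕ) → DecidableEq (s.LevelWire W k)
  | 0 => inferInstanceAs (DecidableEq W)
  | k + 1 =>
    haveI := instDecidableEqLevelWire W k
    inferInstanceAs (DecidableEq (s.LevelWire W k × s.Q))

/-- The circuit `M_k` that simulates `M_0` at level `k` of concatenation. -/
def level {W : Type} (M₀ : Circuit 𝒢 W) : (k : ℕ) → List (Loc 𝒢 (s.LevelWire W k))
  | 0 => M₀.locs
  | k + 1 => s.encode (level M₀ k)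

/-- The recursive classical decoding of the measurement outcomes of `M_k` to those of `M_0`. -/
def levelDec {W : Type} : (k : ℕ) → (s.LevelWire W k → Bool) → (W → Bool)
  | 0, y => y
  | k + 1, y => levelDec k fun w => s.dec fun q => y (w, q)

/-! ### States with errors -/

/-- The qubits of `n` 1-blocks. -/
abbrev Block (n : ℕ) : Type := Fin n × Fin s.m

/-- The encoding `C^{⊗ n}` of `n` qubits into `n` 1-blocks. -/
noncomputable def encN (n : ℕ) (ψ : Vec (Fin n)) : Vec (s.Block n) :=
  fun x => ∑ b : Fin n → Bool, (∏ i, s.enc (fun j => x (i, j)) (b i)) * ψ b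

/-- Operators that introduce at most one error in `n` blocks altogether: (linear combinations of)
operators that act on a single qubit. -/
def singleError (n : ℕ) : Submodule ℂ (Op (s.Block n)) :=
  Submodule.span ℂ ({1} ∪ {F | ∃ (p : s.Block n) (A : Op (Fin 1)), F = embed (oneWire p) A})

/-- Operators that introduce at most one error in each of `n` blocks: (linear combinations of)
operators that act on one qubit `(i, f i)` of each block `i`. -/
def blockError (n : ℕ) : Submodule ℂ (Op (s.Block n)) :=
  Submodule.span ℂ {F | ∃ (f : Fin n → Fin s.m) (A : Op (Fin n)),
    F = embed ⟨fun i => (i, f i), fun _ _ h => (Prod.mk.inj h).1⟩ A}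

/-- The code space (of one block). -/
def codeSpace : Submodule ℂ (Vec (s.Block 1)) :=
  Submodule.span ℂ (Set.range (s.encN 1))

/-- The states of one block that have at most one error, i.e. the span of the states that arise
from a codeword by an operator on a single qubit. -/
def nearCode : Submodule ℂ (Vec (s.Block 1)) :=
  Submodule.span ℂ {v | ∃ F ∈ s.singleError 1, ∃ ψ, v = F *ᵥ s.encN 1 ψ}

/-- The states of `n` blocks that arise from the encoding of `φ` by at most one error in each
block. -/
def erroneous (n : ℕ) (φ : Vec (Fin n)) : Set (Vec (s.Block n)) :=
  {v | ∃ F ∈ s.blockError n, v = F *ᵥ s.encN n φ}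

/-! ### The conditions on 1-ECs and 1-Gas -/

/-- The state `v` of `n` blocks, with ancillas in the state `|0 ⋯ 0⟩`. (The ancillas are prepared
before they are used, so their initial state is irrelevant.) -/
def withAncillas {n : ℕ} (v : Vec (s.Block n)) : Vec (Fin n × s.Q) :=
  fun x => if ∀ i j, x (i, Sum.inr j) = false then v fun p => x (p.1, Sum.inl p.2) else 0

/-- The state of the blocks after the ancillas have been discarded (partial trace). -/
def discardAncillas {n : ℕ} (ρ : Op (Fin n × s.Q)) : Op (s.Block n) :=
  let join (x : s.Block n → Bool) (z : Fin n × Fin s.a → Bool) : Fin n × s.Q → Bool :=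
    fun p => Sum.elim (fun j => x (p.1, j)) (fun j => z (p.1, j)) p.2
  Matrix.of fun x y => ∑ z : Fin n × Fin s.a → Bool, ρ (join x z) (join y z)

/-- The output of a circuit on `n` blocks, with faults `F`, on the pure input state `v`. -/
noncomputable def output {n : ℕ} (ls : List (Loc 𝒢 (Fin n × s.Q))) (F : ℕ → Option ErrorChoice)
    (v : Vec (s.Block n)) : Op (s.Block n) :=
  s.discardAncillas (run ls F (pureState (s.withAncillas v)))

/-- The probability (unnormalised, if the input state `v` is) that the measurement circuit, with
faults `F`, returns the logical outcome `b` on input `v`. -/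
noncomputable def measProb (F : ℕ → Option ErrorChoice) (v : Vec (s.Block 1)) (b : Bool) : ℝ :=
  ∑ y : Fin 1 × s.Q → Bool,
    if s.dec (fun q => y (0, q)) = b then
      (run s.measGa F (pureState (s.withAncillas v)) y y).re
    else 0

/-- The measurement circuit, with faults `F` and on input `v`, has the outcome distribution of a
measurement of the (not necessarily normalised) qubit state `ψ`. -/
def MeasuresAs (F : ℕ → Option ErrorChoice) (v : Vec (s.Block 1)) (ψ : Vec (Fin 1)) : Prop :=
  ∀ b, s.measProb F v b * ∑ x, ‖ψ x‖ ^ 2 =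
    ‖ψ fun _ => b‖ ^ 2 * ∑ b', s.measProb F v b'

/-- The conditions on 1-ECs and 1-Gas, where preparations count as 1-Gas without input blocks and
measurements as 1-Gas without output blocks (but with a classical output). At most one fault
means: faults at the locations in a set `S` with at most one element, with arbitrary errors. -/
structure FaultTolerant : Prop where
  /-- A 1-EC without faults takes any pure state input to an output in the code space. -/
  ec_any_noFault : ∀ v, IsMixture s.codeSpace (s.output s.ec noFault v)
  /-- A 1-EC with at most one fault takes any pure state input to an output with at most one
  error. -/
  ec_any_fault : ∀ (S : Finset ℕ) (err : ℕ → ErrorChoice), S.card ≤ 1 → ∀ v,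
    IsMixture s.nearCode (s.output s.ec (faultsAt S err) v)
  /-- A 1-EC without faults corrects an input with at most one error. -/
  ec_corrects : ∀ F ∈ s.singleError 1, ∀ ψ,
    IsMixture {v | ∃ c : ℂ, v = c • s.encN 1 ψ} (s.output s.ec noFault (F *ᵥ s.encN 1 ψ))
  /-- A 1-EC with at most one fault takes an input without errors to an output with at most one
  error. -/
  ec_fault : ∀ (S : Finset ℕ) (err : ℕ → ErrorChoice), S.card ≤ 1 → ∀ ψ,
    IsMixture (s.erroneous 1 ψ) (s.output s.ec (faultsAt S err) (s.encN 1 ψ))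
  /-- A 1-Ga implements its gate: without faults and errors it acts as the encoded gate. -/
  ga_implements : ∀ g ψ, s.output (s.ga g) noFault (s.encN (𝒢.arity g) ψ) =
    pureState (s.encN (𝒢.arity g) ((𝒢.U g : Op (Fin (𝒢.arity g))) *ᵥ ψ))
  /-- A 1-Ga without faults takes an input with at most one error to an output with at most one
  error in each output block. -/
  ga_error : ∀ g, ∀ F ∈ s.singleError (𝒢.arity g), ∀ ψ,
    IsMixture (s.erroneous (𝒢.arity g) ((𝒢.U g : Op (Fin (𝒢.arity g))) *ᵥ ψ))
      (s.output (s.ga g) noFault (F *ᵥ s.encN (𝒢.arity g) ψ))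
  /-- A 1-Ga with at most one fault takes an input without errors to an output with at most one
  error in each output block. -/
  ga_fault : ∀ g, ∀ (S : Finset ℕ) (err : ℕ → ErrorChoice), S.card ≤ 1 → ∀ ψ,
    IsMixture (s.erroneous (𝒢.arity g) ((𝒢.U g : Op (Fin (𝒢.arity g))) *ᵥ ψ))
      (s.output (s.ga g) (faultsAt S err) (s.encN (𝒢.arity g) ψ))
  /-- The preparation circuit prepares an encoded `|0⟩`. -/
  prep_implements : s.output s.prepGa noFault (zeroVec _) = pureState (s.encN 1 (zeroVec _))
  /-- With at most one fault, the prepared state has at most one error. -/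
  prep_fault : ∀ (S : Finset ℕ) (err : ℕ → ErrorChoice), S.card ≤ 1 →
    IsMixture (s.erroneous 1 (zeroVec _)) (s.output s.prepGa (faultsAt S err) (zeroVec _))
  /-- Without faults, the measurement circuit measures the logical qubit of an input with at most
  one error. -/
  meas_error : ∀ F ∈ s.singleError 1, ∀ ψ, s.MeasuresAs noFault (F *ᵥ s.encN 1 ψ) ψ
  /-- With at most one fault, the measurement circuit measures the logical qubit of an input
  without errors. -/
  meas_fault : ∀ (S : Finset ℕ) (err : ℕ → ErrorChoice), S.card ≤ 1 →
    ∀ ψ, s.MeasuresAs (faultsAt S err) (s.encN 1 ψ) ψ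

/-! ### The distributions of the outcomes -/

variable {W : Type} [Fintype W] [DecidableEq W]

/-- The probability of the outcome `x` of `M_0` in the final state `ρ` of `M_k`. -/
noncomputable def outcomeProb (M₀ : Circuit 𝒢 W) (k : ℕ) (ρ : Op (s.LevelWire W k))
    (x : measured M₀.locs → Bool) : ℝ :=
  ∑ y : s.LevelWire W k → Bool,
    if ∀ w : measured M₀.locs, s.levelDec k y w = x w then (ρ y y).re else 0

/-- The outcome distribution of the ideal (fault-free) circuit `M_0`. -/
noncomputable def idealDist (M₀ : Circuit 𝒢 W) (x : measured M₀.locs → Bool) : ℝ :=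
  ∑ y : W → Bool,
    if ∀ w : measured M₀.locs, y w = x w then
      (run M₀.locs noFault (pureState (zeroVec W)) y y).re
    else 0

/-- The outcome distribution of `M_k` when every location is faulty with probability `ε`,
independently of the others. If `S` is the set of the faulty locations, then `err S i` is the error
at the location `i ∈ S`. -/
noncomputable def noisyDist (M₀ : Circuit 𝒢 W) (k : ℕ) (ε : ℝ)
    (err : Finset ℕ → ℕ → ErrorChoice) (x : measured M₀.locs → Bool) : ℝ :=
  ∑ S ∈ (Finset.range (s.level M₀ k).length).powerset,
    ε ^ S.card * (1 - ε) ^ ((s.level M₀ k).length - S.card) *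
      s.outcomeProb M₀ k (run (s.level M₀ k) (faultsAt S (err S)) (pureState (zeroVec _))) x

/-- The computation error: the `L₁`-distance between the outcome distributions of the noisy
circuit `M_k` and of the ideal circuit `M_0`. -/
noncomputable def computationError (M₀ : Circuit 𝒢 W) (k : ℕ) (ε : ℝ)
    (err : Finset ℕ → ℕ → ErrorChoice) : ℝ :=
  ∑ x : measured M₀.locs → Bool, |s.noisyDist M₀ k ε err x - idealDist M₀ x|

end Scheme

end FTQC

set_option linter.unusedSectionVars false

/-! The proof removes one level of concatenation at a time. Noise is kept in the form of
`LocallyStochastic`: any prescribed set of `n` locations is faulty with probability at most `ε ^ n`.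
A noisy run of `M_{k+1}`, seen through an ideal decoder of all blocks, is a noisy run of `M_k` whose
faulty locations are those with a bad extended rectangle, one that contains at least two faults.
Each bad rectangle supplies a pair of faults, the pairs of different bad rectangles are disjoint,
and there are at most `A` candidates for each pair; a union bound gives the new rate `A ε²`
(`LocallyStochastic.pairs`). Hence `A` times the rate after `k` reductions is `(A ε) ^ 2 ^ k`. If no
fault survives down to `M_0` the outcome distribution is exactly the ideal one
(`outcomeProb_eq_idealDist`); otherwise the error is at most 2.

Overlaps. Consecutive extended rectangles share a 1-EC. If the later one is bad, the shared 1-EC is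
counted with it and removed from the earlier one, so badness is decided from the end of the circuit
backwards (`exists_isTagging`), and this is what makes the pairs disjoint
(`IsTagging.pairwise_disjoint`). In the circuit the 1-EC is moved next to the bad location. The
history of each single wire stays the same (`flatMap_custChunk`), and this history determines the
effect of the circuit, because operations on different wires commute (`Same.runLabelled_eq`).

The decoder. A block is decoded by a faultless 1-EC followed by the inverse of the encoding, and the
syndrome is thrown away. What a bad rectangle does to the decoded qubits may then depend on the
discarded syndrome, so it need not be a channel on these qubits. For this reason a fault is a
relation between states (`Step`): the new state is positive and has the same reduced state on all
other qubits. Error channels are a special case (`Loc.step_exec`), and the relation is inherited by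
decoded states (`TrEq.decode`), which allows the reduction to be iterated.

Good rectangles. The conditions on the scheme speak of error channels and pure inputs without a
reference system, while a block is entangled with the others and the faults are more general. Two
observations bridge the gap. First, a fault path, i.e. a product of Kraus operators of sound
locations and arbitrary operators at faulty ones, is a linear combination of Kraus operators of runs
with true error channels (`mem_span_runKraus`), so the conditions hold for every fault path. Second,
if each fault path, followed by a Kraus operator of the decoder, acts on the encoded qubits as a
scalar times one isometry, then trace preservation fixes the sum of the weights, and the decoded
operation is exactly that isometry (`kmap_kmap_conj`, `reach_logic`). A rectangle with at most one
fault is treated by following the support of each block, which is either the code space or the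
states with at most one error; operations on other blocks cannot change it (`TrEq.mem_cone_lift`).
-/

namespace FTQC

/-! ### Slices and extended operators -/

section Slices

variable {V W X : Type}

/-- Overwrite the configuration `r` of `W` by `x` on the range of `f`. -/
noncomputable abbrev overwrite (f : V ↪ W) (x : V → Bool) (r : W → Bool) : W → Bool :=
  Function.extend f x r

@[simp] theorem overwrite_apply (f : V ↪ W) (x : V → Bool) (r : W → Bool) (i : V) :
    overwrite f x r (f i) = x i := f.injective.extend_apply x r i

theorem overwrite_of_notMem (f : V ↪ W) (x : V → Bool) (r : W → Bool) {w : W}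
    (h : ∀ i, f i ≠ w) : overwrite f x r w = r w :=
  Function.extend_apply' _ _ _ (by rintro ⟨i, hi⟩; exact h i hi)

theorem eq_overwrite_iff (f : V ↪ W) (x : V → Bool) (r y : W → Bool) :
    y = overwrite f x r ↔ (∀ i, y (f i) = x i) ∧ ∀ w, (∀ i, f i ≠ w) → y w = r w := by
  constructor
  · rintro rfl
    exact ⟨fun i => overwrite_apply f x r i, fun w hw => overwrite_of_notMem f x r hw⟩
  · rintro ⟨h₁, h₂⟩
    funext w
    by_cases h : ∃ i, f i = w
    · obtain ⟨i, rfl⟩ := h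
      rw [h₁, overwrite_apply]
    · push Not at h
      rw [h₂ w h, overwrite_of_notMem f x r h]

@[simp] theorem overwrite_self (f : V ↪ W) (r : W → Bool) :
    overwrite f (fun i => r (f i)) r = r :=
  ((eq_overwrite_iff f _ r r).2 ⟨fun _ => rfl, fun _ _ => rfl⟩).symm

@[simp] theorem overwrite_overwrite (f : V ↪ W) (x x' : V → Bool) (r : W → Bool) :
    overwrite f x (overwrite f x' r) = overwrite f x r := by
  rw [eq_overwrite_iff]
  exact ⟨fun i => by simp, fun w hw => by simp [hw]⟩

theorem overwrite_trans (g : X ↪ V) (f : V ↪ W) (x : X → Bool) (y : V → Bool) (r : W → Bool) :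
    overwrite (g.trans f) x (overwrite f y r) = overwrite f (overwrite g x y) r := by
  rw [eq_comm, eq_overwrite_iff]
  refine ⟨fun i => ?_, fun w hw => ?_⟩
  · rw [Function.Embedding.trans_apply, overwrite_apply, overwrite_apply]
  · by_cases h : ∃ i, f i = w
    · obtain ⟨i, rfl⟩ := h
      rw [overwrite_apply, overwrite_apply, overwrite_of_notMem]
      exact fun j hj => hw j (by simp [hj])
    · push Not at h
      rw [overwrite_of_notMem _ _ _ h, overwrite_of_notMem _ _ _ h]

theorem overwrite_trans_self (g : X ↪ V) (f : V ↪ W) (x : X → Bool) (r : W → Bool) :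
    overwrite (g.trans f) x r = overwrite f (overwrite g x fun i => r (f i)) r := by
  conv_lhs => rw [← overwrite_self f r, overwrite_trans]

theorem overwrite_comm (f : V ↪ W) (g : X ↪ W) (h : ∀ i j, f i ≠ g j) (x : V → Bool)
    (y : X → Bool) (r : W → Bool) :
    overwrite f x (overwrite g y r) = overwrite g y (overwrite f x r) := by
  rw [eq_comm, eq_overwrite_iff]
  refine ⟨fun i => ?_, fun w hw => ?_⟩
  · rw [overwrite_of_notMem _ _ _ fun j => (h i j).symm, overwrite_apply]
  · by_cases h : ∃ i, g i = w
    · obtain ⟨i, rfl⟩ := h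
      rw [overwrite_apply, overwrite_apply]
    · push Not at h
      rw [overwrite_of_notMem _ _ _ h, overwrite_of_notMem _ _ _ h, overwrite_of_notMem _ _ _ hw]

/-- The component of the vector `v` on the wires `f`, for the configuration `r` of the others. -/
noncomputable def vslice (f : V ↪ W) (v : Vec W) (r : W → Bool) : Vec V :=
  fun x => v (overwrite f x r)

/-- The component of the operator `ρ` on the wires `f`, for the configurations `r`, `r'` of the
others. -/
noncomputable def slice (f : V ↪ W) (r r' : W → Bool) : Op W →ₗ[ℂ] Op V where
  toFun ρ := Matrix.of fun x x' => ρ (overwrite f x r) (overwrite f x' r')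
  map_add' _ _ := rfl
  map_smul' _ _ := rfl

theorem slice_apply (f : V ↪ W) (r r' : W → Bool) (ρ : Op W) (x x' : V → Bool) :
    slice f r r' ρ x x' = ρ (overwrite f x r) (overwrite f x' r') := rfl

theorem slice_ext (f : V ↪ W) {ρ σ : Op W} (h : ∀ r r', slice f r r' ρ = slice f r r' σ) :
    ρ = σ := by
  ext x y
  have := congrFun (congrFun (h x y) fun i => x (f i)) fun i => y (f i)
  simpa [slice_apply] using this

theorem slice_slice (g : X ↪ V) (f : V ↪ W) (r r' : W → Bool) (x x' : V → Bool) (ρ : Op W) :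
    slice g x x' (slice f r r' ρ) = slice (g.trans f) (overwrite f x r) (overwrite f x' r') ρ := by
  ext y y'
  simp only [slice_apply, overwrite_trans]

theorem vslice_vslice (g : X ↪ V) (f : V ↪ W) (r : W → Bool) (x : V → Bool) (v : Vec W) :
    vslice g (vslice f v r) x = vslice (g.trans f) v (overwrite f x r) := by
  funext y
  simp only [vslice, overwrite_trans]

theorem vslice_add (f : V ↪ W) (u v : Vec W) (r : W → Bool) :
    vslice f (u + v) r = vslice f u r + vslice f v r := rfl

theorem vslice_smul (f : V ↪ W) (c : ℂ) (v : Vec W) (r : W → Bool) :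
    vslice f (c • v) r = c • vslice f v r := rfl

theorem slice_vecMulVec (f : V ↪ W) (u v : Vec W) (r r' : W → Bool) :
    slice f r r' (vecMulVec u (star v)) = vecMulVec (vslice f u r) (star (vslice f v r')) := rfl

variable [Fintype V] [DecidableEq V] [Fintype W] [DecidableEq W] [Fintype X] [DecidableEq X]

/-- `A ⊗ 1`: the operator `A` acting on the qubits `f i` of the system `W`. -/
def emb (f : V ↪ W) (A : Op V) : Op W :=
  Matrix.of fun x y =>
    if ∀ w, (∀ i, f i ≠ w) → x w = y w then A (fun i => x (f i)) (fun i => y (f i)) else 0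

theorem embed_eq_emb {n : ℕ} (e : Fin n ↪ W) (A : Op (Fin n)) : embed e A = emb e A := by
  ext x y
  simp only [embed, emb, of_apply]
  congr

theorem sum_overwrite_eq {M : Type*} [AddCommMonoid M] (f : V ↪ W) (x : W → Bool)
    (F : (W → Bool) → M) :
    (∑ y, if ∀ w, (∀ i, f i ≠ w) → x w = y w then F y else 0) = ∑ u, F (overwrite f u x) := by
  rw [← Finset.sum_filter]
  symm
  refine Finset.sum_bij (fun u _ => overwrite f u x) ?_ ?_ ?_ ?_
  · intro u _
    simp only [Finset.mem_filter, Finset.mem_univ, true_and]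
    exact fun w hw => (overwrite_of_notMem f u x hw).symm
  · intro u _ u' _ h
    funext i
    simpa using congrFun h (f i)
  · intro y hy
    refine ⟨fun i => y (f i), Finset.mem_univ _, ?_⟩
    rw [eq_comm, eq_overwrite_iff]
    exact ⟨fun _ => rfl, fun w hw => ((Finset.mem_filter.1 hy).2 w hw).symm⟩
  · intro u _; rfl

theorem emb_mulVec_apply (f : V ↪ W) (A : Op V) (v : Vec W) (x : W → Bool) :
    (emb f A *ᵥ v) x = ∑ u, A (fun i => x (f i)) u * v (overwrite f u x) := by
  simp only [mulVec, dotProduct, emb, of_apply, ite_mul, zero_mul]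
  rw [sum_overwrite_eq f x (fun y => A (fun i => x (f i)) (fun i => y (f i)) * v y)]
  simp

theorem vslice_emb_mulVec (f : V ↪ W) (A : Op V) (v : Vec W) (r : W → Bool) :
    vslice f (emb f A *ᵥ v) r = A *ᵥ vslice f v r := by
  funext x
  rw [vslice, emb_mulVec_apply]
  simp only [overwrite_apply, overwrite_overwrite, mulVec, dotProduct, vslice]

theorem op_ext {U : Type} [Fintype U] [DecidableEq U] {A B : Op U} (h : ∀ v, A *ᵥ v = B *ᵥ v) : A = B := by
  exact Matrix.ext_of_mulVec_single fun i => h _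

theorem vec_ext (f : V ↪ W) {u v : Vec W} (h : ∀ r, vslice f u r = vslice f v r) : u = v := by
  funext x
  have := congrFun (h x) fun i => x (f i)
  simpa [vslice] using this

theorem emb_one (f : V ↪ W) : emb f (1 : Op V) = 1 :=
  op_ext fun v => vec_ext f fun r => by rw [vslice_emb_mulVec, one_mulVec, one_mulVec]

theorem emb_mul (f : V ↪ W) (A B : Op V) : emb f (A * B) = emb f A * emb f B :=
  op_ext fun v => vec_ext f fun r => by
    rw [vslice_emb_mulVec, ← mulVec_mulVec, ← mulVec_mulVec, vslice_emb_mulVec, vslice_emb_mulVec]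

theorem emb_conjTranspose (f : V ↪ W) (A : Op V) : (emb f A)ᴴ = emb f Aᴴ := by
  ext x y
  simp only [emb, conjTranspose_apply, of_apply, apply_ite star, star_zero]
  congr 1
  exact propext ⟨fun h w hw => (h w hw).symm, fun h w hw => (h w hw).symm⟩

/-- `emb f` as a linear map. -/
def embₗ (f : V ↪ W) : Op V →ₗ[ℂ] Op W where
  toFun := emb f
  map_add' A B := op_ext fun v => vec_ext f fun r => by
    rw [vslice_emb_mulVec, add_mulVec, add_mulVec, vslice_add, vslice_emb_mulVec,
      vslice_emb_mulVec]
  map_smul' c A := op_ext fun v => vec_ext f fun r => by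
    rw [vslice_emb_mulVec, smul_mulVec, RingHom.id_apply, smul_mulVec, vslice_smul,
      vslice_emb_mulVec]

theorem embₗ_apply (f : V ↪ W) (A : Op V) : embₗ f A = emb f A := rfl

theorem emb_trans (g : X ↪ V) (f : V ↪ W) (A : Op X) : emb (g.trans f) A = emb f (emb g A) :=
  op_ext fun v => by
    funext x
    simp only [emb_mulVec_apply, Function.Embedding.trans_apply]
    have h := emb_mulVec_apply g A (vslice f v x) (fun i => x (f i))
    simp only [vslice, ← overwrite_trans_self] at h
    rw [← h]
    rfl

theorem emb_comm (f : V ↪ W) (g : X ↪ W) (h : ∀ i j, f i ≠ g j) (A : Op V) (B : Op X) :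
    emb f A * emb g B = emb g B * emb f A :=
  op_ext fun v => by
    funext x
    simp only [← mulVec_mulVec, emb_mulVec_apply, Finset.mul_sum]
    rw [Finset.sum_comm]
    refine Finset.sum_congr rfl fun u _ => Finset.sum_congr rfl fun t _ => ?_
    rw [overwrite_comm f g h]
    have h₁ : (fun i => overwrite f t x (g i)) = fun i => x (g i) := by
      funext i; exact overwrite_of_notMem _ _ _ fun j => h j i
    have h₂ : (fun i => overwrite g u x (f i)) = fun i => x (f i) := by
      funext i; exact overwrite_of_notMem _ _ _ fun j => (h i j).symm
    rw [h₁, h₂]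
    ring

theorem emb_conj_apply (f : V ↪ W) (A B : Op V) (ρ : Op W) (x y : W → Bool) :
    (emb f A * ρ * (emb f B)ᴴ) x y = ∑ u, ∑ u', A (fun i => x (f i)) u *
      ρ (overwrite f u x) (overwrite f u' y) * star (B (fun i => y (f i)) u') := by
  have h₁ : ∀ (σ : Op W) x y, (emb f A * σ) x y = ∑ u, A (fun i => x (f i)) u *
      σ (overwrite f u x) y := fun σ x y => emb_mulVec_apply f A (fun z => σ z y) x
  have h₂ : ∀ (σ : Op W) x y, (σ * (emb f B)ᴴ) x y = ∑ u, σ x (overwrite f u y) *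
      star (B (fun i => y (f i)) u) := by
    intro σ x y
    have := emb_mulVec_apply f B (fun z => star (σ x z)) y
    rw [← star_star ((σ * (emb f B)ᴴ) x y), ← conjTranspose_apply, conjTranspose_mul,
      conjTranspose_conjTranspose]
    refine (congrArg star this).trans ?_
    simp [mul_comm]
  rw [mul_assoc, h₁]
  simp only [h₂, Finset.mul_sum, mul_assoc]

theorem slice_emb_conj (f : V ↪ W) (A B : Op V) (ρ : Op W) (r r' : W → Bool) :
    slice f r r' (emb f A * ρ * (emb f B)ᴴ) = A * slice f r r' ρ * Bᴴ := by
  ext x y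
  rw [slice_apply, emb_conj_apply]
  simp only [overwrite_apply, overwrite_overwrite, mul_apply, Finset.sum_mul,
    conjTranspose_apply, slice_apply]
  rw [Finset.sum_comm]

/-- The map `(a, r) ↦ (r ∘ f, overwrite f a r)` is an involution of pairs, so each configuration is
hit equally often. Sums over the complement of `f` can thus be written as sums over all
configurations, at the price of a nonzero factor. -/
theorem sum_overwrite {M : Type*} [AddCommMonoid M] (f : V ↪ W) (g : (W → Bool) → M) :
    ∑ a : V → Bool, ∑ r : W → Bool, g (overwrite f a r) =
      Fintype.card (V → Bool) • ∑ r : W → Bool, g r := by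
  have hinv : Function.Involutive fun p : (V → Bool) × (W → Bool) =>
      ((fun i => p.2 (f i)), overwrite f p.1 p.2) := by
    rintro ⟨a, r⟩
    simp
  rw [← Fintype.sum_prod_type' (f := fun a r => g (overwrite f a r)),
    ← Equiv.sum_comp hinv.toPerm]
  simp only [Function.Involutive.coe_toPerm, overwrite_overwrite, overwrite_self]
  rw [Fintype.sum_prod_type]
  simp

theorem card_config_ne_zero (U : Type) [Fintype U] [DecidableEq U] :
    (Fintype.card (U → Bool) : ℂ) ≠ 0 := by
  exact_mod_cast Fintype.card_ne_zero

end Slices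

/-! ### Mixtures and their supports -/

section Cone

variable {X Y : Type}

/-- The mixtures of pure states from `V`. -/
def cone (V : Set (X → ℂ)) : AddSubmonoid (Matrix X X ℂ) :=
  AddSubmonoid.closure (pureState '' V)

theorem isMixture_iff {V : Set (X → ℂ)} {ρ : Matrix X X ℂ} : IsMixture V ρ ↔ ρ ∈ cone V := by
  constructor
  · rintro ⟨r, v, hv, rfl⟩
    exact sum_mem fun j _ => AddSubmonoid.subset_closure ⟨v j, hv j, rfl⟩
  · intro h
    induction h using AddSubmonoid.closure_induction with
    | mem ρ h =>
      obtain ⟨v, hv, rfl⟩ := h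
      exact ⟨1, fun _ => v, fun _ => hv, by simp⟩
    | zero => exact ⟨0, Fin.elim0, fun j => j.elim0, by simp⟩
    | add ρ σ _ _ h₁ h₂ =>
      obtain ⟨r, v, hv, rfl⟩ := h₁
      obtain ⟨q, u, hu, rfl⟩ := h₂
      refine ⟨r + q, Fin.append v u, fun j => ?_, ?_⟩
      · refine Fin.addCases (fun i => ?_) (fun i => ?_) j
        · simpa using hv i
        · simpa using hu i
      · rw [Fin.sum_univ_add]
        simp

theorem cone_mono {V V' : Set (X → ℂ)} (h : V ⊆ V') : cone V ≤ cone V' :=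
  AddSubmonoid.closure_mono (Set.image_mono h)

theorem pureState_mem_cone {V : Set (X → ℂ)} {v : X → ℂ} (h : v ∈ V) : pureState v ∈ cone V :=
  AddSubmonoid.subset_closure ⟨v, h, rfl⟩

variable [Fintype X] [DecidableEq X] [Fintype Y] [DecidableEq Y]

/-- The operation with the Kraus operators in the list `L`. -/
def kmap (L : List (Matrix Y X ℂ)) : Matrix X X ℂ →ₗ[ℂ] Matrix Y Y ℂ where
  toFun ρ := (L.map fun K => K * ρ * Kᴴ).sum
  map_add' ρ σ := by
    induction L with
    | nil => simp
    | cons K L ih => simp only [List.map_cons, List.sum_cons, ih]; rw [Matrix.mul_add, Matrix.add_mul]; abel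
  map_smul' c ρ := by
    induction L with
    | nil => simp
    | cons K L ih => simp_all [smul_add]

theorem kmap_apply (L : List (Matrix Y X ℂ)) (ρ : Matrix X X ℂ) :
    kmap L ρ = (L.map fun K => K * ρ * Kᴴ).sum := rfl

@[simp] theorem kmap_nil (ρ : Matrix X X ℂ) : kmap ([] : List (Matrix Y X ℂ)) ρ = 0 := rfl

@[simp] theorem kmap_cons (K : Matrix Y X ℂ) (L : List (Matrix Y X ℂ)) (ρ : Matrix X X ℂ) :
    kmap (K :: L) ρ = K * ρ * Kᴴ + kmap L ρ := rfl

theorem kmap_append (L M : List (Matrix Y X ℂ)) (ρ : Matrix X X ℂ) :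
    kmap (L ++ M) ρ = kmap L ρ + kmap M ρ := by
  simp [kmap_apply]

theorem conj_pureState (K : Matrix Y X ℂ) (v : X → ℂ) :
    K * pureState v * Kᴴ = pureState (K *ᵥ v) := by
  rw [pureState, pureState, mul_vecMulVec, vecMulVec_mul, star_mulVec]

theorem conj_mem_cone {V : Set (X → ℂ)} {V' : Set (Y → ℂ)} {K : Matrix Y X ℂ}
    (h : ∀ v ∈ V, K *ᵥ v ∈ V') {ρ : Matrix X X ℂ} (hρ : ρ ∈ cone V) : K * ρ * Kᴴ ∈ cone V' := by
  induction hρ using AddSubmonoid.closure_induction with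
  | mem ρ h' =>
    obtain ⟨v, hv, rfl⟩ := h'
    rw [conj_pureState]
    exact pureState_mem_cone (h v hv)
  | zero => simp
  | add ρ σ _ _ h₁ h₂ => rw [Matrix.mul_add, Matrix.add_mul]; exact add_mem h₁ h₂

theorem kmap_mem_cone {V : Set (X → ℂ)} {V' : Set (Y → ℂ)} {L : List (Matrix Y X ℂ)}
    (h : ∀ K ∈ L, ∀ v ∈ V, K *ᵥ v ∈ V') {ρ : Matrix X X ℂ} (hρ : ρ ∈ cone V) :
    kmap L ρ ∈ cone V' := by
  refine list_sum_mem fun σ hσ => ?_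
  obtain ⟨K, hK, rfl⟩ := List.mem_map.1 hσ
  exact conj_mem_cone (h K hK) hρ

/-- The quadratic form `⟨z̄|ρ|z̄⟩`. -/
def quad (z : X → ℂ) : Matrix X X ℂ →ₗ[ℂ] ℂ where
  toFun ρ := z ⬝ᵥ ρ *ᵥ star z
  map_add' ρ σ := by rw [add_mulVec, dotProduct_add]
  map_smul' c ρ := by rw [smul_mulVec, dotProduct_smul, RingHom.id_apply]

theorem quad_apply (z : X → ℂ) (ρ : Matrix X X ℂ) : quad z ρ = z ⬝ᵥ ρ *ᵥ star z := rfl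

theorem quad_pureState (z v : X → ℂ) : quad z (pureState v) = ((‖z ⬝ᵥ v‖ ^ 2 : ℝ) : ℂ) := by
  rw [quad_apply, pureState, vecMulVec_mulVec, Matrix.star_dotProduct_star, dotProduct_smul,
    op_smul_eq_smul, smul_eq_mul, mul_comm, RCLike.star_def, RCLike.mul_conj]
  push_cast
  rfl

/-- A subspace is the common kernel of the functionals that vanish on it. Supports of mixtures are
tested with these functionals, through the numbers `quad z ρ`. -/
theorem mem_of_dotProduct {V : Submodule ℂ (X → ℂ)} {v : X → ℂ}
    (h : ∀ z : X → ℂ, (∀ u ∈ V, z ⬝ᵥ u = 0) → z ⬝ᵥ v = 0) : v ∈ V := by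
  by_contra hv
  obtain ⟨f, hf, hV⟩ := Submodule.exists_le_ker_of_notMem hv
  have key : ∀ u, (fun x => f (Pi.single x 1)) ⬝ᵥ u = f u := by
    intro u
    conv_rhs => rw [pi_eq_sum_univ u, map_sum]
    refine Finset.sum_congr rfl fun x _ => ?_
    rw [map_smul, smul_eq_mul, mul_comm]
    refine congrArg (u x * ·) (congrArg f (funext fun y => ?_))
    simp [Pi.single_apply, eq_comm]
  exact hf (by rw [← key]; exact h _ fun u hu => by rw [key]; exact hV hu)

theorem quad_eq_zero {V : Set (X → ℂ)} {z : X → ℂ} (h : ∀ u ∈ V, z ⬝ᵥ u = 0)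
    {ρ : Matrix X X ℂ} (hρ : ρ ∈ cone V) : quad z ρ = 0 := by
  induction hρ using AddSubmonoid.closure_induction with
  | mem ρ h' =>
    obtain ⟨v, hv, rfl⟩ := h'
    rw [quad_pureState, h v hv]
    simp
  | zero => simp
  | add ρ σ _ _ h₁ h₂ => rw [map_add, h₁, h₂, add_zero]

theorem kmap_list_sum_pureState (L : List (Matrix Y X ℂ)) (v : X → ℂ) :
    kmap L (pureState v) = (L.map fun K => pureState (K *ᵥ v)).sum := by
  simp only [kmap_apply, conj_pureState]

/-- A vanishing sum of nonnegative numbers has vanishing terms, so every pure state in any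
decomposition of `ρ` passes the tests. This leads back from facts about a state to facts about the
vectors in it, and is the converse of `quad_eq_zero`. -/
theorem mem_cone_of_quad {V V' : Set (X → ℂ)} {ρ : Matrix X X ℂ} (ι : Type*) (φ : ι → Matrix X X ℂ →ₗ[ℂ] ℂ)
    (N : ι → (X → ℂ) → ℝ) (hN : ∀ i v, 0 ≤ N i v) (hφ : ∀ i v, φ i (pureState v) = N i v)
    (hρ : ρ ∈ cone V) (h : ∀ i, φ i ρ = 0) (hV' : ∀ v ∈ V, (∀ i, N i v = 0) → v ∈ V') :
    ρ ∈ cone V' := by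
  obtain ⟨r, v, hv, rfl⟩ := isMixture_iff.2 hρ
  refine sum_mem fun j _ => pureState_mem_cone (hV' _ (hv j) fun i => ?_)
  have h' := h i
  simp only [map_sum, hφ] at h'
  norm_cast at h'
  exact (Finset.sum_eq_zero_iff_of_nonneg fun j _ => hN i (v j)).1 h' j (Finset.mem_univ j)

theorem eq_zero_of_list_sum_eq_zero {α : Type*} {L : List α} {f : α → ℝ} (hf : ∀ a, 0 ≤ f a)
    (h : (L.map f).sum = 0) : ∀ a ∈ L, f a = 0 := by
  induction L with
  | nil => simp
  | cons b L ih =>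
    rw [List.map_cons, List.sum_cons] at h
    have h₁ : 0 ≤ (L.map f).sum := List.sum_nonneg fun x hx => by
      obtain ⟨a, -, rfl⟩ := List.mem_map.1 hx
      exact hf a
    intro a ha
    rcases List.mem_cons.1 ha with rfl | ha
    · linarith [hf a]
    · exact ih (by linarith [hf b]) a ha

/-- If the image of a mixture under Kraus operators is supported in `V`, then the mixture is
supported on the vectors that all the Kraus operators send into `V`. -/
theorem mem_cone_of_kmap {V : Submodule ℂ (Y → ℂ)} {V₀ V' : Set (X → ℂ)}
    {L : List (Matrix Y X ℂ)} {ρ : Matrix X X ℂ} (hρ : ρ ∈ cone V₀)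
    (h : kmap L ρ ∈ cone (V : Set (Y → ℂ)))
    (hV' : ∀ v ∈ V₀, (∀ K ∈ L, K *ᵥ v ∈ V) → v ∈ V') : ρ ∈ cone V' := by
  refine mem_cone_of_quad {z : Y → ℂ // ∀ u ∈ V, z ⬝ᵥ u = 0}
    (fun z => quad z.1 ∘ₗ kmap L) (fun z v => (L.map fun K => ‖z.1 ⬝ᵥ (K *ᵥ v)‖ ^ 2).sum)
    (fun z v => List.sum_nonneg ?_) (fun z v => ?_) hρ (fun z => quad_eq_zero z.2 h)
    fun v hv hz => hV' v hv fun K hK => mem_of_dotProduct fun z hz' => ?_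
  · intro a ha
    obtain ⟨K, -, rfl⟩ := List.mem_map.1 ha
    positivity
  · rw [LinearMap.comp_apply, kmap_list_sum_pureState, map_list_sum, List.map_map]
    have : (quad z.1 ∘ fun K => pureState (K *ᵥ v)) = fun K : Matrix Y X ℂ =>
        ((‖z.1 ⬝ᵥ (K *ᵥ v)‖ ^ 2 : ℝ) : ℂ) := by
      funext K
      exact quad_pureState _ _
    rw [this]
    rw [← Complex.ofRealHom_eq_coe, map_list_sum, List.map_map]
    rfl
  · have h₀ := hz ⟨z, hz'⟩
    simpa using eq_zero_of_list_sum_eq_zero (fun K => by positivity) h₀ K hK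

end Cone

/-! ### Complete lists of Kraus operators -/

section Complete

variable {X Y Z : Type} [Fintype X] [DecidableEq X] [Fintype Y] [DecidableEq Y] [Fintype Z]
  [DecidableEq Z]

/-- The operation with the Kraus operators in the list `L` preserves the trace. -/
def Complete (L : List (Matrix Y X ℂ)) : Prop := (L.map fun K => Kᴴ * K).sum = 1

/-- The Kraus operators of a composition. -/
def kcomp (L : List (Matrix Z Y ℂ)) (M : List (Matrix Y X ℂ)) : List (Matrix Z X ℂ) :=
  M.flatMap fun k => L.map fun K => K * k

theorem mem_kcomp {L : List (Matrix Z Y ℂ)} {M : List (Matrix Y X ℂ)} {N : Matrix Z X ℂ} :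
    N ∈ kcomp L M ↔ ∃ K ∈ L, ∃ k ∈ M, N = K * k := by
  simp only [kcomp, List.mem_flatMap, List.mem_map]
  exact ⟨fun ⟨k, hk, K, hK, h⟩ => ⟨K, hK, k, hk, h.symm⟩,
    fun ⟨K, hK, k, hk, h⟩ => ⟨k, hk, K, hK, h.symm⟩⟩

theorem kmap_kcomp (L : List (Matrix Z Y ℂ)) (M : List (Matrix Y X ℂ)) (ρ : Matrix X X ℂ) :
    kmap (kcomp L M) ρ = kmap L (kmap M ρ) := by
  induction M with
  | nil => simp [kcomp]
  | cons k M ih =>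
    have : kcomp L (k :: M) = (L.map fun K => K * k) ++ kcomp L M := rfl
    rw [this, kmap_append, ih, kmap_cons, map_add]
    congr 1
    simp only [kmap_apply, List.map_map]
    refine congrArg List.sum (List.map_congr_left fun K _ => ?_)
    simp only [Function.comp, conjTranspose_mul, Matrix.mul_assoc]

theorem list_sum_mul_mul {A B C D : Type} [Fintype B] [Fintype C] {α : Type*}
    (P : Matrix A B ℂ) (Q : Matrix C D ℂ) (L : List α) (f : α → Matrix B C ℂ) :
    (L.map fun a => P * f a * Q).sum = P * (L.map f).sum * Q := by
  induction L with
  | nil => simp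
  | cons a L ih =>
    simp only [List.map_cons, List.sum_cons, ih]
    rw [Matrix.mul_add, Matrix.add_mul]

theorem Complete.kcomp {L : List (Matrix Z Y ℂ)} {M : List (Matrix Y X ℂ)} (hL : Complete L)
    (hM : Complete M) : Complete (kcomp L M) := by
  have key : ∀ M : List (Matrix Y X ℂ),
      ((FTQC.kcomp L M).map fun K => Kᴴ * K).sum = (M.map fun K => Kᴴ * K).sum := by
    intro M
    induction M with
    | nil => simp [FTQC.kcomp]
    | cons k M ih =>
      have : FTQC.kcomp L (k :: M) = (L.map fun K => K * k) ++ FTQC.kcomp L M := rfl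
      rw [this, List.map_append, List.sum_append, ih, List.map_cons, List.sum_cons]
      congr 1
      rw [List.map_map]
      have : ((fun K => Kᴴ * K) ∘ fun K : Matrix Z Y ℂ => K * k) =
          fun K => kᴴ * (Kᴴ * K) * k := by
        funext K
        simp only [Function.comp, conjTranspose_mul, Matrix.mul_assoc]
      rw [this, list_sum_mul_mul, hL, Matrix.mul_one]
  rw [Complete, key, hM]

theorem trace_kmap {L : List (Matrix Y X ℂ)} (hL : Complete L) (ρ : Matrix X X ℂ) :
    (kmap L ρ).trace = ρ.trace := by
  have key : ∀ L : List (Matrix Y X ℂ),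
      (kmap L ρ).trace = ((L.map fun K => Kᴴ * K).sum * ρ).trace := by
    intro L
    induction L with
    | nil => simp
    | cons K L ih =>
      rw [kmap_cons, trace_add, ih, List.map_cons, List.sum_cons, Matrix.add_mul, trace_add,
        Matrix.mul_assoc K, trace_mul_comm K, Matrix.mul_assoc ρ, trace_mul_comm ρ]
  rw [key, hL, Matrix.one_mul]

theorem complete_singleton_one : Complete [(1 : Matrix X X ℂ)] := by
  simp [Complete]

end Complete

/-! ### Kraus operators of locations -/

section Locations

variable {𝒢 : GateSet} {V W : Type} [Fintype V] [DecidableEq V] [Fintype W] [DecidableEq W]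

/-- The Kraus operators `|0⟩⟨b|` of the operation that resets all qubits. -/
noncomputable def resetKraus (n : ℕ) : List (Op (Fin n)) :=
  Finset.univ.toList.map fun b : Fin n → Bool => Matrix.single (fun _ => false) b 1

theorem complete_resetKraus (n : ℕ) : Complete (resetKraus n) := by
  rw [Complete, resetKraus, List.map_map, Finset.sum_map_toList]
  ext x y
  simp only [Function.comp, conjTranspose_single, single_mul_single_same, Matrix.sum_apply,
    single_apply, one_apply, star_one, mul_one]
  by_cases h : x = y
  · subst h; simp
  · simp only [h, if_false]
    exact Finset.sum_eq_zero fun b _ => if_neg fun hb => h (hb.1.symm.trans hb.2)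

theorem kmap_resetKraus (n : ℕ) (M : Op (Fin n)) :
    kmap (resetKraus n) M = M.trace • Matrix.single (fun _ => false) (fun _ => false) 1 := by
  rw [kmap_apply, resetKraus, List.map_map, Finset.sum_map_toList, trace, Finset.sum_smul]
  refine Finset.sum_congr rfl fun b _ => ?_
  ext x y
  simp [Function.comp, conjTranspose_single, single_mul_mul_single, single_apply]

theorem complete_map_emb (f : V ↪ W) {L : List (Op V)} (hL : Complete L) :
    Complete (L.map (emb f)) := by
  have : (List.map (fun K => Kᴴ * K) (L.map (emb f))) = (L.map fun K => Kᴴ * K).map (embₗ f) := by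
    simp only [List.map_map]
    refine List.map_congr_left fun K _ => ?_
    simp only [Function.comp, emb_conjTranspose, ← emb_mul, embₗ_apply]
  rw [Complete, this, ← map_list_sum, hL, embₗ_apply, emb_one]

theorem slice_kmap_emb (f : V ↪ W) (L : List (Op V)) (ρ : Op W) (r r' : W → Bool) :
    slice f r r' (kmap (L.map (emb f)) ρ) = kmap L (slice f r r' ρ) := by
  simp only [kmap_apply, map_list_sum, List.map_map]
  exact congrArg List.sum (List.map_congr_left fun K _ => slice_emb_conj f K K ρ r r')

/-- The Kraus operators of a location, as operators on its qubits. -/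
def Loc.kr : (l : Loc 𝒢 W) → List (Op (Fin l.arity))
  | .prep _ => [ketBra false true, ketBra false false]
  | .gate g _ => [(𝒢.U g : Op (Fin (𝒢.arity g)))]
  | .meas _ => [ketBra true true, ketBra false false]

theorem Loc.ideal_eq (l : Loc 𝒢 W) (ρ : Op W) : l.ideal ρ = kmap (l.kr.map (emb l.wires)) ρ := by
  cases l with
  | prep w =>
    change _ = kmap ([ketBra false true, ketBra false false].map (emb (oneWire w))) ρ
    simp [Loc.ideal, embed_eq_emb]
  | gate g e =>
    change _ = kmap ([(𝒢.U g : Op (Fin (𝒢.arity g)))].map (emb e)) ρ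
    simp [Loc.ideal, embed_eq_emb]
  | meas w =>
    change _ = kmap ([ketBra true true, ketBra false false].map (emb (oneWire w))) ρ
    simp [Loc.ideal, embed_eq_emb]

theorem ketBra_conjTranspose (a b : Bool) : (ketBra a b)ᴴ = ketBra b a := by
  ext x y
  simp only [ketBra, conjTranspose_apply, of_apply, and_comm, apply_ite star, star_one, star_zero]

theorem sum_config_one {M : Type*} [AddCommMonoid M] (F : (Fin 1 → Bool) → M) :
    ∑ x, F x = F (fun _ => true) + F (fun _ => false) := by
  rw [← Equiv.sum_comp (Equiv.funUnique (Fin 1) Bool).symm, Fintype.sum_bool]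
  rfl

theorem ketBra_mul (a b c d : Bool) :
    ketBra a b * ketBra c d = if b = c then ketBra a d else 0 := by
  ext x y
  rw [mul_apply, sum_config_one]
  cases b <;> cases c <;> simp [ketBra, ← ite_and, and_comm]

theorem ketBra_add : ketBra true true + ketBra false false = 1 := by
  ext x y
  have : x = y ↔ x 0 = y 0 := by
    rw [funext_iff]; exact ⟨fun h => h 0, fun h i => by rwa [Subsingleton.elim i 0]⟩
  simp only [ketBra, Matrix.add_apply, of_apply, one_apply, this]
  cases x 0 <;> cases y 0 <;> simp

theorem Loc.complete_kr (l : Loc 𝒢 W) : Complete l.kr := by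
  cases l with
  | prep w =>
    change Complete [ketBra false true, ketBra false false]
    simp [Complete, ketBra_conjTranspose, ketBra_mul, ketBra_add]
  | gate g e =>
    change Complete [(𝒢.U g : Op (Fin (𝒢.arity g)))]
    have h := mem_unitaryGroup_iff'.1 (𝒢.U g).2
    rw [star_eq_conjTranspose] at h
    simpa only [Complete, List.map_cons, List.map_nil, List.sum_cons, List.sum_nil, add_zero]
      using h
  | meas w =>
    change Complete [ketBra true true, ketBra false false]
    simp [Complete, ketBra_conjTranspose, ketBra_mul, ketBra_add]

theorem Loc.ideal_map_eq (f : V ↪ W) (l : Loc 𝒢 V) (ρ : Op W) :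
    (l.map f).ideal ρ = kmap ((l.kr.map (emb l.wires)).map (emb f)) ρ := by
  rw [Loc.ideal_eq, List.map_map]
  have : emb f ∘ emb l.wires = emb (l.wires.trans f) := by funext A; exact (emb_trans _ _ _).symm
  rw [this]
  cases l <;> rfl

theorem Loc.slice_ideal_map (f : V ↪ W) (l : Loc 𝒢 V) (ρ : Op W) (r r' : W → Bool) :
    slice f r r' ((l.map f).ideal ρ) = l.ideal (slice f r r' ρ) := by
  rw [Loc.ideal_map_eq, slice_kmap_emb, Loc.ideal_eq]

/-! ### Faults in the presence of a reference system -/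

/-- Discarding the qubits `f` from `ρ` and from `σ` gives the same state. -/
def TrEq (f : V ↪ W) (ρ σ : Op W) : Prop :=
  ∀ r r', (slice f r r' ρ).trace = (slice f r r' σ).trace

theorem TrEq.refl (f : V ↪ W) (ρ : Op W) : TrEq f ρ ρ := fun _ _ => rfl

theorem TrEq.trans {f : V ↪ W} {ρ σ τ : Op W} (h : TrEq f ρ σ) (h' : TrEq f σ τ) :
    TrEq f ρ τ := fun r r' => (h r r').trans (h' r r')

theorem sum_trace_slice (f : V ↪ W) (ρ : Op W) :
    ∑ r, (slice f r r ρ).trace = Fintype.card (V → Bool) • ρ.trace := by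
  simp only [trace, diag_apply, slice_apply]
  rw [Finset.sum_comm]
  exact sum_overwrite f fun r => ρ r r

theorem TrEq.trace_eq {f : V ↪ W} {ρ σ : Op W} (h : TrEq f ρ σ) : ρ.trace = σ.trace := by
  have h₁ := sum_trace_slice f ρ
  have h₂ := sum_trace_slice f σ
  rw [Finset.sum_congr rfl fun r _ => h r r, h₂, nsmul_eq_mul, nsmul_eq_mul] at h₁
  exact (mul_left_cancel₀ (card_config_ne_zero V) h₁).symm

/-- The trace over `V` contains the trace over `X`: states that agree after few qubits are discarded
agree after more are discarded. -/
theorem TrEq.of_trans {X : Type} [Fintype X] [DecidableEq X] {g : X ↪ V} {f : V ↪ W} {ρ σ : Op W}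
    (h : TrEq (g.trans f) ρ σ) : TrEq f ρ σ := fun r r' =>
  TrEq.trace_eq (f := g) fun x x' => by rw [slice_slice, slice_slice, h]

/-- No signalling: a trace preserving operation on some qubits is invisible on the others. -/
theorem trEq_ideal_map (f : V ↪ W) (l : Loc 𝒢 V) (ρ : Op W) : TrEq f ρ ((l.map f).ideal ρ) :=
  fun r r' => by
    rw [Loc.slice_ideal_map, Loc.ideal_eq, trace_kmap (complete_map_emb _ l.complete_kr)]

/-- `σ` is a possible state after the location `l` has been executed on `ρ`: without a fault this
is the ideal operation, and with a fault (`b`) anything may happen to the qubits of the location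
and to an environment. -/
def Step (b : Prop) (l : Loc 𝒢 W) (ρ σ : Op W) : Prop :=
  (b ∧ σ ∈ cone Set.univ ∧ TrEq l.wires ρ σ) ∨ (¬b ∧ σ = l.ideal ρ)

/-- `σ` is a possible state after the execution on `ρ` of the locations in `L`, where the
locations with labels in `S` are faulty. -/
def Reach (S : Finset ℕ) : List (Loc 𝒢 W × ℕ) → Op W → Op W → Prop
  | [], ρ, σ => σ = ρ
  | a :: L, ρ, σ => ∃ τ, Step (a.2 ∈ S) a.1 ρ τ ∧ Reach S L τ σ

theorem reach_append (S : Finset ℕ) (L M : List (Loc 𝒢 W × ℕ)) (ρ σ : Op W) :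
    Reach S (L ++ M) ρ σ ↔ ∃ τ, Reach S L ρ τ ∧ Reach S M τ σ := by
  induction L generalizing ρ with
  | nil => simp [Reach]
  | cons a L ih =>
    simp only [List.cons_append, Reach, ih]
    exact ⟨fun ⟨τ, h, τ', h', h''⟩ => ⟨τ', ⟨τ, h, h'⟩, h''⟩,
      fun ⟨τ', ⟨τ, h, h'⟩, h''⟩ => ⟨τ, h, τ', h', h''⟩⟩

/-- Renaming of wires in a labelled list. -/
def relabel {V W : Type} (f : V ↪ W) (L : List (Loc 𝒢 V × ℕ)) : List (Loc 𝒢 W × ℕ) :=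
  L.map fun a => (a.1.map f, a.2)

theorem trEq_map_wires {f : V ↪ W} {l : Loc 𝒢 V} {ρ σ : Op W} :
    TrEq (l.map f).wires ρ σ ↔ TrEq (l.wires.trans f) ρ σ := by
  cases l <;> exact Iff.rfl

theorem Step.trEq {b : Prop} {f : V ↪ W} {l : Loc 𝒢 V} {ρ σ : Op W} (h : Step b (l.map f) ρ σ) :
    TrEq f ρ σ := by
  rcases h with ⟨-, -, h⟩ | ⟨-, rfl⟩
  · exact (trEq_map_wires.1 h).of_trans
  · exact trEq_ideal_map f l ρ

theorem Loc.ideal_mem_cone (l : Loc 𝒢 W) {ρ : Op W} (h : ρ ∈ cone Set.univ) :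
    l.ideal ρ ∈ cone Set.univ := by
  rw [Loc.ideal_eq]
  exact kmap_mem_cone (fun _ _ _ _ => Set.mem_univ _) h

theorem Step.mem_cone {b : Prop} {l : Loc 𝒢 W} {ρ σ : Op W} (h : Step b l ρ σ)
    (hρ : ρ ∈ cone Set.univ) : σ ∈ cone Set.univ := by
  rcases h with ⟨-, h, -⟩ | ⟨-, rfl⟩
  · exact h
  · exact l.ideal_mem_cone hρ

theorem Reach.mem_cone {S : Finset ℕ} {L : List (Loc 𝒢 W × ℕ)} {ρ σ : Op W} (h : Reach S L ρ σ)
    (hρ : ρ ∈ cone Set.univ) : σ ∈ cone Set.univ := by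
  induction L generalizing ρ with
  | nil => obtain rfl : σ = ρ := h; exact hρ
  | cons a L ih =>
    obtain ⟨τ, h₁, h₂⟩ := h
    exact ih h₂ (h₁.mem_cone hρ)

theorem Reach.trEq {S : Finset ℕ} {f : V ↪ W} {L : List (Loc 𝒢 V × ℕ)} {ρ σ : Op W}
    (h : Reach S (relabel f L) ρ σ) : TrEq f ρ σ := by
  induction L generalizing ρ with
  | nil => obtain rfl : σ = ρ := h; exact TrEq.refl _ _
  | cons a L ih =>
    obtain ⟨τ, h₁, h₂⟩ := h
    exact h₁.trEq.trans (ih h₂)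

/-! ### Supports -/

/-- The vectors all of whose components on the qubits `f` are in `𝒱`. -/
noncomputable def lift (f : V ↪ W) (𝒱 : Submodule ℂ (Vec V)) : Submodule ℂ (Vec W) where
  carrier := {v | ∀ r, vslice f v r ∈ 𝒱}
  add_mem' hu hv r := 𝒱.add_mem (hu r) (hv r)
  zero_mem' _ := 𝒱.zero_mem
  smul_mem' c _ hv r := 𝒱.smul_mem c (hv r)

theorem cone_le_univ {X : Type} (V : Set (X → ℂ)) : cone V ≤ cone Set.univ :=
  cone_mono (Set.subset_univ V)

/-- The operators that a location can apply, where `b` tells whether it is faulty. -/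
def stepOps (b : Prop) (l : Loc 𝒢 W) : Set (Op W) :=
  {K | ∃ A, K = emb l.wires A ∧ (b ∨ A ∈ l.kr)}

theorem sum_single_mul_single (n : ℕ) :
    ∑ b : Fin n → Bool, (Matrix.single b (fun _ => false) 1 *
      Matrix.single (fun _ => false) b 1 : Op (Fin n)) = 1 := by
  have h := complete_resetKraus n
  rw [Complete, resetKraus, List.map_map, Finset.sum_map_toList] at h
  simpa [Function.comp, conjTranspose_single] using h

/-- Discarded qubits may be reset. -/
theorem TrEq.kmap_reset {n : ℕ} {e : Fin n ↪ W} {ρ σ : Op W} (h : TrEq e ρ σ) :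
    kmap ((resetKraus n).map (emb e)) ρ = kmap ((resetKraus n).map (emb e)) σ :=
  slice_ext e fun r r' => by
    rw [slice_kmap_emb, slice_kmap_emb, kmap_resetKraus, kmap_resetKraus, h]

/-- A faulty step is not given by Kraus operators, so its effect on the support is found indirectly.
The states before and after it become equal once the qubits of the location are reset. The support
of the reset state is known from `ρ`, and undoing the reset of `σ` costs only operators on the
qubits of the location, which `𝒱'` already allows for. -/
theorem Step.mem_cone_lift {b : Prop} {f : V ↪ W} {l : Loc 𝒢 V} {𝒱 𝒱' : Submodule ℂ (Vec V)}
    {ρ σ : Op W} (h : Step b (l.map f) ρ σ) (hρ : ρ ∈ cone (lift f 𝒱 : Set (Vec W)))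
    (h𝒱 : ∀ K ∈ stepOps b l, ∀ v ∈ 𝒱, K *ᵥ v ∈ 𝒱') : σ ∈ cone (lift f 𝒱' : Set (Vec W)) := by
  rcases h with ⟨hb, hσ, h⟩ | ⟨hb, rfl⟩
  · have hreset := TrEq.kmap_reset (trEq_map_wires.1 h)
    -- The closure of `𝒱` under all operators on the qubits of the location; `𝒱'` itself need not be
    -- stable under them.
    set 𝒲 : Submodule ℂ (Vec V) :=
      Submodule.span ℂ {w | ∃ A, ∃ u ∈ 𝒱, w = emb l.wires A *ᵥ u} with h𝒲
    have hle : 𝒲 ≤ 𝒱' := by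
      rw [h𝒲, Submodule.span_le]
      rintro _ ⟨A, u, hu, rfl⟩
      exact h𝒱 _ ⟨A, rfl, Or.inl hb⟩ u hu
    have hcl : ∀ A, ∀ w ∈ 𝒲, emb l.wires A *ᵥ w ∈ 𝒲 := by
      intro A w hw
      refine Submodule.span_induction (p := fun w _ => emb l.wires A *ᵥ w ∈ 𝒲)
        ?_ ?_ ?_ ?_ (h𝒲 ▸ hw)
      · rintro _ ⟨B, u, hu, rfl⟩
        rw [mulVec_mulVec, ← emb_mul]
        exact Submodule.subset_span ⟨_, u, hu, rfl⟩
      · rw [mulVec_zero]; exact zero_mem _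
      · intro x y _ _ hx hy
        rw [mulVec_add]
        exact add_mem hx hy
      · intro c x _ hx
        rw [mulVec_smul]
        exact 𝒲.smul_mem c hx
    have h₁ : kmap ((resetKraus l.arity).map (emb (l.wires.trans f))) ρ ∈
        cone (lift f 𝒲 : Set (Vec W)) := by
      refine kmap_mem_cone (fun K hK v hv => ?_) hρ
      obtain ⟨A, -, rfl⟩ := List.mem_map.1 hK
      intro r
      rw [emb_trans, vslice_emb_mulVec]
      exact Submodule.subset_span ⟨_, _, hv r, rfl⟩
    rw [hreset] at h₁
    refine mem_cone_of_kmap hσ h₁ fun v _ hv => ?_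
    intro r
    refine hle ?_
    -- As `∑ b, |b⟩⟨0| |0⟩⟨b| = 1`, a vector is recovered from its resets.
    have hsum : vslice f v r = ∑ b : Fin l.arity → Bool,
        emb l.wires (Matrix.single b (fun _ => false) 1) *ᵥ
          (emb l.wires (Matrix.single (fun _ => false) b 1) *ᵥ vslice f v r) := by
      simp only [mulVec_mulVec, ← emb_mul]
      simp only [← embₗ_apply]
      rw [← Matrix.sum_mulVec, ← map_sum, sum_single_mul_single, embₗ_apply, emb_one, one_mulVec]
    rw [hsum]
    refine sum_mem fun b _ => hcl _ _ ?_
    have := hv (emb (l.wires.trans f) (Matrix.single (fun _ => false) b 1))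
      (List.mem_map_of_mem (List.mem_map_of_mem (Finset.mem_toList.2 (Finset.mem_univ b)))) r
    rwa [emb_trans, vslice_emb_mulVec] at this
  · rw [Loc.ideal_map_eq]
    refine kmap_mem_cone (fun K hK v hv => ?_) hρ
    obtain ⟨_, hA, rfl⟩ := List.mem_map.1 hK
    obtain ⟨A, hA', rfl⟩ := List.mem_map.1 hA
    intro r
    rw [vslice_emb_mulVec]
    exact h𝒱 _ ⟨A, rfl, Or.inr hA'⟩ _ (hv r)

end Locations

section Logic

variable {𝒢 : GateSet} {V W U X I : Type} [Fintype V] [DecidableEq V] [Fintype W] [DecidableEq W]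
  [Fintype U] [DecidableEq U] [Fintype X] [DecidableEq X] [Fintype I] [DecidableEq I]

/-! ### Fault paths -/

/-- The operators that the locations in `L` can apply, where those with labels in `S` are
faulty. -/
def Paths (S : Finset ℕ) : List (Loc 𝒢 V × ℕ) → Set (Op V)
  | [] => {1}
  | a :: L => {N | ∃ K ∈ Paths S L, ∃ k ∈ stepOps (a.2 ∈ S) a.1, N = K * k}

/-- The Kraus operators of a location, where a faulty location resets its qubits. -/
noncomputable def stepKraus (b : Prop) [Decidable b] (l : Loc 𝒢 V) : List (Op V) :=
  (if b then resetKraus l.arity else l.kr).map (emb l.wires)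

/-- The Kraus operators of a list of locations, where faulty locations reset their qubits. -/
noncomputable def pathKraus (S : Finset ℕ) : List (Loc 𝒢 V × ℕ) → List (Op V)
  | [] => [1]
  | a :: L => kcomp (pathKraus S L) (stepKraus (a.2 ∈ S) a.1)

theorem mem_stepOps_of_mem {b : Prop} [Decidable b] {l : Loc 𝒢 V} {K : Op V}
    (h : K ∈ stepKraus b l) : K ∈ stepOps b l := by
  obtain ⟨A, hA, rfl⟩ := List.mem_map.1 h
  refine ⟨A, rfl, ?_⟩
  by_cases hb : b
  · exact Or.inl hb
  · rw [if_neg hb] at hA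
    exact Or.inr hA

theorem mem_paths_of_mem {S : Finset ℕ} {L : List (Loc 𝒢 V × ℕ)} {K : Op V}
    (h : K ∈ pathKraus S L) : K ∈ Paths S L := by
  induction L generalizing K with
  | nil => simpa [pathKraus, Paths] using h
  | cons a L ih =>
    obtain ⟨K', hK', k, hk, rfl⟩ := mem_kcomp.1 h
    exact ⟨K', ih hK', k, mem_stepOps_of_mem hk, rfl⟩

theorem complete_stepKraus (b : Prop) [Decidable b] (l : Loc 𝒢 V) : Complete (stepKraus b l) := by
  refine complete_map_emb _ ?_
  split_ifs
  · exact complete_resetKraus _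
  · exact l.complete_kr

theorem complete_pathKraus (S : Finset ℕ) (L : List (Loc 𝒢 V × ℕ)) :
    Complete (pathKraus S L) := by
  induction L with
  | nil => exact complete_singleton_one
  | cons a L ih => exact ih.kcomp (complete_stepKraus _ _)

theorem Reach.mem_cone_lift {S : Finset ℕ} {f : V ↪ W} {L : List (Loc 𝒢 V × ℕ)}
    {𝒱 𝒱' : Submodule ℂ (Vec V)} {ρ σ : Op W} (h : Reach S (relabel f L) ρ σ)
    (hρ : ρ ∈ cone (lift f 𝒱 : Set (Vec W))) (h𝒱 : ∀ K ∈ Paths S L, ∀ v ∈ 𝒱, K *ᵥ v ∈ 𝒱') :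
    σ ∈ cone (lift f 𝒱' : Set (Vec W)) := by
  induction L generalizing ρ 𝒱 with
  | nil =>
    obtain rfl : σ = ρ := h
    refine cone_mono (fun v hv r => ?_) hρ
    simpa using h𝒱 1 rfl _ (hv r)
  | cons a L ih =>
    obtain ⟨τ, h₁, h₂⟩ := h
    -- The support after the first location: the span of everything that this location can produce
    -- from `𝒱`.
    refine ih (𝒱 := Submodule.span ℂ {w | ∃ k ∈ stepOps (a.2 ∈ S) a.1, ∃ v ∈ 𝒱, w = k *ᵥ v}) h₂
      (h₁.mem_cone_lift hρ fun k hk v hv => Submodule.subset_span ⟨k, hk, v, hv, rfl⟩) ?_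
    intro K hK w hw
    refine Submodule.span_induction (p := fun w _ => K *ᵥ w ∈ 𝒱') ?_ ?_ ?_ ?_ hw
    · rintro _ ⟨k, hk, v, hv, rfl⟩
      rw [mulVec_mulVec]
      exact h𝒱 _ ⟨K, hK, k, hk, rfl⟩ v hv
    · rw [mulVec_zero]; exact zero_mem _
    · intro x y _ _ hx hy
      rw [mulVec_add]; exact add_mem hx hy
    · intro c x _ hx
      rw [mulVec_smul]; exact 𝒱'.smul_mem c hx

/-- The span of the images of the matrices in `𝒥`. -/
def imgSpan (𝒥 : Set (Matrix (V → Bool) I ℂ)) : Submodule ℂ (Vec V) :=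
  Submodule.span ℂ {v | ∃ J ∈ 𝒥, ∃ ψ, v = J *ᵥ ψ}

/-- Sesquilinearity. The hypothesis is needed for pairs `J`, `J'`, because off-diagonal slices of an
entangled state are products of two different vectors, with different errors. -/
theorem eq_on_vecMulVec {𝒥 : Set (Matrix (V → Bool) I ℂ)} {Φ Φ' : Op V →ₗ[ℂ] Matrix X X ℂ}
    (h : ∀ J ∈ 𝒥, ∀ J' ∈ 𝒥, ∀ M : Matrix I I ℂ, Φ (J * M * J'ᴴ) = Φ' (J * M * J'ᴴ)) {u u' : Vec V}
    (hu : u ∈ imgSpan 𝒥) (hu' : u' ∈ imgSpan 𝒥) :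
    Φ (vecMulVec u (star u')) = Φ' (vecMulVec u (star u')) := by
  refine Submodule.span_induction
    (p := fun u _ => Φ (vecMulVec u (star u')) = Φ' (vecMulVec u (star u'))) ?_ ?_ ?_ ?_ hu
  · rintro _ ⟨J, hJ, ψ, rfl⟩
    refine Submodule.span_induction (p := fun u' _ => Φ (vecMulVec (J *ᵥ ψ) (star u')) =
      Φ' (vecMulVec (J *ᵥ ψ) (star u'))) ?_ ?_ ?_ ?_ hu'
    · rintro _ ⟨J', hJ', ψ', rfl⟩
      have := h J hJ J' hJ' (vecMulVec ψ (star ψ'))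
      rwa [mul_vecMulVec, vecMulVec_mul, ← star_mulVec] at this
    · simp
    · intro x y _ _ hx hy
      rw [star_add, vecMulVec_add, map_add, map_add, hx, hy]
    · intro c x _ hx
      rw [star_smul, vecMulVec_smul, map_smul, map_smul, hx]
  · simp
  · intro x y _ _ hx hy
    rw [add_vecMulVec, map_add, map_add, hx, hy]
  · intro c x _ hx
    rw [smul_vecMulVec, map_smul, map_smul, hx]

theorem eq_on_slice {f : V ↪ W} {𝒥 : Set (Matrix (V → Bool) I ℂ)}
    {Φ Φ' : Op V →ₗ[ℂ] Matrix X X ℂ}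
    (h : ∀ J ∈ 𝒥, ∀ J' ∈ 𝒥, ∀ M : Matrix I I ℂ, Φ (J * M * J'ᴴ) = Φ' (J * M * J'ᴴ)) {ρ : Op W}
    (hρ : ρ ∈ cone (lift f (imgSpan 𝒥) : Set (Vec W))) (r r' : W → Bool) :
    Φ (slice f r r' ρ) = Φ' (slice f r r' ρ) := by
  induction hρ using AddSubmonoid.closure_induction with
  | mem ρ h' =>
    obtain ⟨v, hv, rfl⟩ := h'
    rw [pureState, slice_vecMulVec]
    exact eq_on_vecMulVec h (hv r) (hv r')
  | zero => simp
  | add ρ σ _ _ h₁ h₂ => simp only [map_add, h₁, h₂]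

/-- Each Kraus operator of the composition `Λ ∘ Ξ` contributes the logical operation `B`, with a
weight read off from its Gram matrix on `J`, `J'`. By completeness the weights add up to `J'ᴴ * J`,
in which `Ξ` no longer occurs: all complete families of fault paths have the same decoded effect. -/
theorem kmap_kmap_conj {Λ : List (Matrix X (V → Bool) ℂ)} (hΛ : Complete Λ)
    {B : Matrix I I ℂ →ₗ[ℂ] Matrix X X ℂ} {𝒩 : Set (Matrix (V → Bool) I ℂ)}
    (hB : ∀ T ∈ Λ, ∀ N ∈ 𝒩, ∀ N' ∈ 𝒩, ∀ M,
      T * N * M * (T * N')ᴴ = B (M * ((T * N')ᴴ * (T * N))))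
    {Ξ : List (Op V)} (hΞ : Complete Ξ) {J J' : Matrix (V → Bool) I ℂ}
    (hJ : ∀ K ∈ Ξ, K * J ∈ 𝒩) (hJ' : ∀ K ∈ Ξ, K * J' ∈ 𝒩) (M : Matrix I I ℂ) :
    kmap Λ (kmap Ξ (J * M * J'ᴴ)) = B (M * (J'ᴴ * J)) := by
  have key : ∀ N ∈ kcomp Λ Ξ, N * (J * M * J'ᴴ) * Nᴴ = B (M * (J'ᴴ * (Nᴴ * N) * J)) := by
    intro N hN
    obtain ⟨T, hT, K, hK, rfl⟩ := mem_kcomp.1 hN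
    have := hB T hT (K * J) (hJ K hK) (K * J') (hJ' K hK) M
    simp only [conjTranspose_mul, Matrix.mul_assoc] at this ⊢
    exact this
  rw [← kmap_kcomp, kmap_apply, List.map_congr_left key]
  have : (fun N : Matrix X (V → Bool) ℂ => B (M * (J'ᴴ * (Nᴴ * N) * J))) =
      B ∘ fun N : Matrix X (V → Bool) ℂ => M * J'ᴴ * (Nᴴ * N) * J := by
    funext N
    simp only [Function.comp, Matrix.mul_assoc]
  rw [this, ← List.map_map, ← map_list_sum, list_sum_mul_mul, hΛ.kcomp hΞ]
  simp only [Matrix.mul_assoc, Matrix.one_mul]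

/-- For the decoder a faulty location might as well reset its qubits. Resetting `τ` or `ρ` gives the
same state. Whether `τ` is reset or left alone before the remaining circuit does not matter either,
since both alternatives are complete families of fault paths and `kmap_kmap_conj` gives them the
same decoded result. -/
theorem reach_logic_aux {f : V ↪ W} {S : Finset ℕ} {L : List (Loc 𝒢 V × ℕ)}
    {Λ : List (Matrix X (V → Bool) ℂ)} (hΛ : Complete Λ)
    {B : Matrix I I ℂ →ₗ[ℂ] Matrix X X ℂ} {𝒩 : Set (Matrix (V → Bool) I ℂ)}
    (hB : ∀ T ∈ Λ, ∀ N ∈ 𝒩, ∀ N' ∈ 𝒩, ∀ M,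
      T * N * M * (T * N')ᴴ = B (M * ((T * N')ᴴ * (T * N))))
    {𝒥 : Set (Matrix (V → Bool) I ℂ)} (hP : ∀ K ∈ Paths S L, ∀ J ∈ 𝒥, K * J ∈ 𝒩)
    {ρ σ : Op W} (hρ : ρ ∈ cone (lift f (imgSpan 𝒥) : Set (Vec W)))
    (h : Reach S (relabel f L) ρ σ) (r r' : W → Bool) :
    kmap Λ (slice f r r' σ) = kmap Λ (kmap (pathKraus S L) (slice f r r' ρ)) := by
  induction L generalizing ρ 𝒥 with
  | nil =>
    obtain rfl : σ = ρ := h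
    simp [pathKraus]
  | cons a L ih =>
    obtain ⟨τ, h₁, h₂⟩ := h
    have hτ : τ ∈ cone (lift f (imgSpan {N : Matrix (V → Bool) I ℂ |
        ∃ k ∈ stepOps (a.2 ∈ S) a.1, ∃ J ∈ 𝒥, N = k * J}) : Set (Vec W)) := by
      refine h₁.mem_cone_lift hρ fun K hK v hv => ?_
      refine Submodule.span_induction (p := fun v _ => K *ᵥ v ∈ imgSpan _) ?_ ?_ ?_ ?_ hv
      · rintro _ ⟨J, hJ, ψ, rfl⟩
        rw [mulVec_mulVec]
        exact Submodule.subset_span ⟨_, ⟨K, hK, J, hJ, rfl⟩, ψ, rfl⟩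
      · rw [mulVec_zero]; exact zero_mem _
      · intro x y _ _ hx hy
        rw [mulVec_add]; exact add_mem hx hy
      · intro c x _ hx
        rw [mulVec_smul]; exact Submodule.smul_mem _ c hx
    rw [ih (fun K hK N hN => ?_) hτ h₂]
    · change _ = kmap Λ (kmap (kcomp (pathKraus S L) (stepKraus (a.2 ∈ S) a.1)) _)
      rw [kmap_kcomp]
      rcases h₁ with ⟨hb, -, h₁⟩ | ⟨hb, rfl⟩
      · have hreset : kmap (stepKraus (a.2 ∈ S) a.1) (slice f r r' ρ) =
            kmap (stepKraus (a.2 ∈ S) a.1) (slice f r r' τ) := by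
          rw [stepKraus, if_pos hb]
          refine TrEq.kmap_reset fun x x' => ?_
          rw [slice_slice, slice_slice]
          exact trEq_map_wires.1 h₁ _ _
        rw [hreset, ← kmap_kcomp (pathKraus S L)]
        refine eq_on_slice (Φ := kmap Λ ∘ₗ kmap (pathKraus S L))
          (Φ' := kmap Λ ∘ₗ kmap (kcomp (pathKraus S L) (stepKraus (a.2 ∈ S) a.1))) ?_ hτ r r'
        rintro _ ⟨k, hk, J, hJ, rfl⟩ _ ⟨k', hk', J', hJ', rfl⟩ M
        have h₃ : ∀ k ∈ stepOps (a.2 ∈ S) a.1, ∀ J ∈ 𝒥, ∀ K ∈ pathKraus S L,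
            K * (k * J) ∈ 𝒩 := fun k hk J hJ K hK => by
          rw [← Matrix.mul_assoc]
          exact hP _ ⟨K, mem_paths_of_mem hK, k, hk, rfl⟩ J hJ
        -- An additional reset at a faulty location is absorbed into the arbitrary operator that the
        -- location applies, so the product is still a fault path.
        have h₄ : ∀ k ∈ stepOps (a.2 ∈ S) a.1, ∀ J ∈ 𝒥,
            ∀ K ∈ kcomp (pathKraus S L) (stepKraus (a.2 ∈ S) a.1), K * (k * J) ∈ 𝒩 := by
          intro k hk J hJ N hN
          obtain ⟨K, hK, R, hR, rfl⟩ := mem_kcomp.1 hN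
          obtain ⟨A, rfl, -⟩ := hk
          obtain ⟨A', rfl, -⟩ := mem_stepOps_of_mem hR
          rw [Matrix.mul_assoc, ← Matrix.mul_assoc (emb _ A'), ← emb_mul]
          exact h₃ _ ⟨_, rfl, Or.inl hb⟩ J hJ K hK
        rw [LinearMap.comp_apply, LinearMap.comp_apply,
          kmap_kmap_conj hΛ hB (complete_pathKraus S L) (h₃ k hk J hJ) (h₃ k' hk' J' hJ'),
          kmap_kmap_conj hΛ hB ((complete_pathKraus S L).kcomp (complete_stepKraus _ _))
            (h₄ k hk J hJ) (h₄ k' hk' J' hJ')]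
      · rw [Loc.slice_ideal_map, Loc.ideal_eq, stepKraus, if_neg hb]
    · obtain ⟨k, hk, J, hJ, rfl⟩ := hN
      rw [← Matrix.mul_assoc]
      exact hP _ ⟨K, hK, k, hk, rfl⟩ J hJ

/-- If all fault paths send the encodings `𝒥` to encodings `𝒩` that the decoder `Λ` decodes up to
the logical operation `B`, then the faulty circuit performs the logical operation `B`. -/
theorem reach_logic {f : V ↪ W} {S : Finset ℕ} {L : List (Loc 𝒢 V × ℕ)}
    {Λ : List (Matrix X (V → Bool) ℂ)} (hΛ : Complete Λ)
    {B : Matrix I I ℂ →ₗ[ℂ] Matrix X X ℂ} {𝒩 : Set (Matrix (V → Bool) I ℂ)}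
    (hB : ∀ T ∈ Λ, ∀ N ∈ 𝒩, ∀ N' ∈ 𝒩, ∀ M,
      T * N * M * (T * N')ᴴ = B (M * ((T * N')ᴴ * (T * N))))
    {𝒥 : Set (Matrix (V → Bool) I ℂ)} (hP : ∀ K ∈ Paths S L, ∀ J ∈ 𝒥, K * J ∈ 𝒩)
    {ρ σ : Op W} (hρ : ρ ∈ cone (lift f (imgSpan 𝒥) : Set (Vec W)))
    (h : Reach S (relabel f L) ρ σ) {Φ₀ : Op V →ₗ[ℂ] Matrix X X ℂ}
    (hΦ₀ : ∀ J ∈ 𝒥, ∀ J' ∈ 𝒥, ∀ M : Matrix I I ℂ, Φ₀ (J * M * J'ᴴ) = B (M * (J'ᴴ * J))) (r r' : W → Bool) :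
    kmap Λ (slice f r r' σ) = Φ₀ (slice f r r' ρ) := by
  rw [reach_logic_aux hΛ hB hP hρ h]
  refine eq_on_slice (Φ := kmap Λ ∘ₗ kmap (pathKraus S L)) (fun J hJ J' hJ' M => ?_) hρ r r'
  rw [hΦ₀ J hJ J' hJ', LinearMap.comp_apply, kmap_kmap_conj hΛ hB (complete_pathKraus S L)
    (fun K hK => hP K (mem_paths_of_mem hK) J hJ) fun K hK => hP K (mem_paths_of_mem hK) J' hJ']

theorem slice_mem_cone {g : U ↪ W} {𝒱 : Submodule ℂ (Vec U)} {ρ : Op W}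
    (hρ : ρ ∈ cone (lift g 𝒱 : Set (Vec W))) (r : W → Bool) :
    slice g r r ρ ∈ cone (𝒱 : Set (Vec U)) := by
  induction hρ using AddSubmonoid.closure_induction with
  | mem ρ h' =>
    obtain ⟨v, hv, rfl⟩ := h'
    rw [pureState, slice_vecMulVec, ← pureState]
    exact pureState_mem_cone (hv r)
  | zero => rw [map_zero]; exact zero_mem _
  | add ρ σ _ _ h₁ h₂ => rw [map_add]; exact add_mem h₁ h₂

/-- An operation on other qubits does not change the support. -/
theorem TrEq.mem_cone_lift {f : V ↪ W} {g : U ↪ W} (hfg : ∀ i j, f i ≠ g j) {ρ σ : Op W}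
    (h : TrEq f ρ σ) (hσ : σ ∈ cone Set.univ) {𝒱 : Submodule ℂ (Vec U)}
    (hρ : ρ ∈ cone (lift g 𝒱 : Set (Vec W))) : σ ∈ cone (lift g 𝒱 : Set (Vec W)) := by
  -- Summing over the configurations of `f` first shows that the test involves only the state that
  -- is left when `f` is discarded, and this state is the same for `ρ` and `σ`.
  have hquad : ∀ (z : Vec U) (ρ : Op W), Fintype.card (V → Bool) •
      ∑ r, quad z (slice g r r ρ) = ∑ r, quad z (Matrix.of fun x x' =>
        (slice f (overwrite g x r) (overwrite g x' r) ρ).trace) := by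
    intro z ρ
    rw [← sum_overwrite f fun r => quad z (slice g r r ρ), Finset.sum_comm]
    refine Finset.sum_congr rfl fun r _ => ?_
    rw [← map_sum]
    congr 1
    ext x x'
    rw [Matrix.sum_apply, of_apply, trace]
    refine Finset.sum_congr rfl fun a _ => ?_
    rw [slice_apply, diag_apply, slice_apply, overwrite_comm f g hfg, overwrite_comm f g hfg]
  refine mem_cone_of_quad {z : Vec U // ∀ u ∈ 𝒱, z ⬝ᵥ u = 0}
    (fun z => ∑ r, quad z.1 ∘ₗ slice g r r) (fun z v => ∑ r, ‖z.1 ⬝ᵥ vslice g v r‖ ^ 2)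
    (fun z v => by positivity) (fun z v => ?_) hσ (fun z => ?_)
    fun v _ hv r => mem_of_dotProduct fun z hz => ?_
  · rw [LinearMap.sum_apply]
    push_cast
    refine Finset.sum_congr rfl fun r _ => ?_
    change quad z.1 (slice g r r (pureState v)) = _
    rw [pureState, slice_vecMulVec, ← pureState, quad_pureState]
    push_cast
    rfl
  · have h₁ : ∑ r, quad z.1 (slice g r r ρ) = 0 :=
      Finset.sum_eq_zero fun r _ =>
        quad_eq_zero (V := (𝒱 : Set (Vec U))) z.2 (slice_mem_cone hρ r)
    have h₂ := hquad z.1 σ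
    have h₃ : ∀ r r', (slice f r r' σ).trace = (slice f r r' ρ).trace := fun r r' => (h r r').symm
    simp only [h₃] at h₂
    rw [← hquad z.1 ρ, h₁, smul_zero, nsmul_eq_mul, mul_eq_zero] at h₂
    rw [LinearMap.sum_apply]
    exact h₂.resolve_left (card_config_ne_zero V)
  · have := hv ⟨z, hz⟩
    rw [Finset.sum_eq_zero_iff_of_nonneg fun _ _ => by positivity] at this
    simpa using this r (Finset.mem_univ r)

end Logic

/-! ### Tensor products and block-wise decoding -/

section Tensor

variable {ι A B C : Type} [Fintype ι] [DecidableEq ι] [Fintype A] [DecidableEq A] [Fintype B]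
  [DecidableEq B] [Fintype C] [DecidableEq C]

/-- The tensor product of a family of matrices. -/
def tens (G : ι → Matrix A B ℂ) : Matrix (ι → A) (ι → B) ℂ :=
  Matrix.of fun x y => ∏ i, G i (x i) (y i)

theorem tens_mul (G : ι → Matrix A B ℂ) (H : ι → Matrix B C ℂ) :
    tens G * tens H = tens fun i => G i * H i := by
  ext x y
  simp only [tens, mul_apply, of_apply, ← Finset.prod_mul_distrib]
  rw [Finset.prod_univ_sum]
  simp

theorem tens_conjTranspose (G : ι → Matrix A B ℂ) : (tens G)ᴴ = tens fun i => (G i)ᴴ := by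
  ext x y
  simp [tens, conjTranspose_apply]

theorem tens_smul_one (c : ι → ℂ) :
    tens (fun i => c i • (1 : Matrix A A ℂ)) = (∏ i, c i) • 1 := by
  ext x y
  simp only [tens, of_apply, Matrix.smul_apply, smul_eq_mul, Finset.prod_mul_distrib]
  congr 1
  simp only [one_apply]
  rw [Finset.prod_ite_zero]
  simp [funext_iff]

theorem tens_one : tens (fun _ : ι => (1 : Matrix A A ℂ)) = 1 := by
  simpa using tens_smul_one (ι := ι) (A := A) fun _ => 1

theorem sum_tens {K : Type} [Fintype K] (G : ι → K → Matrix A B ℂ) :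
    ∑ k : ι → K, tens (fun i => G i (k i)) = tens fun i => ∑ k, G i k := by
  ext x y
  simp only [Matrix.sum_apply, tens, of_apply]
  rw [Finset.prod_univ_sum]
  simp

end Tensor

section Decode

variable {V W Q K : Type} [Fintype V] [DecidableEq V] [Fintype W] [DecidableEq W]
  [Fintype Q] [DecidableEq Q] [Fintype K] [DecidableEq K]

/-- The tensor product of matrices that act on blocks. -/
def blockTens (T : W → Matrix Bool (Q → Bool) ℂ) : Matrix (W → Bool) (W × Q → Bool) ℂ :=
  (tens T).submatrix id Function.curry

theorem blockTens_apply (T : W → Matrix Bool (Q → Bool) ℂ) (x : W → Bool) (y : W × Q → Bool) :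
    blockTens T x y = ∏ w, T w (x w) fun q => y (w, q) := rfl

theorem blockTens_conj_mul (T T' : W → Matrix Bool (Q → Bool) ℂ) :
    (blockTens T)ᴴ * blockTens T' =
      (tens fun w => (T w)ᴴ * T' w).submatrix Function.curry Function.curry := by
  rw [blockTens, blockTens, conjTranspose_submatrix, ← submatrix_mul _ _ _ _ _ Function.bijective_id,
    tens_conjTranspose, tens_mul]

/-- The Kraus operators of the decoding of all blocks, where the block `w` is decoded by the Kraus
operators `τ w`. -/
noncomputable def decKraus (τ : W → K → Matrix Bool (Q → Bool) ℂ) :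
    List (Matrix (W → Bool) (W × Q → Bool) ℂ) :=
  Finset.univ.toList.map fun k : W → K => blockTens fun w => τ w (k w)

/-- The decoding of all blocks. -/
noncomputable abbrev decode (τ : W → K → Matrix Bool (Q → Bool) ℂ) : Op (W × Q) →ₗ[ℂ] Op W :=
  kmap (decKraus τ)

theorem complete_decKraus {τ : W → K → Matrix Bool (Q → Bool) ℂ}
    (hτ : ∀ w, ∑ k, (τ w k)ᴴ * τ w k = 1) : Complete (decKraus τ) := by
  rw [Complete, decKraus, List.map_map, Finset.sum_map_toList]
  simp only [Function.comp, blockTens_conj_mul]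
  have h := sum_tens fun w k => (τ w k)ᴴ * τ w k
  simp only [hτ, tens_one] at h
  ext x y
  have h' := congrFun (congrFun h (Function.curry x)) (Function.curry y)
  rw [Matrix.sum_apply] at h' ⊢
  simp only [submatrix_apply]
  rw [h', one_apply, one_apply]
  simp only [(Equiv.curry W Q Bool).injective.eq_iff (a := x) (b := y) |>.symm, Equiv.curry]
  rfl

/-- The matrix of the decoding of the block `w`. -/
noncomputable def decKernel (τ : W → K → Matrix Bool (Q → Bool) ℂ) (w : W) (a a' : Bool)
    (q q' : Q → Bool) : ℂ := ∑ k, τ w k a q * star (τ w k a' q')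

theorem decode_apply (τ : W → K → Matrix Bool (Q → Bool) ℂ) (ρ : Op (W × Q)) (x x' : W → Bool) :
    decode τ ρ x x' = ∑ y, ∑ y', (∏ w, decKernel τ w (x w) (x' w) (fun q => y (w, q))
      fun q => y' (w, q)) * ρ y y' := by
  have hk : ∀ y y' : W × Q → Bool, (∏ w, decKernel τ w (x w) (x' w) (fun q => y (w, q))
      fun q => y' (w, q)) = ∑ k : W → K, (blockTens (fun w => τ w (k w)) x y) *
        star (blockTens (fun w => τ w (k w)) x' y') := by
    intro y y'
    simp only [decKernel, blockTens_apply, star_prod, ← Finset.prod_mul_distrib]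
    rw [Finset.prod_univ_sum]
    simp
  rw [kmap_apply, decKraus, List.map_map, Finset.sum_map_toList, Matrix.sum_apply]
  simp only [Function.comp, mul_apply, conjTranspose_apply, Finset.sum_mul, hk]
  calc _ = ∑ y', ∑ y, ∑ k : W → K, blockTens (fun w => τ w (k w)) x y * ρ y y' *
        star (blockTens (fun w => τ w (k w)) x' y') := by
        rw [Finset.sum_comm]
        exact Finset.sum_congr rfl fun y' _ => Finset.sum_comm
    _ = _ := by
        rw [Finset.sum_comm]
        exact Finset.sum_congr rfl fun y _ => Finset.sum_congr rfl fun y' _ =>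
          Finset.sum_congr rfl fun k _ => by ring

theorem prod_split {M : Type*} [CommMonoid M] (e : V ↪ W) (F : W → M) :
    ∏ w, F w = (∏ i, F (e i)) * ∏ w with ∀ i, e i ≠ w, F w := by
  rw [← Finset.prod_filter_mul_prod_filter_not Finset.univ (fun w => ∃ i, e i = w)]
  congr 1
  · have : (Finset.univ.filter fun w => ∃ i, e i = w) = Finset.univ.map e := by
      ext w; simp
    rw [this, Finset.prod_map]
  · refine Finset.prod_congr ?_ fun _ _ => rfl
    ext w; simp

/-- The qubits of the blocks `e`. -/
abbrev blocks (e : V ↪ W) : V × Q ↪ W × Q := e.prodMap (Function.Embedding.refl Q)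

theorem overwrite_blocks (e : V ↪ W) (u : V × Q → Bool) (r : W × Q → Bool) (i : V) :
    (fun q => overwrite (blocks e) u r (e i, q)) = fun q => u (i, q) := by
  funext q
  exact overwrite_apply (blocks e) u r (i, q)

theorem overwrite_blocks_of_notMem (e : V ↪ W) (u : V × Q → Bool) (r : W × Q → Bool) {w : W}
    (h : ∀ i, e i ≠ w) : (fun q => overwrite (blocks e) u r (w, q)) = fun q => r (w, q) := by
  funext q
  refine overwrite_of_notMem (blocks e) u r fun i hi => h i.1 ?_
  exact congrArg Prod.fst hi

/-- The decoding kernel is a product over blocks, so the blocks outside `e` contribute coefficients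
and only the blocks `e` are still to be decoded. The factor on the left arises because `r` and `r'`
run over configurations of all qubits, not only of those outside the blocks `e`. -/
theorem slice_decode (e : V ↪ W) (τ : W → K → Matrix Bool (Q → Bool) ℂ) (ρ : Op (W × Q))
    (s s' : W → Bool) :
    (Fintype.card (V × Q → Bool) * Fintype.card (V × Q → Bool) : ℂ) • slice e s s' (decode τ ρ) =
      ∑ r, ∑ r', (∏ w with ∀ i, e i ≠ w, decKernel τ w (s w) (s' w) (fun q => r (w, q))
        fun q => r' (w, q)) • decode (fun i => τ (e i)) (slice (blocks e) r r' ρ) := by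
  ext x x'
  set G : (W × Q → Bool) → (W × Q → Bool) → ℂ := fun y y' =>
    (∏ w, decKernel τ w (overwrite e x s w) (overwrite e x' s' w) (fun q => y (w, q))
      fun q => y' (w, q)) * ρ y y' with hG
  have h₁ : (slice e s s' (decode τ ρ)) x x' = ∑ y, ∑ y', G y y' := by
    rw [slice_apply, decode_apply]
  have h₂ : ∑ u, ∑ r, ∑ u', ∑ r', G (overwrite (blocks e) u r) (overwrite (blocks e) u' r') =
      (Fintype.card (V × Q → Bool) * Fintype.card (V × Q → Bool) : ℂ) * ∑ y, ∑ y', G y y' := by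
    rw [sum_overwrite (blocks e) fun y => ∑ u', ∑ r', G y (overwrite (blocks e) u' r')]
    simp only [sum_overwrite (blocks e), nsmul_eq_mul, ← Finset.mul_sum, mul_assoc]
  have h₃ : ∀ u r u' r', G (overwrite (blocks e) u r) (overwrite (blocks e) u' r') =
      (∏ w with ∀ i, e i ≠ w, decKernel τ w (s w) (s' w) (fun q => r (w, q))
        fun q => r' (w, q)) * ((∏ i, decKernel (fun i => τ (e i)) i (x i) (x' i)
          (fun q => u (i, q)) fun q => u' (i, q)) * slice (blocks e) r r' ρ u u') := by
    intro u r u' r'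
    rw [hG]
    simp only
    rw [prod_split e, mul_comm (∏ i, _), mul_assoc]
    congr 1
    · refine Finset.prod_congr rfl fun w hw => ?_
      have hw' := (Finset.mem_filter.1 hw).2
      rw [overwrite_blocks_of_notMem e u r hw', overwrite_blocks_of_notMem e u' r' hw',
        overwrite_of_notMem e _ _ hw', overwrite_of_notMem e _ _ hw']
    · congr 1
      refine Finset.prod_congr rfl fun i _ => ?_
      rw [overwrite_blocks, overwrite_blocks, overwrite_apply, overwrite_apply]
      rfl
  rw [Matrix.smul_apply, h₁, smul_eq_mul, ← h₂, Matrix.sum_apply, Finset.sum_comm]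
  refine Finset.sum_congr rfl fun r _ => ?_
  rw [Matrix.sum_apply]
  calc _ = ∑ u', ∑ r', ∑ u, G (overwrite (blocks e) u r) (overwrite (blocks e) u' r') := by
        rw [Finset.sum_comm]
        exact Finset.sum_congr rfl fun _ _ => Finset.sum_comm
    _ = ∑ r', ∑ u', ∑ u, G (overwrite (blocks e) u r) (overwrite (blocks e) u' r') :=
        Finset.sum_comm
    _ = _ := by
        refine Finset.sum_congr rfl fun r' _ => ?_
        rw [Matrix.smul_apply, decode_apply, smul_eq_mul, Finset.sum_comm]
        simp only [Finset.mul_sum, h₃]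

/-- If operations on the blocks `e` are related, after decoding these blocks, as stated, then they
are related in the same way after decoding all blocks. -/
theorem slice_decode_congr {Y : Type*} [AddCommGroup Y] [Module ℂ Y] (e : V ↪ W)
    {τ τ' : W → K → Matrix Bool (Q → Bool) ℂ} (hτ : ∀ w, (∀ i, e i ≠ w) → τ' w = τ w)
    {ρ ρ' : Op (W × Q)} {P P' : Op V →ₗ[ℂ] Y}
    (h : ∀ r r', P' (decode (fun i => τ' (e i)) (slice (blocks e) r r' ρ')) =
      P (decode (fun i => τ (e i)) (slice (blocks e) r r' ρ))) (s s' : W → Bool) :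
    P' (slice e s s' (decode τ' ρ')) = P (slice e s s' (decode τ ρ)) := by
  have hc := card_config_ne_zero (V × Q)
  refine (smul_right_injective Y (mul_ne_zero hc hc)) ?_
  simp only
  rw [← map_smul P', ← map_smul P, slice_decode, slice_decode]
  simp only [map_sum, map_smul, h]
  refine Finset.sum_congr rfl fun r _ => Finset.sum_congr rfl fun r' _ => ?_
  congr 1
  refine Finset.prod_congr rfl fun w hw => ?_
  simp only [decKernel, hτ w (Finset.mem_filter.1 hw).2]

theorem decode_mem_cone (τ : W → K → Matrix Bool (Q → Bool) ℂ) {ρ : Op (W × Q)}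
    (h : ρ ∈ cone Set.univ) : decode τ ρ ∈ cone Set.univ :=
  kmap_mem_cone (fun _ _ _ _ => Set.mem_univ _) h

/-- Decoders preserve the trace, so anything that is confined to the blocks `e`, a change of decoder
on them included, remains confined to the qubits `e` after decoding. In this way a bad rectangle
becomes a fault of the decoded circuit. -/
theorem TrEq.decode {e : V ↪ W} {τ τ' : W → K → Matrix Bool (Q → Bool) ℂ}
    (hτ : ∀ w, (∀ i, e i ≠ w) → τ' w = τ w) (hc : ∀ w, ∑ k, (τ w k)ᴴ * τ w k = 1)
    (hc' : ∀ w, ∑ k, (τ' w k)ᴴ * τ' w k = 1) {ρ ρ' : Op (W × Q)} (h : TrEq (blocks e) ρ ρ') :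
    TrEq e (decode τ ρ) (decode τ' ρ') := fun s s' => by
  refine (slice_decode_congr (P := traceLinearMap _ ℂ ℂ) (P' := traceLinearMap _ ℂ ℂ) e hτ
    (fun r r' => ?_) s s').symm
  simp only [traceLinearMap_apply]
  rw [trace_kmap (complete_decKraus fun i => hc (e i)),
    trace_kmap (complete_decKraus fun i => hc' (e i)), h]

end Decode

/-! ### Irrelevance of the state of unprepared wires -/

section Irrelevance

variable {𝒢 : GateSet} {V W : Type} [Fintype V] [DecidableEq V] [Fintype W] [DecidableEq W]

open Classical in
/-- The configuration that agrees with `z` on `s` and with `x` elsewhere. -/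
noncomputable def mix (s : Set W) (z x : W → Bool) : W → Bool :=
  fun w => if w ∈ s then z w else x w

theorem mix_of_mem {s : Set W} {w : W} (h : w ∈ s) (z x : W → Bool) : mix s z x w = z w :=
  if_pos h

theorem mix_of_notMem {s : Set W} {w : W} (h : w ∉ s) (z x : W → Bool) : mix s z x w = x w :=
  if_neg h

/-- The state of the wires not in `s` (up to normalisation). -/
noncomputable def forget (s : Set W) (ρ : Op W) : Op W :=
  Matrix.of fun x y => ∑ z, ρ (mix s z x) (mix s z y)

theorem forget_apply (s : Set W) (ρ : Op W) (x y : W → Bool) :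
    forget s ρ x y = ∑ z, ρ (mix s z x) (mix s z y) := rfl

theorem sum_mix {M : Type*} [AddCommMonoid M] (s : Set W) (g : (W → Bool) → M) :
    ∑ z, ∑ z', g (mix s z' z) = Fintype.card (W → Bool) • ∑ z, g z := by
  have hinv : Function.Involutive fun p : (W → Bool) × (W → Bool) =>
      (mix s p.2 p.1, mix s p.1 p.2) := by
    rintro ⟨a, r⟩
    ext w <;> by_cases h : w ∈ s <;> simp [mix, h]
  rw [← Fintype.sum_prod_type' (f := fun z z' => g (mix s z' z)), ← Equiv.sum_comp hinv.toPerm]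
  have : ∀ p : (W → Bool) × (W → Bool), mix s (hinv.toPerm _ p).2 (hinv.toPerm _ p).1 = p.1 := by
    rintro ⟨a, r⟩
    change mix s (mix s a r) (mix s r a) = a
    funext w
    by_cases h : w ∈ s <;> simp [mix, h]
  simp only [this]
  rw [Fintype.sum_prod_type, Finset.sum_comm]
  simp

theorem forget_forget {s t : Set W} (h : s ⊆ t) (ρ : Op W) (x y : W → Bool) :
    ∑ z, forget s ρ (mix t z x) (mix t z y) = Fintype.card (W → Bool) • forget t ρ x y := by
  rw [forget_apply, ← sum_mix s fun z => ρ (mix t z x) (mix t z y)]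
  refine Finset.sum_congr rfl fun z _ => Finset.sum_congr rfl fun z' _ => ?_
  have : ∀ x : W → Bool, mix s z' (mix t z x) = mix t (mix s z' z) x := by
    intro x
    funext w
    by_cases hs : w ∈ s
    · simp [mix, hs, h hs]
    · simp [mix, hs]
  rw [this, this]

theorem forget_mono {s t : Set W} (h : s ⊆ t) {ρ ρ' : Op W} (hρ : forget s ρ = forget s ρ') :
    forget t ρ = forget t ρ' := by
  ext x y
  have h₁ := forget_forget h ρ x y
  rw [hρ, forget_forget h, nsmul_eq_mul, nsmul_eq_mul] at h₁
  exact (mul_left_cancel₀ (card_config_ne_zero W) h₁).symm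

theorem overwrite_mix {f : V ↪ W} {s : Set W} (h : ∀ i, f i ∉ s) (u : V → Bool) (z x : W → Bool) :
    overwrite f u (mix s z x) = mix s z (overwrite f u x) := by
  rw [eq_comm, eq_overwrite_iff]
  refine ⟨fun i => by rw [mix_of_notMem (h i), overwrite_apply], fun w hw => ?_⟩
  by_cases hs : w ∈ s
  · rw [mix_of_mem hs, mix_of_mem hs]
  · rw [mix_of_notMem hs, mix_of_notMem hs, overwrite_of_notMem _ _ _ hw]

theorem forget_conj {f : V ↪ W} {s : Set W} (h : ∀ i, f i ∉ s) (A : Op V) (ρ : Op W) :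
    forget s (emb f A * ρ * (emb f A)ᴴ) = emb f A * forget s ρ * (emb f A)ᴴ := by
  ext x y
  simp only [forget_apply, emb_conj_apply, mix_of_notMem (h _), overwrite_mix h, Finset.mul_sum,
    Finset.sum_mul]
  rw [Finset.sum_comm]
  exact Finset.sum_congr rfl fun _ _ => Finset.sum_comm

theorem forget_add (s : Set W) (ρ σ : Op W) : forget s (ρ + σ) = forget s ρ + forget s σ := by
  ext x y
  simp [forget_apply, Finset.sum_add_distrib]

theorem forget_kmap {f : V ↪ W} {s : Set W} (h : ∀ i, f i ∉ s) (L : List (Op V)) (ρ : Op W) :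
    forget s (kmap (L.map (emb f)) ρ) = kmap (L.map (emb f)) (forget s ρ) := by
  induction L with
  | nil => ext x y; simp [forget_apply]
  | cons A L ih => rw [List.map_cons, kmap_cons, forget_add, forget_conj h, ih, kmap_cons]

theorem prep_ideal_apply (w : W) (ρ : Op W) (x y : W → Bool) :
    (Loc.prep w : Loc 𝒢 W).ideal ρ x y = if x w = false ∧ y w = false then
      ∑ b : Fin 1 → Bool, ρ (overwrite (oneWire w) b x) (overwrite (oneWire w) b y) else 0 := by
  have h : ∀ b, (embed (oneWire w) (ketBra false b) * ρ * (embed (oneWire w) (ketBra false b))ᴴ) x y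
      = if x w = false ∧ y w = false then
        ρ (overwrite (oneWire w) (fun _ => b) x) (overwrite (oneWire w) (fun _ => b) y) else 0 := by
    intro b
    rw [embed_eq_emb, emb_conj_apply]
    simp only [ketBra, of_apply]
    change ∑ u : Fin 1 → Bool, ∑ u' : Fin 1 → Bool, (if x w = false ∧ u 0 = b then (1 : ℂ) else 0) *
      ρ (overwrite (oneWire w) u x) (overwrite (oneWire w) u' y) *
        star (if y w = false ∧ u' 0 = b then (1 : ℂ) else 0) = _
    simp only [sum_config_one]
    cases b <;> by_cases h₁ : x w = false <;> by_cases h₂ : y w = false <;> simp [h₁, h₂]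
  rw [Loc.ideal, Fintype.sum_bool, Matrix.add_apply, h, h, sum_config_one]
  split_ifs <;> simp

/-- A preparation traces out whatever the wire carried, so the wire may be dropped from the
forgotten ones. The factor 2 counts the values that `z` may take on `w` without changing `mix`. -/
theorem forget_prep (w : W) (s : Set W) (ρ : Op W) (x y : W → Bool) :
    forget (s \ {w}) ((Loc.prep w : Loc 𝒢 W).ideal ρ) x y =
      if x w = false ∧ y w = false then 2 * forget (insert w s) ρ x y else 0 := by
  have hw : w ∉ s \ {w} := by simp
  simp only [forget_apply, prep_ideal_apply, mix_of_notMem hw]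
  split_ifs with h
  · have h₁ : ∀ (b : Fin 1 → Bool) (z x : W → Bool), overwrite (oneWire w) b (mix (s \ {w}) z x) =
        mix (insert w s) (overwrite (oneWire w) b z) x := by
      intro b z x
      rw [eq_comm, eq_overwrite_iff]
      refine ⟨fun i => ?_, fun v hv => ?_⟩
      · have hm : oneWire w i ∈ insert w s := Or.inl rfl
        rw [mix_of_mem hm, overwrite_apply]
      · have hvw : v ≠ w := fun h => hv 0 h.symm
        by_cases hs : v ∈ s
        · rw [mix_of_mem (by simp [hs]), mix_of_mem (by simp [hs, hvw]),
            overwrite_of_notMem _ _ _ hv]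
        · rw [mix_of_notMem (by simp [hs, hvw]), mix_of_notMem (by simp [hs])]
    simp only [h₁]
    rw [Finset.sum_comm, sum_overwrite (oneWire w) fun z =>
      ρ (mix (insert w s) z x) (mix (insert w s) z y)]
    simp
  · exact Finset.sum_const_zero

theorem forget_prep_congr {w : W} {s : Set W} {ρ ρ' : Op W} (h : forget s ρ = forget s ρ') :
    forget (s \ {w}) ((Loc.prep w : Loc 𝒢 W).ideal ρ) =
      forget (s \ {w}) ((Loc.prep w : Loc 𝒢 W).ideal ρ') := by
  ext x y
  rw [forget_prep, forget_prep, forget_mono (Set.subset_insert w s) h]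

/-! ### Kraus operators of circuits with error channels -/

/-- The Kraus operators of a channel as a list. -/
def Channel.list {n : ℕ} (E : Channel n) : List (Op (Fin n)) := List.ofFn E.kraus

theorem Channel.complete_list {n : ℕ} (E : Channel n) : FTQC.Complete E.list := by
  rw [FTQC.Complete, Channel.list, List.map_ofFn, List.sum_ofFn]
  exact E.complete

theorem Channel.on_eq {n : ℕ} (E : Channel n) (e : Fin n ↪ W) (ρ : Op W) :
    E.on e ρ = kmap (E.list.map (emb e)) ρ := by
  rw [kmap_apply, Channel.list, List.map_ofFn, List.map_ofFn, List.sum_ofFn]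
  simp only [Channel.on, embed_eq_emb]
  rfl

/-- The effect of a location with an optional fault. -/
noncomputable def Loc.exec (l : Loc 𝒢 W) : Option ErrorChoice → Op W → Op W
  | none => l.ideal
  | some E => l.faulty (E l.arity)

theorem run_cons (l : Loc 𝒢 W) (ls : List (Loc 𝒢 W)) (F : ℕ → Option ErrorChoice) (ρ : Op W) :
    run (l :: ls) F ρ = run ls (fun i => F (i + 1)) (l.exec (F 0) ρ) := by
  rw [run]
  cases F 0 <;> rfl

/-- The Kraus operators of a location with an optional fault. -/
def Loc.execKr : (l : Loc 𝒢 W) → Option ErrorChoice → List (Op (Fin l.arity))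
  | l, none => l.kr
  | .prep _, some E => kcomp (E 1).list [ketBra false true, ketBra false false]
  | .gate g _, some E => kcomp (E (𝒢.arity g)).list [(𝒢.U g : Op (Fin (𝒢.arity g)))]
  | .meas _, some E => kcomp [ketBra true true, ketBra false false] (E 1).list

theorem kcomp_map_emb (f : V ↪ W) (L M : List (Op V)) :
    kcomp (L.map (emb f)) (M.map (emb f)) = (kcomp L M).map (emb f) := by
  simp only [kcomp, List.flatMap_map, List.map_flatMap, List.map_map]
  congr 1
  funext k
  exact List.map_congr_left fun K _ => (emb_mul f K k).symm

theorem Loc.exec_eq (l : Loc 𝒢 W) (o : Option ErrorChoice) (ρ : Op W) :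
    l.exec o ρ = kmap ((l.execKr o).map (emb l.wires)) ρ := by
  cases o with
  | none =>
    cases l with
    | prep w => exact Loc.ideal_eq (Loc.prep w) ρ
    | gate g e => exact Loc.ideal_eq (Loc.gate g e) ρ
    | meas w => exact Loc.ideal_eq (Loc.meas w) ρ
  | some E =>
    cases l with
    | prep w =>
      change (E 1).on (oneWire w) ((Loc.prep w : Loc 𝒢 W).ideal ρ) = kmap (List.map (emb (oneWire w))
        (kcomp (E 1).list [ketBra false true, ketBra false false])) ρ
      rw [← kcomp_map_emb, kmap_kcomp, Channel.on_eq, Loc.ideal_eq]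
      rfl
    | gate g e =>
      change (E _).on e ((Loc.gate g e : Loc 𝒢 W).ideal ρ) = kmap (List.map (emb e)
        (kcomp (E _).list [(𝒢.U g : Op (Fin (𝒢.arity g)))])) ρ
      rw [← kcomp_map_emb, kmap_kcomp, Channel.on_eq, Loc.ideal_eq]
      rfl
    | meas w =>
      change (Loc.meas w : Loc 𝒢 W).ideal ((E 1).on (oneWire w) ρ) = kmap (List.map (emb (oneWire w))
        (kcomp [ketBra true true, ketBra false false] (E 1).list)) ρ
      rw [← kcomp_map_emb, kmap_kcomp, Channel.on_eq, Loc.ideal_eq]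
      rfl

theorem Loc.complete_execKr (l : Loc 𝒢 W) (o : Option ErrorChoice) : Complete (l.execKr o) := by
  cases o with
  | none =>
    cases l with
    | prep w => exact (Loc.prep w : Loc 𝒢 W).complete_kr
    | gate g e => exact (Loc.gate g e : Loc 𝒢 W).complete_kr
    | meas w => exact (Loc.meas w : Loc 𝒢 W).complete_kr
  | some E =>
    cases l with
    | prep w => exact (E 1).complete_list.kcomp (Loc.prep w : Loc 𝒢 W).complete_kr
    | gate g e => exact (E _).complete_list.kcomp (Loc.gate g e : Loc 𝒢 W).complete_kr
    | meas w => exact (Loc.meas w : Loc 𝒢 W).complete_kr.kcomp (E 1).complete_list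

/-- A faulty location with an error channel is still a trace preserving operation on its own qubits,
hence an instance of the abstract fault. -/
theorem Loc.step_exec (l : Loc 𝒢 W) (o : Option ErrorChoice) {ρ : Op W}
    (hρ : ρ ∈ cone Set.univ) {b : Prop} (hb : b ↔ o.isSome) : Step b l ρ (l.exec o ρ) := by
  cases o with
  | none => exact Or.inr ⟨by simp [hb], rfl⟩
  | some E =>
    refine Or.inl ⟨by simp [hb], ?_, fun r r' => ?_⟩
    · rw [Loc.exec_eq]
      exact kmap_mem_cone (fun _ _ _ _ => Set.mem_univ _) hρ
    · rw [Loc.exec_eq, slice_kmap_emb, trace_kmap (l.complete_execKr _)]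

/-- The Kraus operators of a list of locations with optional faults. -/
noncomputable def runKraus : List (Loc 𝒢 W) → (ℕ → Option ErrorChoice) → List (Op W)
  | [], _ => [1]
  | l :: ls, F => kcomp (runKraus ls fun i => F (i + 1)) ((l.execKr (F 0)).map (emb l.wires))

theorem run_eq (ls : List (Loc 𝒢 W)) (F : ℕ → Option ErrorChoice) (ρ : Op W) :
    run ls F ρ = kmap (runKraus ls F) ρ := by
  induction ls generalizing F ρ with
  | nil => simp [run, runKraus]
  | cons l ls ih => rw [run_cons, ih, Loc.exec_eq, runKraus, kmap_kcomp]

theorem complete_runKraus (ls : List (Loc 𝒢 W)) (F : ℕ → Option ErrorChoice) :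
    Complete (runKraus ls F) := by
  induction ls generalizing F with
  | nil => exact complete_singleton_one
  | cons l ls ih => exact (ih _).kcomp (complete_map_emb _ (l.complete_execKr _))

/-- The wires that carry a qubit after the execution of a list of locations. -/
def liveAfter {W : Type} (live : Set W) (ls : List (Loc 𝒢 W)) : Set W := live ∪ {w | Loc.prep w ∈ ls}

theorem liveAfter_cons {W : Type} (live : Set W) (l : Loc 𝒢 W) (ls : List (Loc 𝒢 W)) :
    liveAfter live (l :: ls) = liveAfter (liveAfter live [l]) ls := by
  ext w
  simp [liveAfter, or_assoc]

theorem forget_exec {l : Loc 𝒢 W} {live : Set W} (o : Option ErrorChoice)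
    (hl : WellFormed live [l]) {ρ ρ' : Op W} (h : forget liveᶜ ρ = forget liveᶜ ρ') :
    forget (liveAfter live [l])ᶜ (l.exec o ρ) = forget (liveAfter live [l])ᶜ (l.exec o ρ') := by
  have key : ∀ l : Loc 𝒢 W, (∀ w, l ≠ Loc.prep w) → (∀ i, l.wires i ∈ live) →
      forget (liveAfter live [l])ᶜ (l.exec o ρ) =
        forget (liveAfter live [l])ᶜ (l.exec o ρ') := by
    intro l hl hw
    have : liveAfter live [l] = live := by
      ext w
      simp [liveAfter, (hl w).symm]
    have hw' : ∀ i, l.wires i ∉ liveᶜ := fun i => not_not.2 (hw i)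
    rw [this, Loc.exec_eq, Loc.exec_eq, forget_kmap hw', forget_kmap hw', h]
  cases l with
  | prep w =>
    have hlive : (liveAfter live [(Loc.prep w : Loc 𝒢 W)])ᶜ = liveᶜ \ {w} := by
      ext v
      simp [liveAfter, eq_comm, and_comm]
    rw [hlive]
    have h₁ := forget_prep_congr (𝒢 := 𝒢) (w := w) h
    cases o with
    | none => exact h₁
    | some E =>
      change forget _ ((E 1).on (oneWire w) _) = forget _ ((E 1).on (oneWire w) _)
      have hw' : ∀ i, oneWire w i ∉ liveᶜ \ {w} := fun i h => h.2 rfl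
      rw [Channel.on_eq, Channel.on_eq, forget_kmap hw', forget_kmap hw', h₁]
  | gate g e => exact key _ ((fun _ => by simp)) hl.1
  | meas w => exact key _ ((fun _ => by simp)) fun _ => hl.1

theorem WellFormed.head {live : Set W} {l : Loc 𝒢 W} {ls : List (Loc 𝒢 W)}
    (h : WellFormed live (l :: ls)) : WellFormed live [l] := by
  cases l with
  | prep w => exact trivial
  | gate g e => exact ⟨h.1, trivial⟩
  | meas w => exact ⟨h.1, by simp, trivial⟩

theorem WellFormed.tail {W : Type} {live : Set W} {l : Loc 𝒢 W} {ls : List (Loc 𝒢 W)}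
    (h : WellFormed live (l :: ls)) : WellFormed (liveAfter live [l]) ls := by
  cases l with
  | prep w =>
    have : liveAfter live [(Loc.prep w : Loc 𝒢 W)] = insert w live := by
      ext v
      simp [liveAfter, or_comm]
    rw [this]
    exact h
  | gate g e =>
    have : liveAfter live [(Loc.gate g e : Loc 𝒢 W)] = live := by ext v; simp [liveAfter]
    rw [this]
    exact h.2
  | meas w =>
    have : liveAfter live [(Loc.meas w : Loc 𝒢 W)] = live := by ext v; simp [liveAfter]
    rw [this]
    exact h.2.2

/-- The final state of the live wires does not depend on the initial state of the others. -/
theorem forget_run {ls : List (Loc 𝒢 W)} {live : Set W} (hls : WellFormed live ls)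
    (F : ℕ → Option ErrorChoice) {ρ ρ' : Op W} (h : forget liveᶜ ρ = forget liveᶜ ρ') :
    forget (liveAfter live ls)ᶜ (run ls F ρ) = forget (liveAfter live ls)ᶜ (run ls F ρ') := by
  induction ls generalizing live F ρ ρ' with
  | nil => simpa [liveAfter, run] using h
  | cons l ls ih =>
    rw [run_cons, run_cons, liveAfter_cons]
    exact ih hls.tail _ (forget_exec _ hls.head h)

/-! ### Fault paths are combinations of Kraus operators -/

/-- The channel that resets all qubits to the basis state `a`. -/
noncomputable def resetChannel (n : ℕ) (a : Fin n → Bool) : Channel n where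
  r := Fintype.card (Fin n → Bool)
  kraus j := Matrix.single a ((Fintype.equivFin (Fin n → Bool)).symm j) 1
  complete := by
    rw [Equiv.sum_comp (Fintype.equivFin (Fin n → Bool)).symm fun b =>
      (Matrix.single a b (1 : ℂ))ᴴ * Matrix.single a b 1]
    ext x y
    simp only [conjTranspose_single, single_mul_single_same, Matrix.sum_apply,
      single_apply, one_apply, star_one, mul_one]
    by_cases h : x = y
    · subst h; simp
    · simp only [h, if_false]
      exact Finset.sum_eq_zero fun b _ => if_neg fun hb => h (hb.1.symm.trans hb.2)

theorem single_mem_resetChannel (n : ℕ) (a b : Fin n → Bool) :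
    Matrix.single a b 1 ∈ (resetChannel n a).list := by
  rw [Channel.list, List.mem_ofFn]
  exact ⟨Fintype.equivFin _ b, by simp [resetChannel]⟩

theorem mem_span_of_single {n : ℕ} {P : Submodule ℂ (Op (Fin n))}
    (h : ∀ a b, Matrix.single a b 1 ∈ P) (A : Op (Fin n)) : A ∈ P := by
  rw [matrix_eq_sum_single A]
  refine sum_mem fun a _ => sum_mem fun b _ => ?_
  have : Matrix.single a b (A a b) = A a b • Matrix.single a b (1 : ℂ) := by
    rw [smul_single, smul_eq_mul, mul_one]
  rw [this]
  exact P.smul_mem _ (h a b)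

theorem exists_errorChoice {n : ℕ} (E : Channel n) : ∃ F : ErrorChoice, F n = E :=
  ⟨fun m => if h : n = m then h ▸ E else resetChannel m fun _ => false, by simp⟩

theorem ketBra_eq_single (a b : Fin 1 → Bool) : ketBra (a 0) (b 0) = Matrix.single a b 1 := by
  ext x y
  simp [ketBra, single_apply, funext_iff, Fin.forall_fin_one, eq_comm]

/-- Matrix units `|a⟩⟨b|` are Kraus operators of reset channels, and the ideal operation can be
absorbed: a preparation supplies `|0⟩⟨b|`, a gate is cancelled by its inverse, and a measurement
after the reset to `a` keeps `|a⟩`. Error channels therefore generate every operator on the qubits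
of the location. -/
theorem mem_span_execKr (l : Loc 𝒢 W) (A : Op (Fin l.arity)) :
    A ∈ Submodule.span ℂ {B | ∃ E, B ∈ l.execKr (some E)} := by
  cases l with
  | prep w =>
    suffices h : ∀ A : Op (Fin 1), A ∈ Submodule.span ℂ {B : Op (Fin 1) | ∃ E : ErrorChoice,
      B ∈ kcomp (E 1).list [ketBra false true, ketBra false false]} from h A
    refine mem_span_of_single fun a b => ?_
    obtain ⟨E, hE⟩ := exists_errorChoice (resetChannel 1 a)
    refine Submodule.subset_span ⟨E, mem_kcomp.2 ⟨Matrix.single a (fun _ => false) 1, ?_,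
      ketBra false (b 0), by cases b 0 <;> simp, ?_⟩⟩
    · rw [hE]; exact single_mem_resetChannel 1 a _
    · rw [ketBra_eq_single (fun _ => false) b]
      simp
  | gate g e =>
    have hU : (𝒢.U g : Op (Fin (𝒢.arity g)))ᴴ * (𝒢.U g : Op (Fin (𝒢.arity g))) = 1 := by
      have h := mem_unitaryGroup_iff'.1 (𝒢.U g).2
      rwa [star_eq_conjTranspose] at h
    set P : Submodule ℂ (Op (Fin (𝒢.arity g))) := Submodule.span ℂ
      {B : Op (Fin (𝒢.arity g)) | ∃ E : ErrorChoice,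
        B ∈ kcomp (E (𝒢.arity g)).list [(𝒢.U g : Op (Fin (𝒢.arity g)))]} with hP
    suffices h : ∀ A : Op (Fin (𝒢.arity g)), A ∈ P from h A
    intro A
    -- Used below for `B = A * Uᴴ`, so that the ideal gate in front of the error cancels.
    have h : ∀ B : Op (Fin (𝒢.arity g)), B ∈ P.comap
        (LinearMap.mulRight ℂ (𝒢.U g : Op (Fin (𝒢.arity g)))) := by
      refine mem_span_of_single fun a b => ?_
      obtain ⟨E, hE⟩ := exists_errorChoice (resetChannel _ a)
      refine Submodule.subset_span ⟨E, mem_kcomp.2 ⟨Matrix.single a b 1, ?_, _,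
        List.mem_singleton.2 rfl, rfl⟩⟩
      rw [hE]; exact single_mem_resetChannel _ a _
    have := h (A * (𝒢.U g : Op (Fin (𝒢.arity g)))ᴴ)
    rw [Submodule.mem_comap, LinearMap.mulRight_apply, Matrix.mul_assoc, hU, Matrix.mul_one] at this
    exact this
  | meas w =>
    suffices h : ∀ A : Op (Fin 1), A ∈ Submodule.span ℂ {B : Op (Fin 1) | ∃ E : ErrorChoice,
      B ∈ kcomp [ketBra true true, ketBra false false] (E 1).list} from h A
    refine mem_span_of_single fun a b => ?_
    obtain ⟨E, hE⟩ := exists_errorChoice (resetChannel 1 a)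
    refine Submodule.subset_span ⟨E, mem_kcomp.2 ⟨ketBra (a 0) (a 0), by cases a 0 <;> simp,
      Matrix.single a b 1, ?_, ?_⟩⟩
    · rw [hE]; exact single_mem_resetChannel 1 a _
    · rw [ketBra_eq_single a a]
      simp

/-- Faults at the locations with labels in `S`, when the labels start at `off`. -/
def faultsFrom (S : Finset ℕ) (off : ℕ) (err : ℕ → ErrorChoice) : ℕ → Option ErrorChoice :=
  fun i => if off + i ∈ S then some (err i) else none

/-- A product of linear combinations is a linear combination of products, with independent error
choices at the different locations. Linear statements about runs with error channels thereby extend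
to all fault paths. -/
theorem mem_span_runKraus {S : Finset ℕ} {ls : List (Loc 𝒢 W)} {off : ℕ} {K : Op W}
    (hK : K ∈ Paths S (ls.zipIdx off)) :
    K ∈ Submodule.span ℂ {K' | ∃ err, K' ∈ runKraus ls (faultsFrom S off err)} := by
  induction ls generalizing off K with
  | nil =>
    obtain rfl : K = 1 := hK
    exact Submodule.subset_span ⟨fun _ n => resetChannel n fun _ => false, by simp [runKraus]⟩
  | cons l ls ih =>
    rw [List.zipIdx_cons] at hK
    obtain ⟨K, hK, _, ⟨A, rfl, hA⟩, rfl⟩ := hK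
    have hA' : emb l.wires A ∈ Submodule.span ℂ {B | ∃ E, B ∈
        (l.execKr (if off ∈ S then some E else none)).map (emb l.wires)} := by
      by_cases hS : off ∈ S
      · simp only [hS, if_true]
        have := Submodule.mem_map_of_mem (f := embₗ l.wires) (mem_span_execKr l A)
        rw [Submodule.map_span] at this
        refine Submodule.span_mono ?_ this
        rintro _ ⟨B, ⟨E, hB⟩, rfl⟩
        exact ⟨E, List.mem_map_of_mem hB⟩
      · simp only [hS, if_false]
        refine Submodule.subset_span ⟨fun n => resetChannel n fun _ => false, ?_⟩
        cases l <;> exact List.mem_map_of_mem (hA.resolve_left hS)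
    have := Submodule.mul_mem_mul (ih hK) hA'
    rw [Submodule.span_mul_span] at this
    refine Submodule.span_mono ?_ this
    rintro _ ⟨K', ⟨err, hK'⟩, B, ⟨E, hB⟩, rfl⟩
    refine ⟨fun i => Nat.casesOn i E err, mem_kcomp.2 ⟨K', ?_, B, ?_, rfl⟩⟩
    · convert hK' using 2
      funext i
      simp [faultsFrom, add_comm, add_left_comm]
    · exact hB

end Irrelevance

/-! ### Isometric injections of subsystems -/

section Inj

variable {V W X : Type} [Fintype V] [DecidableEq V] [Fintype W] [DecidableEq W]
  [Fintype X] [DecidableEq X]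

/-- The isometry that adds the basis state `r` on the qubits not in the range of `f`. -/
noncomputable def inj (f : V ↪ W) (r : W → Bool) : Matrix (W → Bool) (V → Bool) ℂ :=
  Matrix.of fun x u => if x = overwrite f u r then 1 else 0

theorem inj_conjTranspose_mulVec (f : V ↪ W) (r : W → Bool) (w : Vec W) :
    (inj f r)ᴴ *ᵥ w = vslice f w r := by
  funext u
  simp [mulVec, dotProduct, inj, conjTranspose_apply, vslice, apply_ite star]

theorem inj_mulVec_apply (f : V ↪ W) (r : W → Bool) (v : Vec V) (x : W → Bool) :
    (inj f r *ᵥ v) x =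
      if ∀ w, (∀ i, f i ≠ w) → x w = r w then v (fun i => x (f i)) else 0 := by
  simp only [mulVec, dotProduct, inj, of_apply, ite_mul, one_mul, zero_mul, eq_overwrite_iff]
  split_ifs with h
  · have : ∀ u : V → Bool, ((∀ i, x (f i) = u i) ∧ ∀ w, (∀ i, f i ≠ w) → x w = r w) ↔
        (fun i => x (f i)) = u := fun u => by simp only [funext_iff]; tauto
    simp [this]
  · exact Finset.sum_eq_zero fun u _ => if_neg fun hu => h hu.2

theorem vslice_inj_mulVec (f : V ↪ W) (r r' : W → Bool) (v : Vec V) :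
    vslice f (inj f r *ᵥ v) r' = if ∀ w, (∀ i, f i ≠ w) → r' w = r w then v else 0 := by
  funext u
  rw [vslice, inj_mulVec_apply]
  have : (∀ w, (∀ i, f i ≠ w) → overwrite f u r' w = r w) ↔
      ∀ w, (∀ i, f i ≠ w) → r' w = r w :=
    forall_congr' fun w => forall_congr' fun hw => by rw [overwrite_of_notMem _ _ _ hw]
  simp only [this, overwrite_apply]
  split_ifs <;> rfl

theorem emb_mul_inj (f : V ↪ W) (r : W → Bool) (A : Op V) : emb f A * inj f r = inj f r * A := by
  refine Matrix.ext_of_mulVec_single fun i => vec_ext f fun r' => ?_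
  rw [← mulVec_mulVec, ← mulVec_mulVec, vslice_emb_mulVec, vslice_inj_mulVec, vslice_inj_mulVec]
  split_ifs <;> simp

theorem sum_inj_vslice (f : V ↪ W) (u : Vec W) :
    ∑ r, inj f r *ᵥ vslice f u r = (Fintype.card (V → Bool) : ℂ) • u := by
  funext x
  rw [Finset.sum_apply]
  simp only [inj_mulVec_apply]
  rw [sum_overwrite_eq f x fun r => vslice f u r fun i => x (f i)]
  simp [vslice]

/-- Each vector is, up to a factor, the sum of its slices put back in place by `inj`. -/
theorem lift_le {f : V ↪ W} {𝒱 : Submodule ℂ (Vec V)} {P : Submodule ℂ (Vec W)}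
    (h : ∀ v ∈ 𝒱, ∀ r, inj f r *ᵥ v ∈ P) : lift f 𝒱 ≤ P := by
  intro u hu
  have : u = (Fintype.card (V → Bool) : ℂ)⁻¹ • ∑ r, inj f r *ᵥ vslice f u r := by
    rw [sum_inj_vslice, inv_smul_smul₀ (card_config_ne_zero V)]
  rw [this]
  exact P.smul_mem _ (sum_mem fun r _ => h _ (hu r) r)

theorem lift_mono (f : V ↪ W) {𝒱 𝒱' : Submodule ℂ (Vec V)} (h : 𝒱 ≤ 𝒱') : lift f 𝒱 ≤ lift f 𝒱' :=
  fun _ hv r => h (hv r)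

theorem lift_lift (g : X ↪ V) (f : V ↪ W) (𝒱 : Submodule ℂ (Vec X)) :
    lift f (lift g 𝒱) = lift (g.trans f) 𝒱 := by
  ext v
  refine ⟨fun h r => ?_, fun h r x => ?_⟩
  · have := h r fun i => r (f i)
    rwa [vslice_vslice, overwrite_self] at this
  · rw [vslice_vslice]
    exact h _

/-- The Kraus operators of the partial trace over the qubits not in the range of `f`. -/
noncomputable def ptrKraus (f : V ↪ W) : List (Matrix (V → Bool) (W → Bool) ℂ) :=
  Finset.univ.toList.map fun r => (inj f r)ᴴ

theorem kmap_ptrKraus (f : V ↪ W) (ρ : Op W) : kmap (ptrKraus f) ρ = ∑ r, slice f r r ρ := by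
  rw [kmap_apply, ptrKraus, List.map_map, Finset.sum_map_toList]
  refine Finset.sum_congr rfl fun r _ => ?_
  ext x y
  simp [Function.comp, inj, mul_apply, slice_apply, conjTranspose_apply, apply_ite star]

theorem kmap_ptrKraus_congr {f : V ↪ W} {s : Set W} (hs : ∀ w, (∀ i, f i ≠ w) ↔ w ∈ s) {ρ ρ' : Op W}
    (h : forget s ρ = forget s ρ') : kmap (ptrKraus f) ρ = kmap (ptrKraus f) ρ' := by
  have key : ∀ ρ : Op W, kmap (ptrKraus f) ρ = Matrix.of fun x y =>
      forget s ρ (overwrite f x fun _ => false) (overwrite f y fun _ => false) := by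
    intro ρ
    rw [kmap_ptrKraus]
    ext x y
    rw [Matrix.sum_apply, of_apply, forget_apply]
    have h₁ : ∀ (z : W → Bool) (x : V → Bool),
        mix s z (overwrite f x fun _ => false) = overwrite f x z := by
      intro z x
      rw [eq_overwrite_iff]
      refine ⟨fun i => ?_, fun w hw => mix_of_mem ((hs w).1 hw) _ _⟩
      rw [mix_of_notMem fun hi => (hs _).2 hi i rfl, overwrite_apply]
    simp only [h₁, slice_apply]
  rw [key, key, h]

/-- Positive terms cannot cancel, so the support of a mixture contains the image under each Kraus
operator. The factor `c` accommodates partial traces that are not normalised. -/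
theorem mulVec_mem_of_kmap_mem_cone {Y : Type} [Fintype Y] [DecidableEq Y] {Z : Type} [Fintype Z] [DecidableEq Z]
    {𝒱 : Submodule ℂ (Y → ℂ)}
    {L : List (Matrix Y Z ℂ)} {u : Z → ℂ} {c : ℕ} (hc : c ≠ 0)
    (h : c • kmap L (pureState u) ∈ cone (𝒱 : Set (Y → ℂ))) {K : Matrix Y Z ℂ} (hK : K ∈ L) :
    K *ᵥ u ∈ 𝒱 := by
  refine mem_of_dotProduct fun z hz => ?_
  have h₁ := quad_eq_zero hz h
  have h₂ : quad z (kmap L (pureState u)) =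
      (((L.map fun K => ‖z ⬝ᵥ (K *ᵥ u)‖ ^ 2).sum : ℝ) : ℂ) := by
    rw [kmap_list_sum_pureState, map_list_sum, List.map_map, ← Complex.ofRealHom_eq_coe,
      map_list_sum, List.map_map]
    exact congrArg List.sum (List.map_congr_left fun K _ => quad_pureState _ _)
  rw [map_nsmul, h₂, smul_eq_zero] at h₁
  have h₃ := h₁.resolve_left hc
  norm_cast at h₃
  simpa using eq_zero_of_list_sum_eq_zero (fun K => by positivity) h₃ K hK

end Inj

/-! ### Fault paths of the circuits of a scheme -/

namespace Scheme

variable {𝒢 : GateSet} (s : Scheme 𝒢)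

/-- The data qubits of `n` blocks. -/
def data (n : ℕ) : s.Block n ↪ Fin n × s.Q :=
  ⟨fun p => (p.1, Sum.inl p.2), fun p q h => by
    simp only [Prod.mk.injEq, Sum.inl.injEq] at h
    exact Prod.ext h.1 h.2⟩

theorem notMem_data {n : ℕ} (p : Fin n × s.Q) :
    (∀ i, s.data n i ≠ p) ↔ p ∈ ({p | p.2.isLeft} : Set (Fin n × s.Q))ᶜ := by
  rcases p with ⟨i, j | j⟩
  · simpa using ⟨i, j, rfl⟩
  · refine iff_of_true (fun q hq => ?_) (by simp)
    exact Sum.inl_ne_inr (congrArg Prod.snd hq)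

theorem withAncillas_eq {n : ℕ} (v : Vec (s.Block n)) :
    s.withAncillas v = inj (s.data n) (fun _ => false) *ᵥ v := by
  funext x
  rw [inj_mulVec_apply, withAncillas]
  have : (∀ w, (∀ i, s.data n i ≠ w) → x w = false) ↔ ∀ i j, x (i, Sum.inr j) = false := by
    simp only [notMem_data]
    simp
  simp only [this]
  rfl

/-- `ptrKraus` sums over configurations of all wires, `discardAncillas` over those of the ancillas
only; the two factors compare the multiplicities. -/
theorem kmap_ptrKraus_data {n : ℕ} (ρ : Op (Fin n × s.Q)) :
    Fintype.card (Fin n × Fin s.a → Bool) • kmap (ptrKraus (s.data n)) ρ =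
      Fintype.card (Fin n × s.Q → Bool) • s.discardAncillas ρ := by
  let γ : Fin n × Fin s.a ↪ Fin n × s.Q := ⟨fun p => (p.1, Sum.inr p.2), fun p q h => by
    simp only [Prod.mk.injEq, Sum.inr.injEq] at h
    exact Prod.ext h.1 h.2⟩
  rw [kmap_ptrKraus]
  ext x y
  rw [Matrix.smul_apply, Matrix.smul_apply, Matrix.sum_apply]
  simp only [slice_apply]
  rw [← sum_overwrite γ]
  have : ∀ (z : Fin n × Fin s.a → Bool) (r : Fin n × s.Q → Bool) (x : s.Block n → Bool),
      overwrite (s.data n) x (overwrite γ z r) = fun p : Fin n × s.Q =>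
        Sum.elim (fun j => x (p.1, j)) (fun j => z (p.1, j)) p.2 := by
    intro z r x
    rw [eq_comm, eq_overwrite_iff]
    refine ⟨fun i => rfl, fun w hw => ?_⟩
    rw [notMem_data] at hw
    rcases w with ⟨i, j | j⟩
    · simp at hw
    · exact (overwrite_apply γ z r (i, j)).symm
  simp only [this]
  simp only [discardAncillas, of_apply, Finset.sum_const, Finset.card_univ, ← Finset.smul_sum]

theorem cone_smul {X : Type} {𝒱 : Submodule ℂ (X → ℂ)} {ρ : Matrix X X ℂ}
    (h : ρ ∈ cone (𝒱 : Set (X → ℂ))) (c : ℂ) : (c * star c) • ρ ∈ cone (𝒱 : Set (X → ℂ)) := by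
  induction h using AddSubmonoid.closure_induction with
  | mem ρ h' =>
    obtain ⟨v, hv, rfl⟩ := h'
    have : (c * star c) • pureState v = pureState (c • v) := by
      rw [pureState, pureState, star_smul, smul_vecMulVec, vecMulVec_smul, smul_smul]
    rw [this]
    exact pureState_mem_cone (𝒱.smul_mem c hv)
  | zero => rw [smul_zero]; exact zero_mem _
  | add ρ σ _ _ h₁ h₂ => rw [smul_add]; exact add_mem h₁ h₂

theorem output_smul {n : ℕ} (ls : List (Loc 𝒢 (Fin n × s.Q))) (F : ℕ → Option ErrorChoice)
    (v : Vec (s.Block n)) (c : ℂ) : s.output ls F (c • v) = (c * star c) • s.output ls F v := by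
  have : pureState (s.withAncillas (c • v)) = (c * star c) • pureState (s.withAncillas v) := by
    rw [withAncillas_eq, withAncillas_eq, mulVec_smul, pureState, pureState, star_smul,
      smul_vecMulVec, vecMulVec_smul, smul_smul]
  rw [output, this, run_eq, map_smul, ← run_eq, output]
  ext x y
  simp only [discardAncillas, of_apply, Matrix.smul_apply, Finset.smul_sum]

/-- This turns a condition on the outputs of a circuit under error channels into one on fault paths.
Each Kraus operator of such a run maps `u` into the support of the output, and fault paths are
combinations of Kraus operators. The vector `u` may differ from the standard input in everything
that the circuit discards or prepares itself. -/
theorem paths_mulVec_mem {n : ℕ} {ls : List (Loc 𝒢 (Fin n × s.Q))} {live : Set (Fin n × s.Q)}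
    (hls : WellFormed live ls) (hlive : {p | p.2.isLeft} ⊆ liveAfter live ls) {S : Finset ℕ}
    {off : ℕ} {u : Vec (Fin n × s.Q)} {v : Vec (s.Block n)}
    (hu : forget liveᶜ (pureState u) = forget liveᶜ (pureState (s.withAncillas v)))
    {𝒱 : Submodule ℂ (Vec (s.Block n))}
    (h : ∀ err, IsMixture (𝒱 : Set (Vec (s.Block n))) (s.output ls (faultsFrom S off err) v))
    {K : Op (Fin n × s.Q)} (hK : K ∈ Paths S (ls.zipIdx off)) : K *ᵥ u ∈ lift (s.data n) 𝒱 := by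
  refine Submodule.span_induction (p := fun K _ => K *ᵥ u ∈ lift (s.data n) 𝒱) ?_ ?_ ?_ ?_
    (mem_span_runKraus hK)
  · rintro K ⟨err, hK⟩ r
    have h₁ := kmap_ptrKraus_congr (s.notMem_data (n := n))
      (forget_mono (Set.compl_subset_compl.2 hlive) (forget_run hls (faultsFrom S off err) hu))
    have h₂ := nsmul_mem (isMixture_iff.1 (h err)) (Fintype.card (Fin n × s.Q → Bool))
    rw [output, ← kmap_ptrKraus_data, ← h₁, run_eq, ← kmap_kcomp] at h₂
    rw [← inj_conjTranspose_mulVec, mulVec_mulVec]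
    exact mulVec_mem_of_kmap_mem_cone Fintype.card_ne_zero h₂ (mem_kcomp.2 ⟨_,
      List.mem_map_of_mem (Finset.mem_toList.2 (Finset.mem_univ r)), K, hK, rfl⟩)
  · rw [zero_mulVec]; exact zero_mem _
  · intro A B _ _ hA hB
    rw [add_mulVec]; exact add_mem hA hB
  · intro c A _ hA
    rw [smul_mulVec]; exact Submodule.smul_mem _ c hA

theorem forget_inj {n : ℕ} (r : Fin n × s.Q → Bool) (v : Vec (s.Block n)) :
    forget {p | p.2.isLeft}ᶜ (pureState (inj (s.data n) r *ᵥ v)) =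
      forget {p | p.2.isLeft}ᶜ (pureState (s.withAncillas v)) := by
  rw [withAncillas_eq]
  ext x y
  -- Adding `r` modulo 2 permutes the ancilla configurations and exchanges the ancilla states `|0 ⋯
  -- 0⟩` and `|r⟩`.
  have hinv : Function.Involutive fun z : Fin n × s.Q → Bool => fun w => xor (z w) (r w) := by
    intro z; funext w; simp
  rw [forget_apply, forget_apply, ← Equiv.sum_comp hinv.toPerm]
  refine Finset.sum_congr rfl fun z _ => ?_
  have : ∀ x : Fin n × s.Q → Bool, (inj (s.data n) r *ᵥ v)
      (mix {p | p.2.isLeft}ᶜ (hinv.toPerm _ z) x) =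
        (inj (s.data n) (fun _ => false) *ᵥ v) (mix {p | p.2.isLeft}ᶜ z x) := by
    intro x
    rw [inj_mulVec_apply, inj_mulVec_apply]
    have h₁ : ∀ z : Fin n × s.Q → Bool,
        (fun i => mix {p | p.2.isLeft}ᶜ z x (s.data n i)) = fun i => x (s.data n i) := by
      intro z
      funext i
      exact mix_of_notMem (fun hi => (s.notMem_data _).2 hi i rfl) _ _
    have h₂ : (∀ w, (∀ i, s.data n i ≠ w) →
        mix {p | p.2.isLeft}ᶜ (hinv.toPerm _ z) x w = r w) ↔
        ∀ w, (∀ i, s.data n i ≠ w) → mix {p | p.2.isLeft}ᶜ z x w = false := by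
      refine forall_congr' fun w => forall_congr' fun hw => ?_
      rw [mix_of_mem ((s.notMem_data w).1 hw), mix_of_mem ((s.notMem_data w).1 hw)]
      change (xor (z w) (r w)) = r w ↔ z w = false
      cases z w <;> cases r w <;> simp
    rw [h₁, h₁]
    simp only [h₂]
  simp only [pureState, vecMulVec_apply, Pi.star_apply, this]

theorem paths_inj_mem {n : ℕ} {ls : List (Loc 𝒢 (Fin n × s.Q))}
    (hls : WellFormed {p | p.2.isLeft} ls) {S : Finset ℕ} {off : ℕ} {v : Vec (s.Block n)}
    {𝒱 : Submodule ℂ (Vec (s.Block n))}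
    (h : ∀ err, IsMixture (𝒱 : Set (Vec (s.Block n))) (s.output ls (faultsFrom S off err) v))
    {K : Op (Fin n × s.Q)} (hK : K ∈ Paths S (ls.zipIdx off)) (r : Fin n × s.Q → Bool) :
    K *ᵥ (inj (s.data n) r *ᵥ v) ∈ lift (s.data n) 𝒱 :=
  s.paths_mulVec_mem hls (fun _ hp => Or.inl hp) (s.forget_inj r v) h hK

end Scheme

/-! ### Block-wise operators -/

section Bop

variable {ι A B C : Type} [Fintype ι] [DecidableEq ι] [Fintype A] [DecidableEq A] [Fintype B]
  [DecidableEq B] [Fintype C] [DecidableEq C]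

/-- The tensor product of operators on blocks. -/
def bop (P : ι → Matrix (A → Bool) (B → Bool) ℂ) : Matrix (ι × A → Bool) (ι × B → Bool) ℂ :=
  (tens P).submatrix Function.curry Function.curry

/-- The tensor product of encodings. -/
def benc (P : ι → Matrix (A → Bool) Bool ℂ) : Matrix (ι × A → Bool) (ι → Bool) ℂ :=
  (tens P).submatrix Function.curry id

theorem bop_apply (P : ι → Matrix (A → Bool) (B → Bool) ℂ) (x : ι × A → Bool) (y : ι × B → Bool) :
    bop P x y = ∏ i, P i (fun a => x (i, a)) fun b => y (i, b) := rfl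

theorem bijective_curry : Function.Bijective (Function.curry : (ι × B → Bool) → ι → B → Bool) :=
  (Equiv.curry ι B Bool).bijective

theorem bop_mul_bop (P : ι → Matrix (A → Bool) (B → Bool) ℂ)
    (P' : ι → Matrix (B → Bool) (C → Bool) ℂ) : bop P * bop P' = bop fun i => P i * P' i := by
  rw [bop, bop, ← submatrix_mul _ _ _ _ _ bijective_curry, tens_mul, bop]

theorem bop_mul_benc (P : ι → Matrix (A → Bool) (B → Bool) ℂ)
    (P' : ι → Matrix (B → Bool) Bool ℂ) : bop P * benc P' = benc fun i => P i * P' i := by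
  rw [bop, benc, ← submatrix_mul _ _ _ _ _ bijective_curry, tens_mul, benc]

theorem blockTens_mul_benc (T : ι → Matrix Bool (A → Bool) ℂ) (P : ι → Matrix (A → Bool) Bool ℂ) :
    blockTens T * benc P = tens fun i => T i * P i := by
  rw [benc, blockTens, ← submatrix_mul _ _ _ _ _ bijective_curry, tens_mul, submatrix_id_id]

theorem benc_mul_blockTens (P : ι → Matrix (A → Bool) Bool ℂ) (T : ι → Matrix Bool (B → Bool) ℂ) :
    benc P * blockTens T = bop fun i => P i * T i := by
  rw [benc, blockTens, ← submatrix_mul _ _ _ _ _ Function.bijective_id, tens_mul, bop]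

theorem benc_conjTranspose (P : ι → Matrix (A → Bool) Bool ℂ) :
    (benc P)ᴴ = blockTens fun i => (P i)ᴴ := by
  rw [benc, conjTranspose_submatrix, tens_conjTranspose, blockTens]

theorem bop_one : bop (fun _ : ι => (1 : Op A)) = 1 := by
  rw [bop, tens_one]
  exact submatrix_one _ (bijective_curry (ι := ι) (B := A)).1

theorem emb_blocks (a : ι) (P : Op A) :
    emb (blocks (oneWire a)) (bop fun _ : Fin 1 => P) = bop (Function.update (fun _ => 1) a P) := by
  ext x y
  simp only [emb, of_apply]
  rw [bop_apply, bop_apply, ← Finset.mul_prod_erase Finset.univ _ (Finset.mem_univ a)]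
  have h₁ : ∏ b ∈ Finset.univ.erase a, (Function.update (fun _ : ι => (1 : Op A)) a P) b
      (fun q => x (b, q)) (fun q => y (b, q)) = if ∀ b ∈ Finset.univ.erase a,
        (fun q => x (b, q)) = (fun q => y (b, q)) then 1 else 0 := by
    have : ∀ b ∈ Finset.univ.erase a, (Function.update (fun _ : ι => (1 : Op A)) a P) b
        (fun q => x (b, q)) (fun q => y (b, q)) =
          if (fun q => x (b, q)) = (fun q => y (b, q)) then 1 else 0 := fun b hb => by
      rw [Function.update_of_ne (Finset.ne_of_mem_erase hb)]
      exact one_apply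
    rw [Finset.prod_congr rfl this, Finset.prod_ite_zero, Finset.prod_const_one]
    congr
  have h₂ : (∀ w : ι × A, (∀ i : Fin 1 × A, blocks (oneWire a) i ≠ w) → x w = y w) ↔
      ∀ b ∈ Finset.univ.erase a, (fun q => x (b, q)) = (fun q => y (b, q)) := by
    constructor
    · intro h b hb
      funext q
      refine h (b, q) fun i hi => Finset.ne_of_mem_erase hb ?_
      exact (congrArg Prod.fst hi).symm
    · rintro h ⟨b, q⟩ hw
      refine congrFun (h b (Finset.mem_erase.2 ⟨?_, Finset.mem_univ b⟩)) q
      rintro rfl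
      exact hw (0, q) rfl
  rw [h₁, Function.update_self]
  simp only [h₂]
  split_ifs
  · simp
    rfl
  · simp

theorem exists_bop_one (F : Op (Fin 1 × A)) : ∃ P, F = bop fun _ : Fin 1 => P := by
  refine ⟨F.submatrix (fun x p => x p.2) (fun x p => x p.2), ?_⟩
  ext x y
  rw [bop_apply]
  simp only [Finset.univ_unique, Finset.prod_singleton, submatrix_apply]
  congr 1 <;> funext p <;> rw [Subsingleton.elim (default : Fin 1) p.1]

theorem tens_one_inj {T T' : Matrix A B ℂ}
    (h : tens (fun _ : Fin 1 => T) = tens fun _ : Fin 1 => T') : T = T' := by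
  ext a b
  simpa [tens] using congrFun (congrFun h fun _ => a) fun _ => b

theorem emb_transversal (f : ι → A) (G : ι → Matrix Bool Bool ℂ)
    (g : ι ↪ ι × A) (hg : ∀ i, g i = (i, f i)) :
    emb g (tens G) = bop fun i => emb (oneWire (f i)) (tens fun _ : Fin 1 => G i) := by
  ext x y
  rw [bop_apply]
  simp only [emb, of_apply, tens, Finset.univ_unique, Finset.prod_singleton, hg]
  rw [Finset.prod_ite_zero]
  have : (∀ w : ι × A, (∀ i, (i, f i) ≠ w) → x w = y w) ↔ ∀ i ∈ Finset.univ, ∀ j,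
      (∀ k, oneWire (f i) k ≠ j) → x (i, j) = y (i, j) := by
    refine ⟨fun h i _ j hj => h (i, j) fun k hk => ?_, fun h w hw => ?_⟩
    · obtain ⟨rfl, rfl⟩ := Prod.mk.inj hk
      exact hj 0 rfl
    · obtain ⟨i, j⟩ := w
      exact h i (Finset.mem_univ i) j fun _ hj => hw i (by rw [← hj]; rfl)
  by_cases h : ∀ i ∈ Finset.univ, ∀ j, (∀ k, oneWire (f i) k ≠ j) → x (i, j) = y (i, j)
  · rw [if_pos h, if_pos (this.2 h)]
    rfl
  · rw [if_neg h, if_neg fun h' => h (this.1 h')]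

theorem single_eq_tens (a b : ι → Bool) :
    (Matrix.single a b 1 : Op ι) = tens fun i => Matrix.single (a i) (b i) 1 := by
  ext x y
  simp only [single_apply, tens, of_apply]
  rw [Finset.prod_ite_zero]
  simp only [Finset.prod_const_one, funext_iff, forall_and, Finset.mem_univ, true_imp_iff]

theorem exists_tens_one (G : Op (Fin 1)) : ∃ P : Matrix Bool Bool ℂ, G = tens fun _ : Fin 1 => P := by
  refine ⟨G.submatrix (fun x _ => x) (fun x _ => x), ?_⟩
  ext x y
  simp only [tens, of_apply, Finset.univ_unique, Finset.prod_singleton, submatrix_apply]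
  congr 1 <;> funext p <;> rw [Subsingleton.elim (default : Fin 1) p]

/-- A linear map for which every vector is an eigenvector is a scalar, relative to the injective map
`R`. It turns state-by-state conditions, where the scalar may depend on the logical state, into an
identity of operators. -/
theorem exists_eq_smul {X I : Type} [Fintype X] [DecidableEq X] [Fintype I] [DecidableEq I]
    {R N : Matrix X I ℂ} (hR : Rᴴ * R = 1) (h : ∀ ψ, ∃ c : ℂ, N *ᵥ ψ = c • R *ᵥ ψ) :
    ∃ c : ℂ, N = c • R := by
  have hinj : ∀ ψ, R *ᵥ ψ = 0 → ψ = 0 := fun ψ hψ => by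
    rw [← one_mulVec ψ, ← hR, ← mulVec_mulVec, hψ, mulVec_zero]
  choose c hc using fun i : I => h (Pi.single i 1)
  have hcc : ∀ i j, c i = c j := by
    intro i j
    by_cases hij : i = j
    · rw [hij]
    -- The image of a sum of two basis vectors forces their two scalars to be equal.
    obtain ⟨d, hd⟩ := h (Pi.single i 1 + Pi.single j 1)
    rw [mulVec_add, hc, hc, mulVec_add, ← mulVec_smul, ← mulVec_smul, ← mulVec_add, ← mulVec_add,
      ← mulVec_smul, ← sub_eq_zero, ← mulVec_sub] at hd
    have h₀ := hinj _ hd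
    have hi := congrFun h₀ i
    have hj := congrFun h₀ j
    simp [Ne.symm hij, hij] at hi hj
    rw [sub_eq_zero] at hi hj
    rw [hi, hj]
  by_cases hI : Nonempty I
  · obtain ⟨i₀⟩ := hI
    refine ⟨c i₀, Matrix.ext_of_mulVec_single fun i => ?_⟩
    rw [hc, hcc i i₀, smul_mulVec]
  · exact ⟨0, by ext x i; exact (hI ⟨i⟩).elim⟩

end Bop

namespace Scheme

variable {𝒢 : GateSet} (s : Scheme 𝒢)

/-! ### Encodings and errors, block by block -/

/-- The encoding of `n` qubits, as a matrix. -/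
noncomputable def encMat (n : ℕ) : Matrix (s.Block n → Bool) (Fin n → Bool) ℂ :=
  benc fun _ => s.enc

theorem encN_eq (n : ℕ) (ψ : Vec (Fin n)) : s.encN n ψ = s.encMat n *ᵥ ψ := rfl

theorem isometry_encMat (n : ℕ) : (s.encMat n)ᴴ * s.encMat n = 1 := by
  rw [encMat, benc_conjTranspose, blockTens_mul_benc]
  simp only [s.isometry_enc, tens_one]

/-- The data qubits of one block. -/
def qdata : Fin s.m ↪ s.Q := ⟨Sum.inl, Sum.inl_injective⟩

theorem inj_data {n : ℕ} (r : Fin n × s.Q → Bool) :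
    inj (s.data n) r = bop fun i => inj s.qdata fun q => r (i, q) := by
  ext x u
  rw [bop_apply]
  simp only [inj, of_apply, eq_overwrite_iff]
  rw [Finset.prod_ite_zero, Finset.prod_const_one]
  have : ((∀ i, x (s.data n i) = u i) ∧ ∀ w, (∀ i, s.data n i ≠ w) → x w = r w) ↔
      ∀ i ∈ Finset.univ, (∀ j, x (i, s.qdata j) = u (i, j)) ∧
        ∀ q, (∀ j, s.qdata j ≠ q) → x (i, q) = r (i, q) := by
    constructor
    · rintro ⟨h₁, h₂⟩ i -
      exact ⟨fun j => h₁ (i, j), fun q hq => h₂ (i, q) fun p hp =>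
        hq p.2 (congrArg Prod.snd hp)⟩
    · intro h
      refine ⟨fun p => (h p.1 (Finset.mem_univ _)).1 p.2, fun p hp => ?_⟩
      refine (h p.1 (Finset.mem_univ _)).2 p.2 fun j hj => hp (p.1, j) ?_
      exact Prod.ext rfl hj
  by_cases h : ∀ i ∈ Finset.univ, (∀ j, x (i, s.qdata j) = u (i, j)) ∧
        ∀ q, (∀ j, s.qdata j ≠ q) → x (i, q) = r (i, q)
  · rw [if_pos (this.2 h), if_pos h]
  · rw [if_neg fun h' => h (this.1 h'), if_neg h]

/-- The operators on one block that act on at most one qubit. -/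
def oneErr : Set (Op (Fin s.m)) :=
  {1} ∪ {E | ∃ j A, E = emb (oneWire j) A}

/-- The combinations of products of operators that act on at most one qubit in each block. -/
def blockErr (n : ℕ) : Submodule ℂ (Op (s.Block n)) :=
  Submodule.span ℂ {G | ∃ E : Fin n → Op (Fin s.m), (∀ i, E i ∈ s.oneErr) ∧ G = bop E}

/-- A matrix unit on one qubit per block is a product of matrix units of single qubits. Joint
errors, even entangling ones, are therefore combinations of products of errors of single blocks. -/
theorem blockError_le (n : ℕ) : s.blockError n ≤ s.blockErr n := by
  refine Submodule.span_le.2 ?_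
  rintro _ ⟨f, A, rfl⟩
  suffices h : ∀ A : Op (Fin n), A ∈ (s.blockErr n).comap
      (embₗ (⟨fun i => (i, f i), fun _ _ h => (Prod.mk.inj h).1⟩ : Fin n ↪ s.Block n)) by
    rw [SetLike.mem_coe, embed_eq_emb]
    exact h A
  refine mem_span_of_single fun a b => Submodule.subset_span
    ⟨fun i => emb (oneWire (f i)) (tens fun _ : Fin 1 => Matrix.single (a i) (b i) 1),
      fun i => Or.inr ⟨_, _, rfl⟩, ?_⟩
  rw [embₗ_apply, single_eq_tens]
  exact emb_transversal f _ _ fun _ => rfl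

theorem oneWire_pair {n : ℕ} (i : Fin n) (j : Fin s.m) (A : Op (Fin 1)) :
    embed (oneWire ((i, j) : s.Block n)) A =
      bop (Function.update (fun _ => 1) i (emb (oneWire j) A)) := by
  obtain ⟨P, rfl⟩ := exists_tens_one A
  rw [embed_eq_emb, ← emb_blocks, ← emb_transversal (fun _ : Fin 1 => j) (fun _ => P)
    (oneWire (0, j)) (fun i => by rw [Subsingleton.elim i 0]; rfl), ← emb_trans]
  rfl

theorem singleError_le (n : ℕ) : s.singleError n ≤ s.blockErr n := by
  refine Submodule.span_le.2 ?_
  rintro _ (rfl | ⟨p, A, rfl⟩)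
  · exact Submodule.subset_span ⟨fun _ => 1, fun _ => Or.inl rfl, bop_one.symm⟩
  · refine Submodule.subset_span ⟨_, fun i => ?_, s.oneWire_pair p.1 p.2 A⟩
    by_cases h : i = p.1
    · subst h
      rw [Function.update_self]
      exact Or.inr ⟨_, _, rfl⟩
    · rw [Function.update_of_ne h]
      exact Or.inl rfl

/-- The span of the encodings of `φ` with at most one error in each block. -/
noncomputable def errSpan (n : ℕ) (φ : Vec (Fin n)) : Submodule ℂ (Vec (s.Block n)) :=
  (s.blockErr n).map ((LinearMap.flip (Matrix.mulVecBilin ℂ ℂ)) (s.encMat n *ᵥ φ))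

theorem erroneous_subset (n : ℕ) (φ : Vec (Fin n)) :
    s.erroneous n φ ⊆ (s.errSpan n φ : Set (Vec (s.Block n))) := by
  rintro _ ⟨F, hF, rfl⟩
  exact ⟨F, s.blockError_le n hF, rfl⟩

theorem encMat_mem_errSpan (n : ℕ) (φ : Vec (Fin n)) : s.encMat n *ᵥ φ ∈ s.errSpan n φ :=
  ⟨1, s.singleError_le n (Submodule.subset_span (Or.inl rfl)), one_mulVec _⟩

/-! ### Rows of decoders -/

/-- A Kraus operator of a decoder that is correct on encodings with at most one error. -/
def Good (T : Matrix Bool (s.Q → Bool) ℂ) : Prop :=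
  ∀ z, ∀ E ∈ s.oneErr, ∃ c : ℂ, T * (inj s.qdata z * (E * s.enc)) = c • 1

variable {s}

theorem Good.blockTens {n : ℕ} {T : Fin n → Matrix Bool (s.Q → Bool) ℂ} (hT : ∀ i, s.Good (T i))
    (r : Fin n × s.Q → Bool) {G : Op (s.Block n)} (hG : G ∈ s.blockErr n) :
    ∃ c : ℂ, FTQC.blockTens T * (inj (s.data n) r * (G * s.encMat n)) = c • 1 := by
  refine Submodule.span_induction (p := fun G _ => ∃ c : ℂ,
    FTQC.blockTens T * (inj (s.data n) r * (G * s.encMat n)) = c • 1) ?_ ?_ ?_ ?_ hG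
  · rintro _ ⟨E, hE, rfl⟩
    choose c hc using fun i => hT i (fun q => r (i, q)) (E i) (hE i)
    refine ⟨∏ i, c i, ?_⟩
    rw [encMat, bop_mul_benc, inj_data, bop_mul_benc, blockTens_mul_benc]
    simp only [hc]
    exact tens_smul_one c
  · exact ⟨0, by simp⟩
  · rintro A B _ _ ⟨c, hc⟩ ⟨d, hd⟩
    exact ⟨c + d, by rw [Matrix.add_mul, Matrix.mul_add, Matrix.mul_add, hc, hd, add_smul]⟩
  · rintro d A _ ⟨c, hc⟩
    exact ⟨d * c, by rw [Matrix.smul_mul, Matrix.mul_smul, Matrix.mul_smul, hc, smul_smul]⟩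

/-- Each error returns a multiple of the same `φ`, so superpositions of errors, with any state of
the workspace, do so too. -/
theorem Good.mulVec {n : ℕ} {T : Fin n → Matrix Bool (s.Q → Bool) ℂ} (hT : ∀ i, s.Good (T i))
    {φ : Vec (Fin n)} {w : Vec (Fin n × s.Q)} (hw : w ∈ lift (s.data n) (s.errSpan n φ)) :
    ∃ c : ℂ, FTQC.blockTens T *ᵥ w = c • φ := by
  have : lift (s.data n) (s.errSpan n φ) ≤
      (Submodule.span ℂ {φ}).comap (FTQC.blockTens T).mulVecLin := by
    refine lift_le ?_
    rintro _ ⟨G, hG, rfl⟩ r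
    obtain ⟨c, hc⟩ := Good.blockTens hT r hG
    rw [Submodule.mem_comap, mulVecLin_apply]
    change FTQC.blockTens T *ᵥ (inj (s.data n) r *ᵥ (G *ᵥ (s.encMat n *ᵥ φ))) ∈ _
    rw [mulVec_mulVec, mulVec_mulVec, mulVec_mulVec]
    simp only [Matrix.mul_assoc] at hc ⊢
    rw [hc, smul_mulVec, one_mulVec]
    exact Submodule.mem_span_singleton.2 ⟨c, rfl⟩
  obtain ⟨c, hc⟩ := Submodule.mem_span_singleton.1 (this hw)
  exact ⟨c, hc.symm⟩

/-! ### Faults in pieces of a circuit -/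

/-- The number of faults among the `len` labels from `off` on. -/
def cnt (S : Finset ℕ) (off len : ℕ) : ℕ := ((Finset.range len).filter fun i => off + i ∈ S).card

theorem run_congr {W : Type} [Fintype W] [DecidableEq W] (ls : List (Loc 𝒢 W))
    {F F' : ℕ → Option ErrorChoice} (h : ∀ i < ls.length, F i = F' i) (ρ : Op W) :
    run ls F ρ = run ls F' ρ := by
  induction ls generalizing F F' ρ with
  | nil => rfl
  | cons l ls ih =>
    rw [run_cons, run_cons, h 0 (by simp)]
    exact ih (fun i hi => h (i + 1) (by simpa using hi)) _

theorem run_faultsFrom_zero {W : Type} [Fintype W] [DecidableEq W] {ls : List (Loc 𝒢 W)}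
    {S : Finset ℕ} {off : ℕ} (h : cnt S off ls.length = 0) (err : ℕ → ErrorChoice) :
    run ls (faultsFrom S off err) = run ls noFault := by
  funext ρ
  refine run_congr ls (fun i hi => if_neg fun hS => ?_) ρ
  rw [cnt, Finset.card_eq_zero, Finset.filter_eq_empty_iff] at h
  exact h (Finset.mem_range.2 hi) hS

theorem run_faultsFrom {W : Type} [Fintype W] [DecidableEq W] (ls : List (Loc 𝒢 W))
    (S : Finset ℕ) (off : ℕ) (err : ℕ → ErrorChoice) :
    run ls (faultsFrom S off err) =
      run ls (faultsAt ((Finset.range ls.length).filter fun i => off + i ∈ S) err) := by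
  funext ρ
  refine run_congr ls (fun i hi => ?_) ρ
  simp [faultsFrom, faultsAt, hi]

theorem mem_paths_of_mem_runKraus {W : Type} [Fintype W] [DecidableEq W] {ls : List (Loc 𝒢 W)}
    {K : Op W} (h : K ∈ runKraus ls noFault) (off : ℕ) : K ∈ Paths ∅ (ls.zipIdx off) := by
  induction ls generalizing K off with
  | nil => simpa [runKraus, Paths] using h
  | cons l ls ih =>
    obtain ⟨K, hK, k, hk, rfl⟩ := mem_kcomp.1 h
    obtain ⟨A, hA, rfl⟩ := List.mem_map.1 hk
    rw [List.zipIdx_cons]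
    refine ⟨K, ih hK _, _, ⟨A, rfl, Or.inr ?_⟩, rfl⟩
    cases l <;> exact hA

/-! ### Fault paths of the circuits of a fault-tolerant scheme -/

/-- The states of a block, its workspace included, whose data are in the code space. -/
noncomputable def codeQ (s : Scheme 𝒢) : Submodule ℂ (Vec (Fin 1 × s.Q)) :=
  lift (s.data 1) s.codeSpace

/-- The states of a block, its workspace included, whose data have at most one error. -/
noncomputable def nearQ (s : Scheme 𝒢) : Submodule ℂ (Vec (Fin 1 × s.Q)) :=
  lift (s.data 1) s.nearCode

variable {S : Finset ℕ} {off : ℕ}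

theorem mulVec_mem_of_inj {n : ℕ} {K : Op (Fin n × s.Q)} {P : Submodule ℂ (Vec (Fin n × s.Q))}
    (h : ∀ r v, K *ᵥ (inj (s.data n) r *ᵥ v) ∈ P) (u : Vec (Fin n × s.Q)) : K *ᵥ u ∈ P :=
  lift_le (𝒱 := ⊤) (P := P.comap K.mulVecLin) (fun v _ r => h r v)
    (show u ∈ lift (s.data n) ⊤ from fun _ => Submodule.mem_top)

theorem ec_any_zero (hs : s.FaultTolerant) (h : cnt S off s.ec.length = 0) {K : Op (Fin 1 × s.Q)}
    (hK : K ∈ Paths S (s.ec.zipIdx off)) (u : Vec (Fin 1 × s.Q)) : K *ᵥ u ∈ s.codeQ :=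
  mulVec_mem_of_inj (fun r v => s.paths_inj_mem s.ec_wf (fun err => by
    rw [output, run_faultsFrom_zero h]; exact hs.ec_any_noFault v) hK r) u

theorem ec_any_one (hs : s.FaultTolerant) (h : cnt S off s.ec.length ≤ 1) {K : Op (Fin 1 × s.Q)}
    (hK : K ∈ Paths S (s.ec.zipIdx off)) (u : Vec (Fin 1 × s.Q)) : K *ᵥ u ∈ s.nearQ :=
  mulVec_mem_of_inj (fun r v => s.paths_inj_mem s.ec_wf (fun err => by
    rw [output, run_faultsFrom]; exact hs.ec_any_fault _ err h v) hK r) u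

theorem ec_corrects_paths (hs : s.FaultTolerant) (h : cnt S off s.ec.length = 0) {K : Op (Fin 1 × s.Q)}
    (hK : K ∈ Paths S (s.ec.zipIdx off)) {F : Op (s.Block 1)} (hF : F ∈ s.singleError 1)
    (ψ : Vec (Fin 1)) (r : Fin 1 × s.Q → Bool) :
    K *ᵥ (inj (s.data 1) r *ᵥ (F *ᵥ (s.encMat 1 *ᵥ ψ))) ∈
      lift (s.data 1) (Submodule.span ℂ {s.encMat 1 *ᵥ ψ}) :=
  s.paths_inj_mem s.ec_wf (fun err => by
    rw [output, run_faultsFrom_zero h]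
    refine isMixture_iff.2 (cone_mono ?_ (isMixture_iff.1 (hs.ec_corrects F hF ψ)))
    rintro _ ⟨c, rfl⟩
    exact Submodule.mem_span_singleton.2 ⟨c, rfl⟩) hK r

theorem ec_fault_paths (hs : s.FaultTolerant) (h : cnt S off s.ec.length ≤ 1) {K : Op (Fin 1 × s.Q)}
    (hK : K ∈ Paths S (s.ec.zipIdx off)) (ψ : Vec (Fin 1)) (r : Fin 1 × s.Q → Bool) :
    K *ᵥ (inj (s.data 1) r *ᵥ (s.encMat 1 *ᵥ ψ)) ∈ lift (s.data 1) (s.errSpan 1 ψ) :=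
  s.paths_inj_mem s.ec_wf (fun err => by
    rw [output, run_faultsFrom]
    exact isMixture_iff.2 (cone_mono (s.erroneous_subset 1 ψ)
      (isMixture_iff.1 (hs.ec_fault _ err h ψ)))) hK r

theorem ga_error_paths (hs : s.FaultTolerant) {g : 𝒢.Gate} (h : cnt S off (s.ga g).length = 0)
    {K : Op (Fin (𝒢.arity g) × s.Q)} (hK : K ∈ Paths S ((s.ga g).zipIdx off))
    {F : Op (s.Block (𝒢.arity g))} (hF : F ∈ s.singleError (𝒢.arity g))
    (ψ : Vec (Fin (𝒢.arity g))) (r : Fin (𝒢.arity g) × s.Q → Bool) :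
    K *ᵥ (inj (s.data _) r *ᵥ (F *ᵥ (s.encMat _ *ᵥ ψ))) ∈
      lift (s.data _) (s.errSpan _ ((𝒢.U g : Op (Fin (𝒢.arity g))) *ᵥ ψ)) :=
  s.paths_inj_mem (s.ga_wf g) (fun err => by
    rw [output, run_faultsFrom_zero h]
    exact isMixture_iff.2 (cone_mono (s.erroneous_subset _ _)
      (isMixture_iff.1 (hs.ga_error g F hF ψ)))) hK r

theorem ga_fault_paths (hs : s.FaultTolerant) {g : 𝒢.Gate} (h : cnt S off (s.ga g).length ≤ 1)
    {K : Op (Fin (𝒢.arity g) × s.Q)} (hK : K ∈ Paths S ((s.ga g).zipIdx off))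
    (ψ : Vec (Fin (𝒢.arity g))) (r : Fin (𝒢.arity g) × s.Q → Bool) :
    K *ᵥ (inj (s.data _) r *ᵥ (s.encMat _ *ᵥ ψ)) ∈
      lift (s.data _) (s.errSpan _ ((𝒢.U g : Op (Fin (𝒢.arity g))) *ᵥ ψ)) :=
  s.paths_inj_mem (s.ga_wf g) (fun err => by
    rw [output, run_faultsFrom]
    exact isMixture_iff.2 (cone_mono (s.erroneous_subset _ _)
      (isMixture_iff.1 (hs.ga_fault g _ err h ψ)))) hK r

theorem ga_implements_paths (hs : s.FaultTolerant) {g : 𝒢.Gate} (h : cnt S off (s.ga g).length = 0)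
    {K : Op (Fin (𝒢.arity g) × s.Q)} (hK : K ∈ Paths S ((s.ga g).zipIdx off))
    (ψ : Vec (Fin (𝒢.arity g))) (r : Fin (𝒢.arity g) × s.Q → Bool) :
    K *ᵥ (inj (s.data _) r *ᵥ (s.encMat _ *ᵥ ψ)) ∈ lift (s.data _)
      (Submodule.span ℂ {s.encMat _ *ᵥ ((𝒢.U g : Op (Fin (𝒢.arity g))) *ᵥ ψ)}) :=
  s.paths_inj_mem (s.ga_wf g) (fun err => by
    have := hs.ga_implements g ψ
    rw [output, run_faultsFrom_zero h]
    rw [output, encN_eq, encN_eq] at this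
    rw [this]
    exact isMixture_iff.2 (pureState_mem_cone (Submodule.mem_span_singleton_self _))) hK r

/-- The preparation circuit has no live input, so of `u` only the norm matters, and `u` may be
replaced by a multiple of `|0 ⋯ 0⟩`. -/
theorem prep_paths {𝒱 : Submodule ℂ (Vec (s.Block 1))}
    (h : ∀ err, IsMixture (𝒱 : Set (Vec (s.Block 1)))
      (s.output s.prepGa (faultsFrom S off err) (zeroVec _)))
    {K : Op (Fin 1 × s.Q)} (hK : K ∈ Paths S (s.prepGa.zipIdx off)) (u : Vec (Fin 1 × s.Q)) :
    K *ᵥ u ∈ lift (s.data 1) 𝒱 := by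
  -- The norm of `u`: with all wires forgotten, two pure states agree as soon as their traces do.
  set c : ℂ := ((Real.sqrt (∑ x, ‖u x‖ ^ 2) : ℝ) : ℂ) with hc
  have hcc : c * star c = ∑ x, u x * star (u x) := by
    simp only [RCLike.star_def, RCLike.mul_conj]
    rw [hc]
    norm_cast
    rw [Real.norm_of_nonneg (Real.sqrt_nonneg _), Real.sq_sqrt (by positivity)]
  refine s.paths_mulVec_mem (v := c • zeroVec _) s.prepGa_wf (fun p hp => Or.inr ?_) ?_
    (fun err => ?_) hK
  · obtain ⟨i, j | j⟩ := p
    · rw [Subsingleton.elim i 0]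
      exact s.prepGa_complete j
    · simp at hp
  · have hmix : ∀ z x : Fin 1 × s.Q → Bool, mix ∅ᶜ z x = z := fun z x => by
      funext w
      exact mix_of_mem (by simp) z x
    ext x y
    simp only [forget_apply, hmix, pureState, vecMulVec_apply, Pi.star_apply]
    rw [← hcc, withAncillas_eq, mulVec_smul]
    rw [Finset.sum_eq_single fun _ => false]
    · rw [Pi.smul_apply, inj_mulVec_apply, if_pos fun _ _ => rfl]
      simp [zeroVec]
    · intro z _ hz
      rw [Pi.smul_apply, inj_mulVec_apply]
      split_ifs with h₁
      · have : zeroVec (s.Block 1) (fun i => z (s.data 1 i)) = 0 := by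
          refine if_neg fun h₂ => hz (funext fun w => ?_)
          by_cases hw : ∃ i, s.data 1 i = w
          · obtain ⟨i, rfl⟩ := hw
            exact h₂ i
          · push Not at hw
            exact h₁ w hw
        rw [this, smul_zero, zero_mul]
      · rw [smul_zero, zero_mul]
    · simp
  · rw [output_smul]
    exact isMixture_iff.2 (cone_smul (isMixture_iff.1 (h err)) c)

theorem prep_fault_paths (hs : s.FaultTolerant) (h : cnt S off s.prepGa.length ≤ 1)
    {K : Op (Fin 1 × s.Q)} (hK : K ∈ Paths S (s.prepGa.zipIdx off)) (u : Vec (Fin 1 × s.Q)) :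
    K *ᵥ u ∈ lift (s.data 1) (s.errSpan 1 (zeroVec _)) :=
  prep_paths (fun err => by
    rw [output, run_faultsFrom]
    exact isMixture_iff.2 (cone_mono (s.erroneous_subset _ _)
      (isMixture_iff.1 (hs.prep_fault _ err h)))) hK u

theorem prep_implements_paths (hs : s.FaultTolerant) (h : cnt S off s.prepGa.length = 0)
    {K : Op (Fin 1 × s.Q)} (hK : K ∈ Paths S (s.prepGa.zipIdx off)) (u : Vec (Fin 1 × s.Q)) :
    K *ᵥ u ∈ lift (s.data 1) (Submodule.span ℂ {s.encMat 1 *ᵥ zeroVec _}) :=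
  prep_paths (fun err => by
    have := hs.prep_implements
    rw [output, run_faultsFrom_zero h]
    rw [output, encN_eq] at this
    rw [this]
    exact isMixture_iff.2 (pureState_mem_cone (Submodule.mem_span_singleton_self _))) hK u

end Scheme

/-- Supports of a mixture may be intersected. -/
theorem mem_cone_iInf {X ι : Type} [Fintype X] [DecidableEq X] {𝒱 : ι → Submodule ℂ (X → ℂ)} {ρ : Matrix X X ℂ}
    (hρ : ρ ∈ cone Set.univ) (h : ∀ i, ρ ∈ cone (𝒱 i : Set (X → ℂ))) :
    ρ ∈ cone ((⨅ i, 𝒱 i : Submodule ℂ (X → ℂ)) : Set (X → ℂ)) := by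
  refine mem_cone_of_quad (Σ i, {z : X → ℂ // ∀ u ∈ 𝒱 i, z ⬝ᵥ u = 0}) (fun z => quad z.2.1)
    (fun z v => ‖z.2.1 ⬝ᵥ v‖ ^ 2) (fun z v => by positivity) (fun z v => quad_pureState _ _) hρ
    (fun z => quad_eq_zero (V := (𝒱 z.1 : Set (X → ℂ))) z.2.2 (h z.1)) fun v _ hv => ?_
  refine (Submodule.mem_iInf _).2 fun i => mem_of_dotProduct fun z hz => ?_
  simpa using hv ⟨i, z, hz⟩

theorem blocks_trans {W Q : Type} {n : ℕ} (e : Fin n ↪ W) (a : Fin n) :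
    (blocks (oneWire a)).trans (blocks e) = (blocks (oneWire (e a)) : Fin 1 × Q ↪ W × Q) := rfl

namespace Scheme

variable {𝒢 : GateSet} {s : Scheme 𝒢}

/-! ### Joint supports of several blocks -/

/-- The projection onto the code space. -/
noncomputable def encProj (s : Scheme 𝒢) : Op (Fin s.m) := s.enc * s.encᴴ

theorem bop_encProj (n : ℕ) :
    bop (fun _ : Fin n => s.encProj) = s.encMat n * (s.encMat n)ᴴ := by
  rw [encMat, benc_conjTranspose, benc_mul_blockTens]
  rfl

theorem encProj_mulVec {v : Vec (s.Block 1)} (hv : v ∈ s.codeSpace) :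
    bop (fun _ : Fin 1 => s.encProj) *ᵥ v = v := by
  refine Submodule.span_induction
    (p := fun v _ => bop (fun _ : Fin 1 => s.encProj) *ᵥ v = v) ?_ ?_ ?_ ?_ hv
  · rintro _ ⟨ψ, rfl⟩
    rw [encN_eq, bop_encProj, mulVec_mulVec, Matrix.mul_assoc, isometry_encMat, Matrix.mul_one]
  · rw [mulVec_zero]
  · intro u v _ _ hu hv
    rw [mulVec_add, hu, hv]
  · intro c v _ hv
    rw [mulVec_smul, hv]

theorem bop_ite_mulVec {n : ℕ} {v : Vec (s.Block n)} (T : Finset (Fin n))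
    (h : ∀ a ∈ T, v ∈ lift (blocks (oneWire a)) s.codeSpace) :
    bop (fun a => if a ∈ T then s.encProj else 1) *ᵥ v = v := by
  induction T using Finset.induction_on with
  | empty =>
    simp only [Finset.notMem_empty, if_false]
    rw [bop_one, one_mulVec]
  | insert b T hb ih =>
    have h₁ : bop (fun a => if a ∈ insert b T then s.encProj else 1) =
        emb (blocks (oneWire b)) (bop fun _ : Fin 1 => s.encProj) *
          bop (fun a => if a ∈ T then s.encProj else 1) := by
      rw [emb_blocks, bop_mul_bop]
      congr 1
      funext a
      by_cases hab : a = b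
      · subst hab
        simp [hb]
      · simp [hab]
    rw [h₁, ← mulVec_mulVec, ih fun a ha => h a (Finset.mem_insert_of_mem ha)]
    refine vec_ext (blocks (oneWire b)) fun r => ?_
    rw [vslice_emb_mulVec]
    exact encProj_mulVec (h b (Finset.mem_insert_self b T) r)

/-- The projections onto the code spaces of the single blocks all fix `v`, and their product is `C
Cᴴ` for the joint encoding `C`. -/
theorem exists_encMat_mulVec {n : ℕ} {v : Vec (s.Block n)}
    (h : ∀ a, v ∈ lift (blocks (oneWire a)) s.codeSpace) : ∃ ψ, v = s.encMat n *ᵥ ψ := by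
  have := bop_ite_mulVec Finset.univ fun a _ => h a
  simp only [Finset.mem_univ, if_true] at this
  rw [bop_encProj, ← mulVec_mulVec] at this
  exact ⟨_, this.symm⟩

theorem emb_mem_singleError {n : ℕ} (a : Fin n) {F : Op (s.Block 1)} (hF : F ∈ s.singleError 1) :
    emb (blocks (oneWire a)) F ∈ s.singleError n := by
  suffices h : s.singleError 1 ≤ (s.singleError n).comap (embₗ (blocks (oneWire a))) from h hF
  refine Submodule.span_le.2 ?_
  rintro _ (rfl | ⟨p, A, rfl⟩)
  · rw [SetLike.mem_coe, Submodule.mem_comap, embₗ_apply, emb_one]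
    exact Submodule.subset_span (Or.inl rfl)
  · rw [SetLike.mem_coe, Submodule.mem_comap, embₗ_apply, embed_eq_emb, ← emb_trans]
    exact Submodule.subset_span (Or.inr ⟨blocks (oneWire a) p, A, by rw [embed_eq_emb]; rfl⟩)

/-- The span of the encodings with at most one error altogether. -/
def singleSpan (s : Scheme 𝒢) (n : ℕ) : Submodule ℂ (Vec (s.Block n)) :=
  Submodule.span ℂ {v | ∃ F ∈ s.singleError n, ∃ ψ, v = F *ᵥ (s.encMat n *ᵥ ψ)}

/-- The projections on the blocks other than `a₀` fix `v` and commute with an error in `a₀`.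
Together with the code projection hidden in that error's input they form the projection onto the
joint code space, so `v` is a combination of single errors applied to joint codewords. -/
theorem mem_singleSpan {n : ℕ} {v : Vec (s.Block n)} (a₀ : Fin n)
    (h : ∀ a, a ≠ a₀ → v ∈ lift (blocks (oneWire a)) s.codeSpace)
    (h₀ : v ∈ lift (blocks (oneWire a₀)) s.nearCode) : v ∈ s.singleSpan n := by
  set R := bop fun a => if a ∈ Finset.univ.erase a₀ then s.encProj else 1 with hR
  have hv : R *ᵥ v = v := bop_ite_mulVec _ fun a ha => h a (Finset.ne_of_mem_erase ha)
  rw [← hv]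
  -- As `R` fixes `v`, it suffices to apply `R` to an arbitrary vector whose block `a₀` has at most
  -- one error.
  refine lift_le (P := (s.singleSpan n).comap R.mulVecLin) (fun w hw r => ?_) h₀
  refine Submodule.span_induction (p := fun w _ => inj (blocks (oneWire a₀)) r *ᵥ w ∈
    (s.singleSpan n).comap R.mulVecLin) ?_ ?_ ?_ ?_ hw
  · rintro _ ⟨F, hF, ψ, rfl⟩
    obtain ⟨F', hF'⟩ := exists_bop_one F
    have hcomm : R * emb (blocks (oneWire a₀)) F = emb (blocks (oneWire a₀)) F * R := by
      rw [hF', emb_blocks, hR, bop_mul_bop, bop_mul_bop]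
      congr 1
      funext a
      by_cases ha : a = a₀
      · subst ha; simp
      · simp [ha]
    have hP : R * emb (blocks (oneWire a₀)) (bop fun _ : Fin 1 => s.encProj) =
        s.encMat n * (s.encMat n)ᴴ := by
      rw [emb_blocks, hR, bop_mul_bop, ← bop_encProj]
      congr 1
      funext a
      by_cases ha : a = a₀
      · subst ha; simp
      · simp [ha]
    have hψ : s.encN 1 ψ = bop (fun _ : Fin 1 => s.encProj) *ᵥ s.encN 1 ψ :=
      (encProj_mulVec (Submodule.subset_span ⟨ψ, rfl⟩)).symm
    have hcomm' : ∀ G (u : Vec (s.Block 1)), inj (blocks (oneWire a₀)) r *ᵥ (G *ᵥ u) =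
        emb (blocks (oneWire a₀)) G *ᵥ (inj (blocks (oneWire a₀)) r *ᵥ u) := fun G u => by
      rw [mulVec_mulVec, ← emb_mul_inj, ← mulVec_mulVec]
    rw [Submodule.mem_comap, mulVecLin_apply, hcomm', mulVec_mulVec, hcomm, ← mulVec_mulVec, hψ,
      hcomm', mulVec_mulVec _ R, hP, ← mulVec_mulVec]
    exact Submodule.subset_span ⟨_, emb_mem_singleError a₀ hF, _, rfl⟩
  · rw [mulVec_zero]; exact zero_mem _
  · intro x y _ _ hx hy
    rw [mulVec_add]; exact add_mem hx hy
  · intro c x _ hx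
    rw [mulVec_smul]; exact Submodule.smul_mem _ c hx

theorem encMat_mulVec_mem (n : ℕ) (φ : Vec (Fin n)) (a : Fin n) :
    s.encMat n *ᵥ φ ∈ lift (blocks (oneWire a)) s.codeSpace := fun r => by
  have h : s.encMat n = emb (blocks (oneWire a)) (bop fun _ : Fin 1 => s.encProj) * s.encMat n := by
    rw [emb_blocks, encMat, bop_mul_benc]
    congr 1
    funext b
    by_cases hb : b = a
    · subst hb
      rw [Function.update_self, encProj, Matrix.mul_assoc, s.isometry_enc, Matrix.mul_one]
    · rw [Function.update_of_ne hb, Matrix.one_mul]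
  rw [h, ← mulVec_mulVec, vslice_emb_mulVec, bop_encProj, ← mulVec_mulVec]
  exact Submodule.subset_span ⟨_, rfl⟩

/-- Errors in other blocks commute with the code projection of block `a`, so this block is left in
the code space up to its own error. -/
theorem errSpan_le (n : ℕ) (φ : Vec (Fin n)) (a : Fin n) :
    s.errSpan n φ ≤ lift (blocks (oneWire a)) s.nearCode := by
  rintro _ ⟨G, hG, rfl⟩
  change G *ᵥ (s.encMat n *ᵥ φ) ∈ _
  refine Submodule.span_induction (p := fun G _ => G *ᵥ (s.encMat n *ᵥ φ) ∈
    lift (blocks (oneWire a)) s.nearCode) ?_ ?_ ?_ ?_ hG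
  · rintro _ ⟨E, hE, rfl⟩ r
    have h₁ : bop E = emb (blocks (oneWire a)) (bop fun _ : Fin 1 => E a) *
        bop (Function.update E a 1) := by
      rw [emb_blocks, bop_mul_bop]
      congr 1
      funext b
      by_cases hb : b = a
      · subst hb; simp
      · simp [hb]
    have h₂ : s.encMat n = emb (blocks (oneWire a)) (bop fun _ : Fin 1 => s.encProj) *
        s.encMat n := by
      refine Matrix.ext_of_mulVec_single fun i => ?_
      rw [← mulVec_mulVec]
      refine vec_ext (blocks (oneWire a)) fun r => ?_
      rw [vslice_emb_mulVec]
      exact (encProj_mulVec (encMat_mulVec_mem n _ a r)).symm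
    have h₃ : bop (Function.update E a 1) *
        emb (blocks (oneWire a)) (bop fun _ : Fin 1 => s.encProj) =
          emb (blocks (oneWire a)) (bop fun _ : Fin 1 => s.encProj) *
            bop (Function.update E a 1) := by
      rw [emb_blocks, bop_mul_bop, bop_mul_bop]
      congr 1
      funext b
      by_cases hb : b = a
      · subst hb; simp
      · simp [hb]
    have hEa : (bop fun _ : Fin 1 => E a) ∈ s.singleError 1 := by
      rcases hE a with h | ⟨j, A, h⟩
      · rw [h, bop_one]
        exact Submodule.subset_span (Or.inl rfl)
      · refine Submodule.subset_span (Or.inr ⟨(0, j), A, ?_⟩)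
        rw [oneWire_pair, h]
        congr 1
        funext b
        rw [Subsingleton.elim b 0, Function.update_self]
    have h₄ : ∀ u, bop (Function.update E a 1) *ᵥ
        (emb (blocks (oneWire a)) (bop fun _ : Fin 1 => s.encProj) *ᵥ u) =
          emb (blocks (oneWire a)) (bop fun _ : Fin 1 => s.encProj) *ᵥ
            (bop (Function.update E a 1) *ᵥ u) := fun u => by
      rw [mulVec_mulVec, h₃, ← mulVec_mulVec]
    rw [h₂, h₁, ← mulVec_mulVec, ← mulVec_mulVec, vslice_emb_mulVec, h₄, vslice_emb_mulVec,
      bop_encProj, ← mulVec_mulVec]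
    exact Submodule.subset_span ⟨_, hEa, _, rfl⟩
  · rw [zero_mulVec]; exact zero_mem _
  · intro A B _ _ hA hB
    rw [add_mulVec]; exact add_mem hA hB
  · intro c A _ hA
    rw [smul_mulVec]; exact Submodule.smul_mem _ c hA

theorem lift_blocks_data {n : ℕ} (a : Fin n) (𝒱 : Submodule ℂ (Vec (s.Block 1))) :
    lift (blocks (oneWire a)) (lift (s.data 1) 𝒱) =
      lift (s.data n) (lift (blocks (oneWire a)) 𝒱) := by
  rw [lift_lift, lift_lift]
  rfl

/-! ### The decoder -/

/-- The labels of the Kraus operators of the decoder of a block. -/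
abbrev DecIdx (s : Scheme 𝒢) : Type :=
  (Fin (runKraus s.ec noFault).length × (Fin 1 × s.Q → Bool)) ⊕ (s.Q → Bool)

/-- The decoding of a block by a 1-EC followed by the inverse of the encoding. -/
noncomputable def qdec (s : Scheme 𝒢) : s.DecIdx → Matrix Bool (s.Q → Bool) ℂ
  -- The index `z` runs over configurations of the whole block, data qubits included, so each term
  -- of the partial trace occurs as often as the data have configurations; the root compensates for
  -- this. The labels `Sum.inr` are padding that gives both decoders the same index type.
  | Sum.inl (k, z) => (((Real.sqrt (Fintype.card (s.Block 1 → Bool)) : ℝ) : ℂ)⁻¹ •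
      ((s.encMat 1)ᴴ * ((inj (s.data 1) z)ᴴ * (runKraus s.ec noFault).get k))).submatrix
        (fun b _ => b) (fun q p => q p.2)
  | Sum.inr _ => 0

/-- The decoding of a block that has been measured. -/
def cdec (s : Scheme 𝒢) : s.DecIdx → Matrix Bool (s.Q → Bool) ℂ
  | Sum.inl _ => 0
  | Sum.inr y => Matrix.single (s.dec y) y 1

theorem submatrix_eq_blockTens {A : Type} [Fintype A] [DecidableEq A]
    (F : Matrix (Fin 1 → Bool) (Fin 1 × A → Bool) ℂ) :
    (blockTens fun _ : Fin 1 => F.submatrix (fun b _ => b) (fun q p => q p.2)) = F := by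
  ext x y
  rw [blockTens_apply]
  simp only [Finset.univ_unique, Finset.prod_singleton, submatrix_apply]
  congr 1 <;> funext p
  · rw [Subsingleton.elim (default : Fin 1) p]
  · rw [Subsingleton.elim (default : Fin 1) p.1]

/-- A faultless 1-EC returns the codeword up to a scalar, by `ec_corrects`, and undoing the encoding
yields the logical state; the scalar does not depend on the latter by `exists_eq_smul`. -/
theorem good_qdec (hs : s.FaultTolerant) (k : s.DecIdx) : s.Good (s.qdec k) := by
  rcases k with ⟨k, z⟩ | y
  · intro r E hE
    set F := ((Real.sqrt (Fintype.card (s.Block 1 → Bool)) : ℝ) : ℂ)⁻¹ •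
      ((s.encMat 1)ᴴ * ((inj (s.data 1) z)ᴴ * (runKraus s.ec noFault).get k)) with hF
    have hE' : (bop fun _ : Fin 1 => E) ∈ s.singleError 1 := by
      rcases hE with rfl | ⟨j, A, rfl⟩
      · rw [bop_one]
        exact Submodule.subset_span (Or.inl rfl)
      · refine Submodule.subset_span (Or.inr ⟨(0, j), A, ?_⟩)
        rw [oneWire_pair]
        congr 1
        funext b
        rw [Subsingleton.elim b 0, Function.update_self]
    obtain ⟨c, hc⟩ : ∃ c : ℂ, F * (inj (s.data 1) (fun p => r p.2) *
        ((bop fun _ : Fin 1 => E) * s.encMat 1)) = c • 1 := by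
      refine exists_eq_smul (by simp) fun ψ => ?_
      have h₁ := ec_corrects_paths hs (S := ∅) (off := 0) (by simp [cnt])
        (mem_paths_of_mem_runKraus (List.get_mem _ k) 0) hE' ψ (fun p => r p.2) z
      obtain ⟨d, hd⟩ := Submodule.mem_span_singleton.1 h₁
      refine ⟨((Real.sqrt (Fintype.card (s.Block 1 → Bool)) : ℝ) : ℂ)⁻¹ * d, ?_⟩
      rw [hF]
      simp only [Matrix.smul_mul, smul_mulVec, ← mulVec_mulVec, Matrix.mul_assoc,
        inj_conjTranspose_mulVec]
      rw [← hd, mulVec_smul, mulVec_mulVec, isometry_encMat, smul_smul]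
    refine ⟨c, tens_one_inj ?_⟩
    have h₂ : (bop fun _ : Fin 1 => inj s.qdata r) = inj (s.data 1) fun p => r p.2 := by
      rw [inj_data]
    rw [← blockTens_mul_benc, ← bop_mul_benc, ← bop_mul_benc, h₂]
    refine Eq.trans (congrArg (· * _) (submatrix_eq_blockTens F)) (Eq.trans hc ?_)
    have := tens_smul_one (ι := Fin 1) (A := Bool) fun _ => c
    simpa using this.symm
  · exact fun _ _ _ => ⟨0, by simp [qdec]⟩

/-- Undoing the encoding preserves the trace only on the code space. That is enough, since a
faultless 1-EC takes every input there; this is what the condition on arbitrary inputs is needed for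
here. -/
theorem complete_qdec (hs : s.FaultTolerant) : ∑ k, (s.qdec k)ᴴ * s.qdec k = 1 := by
  set c : ℂ := ((Real.sqrt (Fintype.card (s.Block 1 → Bool)) : ℝ) : ℂ)⁻¹ with hc
  have hcc : star c * c * Fintype.card (s.Block 1 → Bool) = 1 := by
    have h₀ : (0 : ℝ) < Fintype.card (s.Block 1 → Bool) := by exact_mod_cast Fintype.card_pos
    rw [hc, RCLike.star_def, map_inv₀, Complex.conj_ofReal]
    norm_cast
    rw [← mul_inv, Real.mul_self_sqrt h₀.le]
    exact inv_mul_cancel₀ h₀.ne'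
  have key : ∀ K ∈ runKraus s.ec noFault, ∑ z, (c • ((s.encMat 1)ᴴ * ((inj (s.data 1) z)ᴴ * K)))ᴴ *
      (c • ((s.encMat 1)ᴴ * ((inj (s.data 1) z)ᴴ * K))) = Kᴴ * K := by
    intro K hK
    have h₁ : ∀ z, (c • ((s.encMat 1)ᴴ * ((inj (s.data 1) z)ᴴ * K)))ᴴ *
        (c • ((s.encMat 1)ᴴ * ((inj (s.data 1) z)ᴴ * K))) =
          (star c * c) • (Kᴴ * (inj (s.data 1) z * ((inj (s.data 1) z)ᴴ * K))) := by
      intro z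
      have h₂ : s.encMat 1 * ((s.encMat 1)ᴴ * ((inj (s.data 1) z)ᴴ * K)) =
          (inj (s.data 1) z)ᴴ * K := by
        refine Matrix.ext_of_mulVec_single fun i => ?_
        rw [← Matrix.mul_assoc, ← bop_encProj, ← mulVec_mulVec]
        refine encProj_mulVec ?_
        rw [← mulVec_mulVec, inj_conjTranspose_mulVec]
        exact ec_any_zero hs (S := ∅) (off := 0) (by simp [cnt])
          (mem_paths_of_mem_runKraus hK 0) _ z
      simp only [conjTranspose_smul, conjTranspose_mul, conjTranspose_conjTranspose,
        Matrix.smul_mul, Matrix.mul_smul, smul_smul, Matrix.mul_assoc, h₂]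
      rw [mul_comm c]
    have h₃ : ∑ z, inj (s.data 1) z * (inj (s.data 1) z)ᴴ =
        (Fintype.card (s.Block 1 → Bool) : ℂ) • (1 : Op (Fin 1 × s.Q)) := by
      refine Matrix.ext_of_mulVec_single fun i => ?_
      rw [Matrix.sum_mulVec, smul_mulVec, one_mulVec, ← sum_inj_vslice (s.data 1)]
      refine Finset.sum_congr rfl fun z _ => ?_
      rw [← mulVec_mulVec, inj_conjTranspose_mulVec]
    have h₄ : ∑ z, Kᴴ * (inj (s.data 1) z * ((inj (s.data 1) z)ᴴ * K)) =
        Kᴴ * (∑ z, inj (s.data 1) z * (inj (s.data 1) z)ᴴ) * K := by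
      rw [Matrix.mul_sum, Matrix.sum_mul]
      exact Finset.sum_congr rfl fun z _ => by simp only [Matrix.mul_assoc]
    simp only [h₁]
    rw [← Finset.smul_sum, h₄, h₃, Matrix.mul_smul, Matrix.mul_one, Matrix.smul_mul, smul_smul, hcc,
      one_smul]
  have hsum : ∑ k : Fin (runKraus s.ec noFault).length, ((runKraus s.ec noFault).get k)ᴴ *
      (runKraus s.ec noFault).get k = 1 := by
    have := complete_runKraus s.ec noFault
    rw [← this, ← Fin.sum_univ_fun_getElem]
    rfl
  have h₅ : ∀ k z, ((s.qdec (Sum.inl (k, z)))ᴴ * s.qdec (Sum.inl (k, z))) =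
      ((c • ((s.encMat 1)ᴴ * ((inj (s.data 1) z)ᴴ * (runKraus s.ec noFault).get k)))ᴴ *
        (c • ((s.encMat 1)ᴴ * ((inj (s.data 1) z)ᴴ * (runKraus s.ec noFault).get k)))).submatrix
          (fun q p => q p.2) (fun q p => q p.2) := by
    intro k z
    change (Matrix.submatrix _ _ _)ᴴ * Matrix.submatrix _ _ _ = _
    rw [conjTranspose_submatrix, ← submatrix_mul]
    exact (Equiv.funUnique (Fin 1) Bool).symm.bijective
  rw [Fintype.sum_sum_type, Fintype.sum_prod_type]
  ext x y
  have h₆ := congrFun (congrFun hsum fun p => x p.2) fun p => y p.2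
  simp only [← key _ (List.get_mem _ _)] at h₆
  simp only [h₅]
  simp only [qdec, Matrix.mul_zero, Finset.sum_const_zero, add_zero]
  simp only [Matrix.sum_apply, submatrix_apply] at h₆ ⊢
  rw [h₆, one_apply, one_apply]
  refine if_congr ⟨fun h => ?_, fun h => by rw [h]⟩ rfl rfl
  funext q
  exact congrFun h (0, q)

theorem complete_cdec : ∑ k, (s.cdec k)ᴴ * s.cdec k = 1 := by
  rw [Fintype.sum_sum_type]
  simp only [cdec, conjTranspose_single, single_mul_single_same, star_one, mul_one]
  simp only [conjTranspose_zero, Matrix.mul_zero, Finset.sum_const_zero, zero_add]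
  ext x y
  rw [Matrix.sum_apply]
  simp only [single_apply, one_apply]
  by_cases h : x = y
  · subst h; simp
  · simp only [h, if_false]
    exact Finset.sum_eq_zero fun b _ => if_neg fun hb => h (hb.1.symm.trans hb.2)

end Scheme

/-! ### Outcome probabilities and fault paths of the measurement circuit -/

section Diagonal

variable {𝒢 : GateSet} {W : Type} [Fintype W] [DecidableEq W]

theorem sum_diag_congr {s : Set W} {ρ ρ' : Op W} (h : forget s ρ = forget s ρ')
    {p : (W → Bool) → Prop} [DecidablePred p] (hp : ∀ z y, p (mix s z y) ↔ p y) :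
    (∑ y, if p y then ρ y y else 0) = ∑ y, if p y then ρ' y y else 0 := by
  have key : ∀ ρ : Op W, (Fintype.card (W → Bool) : ℂ) * (∑ y, if p y then ρ y y else 0) =
      ∑ y, if p y then forget s ρ y y else 0 := by
    intro ρ
    rw [← nsmul_eq_mul, ← sum_mix s fun y => if p y then ρ y y else 0]
    refine Finset.sum_congr rfl fun y _ => ?_
    simp only [hp, forget_apply]
    split_ifs <;> simp
  have h₁ := key ρ
  rw [h, ← key ρ'] at h₁
  exact mul_left_cancel₀ (card_config_ne_zero W) h₁

theorem mem_liveAfter_of_mem_measured {live : Set W} {ls : List (Loc 𝒢 W)}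
    (h : WellFormed live ls) {w : W} (hw : w ∈ measured ls) : w ∈ liveAfter live ls := by
  induction ls generalizing live with
  | nil => simp [measured] at hw
  | cons l ls ih =>
    rw [liveAfter_cons]
    have h' := h.tail
    cases l with
    | prep v => exact ih h' hw
    | gate g e => exact ih h' hw
    | meas v =>
      rcases Finset.mem_insert.1 hw with rfl | hw
      · exact Or.inl (Or.inl h.1)
      · exact ih h' hw

theorem kmap_pureState_diag {X Y : Type} [Fintype X] [DecidableEq X] [Fintype Y] [DecidableEq Y]
    (L : List (Matrix Y X ℂ)) (u : X → ℂ) (y : Y) :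
    kmap L (pureState u) y y = (((L.map fun K => ‖(K *ᵥ u) y‖ ^ 2).sum : ℝ) : ℂ) := by
  induction L with
  | nil => simp
  | cons K L ih =>
    rw [kmap_cons, Matrix.add_apply, ih, conj_pureState, List.map_cons, List.sum_cons]
    push_cast
    congr 1
    rw [pureState, vecMulVec_apply, Pi.star_apply, RCLike.star_def, RCLike.mul_conj]
    rfl

end Diagonal

namespace Scheme

variable {𝒢 : GateSet} {s : Scheme 𝒢} {S : Finset ℕ} {off : ℕ}

/-- An outcome of probability zero has amplitude zero in every Kraus operator, hence in every fault
path. The state of the ancillas is irrelevant, because the logical outcome is a function of measured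
wires, which are live at the end. -/
theorem meas_paths_apply {v : Vec (s.Block 1)} {b : Bool}
    (h : ∀ err, s.measProb (faultsFrom S off err) v b = 0) {K : Op (Fin 1 × s.Q)}
    (hK : K ∈ Paths S (s.measGa.zipIdx off)) (r y : Fin 1 × s.Q → Bool)
    (hy : s.dec (fun q => y (0, q)) = b) : (K *ᵥ (inj (s.data 1) r *ᵥ v)) y = 0 := by
  refine Submodule.span_induction (p := fun K _ => (K *ᵥ (inj (s.data 1) r *ᵥ v)) y = 0)
    ?_ ?_ ?_ ?_ (mem_span_runKraus hK)
  · rintro K ⟨err, hK⟩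
    have h₁ := sum_diag_congr (p := fun y : Fin 1 × s.Q → Bool => s.dec (fun q => y (0, q)) = b)
      (forget_run s.measGa_wf (faultsFrom S off err) (s.forget_inj r v)) fun z y => by
        refine Eq.congr_left (s.dec_measured _ _ fun q hq => ?_)
        exact mix_of_notMem (not_not.2 (mem_liveAfter_of_mem_measured s.measGa_wf hq)) _ _
    have h₂ := congrArg Complex.re h₁
    rw [Complex.re_sum, Complex.re_sum] at h₂
    simp only [apply_ite Complex.re, Complex.zero_re] at h₂
    have h₃ := h err
    rw [measProb] at h₃
    rw [h₃] at h₂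
    have h₄ : ∀ y, (run s.measGa (faultsFrom S off err) (pureState (inj (s.data 1) r *ᵥ v)) y y).re =
        ((runKraus s.measGa (faultsFrom S off err)).map
          fun K => ‖(K *ᵥ (inj (s.data 1) r *ᵥ v)) y‖ ^ 2).sum := by
      intro y
      rw [run_eq, kmap_pureState_diag, Complex.ofReal_re]
    have h₅ : ∀ y, 0 ≤ ((runKraus s.measGa (faultsFrom S off err)).map
          fun K => ‖(K *ᵥ (inj (s.data 1) r *ᵥ v)) y‖ ^ 2).sum := fun y =>
      List.sum_nonneg fun a ha => by
        obtain ⟨K, -, rfl⟩ := List.mem_map.1 ha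
        positivity
    simp only [h₄] at h₂
    rw [Finset.sum_eq_zero_iff_of_nonneg fun y _ => by
      split_ifs
      exacts [h₅ y, le_rfl]] at h₂
    have h₆ := h₂ y (Finset.mem_univ y)
    rw [if_pos hy] at h₆
    simpa using eq_zero_of_list_sum_eq_zero (fun K => by positivity) h₆ K hK
  · rw [zero_mulVec]; rfl
  · intro A B _ _ hA hB
    rw [add_mulVec, Pi.add_apply, hA, hB, add_zero]
  · intro c A _ hA
    rw [smul_mulVec, Pi.smul_apply, hA, smul_zero]

/-- On a logical basis state the wrong outcome is impossible. Amplitudes are linear, so basis states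
are all that is needed of the measurement conditions. -/
theorem measProb_eq_zero {F : ℕ → Option ErrorChoice} {v : Vec (s.Block 1)} {a : Fin 1 → Bool}
    (h : s.MeasuresAs F v (Pi.single a 1)) {b : Bool} (hb : a 0 ≠ b) : s.measProb F v b = 0 := by
  have h₁ := h b
  have h₂ : ∑ x, ‖(Pi.single a 1 : Vec (Fin 1)) x‖ ^ 2 = 1 := by
    rw [Finset.sum_eq_single a]
    · simp
    · intro x _ hx
      simp [hx]
    · simp
  have h₃ : (Pi.single a 1 : Vec (Fin 1)) (fun _ => b) = 0 :=
    Pi.single_eq_of_ne (fun h => hb (congrFun h 0).symm) _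
  rw [h₂, h₃] at h₁
  simpa using h₁

theorem measProb_congr {F F' : ℕ → Option ErrorChoice} (h : run s.measGa F = run s.measGa F') :
    s.measProb F = s.measProb F' := by
  funext v b
  rw [measProb, measProb, h]

theorem meas_error_paths (hs : s.FaultTolerant) (h : cnt S off s.measGa.length = 0)
    {K : Op (Fin 1 × s.Q)} (hK : K ∈ Paths S (s.measGa.zipIdx off)) {F : Op (s.Block 1)}
    (hF : F ∈ s.singleError 1) (r y : Fin 1 × s.Q → Bool) (a : Fin 1 → Bool)
    (hy : s.dec (fun q => y (0, q)) ≠ a 0) :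
    (K * (inj (s.data 1) r * (F * s.encMat 1))) y a = 0 := by
  have := meas_paths_apply (v := F *ᵥ (s.encMat 1 *ᵥ Pi.single a 1)) (fun err => by
    rw [measProb_congr (run_faultsFrom_zero h err)]
    exact measProb_eq_zero (hs.meas_error F hF (Pi.single a 1)) hy.symm) hK r y rfl
  simp only [mulVec_mulVec] at this
  rwa [mulVec_single_one] at this

theorem meas_fault_paths (hs : s.FaultTolerant) (h : cnt S off s.measGa.length ≤ 1)
    {K : Op (Fin 1 × s.Q)} (hK : K ∈ Paths S (s.measGa.zipIdx off))
    (r y : Fin 1 × s.Q → Bool) (a : Fin 1 → Bool) (hy : s.dec (fun q => y (0, q)) ≠ a 0) :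
    (K * (inj (s.data 1) r * s.encMat 1)) y a = 0 := by
  have := meas_paths_apply (v := s.encMat 1 *ᵥ Pi.single a 1) (fun err => by
    rw [measProb_congr (run_faultsFrom _ S off err)]
    exact measProb_eq_zero (hs.meas_fault _ err h (Pi.single a 1)) hy.symm) hK r y rfl
  simp only [mulVec_mulVec] at this
  rwa [mulVec_single_one] at this

end Scheme

namespace Scheme

variable {𝒢 : GateSet} {s : Scheme 𝒢} {W : Type} [Fintype W] [DecidableEq W] {n : ℕ}

/-! ### Faulty circuits on encoded qubits -/

/-- The state of the block `w` is supported in `𝒱`. -/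
def Supp (w : W) (𝒱 : Submodule ℂ (Vec (Fin 1 × s.Q))) (ρ : Op (W × s.Q)) : Prop :=
  ρ ∈ cone (lift (blocks (oneWire w)) 𝒱 : Set (Vec (W × s.Q)))

/-- The span of the encodings with errors from `ℱ`. -/
def encSpan (ℱ : Set (Op (s.Block n))) : Submodule ℂ (Vec (s.Block n)) :=
  Submodule.span ℂ {v | ∃ F ∈ ℱ, ∃ ψ, v = F *ᵥ (s.encMat n *ᵥ ψ)}

/-- The encodings with errors from `ℱ`. -/
def encSet (ℱ : Set (Op (s.Block n))) : Set (Matrix (Fin n × s.Q → Bool) (Fin n → Bool) ℂ) :=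
  {J | ∃ r, ∃ F ∈ ℱ, J = inj (s.data n) r * (F * s.encMat n)}

theorem lift_encSpan_le (ℱ : Set (Op (s.Block n))) {P : Submodule ℂ (Vec (Fin n × s.Q))}
    (h : ∀ r, ∀ F ∈ ℱ, ∀ ψ, inj (s.data n) r *ᵥ (F *ᵥ (s.encMat n *ᵥ ψ)) ∈ P) :
    lift (s.data n) (encSpan ℱ) ≤ P := by
  refine lift_le fun v hv r => ?_
  refine Submodule.span_induction (p := fun v _ => inj (s.data n) r *ᵥ v ∈ P) ?_ ?_ ?_ ?_ hv
  · rintro _ ⟨F, hF, ψ, rfl⟩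
    exact h r F hF ψ
  · rw [mulVec_zero]; exact zero_mem _
  · intro x y _ _ hx hy
    rw [mulVec_add]; exact add_mem hx hy
  · intro c x _ hx
    rw [mulVec_smul]; exact Submodule.smul_mem _ c hx

theorem lift_encSpan_le_imgSpan (ℱ : Set (Op (s.Block n))) :
    lift (s.data n) (encSpan ℱ) ≤ imgSpan (encSet ℱ) :=
  lift_encSpan_le ℱ fun r F hF ψ => Submodule.subset_span ⟨_, ⟨r, F, hF, rfl⟩, ψ, by
    simp only [mulVec_mulVec]⟩

/-- The support of `n` blocks, given the supports of the single blocks. -/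
theorem mem_cone_encSpan {e : Fin n ↪ W} {ρ : Op (W × s.Q)} (hρ : ρ ∈ cone Set.univ)
    {𝒱 : Fin n → Submodule ℂ (Vec (s.Block 1))} (h : ∀ a, Supp (e a) (lift (s.data 1) (𝒱 a)) ρ)
    {ℱ : Set (Op (s.Block n))}
    (hjoint : ∀ v, (∀ a, v ∈ lift (blocks (oneWire a)) (𝒱 a)) → v ∈ encSpan ℱ) :
    ρ ∈ cone (lift (blocks e) (lift (s.data n) (encSpan ℱ)) : Set (Vec (W × s.Q))) := by
  refine cone_mono ?_ (mem_cone_iInf hρ h)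
  intro v hv r z
  refine hjoint _ fun a => ?_
  have := (Submodule.mem_iInf _).1 hv a
  rw [← blocks_trans, ← lift_lift, lift_blocks_data] at this
  exact this r z

theorem Reach.supp {e : Fin n ↪ W} {S : Finset ℕ} {L : List (Loc 𝒢 (Fin n × s.Q) × ℕ)}
    {ρ σ : Op (W × s.Q)} (h : Reach S (relabel (blocks e) L) ρ σ) {ℱ : Set (Op (s.Block n))}
    (hρ : ρ ∈ cone (lift (blocks e) (lift (s.data n) (encSpan ℱ)) : Set (Vec (W × s.Q))))
    {𝒱 : Submodule ℂ (Vec (s.Block 1))} {a : Fin n}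
    (hP : ∀ K ∈ Paths S L, ∀ r, ∀ F ∈ ℱ, ∀ ψ, K *ᵥ (inj (s.data n) r *ᵥ
      (F *ᵥ (s.encMat n *ᵥ ψ))) ∈ lift (s.data n) (lift (blocks (oneWire a)) 𝒱)) :
    Supp (e a) (lift (s.data 1) 𝒱) σ := by
  rw [Supp, ← blocks_trans, ← lift_lift, lift_blocks_data]
  exact h.mem_cone_lift hρ fun K hK v hv => lift_encSpan_le
    (P := (lift (s.data n) (lift (blocks (oneWire a)) 𝒱)).comap K.mulVecLin) ℱ
    (fun r F hF ψ => hP K hK r F hF ψ) hv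

/-- The decoding of one block. -/
theorem qdec_mul (hs : s.FaultTolerant) {T : Matrix (Fin n → Bool) (Fin n × s.Q → Bool) ℂ}
    (hT : T ∈ decKraus fun _ : Fin n => s.qdec) : ∃ T' : Fin n → Matrix Bool (s.Q → Bool) ℂ,
      (∀ i, s.Good (T' i)) ∧ T = blockTens T' := by
  obtain ⟨k, -, rfl⟩ := List.mem_map.1 hT
  exact ⟨_, fun i => good_qdec hs _, rfl⟩

theorem complete_decode_qdec (hs : s.FaultTolerant) :
    Complete (decKraus fun _ : Fin n => s.qdec) :=
  complete_decKraus fun _ => complete_qdec hs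

theorem kmap_singleton {X I : Type} [Fintype X] [DecidableEq X] [Fintype I] [DecidableEq I]
    (R : Matrix X I ℂ) (M : Matrix I I ℂ) : kmap [R] M = R * M * Rᴴ := by simp

theorem conj_of_eq_smul {X Y I : Type} [Fintype X] [DecidableEq X] [Fintype I] [DecidableEq I]
    [Fintype Y] [DecidableEq Y]
    {R : Matrix X I ℂ} (hR : Rᴴ * R = 1) {T : Matrix X Y ℂ} {N N' : Matrix Y I ℂ} {c c' : ℂ}
    (h : T * N = c • R) (h' : T * N' = c' • R) (M : Matrix I I ℂ) :
    T * N * M * (T * N')ᴴ = kmap [R] (M * ((T * N')ᴴ * (T * N))) := by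
  rw [h, h', kmap_singleton]
  simp only [conjTranspose_smul, Matrix.smul_mul, Matrix.mul_smul, hR, Matrix.mul_one]
  rw [smul_comm]

/-- `kmap_kmap_conj` for the empty circuit: the decoder recovers the logical operator, weighted by
the overlap of the two encodings with their errors. -/
theorem decode_encSet (hs : s.FaultTolerant) {ℱ : Set (Op (s.Block n))} (hℱ : ℱ ⊆ s.blockErr n) :
    ∀ J ∈ encSet ℱ, ∀ J' ∈ encSet ℱ, ∀ M : Matrix (Fin n → Bool) (Fin n → Bool) ℂ,
      decode (fun _ : Fin n => s.qdec) (J * M * J'ᴴ) = M * (J'ᴴ * J) := by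
  rintro _ ⟨r, F, hF, rfl⟩ _ ⟨r', F', hF', rfl⟩ M
  have := kmap_kmap_conj (complete_decode_qdec (n := n) hs) (B := kmap [1]) (𝒩 := encSet ℱ)
    (fun T hT N hN N' hN' M => ?_) (complete_singleton_one (X := Fin n × s.Q → Bool))
    (J := inj (s.data n) r * (F * s.encMat n)) (J' := inj (s.data n) r' * (F' * s.encMat n))
    (fun K hK => ?_) (fun K hK => ?_) M
  · simpa using this
  · obtain ⟨T, hG, rfl⟩ := qdec_mul hs hT
    obtain ⟨r, F, hF, rfl⟩ := hN
    obtain ⟨r', F', hF', rfl⟩ := hN'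
    obtain ⟨c, hc⟩ := Good.blockTens hG r (hℱ hF)
    obtain ⟨c', hc'⟩ := Good.blockTens hG r' (hℱ hF')
    exact conj_of_eq_smul (by simp) hc hc' M
  · rw [List.mem_singleton.1 hK, Matrix.one_mul]
    exact ⟨r, F, hF, rfl⟩
  · rw [List.mem_singleton.1 hK, Matrix.one_mul]
    exact ⟨r', F', hF', rfl⟩

/-- The instance of `reach_logic` for circuits with quantum output. If all fault paths lead to the
encoding of `R ψ` with at most one error per block, then each Kraus operator of the decoder gives a
multiple of `R`, so the circuit acts as `R` on the decoded state, whatever it is entangled with. -/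
theorem decode_slice_of_paths (hs : s.FaultTolerant) {e : Fin n ↪ W} {S : Finset ℕ}
    {L : List (Loc 𝒢 (Fin n × s.Q) × ℕ)} {ρ σ : Op (W × s.Q)}
    (h : Reach S (relabel (blocks e) L) ρ σ) {ℱ : Set (Op (s.Block n))} (hℱ : ℱ ⊆ s.blockErr n)
    (hρ : ρ ∈ cone (lift (blocks e) (lift (s.data n) (encSpan ℱ)) : Set (Vec (W × s.Q))))
    {R : Matrix (Fin n → Bool) (Fin n → Bool) ℂ} (hR : Rᴴ * R = 1)
    (hP : ∀ K ∈ Paths S L, ∀ r, ∀ F ∈ ℱ, ∀ ψ, K *ᵥ (inj (s.data n) r *ᵥ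
      (F *ᵥ (s.encMat n *ᵥ ψ))) ∈ lift (s.data n) (s.errSpan n (R *ᵥ ψ)))
    (r r' : W × s.Q → Bool) :
    decode (fun _ : Fin n => s.qdec) (slice (blocks e) r r' σ) =
      kmap [R] (decode (fun _ : Fin n => s.qdec) (slice (blocks e) r r' ρ)) := by
  refine reach_logic (complete_decode_qdec hs) (B := kmap [R]) (𝒥 := encSet ℱ)
    (𝒩 := {N | ∀ T ∈ decKraus fun _ : Fin n => s.qdec, ∃ c : ℂ, T * N = c • R})
    (fun T hT N hN N' hN' M => ?_) ?_ (cone_mono (lift_mono _ (lift_encSpan_le_imgSpan ℱ)) hρ) h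
    (Φ₀ := kmap [R] ∘ₗ decode fun _ : Fin n => s.qdec) (fun J hJ J' hJ' M => ?_) r r'
  · obtain ⟨c, hc⟩ := hN T hT
    obtain ⟨c', hc'⟩ := hN' T hT
    exact conj_of_eq_smul hR hc hc' M
  · rintro K hK _ ⟨r, F, hF, rfl⟩ T hT
    obtain ⟨T, hG, rfl⟩ := qdec_mul hs hT
    refine exists_eq_smul hR fun ψ => ?_
    obtain ⟨c, hc⟩ := Good.mulVec hG (hP K hK r F hF ψ)
    exact ⟨c, by simpa only [mulVec_mulVec, Matrix.mul_assoc, ← smul_mulVec] using hc⟩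
  · rw [LinearMap.comp_apply, decode_encSet hs hℱ J hJ J' hJ']

/-! #### Preparations -/

/-- The state `|0⟩`, as a column. -/
def zeroCol : Matrix (Fin 1 → Bool) Unit ℂ := Matrix.of fun x _ => zeroVec (Fin 1) x

theorem zeroCol_mulVec (φ : Unit → ℂ) : zeroCol *ᵥ φ = φ () • zeroVec (Fin 1) := by
  funext x
  simp [mulVec, dotProduct, zeroCol, mul_comm]

theorem isometry_zeroCol : zeroColᴴ * zeroCol = 1 := by
  ext i j
  simp [zeroCol, mul_apply, zeroVec, conjTranspose_apply, sum_config_one]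

/-- The Kraus operators of a preparation. -/
def prepKr : List (Op (Fin 1)) := [ketBra false true, ketBra false false]

/-- The Kraus operators of a measurement. -/
def measKr : List (Op (Fin 1)) := [ketBra true true, ketBra false false]

theorem kmap_prepKr (X : Op (Fin 1)) : kmap prepKr X = X.trace • (zeroCol * zeroColᴴ) := by
  rw [trace, sum_config_one]
  ext x y
  simp only [prepKr, kmap_cons, kmap_nil, add_zero, Matrix.add_apply, mul_apply, sum_config_one,
    ketBra, of_apply, conjTranspose_apply, Matrix.smul_apply, zeroCol, zeroVec, diag_apply]
  by_cases h₁ : x 0 = false <;> by_cases h₂ : y 0 = false <;> simp [h₁, h₂]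

/-- A preparation has no logical input, so the logical index type is `Unit` and every vector counts
as an encoding. The logical operation takes the trace and inserts `|0⟩⟨0|`. -/
theorem decode_slice_prep (hs : s.FaultTolerant) {w : W} {S : Finset ℕ} {off : ℕ}
    (hcnt : cnt S off s.prepGa.length ≤ 1) {ρ σ : Op (W × s.Q)} (hρ : ρ ∈ cone Set.univ)
    (h : Reach S (relabel (blocks (oneWire w)) (s.prepGa.zipIdx off)) ρ σ)
    (r r' : W × s.Q → Bool) :
    decode (fun _ : Fin 1 => s.qdec) (slice (blocks (oneWire w)) r r' σ) =
      kmap prepKr (decode (fun _ : Fin 1 => s.qdec) (slice (blocks (oneWire w)) r r' ρ)) := by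
  refine reach_logic (complete_decode_qdec hs) (B := kmap [zeroCol]) (𝒥 := Set.univ)
    (𝒩 := {N | ∀ T ∈ decKraus fun _ : Fin 1 => s.qdec, ∃ c : ℂ, T * N = c • zeroCol})
    (fun T hT N hN N' hN' M => ?_) ?_ (cone_mono (fun v _ r => ?_) hρ) h
    (Φ₀ := kmap prepKr ∘ₗ decode fun _ : Fin 1 => s.qdec)
    (fun J hJ J' hJ' M => ?_) r r'
  · obtain ⟨c, hc⟩ := hN T hT
    obtain ⟨c', hc'⟩ := hN' T hT
    exact conj_of_eq_smul isometry_zeroCol hc hc' M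
  · intro K hK J _ T hT
    obtain ⟨T, hG, rfl⟩ := qdec_mul hs hT
    refine exists_eq_smul isometry_zeroCol fun φ => ?_
    obtain ⟨c, hc⟩ := Good.mulVec hG (prep_fault_paths hs hcnt hK (J *ᵥ φ))
    by_cases hφ : φ () = 0
    · have : φ = 0 := funext fun _ => hφ
      exact ⟨0, by simp [this]⟩
    · refine ⟨c * (φ ())⁻¹, ?_⟩
      rw [zeroCol_mulVec, smul_smul, inv_mul_cancel_right₀ hφ, ← hc]
      simp only [mulVec_mulVec]
  · exact Submodule.subset_span ⟨Matrix.of fun x _ => vslice (blocks (oneWire w)) v r x,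
      Set.mem_univ _, fun _ => 1, by funext x; simp [mulVec, dotProduct]⟩
  · rw [LinearMap.comp_apply, kmap_prepKr, trace_kmap (complete_decode_qdec hs), kmap_singleton,
      trace_mul_comm, ← Matrix.mul_assoc]
    have h₁ : ∀ X : Matrix Unit Unit ℂ, zeroCol * X * zeroColᴴ =
        X.trace • (zeroCol * zeroColᴴ) := by
      intro X
      have hX : X = X.trace • 1 := by ext i j; simp [trace]
      rw [hX]
      simp
    rw [h₁, trace_mul_comm M]

/-! #### Measurements -/

/-- A Kraus operator of the classical decoder sees a single outcome string, and this is reached only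
from the logical basis state that the string decodes to. -/
theorem cdec_mul {T : Matrix (Fin 1 → Bool) (Fin 1 × s.Q → Bool) ℂ}
    (hT : T ∈ decKraus fun _ : Fin 1 => s.cdec) :
    ∃ b, ∀ N : Matrix (Fin 1 × s.Q → Bool) (Fin 1 → Bool) ℂ,
      (∀ y a, s.dec (fun q => y (0, q)) ≠ a 0 → N y a = 0) → ∃ c : ℂ, T * N = c • ketBra b b := by
  obtain ⟨k, -, rfl⟩ := List.mem_map.1 hT
  have h : ∀ x z, blockTens (fun i => s.cdec (k i)) x z = s.cdec (k 0) (x 0) fun q => z (0, q) := by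
    intro x z
    rw [blockTens_apply]
    simp
  suffices hsuff : ∀ T : Matrix (Fin 1 → Bool) (Fin 1 × s.Q → Bool) ℂ,
      (∀ x z, T x z = s.cdec (k 0) (x 0) fun q => z (0, q)) →
      ∃ b, ∀ N : Matrix (Fin 1 × s.Q → Bool) (Fin 1 → Bool) ℂ,
        (∀ y a, s.dec (fun q => y (0, q)) ≠ a 0 → N y a = 0) → ∃ c : ℂ, T * N = c • ketBra b b from
    hsuff _ h
  intro T hT
  rcases hk : k 0 with _ | y
  · refine ⟨true, fun N _ => ⟨0, ?_⟩⟩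
    simp only [hk, cdec, Matrix.zero_apply] at hT
    ext x a
    simp [mul_apply, hT]
  · refine ⟨s.dec y, fun N hN => ⟨N (fun p => y p.2) fun _ => s.dec y, ?_⟩⟩
    simp only [hk, cdec, single_apply] at hT
    ext x a
    rw [mul_apply, Finset.sum_eq_single fun p => y p.2]
    · simp only [hT, Matrix.smul_apply, ketBra, of_apply, smul_eq_mul]
      by_cases ha : a 0 = s.dec y
      · have : a = fun _ => s.dec y := funext fun i => by rw [Subsingleton.elim i 0, ha]
        subst this
        by_cases hx : x 0 = s.dec y
        · simp [hx]
        · simp [hx, Ne.symm hx]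
      · rw [hN _ _ (Ne.symm ha)]
        simp [ha]
    · intro z _ hz
      rw [hT, if_neg, zero_mul]
      rintro ⟨-, hy⟩
      refine hz (funext fun p => ?_)
      rw [hy]
      exact congrArg z (Prod.ext (Subsingleton.elim _ _) rfl)
    · simp

/-- Here a decoded fault path is a multiple of some `|b⟩⟨b|`, with `b` given by the decoder's Kraus
operator, and not of an isometry. The hypothesis of `reach_logic` still holds, with the dephasing as
logical operation. -/
theorem decode_slice_meas (hs : s.FaultTolerant) {w : W} {S : Finset ℕ} {off : ℕ}
    {ℱ : Set (Op (s.Block 1))} (hℱ : ℱ ⊆ s.blockErr 1) {ρ σ : Op (W × s.Q)}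
    (hρ : ρ ∈ cone (lift (blocks (oneWire w)) (lift (s.data 1) (encSpan ℱ)) : Set (Vec (W × s.Q))))
    (h : Reach S (relabel (blocks (oneWire w)) (s.measGa.zipIdx off)) ρ σ)
    (hP : ∀ K ∈ Paths S (s.measGa.zipIdx off), ∀ r, ∀ F ∈ ℱ, ∀ y a,
      s.dec (fun q => y (0, q)) ≠ a 0 → (K * (inj (s.data 1) r * (F * s.encMat 1))) y a = 0)
    (r r' : W × s.Q → Bool) :
    decode (fun _ : Fin 1 => s.cdec) (slice (blocks (oneWire w)) r r' σ) =
      kmap measKr (decode (fun _ : Fin 1 => s.qdec) (slice (blocks (oneWire w)) r r' ρ)) := by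
  refine reach_logic (complete_decKraus fun _ => complete_cdec) (B := kmap measKr) (𝒥 := encSet ℱ)
    (𝒩 := {N | ∀ y a, s.dec (fun q => y (0, q)) ≠ a 0 → N y a = 0})
    (fun T hT N hN N' hN' M => ?_) ?_ (cone_mono (lift_mono _ (lift_encSpan_le_imgSpan ℱ)) hρ) h
    (Φ₀ := kmap measKr ∘ₗ decode fun _ : Fin 1 => s.qdec) (fun J hJ J' hJ' M => ?_) r r'
  · obtain ⟨b, hb⟩ := cdec_mul hT
    obtain ⟨c, hc⟩ := hb N hN
    obtain ⟨c', hc'⟩ := hb N' hN'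
    rw [hc, hc']
    simp only [measKr, kmap_cons, kmap_nil, add_zero, conjTranspose_smul, ketBra_conjTranspose,
      Matrix.smul_mul, Matrix.mul_smul, ketBra_mul, if_true, Matrix.mul_assoc]
    cases b <;> simp [smul_smul, mul_comm]
  · rintro K hK _ ⟨r, F, hF, rfl⟩
    exact hP K hK r F hF
  · rw [LinearMap.comp_apply, decode_encSet hs hℱ J hJ J' hJ']

end Scheme

/-- Preparations have no input. -/
def Loc.IsPrep {𝒢 : GateSet} {W : Type} : Loc 𝒢 W → Prop
  | .prep _ => True
  | .gate _ _ => False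
  | .meas _ => False

/-- Measurements have no output. -/
def Loc.IsMeas {𝒢 : GateSet} {W : Type} : Loc 𝒢 W → Prop
  | .prep _ => False
  | .gate _ _ => False
  | .meas _ => True

instance {𝒢 : GateSet} {W : Type} : DecidablePred (Loc.IsPrep : Loc 𝒢 W → Prop)
  | .prep _ => .isTrue trivial
  | .gate _ _ => .isFalse id
  | .meas _ => .isFalse id

instance {𝒢 : GateSet} {W : Type} : DecidablePred (Loc.IsMeas : Loc 𝒢 W → Prop)
  | .prep _ => .isFalse id
  | .gate _ _ => .isFalse id
  | .meas _ => .isTrue trivial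

namespace Scheme

variable {𝒢 : GateSet} (s : Scheme 𝒢) {W : Type}

/-! ### The pieces of the encoded circuit -/

/-- The 1-Ga of a location. -/
def gaOf : (l : Loc 𝒢 W) → List (Loc 𝒢 (Fin l.arity × s.Q))
  | .prep _ => s.prepGa
  | .gate g _ => s.ga g
  | .meas _ => s.measGa

/-- The 1-EC of the block `w`, labelled from `off` on. -/
def ecAt (w : W) (off : ℕ) : List (Loc 𝒢 (W × s.Q) × ℕ) :=
  relabel (blocks (oneWire w)) (s.ec.zipIdx off)

/-- The 1-Ga of the location `l`, labelled from `off` on. -/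
def gaAt (l : Loc 𝒢 W) (off : ℕ) : List (Loc 𝒢 (W × s.Q) × ℕ) :=
  relabel (blocks l.wires) ((s.gaOf l).zipIdx off)

/-- The label of the first location of the 1-EC on the `a`-th output block of a rectangle whose
labels start at `off`. -/
def ecOff (l : Loc 𝒢 W) (off : ℕ) (a : Fin l.arity) : ℕ :=
  off + (s.gaOf l).length + a * s.ec.length

/-- Where the pieces of the extended rectangle of a location are: its labels start at `off`, the
labels of the 1-EC that precedes it on the block `w` at `lead w`. Moreover, whether it is bad, and
whether the 1-EC on the output block `w` belongs to the next (bad) extended rectangle. -/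
structure Tag (W : Type) where
  off : ℕ
  lead : W → ℕ
  bad : Prop
  pend : W → Prop

open Classical in
/-- A 1-EC on the blocks in a list, except for the pending ones. -/
noncomputable def ecChunk {n : ℕ} (e : Fin n ↪ W) (offs : Fin n → ℕ) (pend : Fin n → Prop)
    (as : List (Fin n)) : List (Loc 𝒢 (W × s.Q) × ℕ) :=
  as.flatMap fun a => if pend a then [] else s.ecAt (e a) (offs a)

open Classical in
/-- The 1-ECs that precede a bad location. -/
noncomputable def leadChunk (l : Loc 𝒢 W) (t : Tag W) : List (Loc 𝒢 (W × s.Q) × ℕ) :=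
  if t.bad ∧ ¬l.IsPrep then
    s.ecChunk l.wires (fun a => t.lead (l.wires a)) (fun _ => False) (List.finRange l.arity)
  else []

/-- The 1-ECs that follow a location, except for the pending ones. -/
noncomputable def trailChunk (l : Loc 𝒢 W) (t : Tag W) : List (Loc 𝒢 (W × s.Q) × ℕ) :=
  if l.IsMeas then [] else
    s.ecChunk l.wires (s.ecOff l t.off) (fun a => t.pend (l.wires a)) (List.finRange l.arity)

/-- The part of the encoded circuit that simulates a location. -/
noncomputable def custChunk (l : Loc 𝒢 W) (t : Tag W) : List (Loc 𝒢 (W × s.Q) × ℕ) :=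
  s.leadChunk l t ++ s.gaAt l t.off ++ s.trailChunk l t

open Classical in
/-- The number of faults in the (truncated) extended rectangle of a location. -/
noncomputable def faultCount (S : Finset ℕ) (l : Loc 𝒢 W) (t : Tag W) : ℕ :=
  (if l.IsPrep then 0 else ∑ a, cnt S (t.lead (l.wires a)) s.ec.length) +
    cnt S t.off (s.gaOf l).length +
    if l.IsMeas then 0 else
      ∑ a, if t.pend (l.wires a) then 0 else cnt S (s.ecOff l t.off a) s.ec.length

variable {s} [Fintype W] [DecidableEq W]

/-- The decoder of the blocks, where those in `M` have been measured. -/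
noncomputable def dec' (s : Scheme 𝒢) (M : Finset W) (w : W) : s.DecIdx → Matrix Bool (s.Q → Bool) ℂ :=
  if w ∈ M then s.cdec else s.qdec

theorem complete_dec' (hs : s.FaultTolerant) (M : Finset W) (w : W) :
    ∑ k, (s.dec' M w k)ᴴ * s.dec' M w k = 1 := by
  rw [dec']
  split_ifs
  · exact complete_cdec
  · exact complete_qdec hs

theorem decode_eq_ideal {l : Loc 𝒢 W} {M M' : Finset W}
    (hM : ∀ w, (∀ i, l.wires i ≠ w) → (w ∈ M' ↔ w ∈ M)) {ρ σ : Op (W × s.Q)}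
    (h : ∀ r r', decode (fun i => s.dec' M' (l.wires i)) (slice (blocks l.wires) r r' σ) =
      kmap l.kr (decode (fun i => s.dec' M (l.wires i)) (slice (blocks l.wires) r r' ρ))) :
    decode (s.dec' M') σ = l.ideal (decode (s.dec' M) ρ) := by
  refine slice_ext l.wires fun r r' => ?_
  rw [Loc.ideal_eq, slice_kmap_emb]
  exact slice_decode_congr (P := kmap l.kr) (P' := LinearMap.id) l.wires
    (fun w hw => by simp only [dec', hM w hw]) h r r'

theorem blocks_disjoint {e : Fin 1 ↪ W} {n : ℕ} {f : Fin n ↪ W} (h : ∀ i j, f i ≠ e j)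
    (i : Fin n × s.Q) (j : Fin 1 × s.Q) : blocks f i ≠ blocks e j := fun hij =>
  h i.1 j.1 (congrArg Prod.fst hij)

/-- An operation on other blocks preserves the support of the block `w`. -/
theorem Supp.of_trEq {w : W} {n : ℕ} {e : Fin n ↪ W} (hw : ∀ i, e i ≠ w)
    {𝒱 : Submodule ℂ (Vec (Fin 1 × s.Q))} {ρ σ : Op (W × s.Q)} (hρ : Supp w 𝒱 ρ)
    (h : TrEq (blocks e) ρ σ) (hσ : σ ∈ cone Set.univ) : Supp w 𝒱 σ :=
  h.mem_cone_lift (blocks_disjoint fun i _ => hw i) hσ hρ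

theorem Supp.mem_cone {w : W} {𝒱 : Submodule ℂ (Vec (Fin 1 × s.Q))} {ρ : Op (W × s.Q)}
    (h : Supp w 𝒱 ρ) : ρ ∈ cone Set.univ := cone_le_univ _ h

/-! ### Error corrections -/

section EC

variable {S : Finset ℕ} {off : ℕ} {w : W} {ρ σ : Op (W × s.Q)}

theorem trEq_ecAt (h : Reach S (s.ecAt w off) ρ σ) : TrEq (blocks (oneWire w)) ρ σ := h.trEq

theorem mem_cone_lift_top {V X : Type} [Fintype V] [DecidableEq V] [Fintype X] [DecidableEq X]
    (f : V ↪ X) {ρ : Op X} (hρ : ρ ∈ cone Set.univ) :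
    ρ ∈ cone (lift f ⊤ : Set (Vec X)) :=
  cone_mono (fun v _ => show v ∈ lift f ⊤ from fun _ => Submodule.mem_top) hρ

theorem supp_ecAt_zero (hs : s.FaultTolerant) (h : Reach S (s.ecAt w off) ρ σ)
    (hρ : ρ ∈ cone Set.univ) (hcnt : cnt S off s.ec.length = 0) : Supp w s.codeQ σ :=
  h.mem_cone_lift (𝒱 := ⊤) (mem_cone_lift_top _ hρ)
    fun _ hK v _ => ec_any_zero hs hcnt hK v

theorem supp_ecAt_one (hs : s.FaultTolerant) (h : Reach S (s.ecAt w off) ρ σ)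
    (hρ : ρ ∈ cone Set.univ) (hcnt : cnt S off s.ec.length ≤ 1) : Supp w s.nearQ σ :=
  h.mem_cone_lift (𝒱 := ⊤) (mem_cone_lift_top _ hρ)
    fun _ hK v _ => ec_any_one hs hcnt hK v

theorem mem_cone_of_near {e : Fin 1 ↪ W} (hρ : Supp (e 0) s.nearQ ρ) :
    ρ ∈ cone (lift (blocks e) (lift (s.data 1)
      (encSpan (s.singleError 1 : Set (Op (s.Block 1))))) : Set (Vec (W × s.Q))) :=
  mem_cone_encSpan hρ.mem_cone (𝒱 := fun _ => s.nearCode)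
    (fun a => by rw [Subsingleton.elim a 0]; exact hρ)
    fun v hv => mem_singleSpan 0 (fun a ha => (ha (Subsingleton.elim _ _)).elim) (hv 0)

theorem mem_cone_of_code {n : ℕ} {e : Fin n ↪ W} (hρ' : ρ ∈ cone Set.univ)
    (hρ : ∀ a, Supp (e a) s.codeQ ρ) :
    ρ ∈ cone (lift (blocks e) (lift (s.data n) (encSpan ({1} : Set (Op (s.Block n))))) :
      Set (Vec (W × s.Q))) :=
  mem_cone_encSpan hρ' (𝒱 := fun _ => s.codeSpace) hρ fun v hv => by
    obtain ⟨ψ, rfl⟩ := exists_encMat_mulVec hv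
    exact Submodule.subset_span ⟨1, rfl, ψ, (one_mulVec _).symm⟩

theorem one_subset_blockErr (n : ℕ) :
    ({1} : Set (Op (s.Block n))) ⊆ s.blockErr n := by
  rintro _ rfl
  exact s.singleError_le n (Submodule.subset_span (Or.inl rfl))

theorem span_le_errSpan (n : ℕ) (φ : Vec (Fin n)) :
    Submodule.span ℂ {s.encMat n *ᵥ φ} ≤ s.errSpan n φ :=
  (Submodule.span_singleton_le_iff_mem _ _).2 (s.encMat_mem_errSpan n φ)

theorem span_le_code (n : ℕ) (φ : Vec (Fin n)) (a : Fin n) :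
    Submodule.span ℂ {s.encMat n *ᵥ φ} ≤ lift (blocks (oneWire a)) s.codeSpace :=
  (Submodule.span_singleton_le_iff_mem _ _).2 (encMat_mulVec_mem n φ a)

/-- A faultless 1-EC corrects one error, and a single fault in a 1-EC leaves at most one error on a
codeword. In either case the logical state, as the ideal decoder reads it, is untouched. -/
theorem decode_ecAt (hs : s.FaultTolerant) (h : Reach S (s.ecAt w off) ρ σ) {M : Finset W}
    (hw : w ∉ M) (hρ : (cnt S off s.ec.length = 0 ∧ Supp w s.nearQ ρ) ∨
      (cnt S off s.ec.length ≤ 1 ∧ Supp w s.codeQ ρ)) :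
    decode (s.dec' M) σ = decode (s.dec' M) ρ := by
  have key : ∀ r r', decode (fun _ : Fin 1 => s.qdec) (slice (blocks (oneWire w)) r r' σ) =
      decode (fun _ : Fin 1 => s.qdec) (slice (blocks (oneWire w)) r r' ρ) := by
    intro r r'
    have h₁ : ∀ X : Op (Fin 1), kmap [1] X = X := fun X => by simp
    rcases hρ with ⟨hc, hρ⟩ | ⟨hc, hρ⟩
    · refine (decode_slice_of_paths hs h (s.singleError_le 1) (mem_cone_of_near hρ) (R := 1)
        (by simp) (fun K hK r F hF ψ => ?_) r r').trans (h₁ _)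
      rw [one_mulVec]
      exact lift_mono _ (span_le_errSpan 1 ψ) (ec_corrects_paths hs hc hK hF ψ r)
    · refine (decode_slice_of_paths hs h (one_subset_blockErr 1) (mem_cone_of_code hρ.mem_cone
        (e := oneWire w) fun _ => hρ) (R := 1) (by simp) (fun K hK r F hF ψ => ?_) r r').trans (h₁ _)
      rw [one_mulVec, hF, one_mulVec]
      exact ec_fault_paths hs hc hK ψ r
  refine slice_ext (oneWire w) fun r r' => ?_
  exact slice_decode_congr (P := LinearMap.id) (P' := LinearMap.id) (oneWire w)
    (fun _ _ => rfl) (fun r r' => by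
      have : (fun i => s.dec' M ((oneWire w) i)) = fun _ : Fin 1 => s.qdec := by
        funext i
        exact if_neg hw
      rw [this]
      exact key r r') r r'

end EC

section Chunk

variable {S : Finset ℕ} {n : ℕ} {e : Fin n ↪ W} {offs : Fin n → ℕ} {pend : Fin n → Prop}
  {ρ σ : Op (W × s.Q)}

theorem reach_ecChunk_cons {a : Fin n} {as : List (Fin n)}
    (h : Reach S (s.ecChunk e offs pend (a :: as)) ρ σ) :
    ∃ τ, ((pend a ∧ τ = ρ) ∨ (¬pend a ∧ Reach S (s.ecAt (e a) (offs a)) ρ τ)) ∧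
      Reach S (s.ecChunk e offs pend as) τ σ := by
  rw [ecChunk, List.flatMap_cons, reach_append] at h
  obtain ⟨τ, h₁, h₂⟩ := h
  refine ⟨τ, ?_, h₂⟩
  by_cases ha : pend a
  · rw [if_pos ha] at h₁
    exact Or.inl ⟨ha, h₁⟩
  · rw [if_neg ha] at h₁
    exact Or.inr ⟨ha, h₁⟩

theorem trEq_ecChunk {as : List (Fin n)} (h : Reach S (s.ecChunk e offs pend as) ρ σ) :
    TrEq (blocks e) ρ σ := by
  induction as generalizing ρ with
  | nil => obtain rfl : σ = ρ := h; exact TrEq.refl _ _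
  | cons a as ih =>
    obtain ⟨τ, h₁, h₂⟩ := reach_ecChunk_cons h
    refine TrEq.trans ?_ (ih h₂)
    rcases h₁ with ⟨-, rfl⟩ | ⟨-, h₁⟩
    · exact TrEq.refl _ _
    · have := trEq_ecAt h₁
      rw [← blocks_trans] at this
      exact this.of_trans

theorem supp_ecChunk_of_notMem {as : List (Fin n)} (h : Reach S (s.ecChunk e offs pend as) ρ σ)
    {w : W} (hw : ∀ a ∈ as, e a ≠ w) {𝒱 : Submodule ℂ (Vec (Fin 1 × s.Q))} (hρ : Supp w 𝒱 ρ) :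
    Supp w 𝒱 σ := by
  induction as generalizing ρ with
  | nil => obtain rfl : σ = ρ := h; exact hρ
  | cons a as ih =>
    obtain ⟨τ, h₁, h₂⟩ := reach_ecChunk_cons h
    refine ih h₂ (fun b hb => hw b (List.mem_cons_of_mem _ hb)) ?_
    rcases h₁ with ⟨-, rfl⟩ | ⟨-, h₁⟩
    · exact hρ
    · exact hρ.of_trEq (fun _ => hw a List.mem_cons_self) (trEq_ecAt h₁) (h₁.mem_cone hρ.mem_cone)

theorem supp_ecChunk (hs : s.FaultTolerant) {as : List (Fin n)} (has : as.Nodup)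
    (h : Reach S (s.ecChunk e offs pend as) ρ σ) (hρ : ρ ∈ cone Set.univ) {a : Fin n}
    (ha : a ∈ as) (hp : ¬pend a) :
    (cnt S (offs a) s.ec.length = 0 → Supp (e a) s.codeQ σ) ∧
      (cnt S (offs a) s.ec.length ≤ 1 → Supp (e a) s.nearQ σ) := by
  induction as generalizing ρ with
  | nil => simp at ha
  | cons b as ih =>
    obtain ⟨τ, h₁, h₂⟩ := reach_ecChunk_cons h
    obtain ⟨hb, has⟩ := List.nodup_cons.1 has
    rcases List.mem_cons.1 ha with rfl | ha
    · obtain ⟨-, h₁⟩ := h₁.resolve_left fun h => hp h.1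
      have hne : ∀ b ∈ as, e b ≠ e a := fun b hb' hba => hb (e.injective hba ▸ hb')
      exact ⟨fun hc => supp_ecChunk_of_notMem h₂ hne (supp_ecAt_zero hs h₁ hρ hc),
        fun hc => supp_ecChunk_of_notMem h₂ hne (supp_ecAt_one hs h₁ hρ hc)⟩
    · refine ih has h₂ ?_ ha
      rcases h₁ with ⟨-, rfl⟩ | ⟨-, h₁⟩
      · exact hρ
      · exact h₁.mem_cone hρ

theorem decode_ecChunk (hs : s.FaultTolerant) {as : List (Fin n)} (has : as.Nodup)
    (h : Reach S (s.ecChunk e offs pend as) ρ σ) {M : Finset W} (hM : ∀ a, e a ∉ M)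
    (hρ : ∀ a ∈ as, ¬pend a → (cnt S (offs a) s.ec.length = 0 ∧ Supp (e a) s.nearQ ρ) ∨
      (cnt S (offs a) s.ec.length ≤ 1 ∧ Supp (e a) s.codeQ ρ)) :
    decode (s.dec' M) σ = decode (s.dec' M) ρ := by
  induction as generalizing ρ with
  | nil => obtain rfl : σ = ρ := h; rfl
  | cons a as ih =>
    obtain ⟨τ, h₁, h₂⟩ := reach_ecChunk_cons h
    obtain ⟨ha, has⟩ := List.nodup_cons.1 has
    rcases h₁ with ⟨-, rfl⟩ | ⟨hp, h₁⟩
    · exact ih has h₂ fun b hb => hρ b (List.mem_cons_of_mem _ hb)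
    · rw [← decode_ecAt hs h₁ (hM a) (hρ a List.mem_cons_self hp)]
      refine ih has h₂ fun b hb hpb => ?_
      have hne : ∀ i : Fin 1, oneWire (e a) i ≠ e b := fun _ hab => ha (e.injective hab ▸ hb)
      exact (hρ b (List.mem_cons_of_mem _ hb) hpb).imp
        (fun h => ⟨h.1, h.2.of_trEq hne (trEq_ecAt h₁) (h₁.mem_cone h.2.mem_cone)⟩)
        (fun h => ⟨h.1, h.2.of_trEq hne (trEq_ecAt h₁) (h₁.mem_cone h.2.mem_cone)⟩)

end Chunk

end Scheme

/-- The blocks that have been measured after a location. -/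
def Loc.addMeas {𝒢 : GateSet} {W : Type} [DecidableEq W] : Loc 𝒢 W → Finset W → Finset W
  | .prep _, M => M
  | .gate _ _, M => M
  | .meas w, M => insert w M

theorem Loc.mem_addMeas {𝒢 : GateSet} {W : Type} [DecidableEq W] (l : Loc 𝒢 W) (M : Finset W)
    {w : W} (h : ∀ i, l.wires i ≠ w) : w ∈ l.addMeas M ↔ w ∈ M := by
  cases l with
  | prep v => exact Iff.rfl
  | gate g e => exact Iff.rfl
  | meas v =>
    have hv : v ≠ w := h (0 : Fin 1)
    exact Finset.mem_insert.trans (or_iff_right (Ne.symm hv))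

namespace Scheme

variable {𝒢 : GateSet} {s : Scheme 𝒢} {W : Type} [Fintype W] [DecidableEq W] {S : Finset ℕ}
  {ρ σ τ : Op (W × s.Q)} {M : Finset W}

/-! ### Good rectangles -/

/-- The single permitted fault lies before, in, or after the 1-Ga. The numbers `c` and `d` count
faults in the 1-ECs on the input and output blocks; they are left abstract so that a removed 1-EC
can count as zero. The alternatives for each output block are those that `decode_ecAt` needs for its
final 1-EC. -/
theorem ga_gate_correct (hs : s.FaultTolerant) {g : 𝒢.Gate} {e : Fin (𝒢.arity g) ↪ W} {off : ℕ}
    (h : Reach S (relabel (blocks e) ((s.ga g).zipIdx off)) ρ τ) (hρ : ρ ∈ cone Set.univ)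
    (hM : ∀ a, e a ∉ M) {c d : Fin (𝒢.arity g) → ℕ}
    (hcount : ∑ a, c a + cnt S off (s.ga g).length + ∑ a, d a ≤ 1)
    (hsupp : ∀ a, (c a = 0 → Supp (e a) s.codeQ ρ) ∧ (c a ≤ 1 → Supp (e a) s.nearQ ρ)) :
    decode (s.dec' M) τ = (Loc.gate g e).ideal (decode (s.dec' M) ρ) ∧
      ∀ a, (d a = 0 ∧ Supp (e a) s.nearQ τ) ∨ (d a ≤ 1 ∧ Supp (e a) s.codeQ τ) := by
  have hdec : (∀ r r', decode (fun _ : Fin (𝒢.arity g) => s.qdec) (slice (blocks e) r r' τ) =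
      kmap [(𝒢.U g : Op (Fin (𝒢.arity g)))]
        (decode (fun _ : Fin (𝒢.arity g) => s.qdec) (slice (blocks e) r r' ρ))) →
      decode (s.dec' M) τ = (Loc.gate g e).ideal (decode (s.dec' M) ρ) := by
    intro hh
    refine decode_eq_ideal (fun _ _ => Iff.rfl) fun r r' => ?_
    have : (fun i => s.dec' M ((Loc.gate g e : Loc 𝒢 W).wires i)) =
        fun _ : Fin (𝒢.arity g) => s.qdec := funext fun i => if_neg (hM i)
    rw [this]
    exact hh r r'
  have hU : ((𝒢.U g : Op (Fin (𝒢.arity g))))ᴴ * (𝒢.U g : Op (Fin (𝒢.arity g))) = 1 := by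
    have h := mem_unitaryGroup_iff'.1 (𝒢.U g).2
    rwa [star_eq_conjTranspose] at h
  have hd : ∀ a, d a ≤ ∑ a, d a := fun a => Finset.single_le_sum (fun _ _ => Nat.zero_le _)
    (Finset.mem_univ a)
  by_cases hc : ∀ a, c a = 0
  · have hcode := mem_cone_of_code (e := e) hρ fun a => (hsupp a).1 (hc a)
    refine ⟨hdec (decode_slice_of_paths hs h (one_subset_blockErr _) hcode hU
      fun K hK r F hF ψ => ?_), fun a => ?_⟩
    · rw [hF, one_mulVec]
      exact ga_fault_paths hs (by omega) hK ψ r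
    -- A faultless 1-Ga maps the code space into itself exactly, which leaves the fault to the 1-ECs
    -- that follow; a fault in the 1-Ga makes these faultless.
    · by_cases h0 : cnt S off (s.ga g).length = 0
      · refine Or.inr ⟨(hd a).trans (by omega), Reach.supp h hcode fun K hK r F hF ψ => ?_⟩
        rw [hF, one_mulVec]
        exact lift_mono _ (span_le_code _ _ a) (ga_implements_paths hs h0 hK ψ r)
      · refine Or.inl ⟨Nat.le_zero.1 ((hd a).trans (by omega)),
          Reach.supp h hcode fun K hK r F hF ψ => ?_⟩
        rw [hF, one_mulVec]
        exact lift_mono _ (errSpan_le _ _ a) (ga_fault_paths hs (by omega) hK ψ r)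
  -- The fault is in the 1-EC on block `a₀`. All other inputs are in the code space, and both the
  -- 1-Ga and the 1-ECs after it are faultless.
  · push Not at hc
    obtain ⟨a₀, ha₀⟩ := hc
    have hsum := Finset.add_sum_erase Finset.univ c (Finset.mem_univ a₀)
    have hother : ∀ a, a ≠ a₀ → c a = 0 := fun a ha => by
      have := Finset.single_le_sum (f := c) (fun _ _ => Nat.zero_le _)
        (Finset.mem_erase.2 ⟨ha, Finset.mem_univ a⟩)
      omega
    have h0 : cnt S off (s.ga g).length = 0 := by omega
    have hnear : ρ ∈ cone (lift (blocks e) (lift (s.data _)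
        (encSpan (s.singleError (𝒢.arity g) : Set (Op (s.Block (𝒢.arity g)))))) : Set (Vec (W × s.Q))) := by
      classical
      refine mem_cone_encSpan hρ (𝒱 := fun a => if a = a₀ then s.nearCode else s.codeSpace)
        (fun a => ?_) fun v hv => ?_
      · by_cases ha : a = a₀
        · rw [if_pos ha]; exact (hsupp a).2 (by rw [ha]; omega)
        · rw [if_neg ha]; exact (hsupp a).1 (hother a ha)
      · refine mem_singleSpan a₀ (fun a ha => ?_) ?_
        · have := hv a
          rwa [if_neg ha] at this
        · have := hv a₀
          rwa [if_pos rfl] at this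
    refine ⟨hdec (decode_slice_of_paths hs h (s.singleError_le _) hnear hU
      fun K hK r F hF ψ => ga_error_paths hs h0 hK hF ψ r), fun a => Or.inl ⟨?_, ?_⟩⟩
    · exact Nat.le_zero.1 ((hd a).trans (by omega))
    · exact Reach.supp h hnear fun K hK r F hF ψ =>
        lift_mono _ (errSpan_le _ _ a) (ga_error_paths hs h0 hK hF ψ r)

theorem ga_prep_correct (hs : s.FaultTolerant) {w : W} {off : ℕ}
    (h : Reach S (relabel (blocks (oneWire w)) (s.prepGa.zipIdx off)) ρ τ)
    (hρ : ρ ∈ cone Set.univ) (hM : w ∉ M) {d : ℕ} (hcount : cnt S off s.prepGa.length + d ≤ 1) :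
    decode (s.dec' M) τ = (Loc.prep w : Loc 𝒢 W).ideal (decode (s.dec' M) ρ) ∧
      ((d = 0 ∧ Supp w s.nearQ τ) ∨ (d ≤ 1 ∧ Supp w s.codeQ τ)) := by
  constructor
  · refine decode_eq_ideal (fun _ _ => Iff.rfl) fun r r' => ?_
    have : (fun i => s.dec' M ((Loc.prep w : Loc 𝒢 W).wires i)) =
        fun _ : Fin 1 => s.qdec := funext fun i => if_neg hM
    rw [this]
    exact decode_slice_prep hs (by omega) hρ h r r'
  · by_cases h0 : cnt S off s.prepGa.length = 0
    · refine Or.inr ⟨by omega, h.mem_cone_lift (mem_cone_lift_top _ hρ) fun K hK v _ => ?_⟩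
      refine lift_mono _ (fun x hx => ?_) (prep_implements_paths hs h0 hK v)
      obtain ⟨c, rfl⟩ := Submodule.mem_span_singleton.1 hx
      exact s.codeSpace.smul_mem c (Submodule.subset_span ⟨_, s.encN_eq 1 _⟩)
    · refine Or.inl ⟨by omega, h.mem_cone_lift (mem_cone_lift_top _ hρ) fun K hK v _ => ?_⟩
      refine lift_mono _ (fun x hx => ?_) (prep_fault_paths hs (by omega) hK v)
      have hx' := errSpan_le 1 _ 0 hx fun _ => false
      -- With one block there are no qubits outside it, so the slice is the vector itself.
      have : vslice (blocks (oneWire 0)) x (fun _ => false) = x := funext fun y =>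
        congrArg x (funext fun p => by
          conv_lhs => rw [show p = blocks (oneWire 0) p from Prod.ext (Subsingleton.elim _ _) rfl]
          exact overwrite_apply _ _ _ _)
      rwa [this] at hx'

theorem ga_meas_correct (hs : s.FaultTolerant) {w : W} {off : ℕ}
    (h : Reach S (relabel (blocks (oneWire w)) (s.measGa.zipIdx off)) ρ τ)
    (hM : w ∉ M) {c : ℕ} (hcount : c + cnt S off s.measGa.length ≤ 1)
    (hsupp : (c = 0 → Supp w s.codeQ ρ) ∧ (c ≤ 1 → Supp w s.nearQ ρ)) :
    decode (s.dec' (insert w M)) τ = (Loc.meas w : Loc 𝒢 W).ideal (decode (s.dec' M) ρ) := by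
  refine decode_eq_ideal (fun v hv => Loc.mem_addMeas (Loc.meas w : Loc 𝒢 W) M hv) fun r r' => ?_
  have h₁ : (fun i : Fin 1 => s.dec' M (oneWire w i)) =
      fun _ : Fin 1 => s.qdec := funext fun i => if_neg hM
  have h₂ : (fun i : Fin 1 => s.dec' (insert w M) (oneWire w i)) =
      fun _ : Fin 1 => s.cdec := funext fun i => if_pos (Finset.mem_insert_self _ _)
  suffices key : decode (fun _ : Fin 1 => s.cdec) (slice (blocks (oneWire w)) r r' τ) =
      kmap measKr (decode (fun _ : Fin 1 => s.qdec) (slice (blocks (oneWire w)) r r' ρ)) by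
    rw [← h₁, ← h₂] at key
    exact key
  by_cases hc : c = 0
  · exact decode_slice_meas hs (one_subset_blockErr 1)
      (mem_cone_of_code (e := oneWire w) (hsupp.1 hc).mem_cone fun _ => hsupp.1 hc) h
      (fun K hK r F hF y a hya => by
        rw [hF, Matrix.one_mul]; exact meas_fault_paths hs (by omega) hK r y a hya) r r'
  · exact decode_slice_meas hs (s.singleError_le 1)
      (mem_cone_of_near (e := oneWire w) (hsupp.2 (by omega))) h
      (fun K hK r F hF y a hya => meas_error_paths hs (by omega) hK hF r y a hya) r r'

/-! ### Simulation of a location -/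

theorem trEq_custChunk {p : Loc 𝒢 W} {t : Tag W} (h : Reach S (s.custChunk p t) ρ σ) :
    TrEq (blocks p.wires) ρ σ := by
  rw [custChunk, List.append_assoc, reach_append] at h
  obtain ⟨τ₁, h₁, h⟩ := h
  rw [reach_append] at h
  obtain ⟨τ₂, h₂, h₃⟩ := h
  have h₁' : TrEq (blocks p.wires) ρ τ₁ := by
    rw [leadChunk] at h₁
    split_ifs at h₁
    · exact trEq_ecChunk h₁
    · obtain rfl : τ₁ = ρ := h₁
      exact TrEq.refl _ _
  have h₃' : TrEq (blocks p.wires) τ₂ σ := by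
    rw [trailChunk] at h₃
    split_ifs at h₃
    · obtain rfl : σ = τ₂ := h₃
      exact TrEq.refl _ _
    · exact trEq_ecChunk h₃
  exact (h₁'.trans h₂.trEq).trans h₃'

/-- This is the level reduction for a single location. For a good rectangle, 1-Ga and decoder may be
interchanged, and the 1-ECs that follow are invisible to the decoder. A pending 1-EC is simply
absent, and the decoder takes its place. -/
theorem step_of_custChunk (hs : s.FaultTolerant) {p : Loc 𝒢 W} {t : Tag W}
    (h : Reach S (s.custChunk p t) ρ σ) (hρ : ρ ∈ cone Set.univ) (hM : ∀ a, p.wires a ∉ M)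
    (hgood : ¬t.bad → s.faultCount S p t ≤ 1)
    (hsupp : ¬t.bad → ¬p.IsPrep → ∀ a,
      (cnt S (t.lead (p.wires a)) s.ec.length = 0 → Supp (p.wires a) s.codeQ ρ) ∧
      (cnt S (t.lead (p.wires a)) s.ec.length ≤ 1 → Supp (p.wires a) s.nearQ ρ)) :
    Step t.bad p (decode (s.dec' M) ρ) (decode (s.dec' (p.addMeas M)) σ) := by
  by_cases hb : t.bad
  -- A bad chunk, its leading 1-ECs included, acts only on the blocks of its location, and nothing
  -- else is required of a fault.
  · exact Or.inl ⟨hb, decode_mem_cone _ (h.mem_cone hρ), TrEq.decode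
      (fun w hw => by simp only [dec', p.mem_addMeas M hw]) (complete_dec' hs _)
      (complete_dec' hs _) (trEq_custChunk h)⟩
  refine Or.inr ⟨hb, ?_⟩
  have hgood := hgood hb
  have hsupp := hsupp hb
  rw [custChunk, leadChunk, if_neg fun h => hb h.1, List.nil_append, reach_append] at h
  obtain ⟨τ, h₁, h₂⟩ := h
  cases p with
  | prep w =>
    rw [faultCount, if_pos (show (Loc.prep w : Loc 𝒢 W).IsPrep from trivial),
      if_neg (show ¬(Loc.prep w : Loc 𝒢 W).IsMeas from id), zero_add] at hgood
    rw [trailChunk, if_neg (show ¬(Loc.prep w : Loc 𝒢 W).IsMeas from id)] at h₂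
    have hd : ∀ a : Fin 1, a = 0 := fun a => Subsingleton.elim _ _
    classical
    obtain ⟨h₃, h₄⟩ := ga_prep_correct hs h₁ hρ (hM (0 : Fin 1)) (d := if t.pend w then 0 else
      cnt S (s.ecOff (Loc.prep w : Loc 𝒢 W) t.off (0 : Fin 1)) s.ec.length)
      (le_trans (Nat.add_le_add_left (le_of_eq (by
        refine Eq.trans ?_ (Fintype.sum_unique (ι := Fin 1) _).symm
        congr)) _) hgood)
    refine Eq.trans (decode_ecChunk hs (List.nodup_finRange _) h₂ hM fun (a : Fin 1) _ hp => ?_) h₃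
    obtain rfl := hd a
    rw [if_neg (show ¬t.pend w from hp)] at h₄
    exact h₄
  | gate g e =>
    rw [faultCount, if_neg (show ¬(Loc.gate g e : Loc 𝒢 W).IsPrep from id),
      if_neg (show ¬(Loc.gate g e : Loc 𝒢 W).IsMeas from id)] at hgood
    rw [trailChunk, if_neg (show ¬(Loc.gate g e : Loc 𝒢 W).IsMeas from id)] at h₂
    obtain ⟨h₃, h₄⟩ := ga_gate_correct hs h₁ hρ hM hgood (hsupp id)
    refine (decode_ecChunk hs (List.nodup_finRange _) h₂ hM fun a _ hp => ?_).trans h₃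
    have := h₄ a
    rwa [if_neg hp] at this
  | meas w =>
    rw [faultCount, if_neg (show ¬(Loc.meas w : Loc 𝒢 W).IsPrep from id),
      if_pos (show (Loc.meas w : Loc 𝒢 W).IsMeas from trivial), add_zero] at hgood
    rw [trailChunk, if_pos (show (Loc.meas w : Loc 𝒢 W).IsMeas from trivial)] at h₂
    obtain rfl : σ = τ := h₂
    refine ga_meas_correct hs h₁ (hM (0 : Fin 1)) (c := cnt S (t.lead w) s.ec.length)
      (le_trans (Nat.add_le_add_right (le_of_eq ?_) _) hgood) (hsupp id (0 : Fin 1))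
    exact (Fintype.sum_unique (ι := Fin 1) fun _ => cnt S (t.lead w) s.ec.length).symm

/-- The 1-ECs at the end of a rectangle repair the blocks. -/
theorem supp_custChunk (hs : s.FaultTolerant) {p : Loc 𝒢 W} {t : Tag W}
    (h : Reach S (s.custChunk p t) ρ σ) (hρ : ρ ∈ cone Set.univ) (hp : ¬p.IsMeas)
    (a : Fin p.arity) (ha : ¬t.pend (p.wires a)) :
    (cnt S (s.ecOff p t.off a) s.ec.length = 0 → Supp (p.wires a) s.codeQ σ) ∧
      (cnt S (s.ecOff p t.off a) s.ec.length ≤ 1 → Supp (p.wires a) s.nearQ σ) := by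
  rw [custChunk, reach_append] at h
  obtain ⟨τ, h₁, h₂⟩ := h
  rw [trailChunk, if_neg hp] at h₂
  exact supp_ecChunk hs (List.nodup_finRange _) h₂ (h₁.mem_cone hρ) (List.mem_finRange a) ha

end Scheme

/-! ### The history of a single wire -/

section WireList

variable {𝒢 : GateSet} {W : Type} [DecidableEq W]

/-- The location acts on the wire `w`. -/
abbrev Loc.Touches (w : W) (l : Loc 𝒢 W) : Prop := ∃ i, l.wires i = w

/-- What happens to the wire `w`. -/
def wireList (w : W) (O : List (Loc 𝒢 W × ℕ)) : List (Loc 𝒢 W × ℕ) :=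
  O.filter fun x => x.1.Touches w

theorem wireList_cons_of_touches {w : W} {x : Loc 𝒢 W × ℕ} (h : x.1.Touches w)
    (O : List (Loc 𝒢 W × ℕ)) : wireList w (x :: O) = x :: wireList w O :=
  List.filter_cons_of_pos (by simpa using h)

theorem wireList_cons_of_not_touches {w : W} {x : Loc 𝒢 W × ℕ} (h : ¬x.1.Touches w)
    (O : List (Loc 𝒢 W × ℕ)) : wireList w (x :: O) = wireList w O :=
  List.filter_cons_of_neg (by simpa using h)

theorem mem_wireList {w : W} {x : Loc 𝒢 W × ℕ} {O : List (Loc 𝒢 W × ℕ)} :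
    x ∈ wireList w O ↔ x ∈ O ∧ x.1.Touches w := by
  simp [wireList]

theorem wireList_append (w : W) (O O' : List (Loc 𝒢 W × ℕ)) :
    wireList w (O ++ O') = wireList w O ++ wireList w O' := List.filter_append ..

/-- The blocks that have been measured after the locations in a list. -/
def addMeasList (M : Finset W) (O : List (Loc 𝒢 W × ℕ)) : Finset W :=
  O.foldl (fun M x => x.1.addMeas M) M

end WireList

/-! ### Decoding one level of a whole circuit -/

namespace Scheme

variable {𝒢 : GateSet} {s : Scheme 𝒢} {W : Type} [DecidableEq W]

/-- The compatibility of the tags of a location and of the next location on the wire `w`. -/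
def Edge (s : Scheme 𝒢) (tg : ℕ → Tag W) (w : W) (p : Loc 𝒢 W × ℕ) :
    Option (Loc 𝒢 W × ℕ) → Prop
  | none => ¬(tg p.2).pend w
  | some q => ¬p.1.IsMeas ∧ ((tg p.2).pend w ↔ ¬q.1.IsPrep ∧ (tg q.2).bad) ∧
      (¬q.1.IsPrep → ∀ a, p.1.wires a = w → (tg q.2).lead w = s.ecOff p.1 (tg p.2).off a)

/-- The compatibility of the tags along the wire `w`. -/
def Cons (s : Scheme 𝒢) (tg : ℕ → Tag W) (w : W) : List (Loc 𝒢 W × ℕ) → Prop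
  | [] => True
  | p :: R => s.Edge tg w p R.head? ∧ Cons s tg w R

variable [Fintype W]

/-- The block `w` is as good as the 1-EC that has been applied to it. -/
def Ready (S : Finset ℕ) (tg : ℕ → Tag W) (w : W) (ρ : Op (W × s.Q)) (q : Option (Loc 𝒢 W × ℕ)) :
    Prop :=
  ∀ x ∈ q, ¬x.1.IsPrep → ¬(tg x.2).bad →
    (cnt S ((tg x.2).lead w) s.ec.length = 0 → Supp w s.codeQ ρ) ∧
      (cnt S ((tg x.2).lead w) s.ec.length ≤ 1 → Supp w s.nearQ ρ)

/-- The encoded circuit, with the locations of bad extended rectangles in `S'`, simulates the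
circuit with faults at `S'`. -/
theorem reach_decode (hs : s.FaultTolerant) {S S' : Finset ℕ} {tg : ℕ → Tag W}
    {O : List (Loc 𝒢 W × ℕ)} {M : Finset W} {ρ σ : Op (W × s.Q)}
    (hcons : ∀ w, s.Cons tg w (wireList w O))
    (hgood : ∀ x ∈ O, ¬(tg x.2).bad → s.faultCount S x.1 (tg x.2) ≤ 1)
    (hS' : ∀ x ∈ O, x.2 ∈ S' ↔ (tg x.2).bad) (hM : ∀ x ∈ O, ∀ a, x.1.wires a ∉ M)
    (hρ : ρ ∈ cone Set.univ) (hready : ∀ w, Ready S tg w ρ (wireList w O).head?)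
    (h : Reach S (O.flatMap fun x => s.custChunk x.1 (tg x.2)) ρ σ) :
    Reach S' O (decode (s.dec' M) ρ) (decode (s.dec' (addMeasList M O)) σ) := by
  induction O generalizing M ρ with
  | nil => obtain rfl : σ = ρ := h; exact rfl
  | cons p R ih =>
    rw [List.flatMap_cons, reach_append] at h
    obtain ⟨τ, h₁, h₂⟩ := h
    have hedge : ∀ a, s.Edge tg (p.1.wires a) p (wireList (p.1.wires a) R).head? := fun a => by
      have := hcons (p.1.wires a)
      rw [wireList_cons_of_touches ⟨a, rfl⟩] at this
      exact this.1
    have hτ := h₁.mem_cone hρ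
    refine ⟨decode (s.dec' (p.1.addMeas M)) τ, ?_, ih (fun w => ?_)
      (fun x hx => hgood x (List.mem_cons_of_mem _ hx))
      (fun x hx => hS' x (List.mem_cons_of_mem _ hx)) (fun x hx a => ?_) hτ
      (fun w => ?_) h₂⟩
    · have := step_of_custChunk hs h₁ hρ (hM p List.mem_cons_self) (hgood p List.mem_cons_self)
        fun hb hp a => by
          have := hready (p.1.wires a)
          rw [wireList_cons_of_touches ⟨a, rfl⟩] at this
          exact this p rfl hp hb
      rwa [← hS' p List.mem_cons_self] at this
    · have := hcons w
      by_cases hw : p.1.Touches w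
      · rw [wireList_cons_of_touches hw] at this
        exact this.2
      · rwa [wireList_cons_of_not_touches hw] at this
    -- A wire that is still to be used has not just been measured, because an edge never starts at a
    -- measurement.
    · intro hxM
      by_cases hw : p.1.Touches (x.1.wires a)
      · obtain ⟨b, hb⟩ := hw
        have hne : wireList (p.1.wires b) R ≠ [] :=
          List.ne_nil_of_mem (mem_wireList.2 ⟨hx, a, hb.symm⟩)
        have hE := hedge b
        rw [List.head?_eq_some_head hne] at hE
        have hmeas : p.1.addMeas M = M := by
          have := hE.1
          cases hp : p.1 with
          | prep => rfl
          | gate => rfl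
          | meas => rw [hp] at this; exact (this trivial).elim
        rw [hmeas] at hxM
        exact hM x (List.mem_cons_of_mem _ hx) a hxM
      · rw [p.1.mem_addMeas M fun i hi => hw ⟨i, hi⟩] at hxM
        exact hM x (List.mem_cons_of_mem _ hx) a hxM
    · intro x hx hxp hxb
      by_cases hw : p.1.Touches w
      · obtain ⟨a, rfl⟩ := hw
        have hE := hedge a
        rw [Option.mem_def.1 hx] at hE
        rw [hE.2.2 hxp a rfl]
        -- The next location on the wire is good, so the 1-EC between the two is not pending: it
        -- stands at the end of this chunk and has repaired the block.
        exact supp_custChunk hs h₁ hρ hE.1 a fun hp => hxb (hE.2.1.1 hp).2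
      · have := hready w
        rw [wireList_cons_of_not_touches hw] at this
        have := this x hx hxp hxb
        have hT := trEq_custChunk h₁
        exact ⟨fun hc => (this.1 hc).of_trEq (fun i hi => hw ⟨i, hi⟩) hT hτ,
          fun hc => (this.2 hc).of_trEq (fun i hi => hw ⟨i, hi⟩) hT hτ⟩

end Scheme

/-! ### Reordering -/

section Reorder

variable {𝒢 : GateSet} {W : Type} [Fintype W] [DecidableEq W]

/-- The execution of a labelled list of locations. -/
noncomputable def runLabelled (F : ℕ → Option ErrorChoice) (O : List (Loc 𝒢 W × ℕ)) (ρ : Op W) :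
    Op W := O.foldl (fun ρ x => x.1.exec (F x.2) ρ) ρ

theorem runLabelled_zipIdx (L : List (Loc 𝒢 W)) (F : ℕ → Option ErrorChoice) (n : ℕ) (ρ : Op W) :
    runLabelled F (L.zipIdx n) ρ = run L (fun i => F (n + i)) ρ := by
  induction L generalizing n ρ with
  | nil => rfl
  | cons l L ih =>
    rw [run_cons, List.zipIdx_cons]
    refine (ih (n + 1) _).trans ?_
    simp only [add_assoc, add_comm 1]
    rfl

theorem reach_runLabelled {F : ℕ → Option ErrorChoice} {S : Finset ℕ}
    (hS : ∀ i, i ∈ S ↔ (F i).isSome) {O : List (Loc 𝒢 W × ℕ)} {ρ : Op W} (hρ : ρ ∈ cone Set.univ) :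
    Reach S O ρ (runLabelled F O ρ) := by
  induction O generalizing ρ with
  | nil => exact rfl
  | cons x O ih =>
    have h := x.1.step_exec (F x.2) hρ (hS x.2)
    exact ⟨_, h, ih (h.mem_cone hρ)⟩

theorem eq_runLabelled_of_reach {O : List (Loc 𝒢 W × ℕ)} {ρ σ : Op W} (h : Reach ∅ O ρ σ) :
    σ = runLabelled noFault O ρ := by
  induction O generalizing ρ with
  | nil => exact h
  | cons x O ih =>
    obtain ⟨τ, h₁, h₂⟩ := h
    have h₁ := (h₁.resolve_left fun h => by simp at h).2
    rw [ih h₂, h₁]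
    rfl

theorem kmap_comm {X : Type} [Fintype X] [DecidableEq X] {L M : List (Matrix X X ℂ)}
    (h : ∀ A ∈ L, ∀ B ∈ M, A * B = B * A) (ρ : Matrix X X ℂ) :
    kmap L (kmap M ρ) = kmap M (kmap L ρ) := by
  have h₁ : ∀ A ∈ L, A * kmap M ρ * Aᴴ = kmap M (A * ρ * Aᴴ) := by
    intro A hA
    induction M with
    | nil => simp
    | cons B M ih =>
      have hAB := h A hA B List.mem_cons_self
      rw [kmap_cons, kmap_cons, Matrix.mul_add, Matrix.add_mul,
        ih fun A hA B hB => h A hA B (List.mem_cons_of_mem _ hB)]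
      congr 1
      have hAB' := congrArg conjTranspose hAB
      rw [conjTranspose_mul, conjTranspose_mul] at hAB'
      simp only [← Matrix.mul_assoc, hAB]
      simp only [Matrix.mul_assoc, hAB']
  clear h
  induction L with
  | nil => simp
  | cons A L ih =>
    rw [kmap_cons, kmap_cons, map_add, h₁ A List.mem_cons_self,
      ih fun A hA => h₁ A (List.mem_cons_of_mem _ hA)]

theorem Loc.exec_comm {l l' : Loc 𝒢 W} (h : ∀ i j, l.wires i ≠ l'.wires j)
    (o o' : Option ErrorChoice) (ρ : Op W) : l.exec o (l'.exec o' ρ) = l'.exec o' (l.exec o ρ) := by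
  simp only [Loc.exec_eq]
  refine kmap_comm (fun A hA B hB => ?_) ρ
  obtain ⟨A, -, rfl⟩ := List.mem_map.1 hA
  obtain ⟨B, -, rfl⟩ := List.mem_map.1 hB
  exact emb_comm _ _ h A B

theorem TrEq.eq_of_isEmpty {n : ℕ} (hn : n = 0) {e : Fin n ↪ W} {ρ σ : Op W} (h : TrEq e ρ σ) :
    ρ = σ := by
  subst hn
  refine slice_ext e fun r r' => ?_
  ext x y
  have := h r r'
  rw [trace, trace, Fintype.sum_unique, Fintype.sum_unique, diag_apply, diag_apply] at this
  convert this

/-- A trace preserving operation on no qubits is the identity on density operators. Gates of arity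
zero lie on no wire, so `Same` does not see them and they have to be treated apart. -/
theorem Loc.exec_of_arity {l : Loc 𝒢 W} (h : l.arity = 0) (o : Option ErrorChoice) (ρ : Op W) :
    l.exec o ρ = ρ := by
  refine (TrEq.eq_of_isEmpty h (e := l.wires) fun r r' => ?_).symm
  rw [Loc.exec_eq, slice_kmap_emb, trace_kmap (l.complete_execKr _)]

/-- Omission of the locations that act on no wire. -/
def trim (O : List (Loc 𝒢 W × ℕ)) : List (Loc 𝒢 W × ℕ) := O.filter fun x => x.1.arity ≠ 0

theorem trim_cons_of_eq {x : Loc 𝒢 W × ℕ} (h : x.1.arity = 0) (O : List (Loc 𝒢 W × ℕ)) :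
    trim (x :: O) = trim O := List.filter_cons_of_neg (by simpa using h)

theorem trim_cons_of_ne {x : Loc 𝒢 W × ℕ} (h : x.1.arity ≠ 0) (O : List (Loc 𝒢 W × ℕ)) :
    trim (x :: O) = x :: trim O := List.filter_cons_of_pos (by simpa using h)

theorem wireList_trim (w : W) (O : List (Loc 𝒢 W × ℕ)) : wireList w (trim O) = wireList w O := by
  rw [wireList, wireList, trim, List.filter_filter]
  refine List.filter_congr fun x _ => ?_
  by_cases h : x.1.arity = 0
  · have : ¬x.1.Touches w := fun ⟨i, _⟩ => by rw [h] at i; exact i.elim0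
    simp [h, this]
  · simp [h]

theorem runLabelled_trim (F : ℕ → Option ErrorChoice) (O : List (Loc 𝒢 W × ℕ)) (ρ : Op W) :
    runLabelled F (trim O) ρ = runLabelled F O ρ := by
  induction O generalizing ρ with
  | nil => rfl
  | cons x O ih =>
    by_cases h : x.1.arity = 0
    · rw [trim_cons_of_eq h, ih]
      exact congrArg (runLabelled F O) (Loc.exec_of_arity h _ ρ).symm
    · rw [trim_cons_of_ne h]
      exact ih _

theorem Reach.of_trim {S : Finset ℕ} {O : List (Loc 𝒢 W × ℕ)} {ρ σ : Op W}
    (h : Reach S (trim O) ρ σ) (hρ : ρ ∈ cone Set.univ) : Reach S O ρ σ := by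
  induction O generalizing ρ with
  | nil => exact h
  | cons x O ih =>
    by_cases hx : x.1.arity = 0
    · rw [trim_cons_of_eq hx] at h
      refine ⟨ρ, ?_, ih h hρ⟩
      by_cases hb : x.2 ∈ S
      · exact Or.inl ⟨hb, hρ, TrEq.refl _ _⟩
      · exact Or.inr ⟨hb, (Loc.exec_of_arity hx none ρ).symm⟩
    · rw [trim_cons_of_ne hx] at h
      obtain ⟨τ, h₁, h₂⟩ := h
      exact ⟨τ, h₁, ih h₂ (h₁.mem_cone hρ)⟩

/-- In both lists the same happens to every wire. -/
def Same (O O' : List (Loc 𝒢 W × ℕ)) : Prop := ∀ w, wireList w O = wireList w O'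

theorem runLabelled_append (F : ℕ → Option ErrorChoice) (O O' : List (Loc 𝒢 W × ℕ)) (ρ : Op W) :
    runLabelled F (O ++ O') ρ = runLabelled F O' (runLabelled F O ρ) := List.foldl_append ..

theorem runLabelled_comm {F : ℕ → Option ErrorChoice} {A : List (Loc 𝒢 W × ℕ)}
    {p : Loc 𝒢 W × ℕ} (h : ∀ x ∈ A, ∀ i j, x.1.wires i ≠ p.1.wires j) (ρ : Op W) :
    p.1.exec (F p.2) (runLabelled F A ρ) = runLabelled F A (p.1.exec (F p.2) ρ) := by
  induction A generalizing ρ with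
  | nil => rfl
  | cons x A ih =>
    refine (ih (fun y hy => h y (List.mem_cons_of_mem _ hy)) _).trans ?_
    rw [Loc.exec_comm fun i j hij => h x List.mem_cons_self j i hij.symm]
    rfl

/-- The first location of `O` is the first one of `O'` on each of its wires. Everything that
precedes it in `O'` acts on other wires and commutes with it, so it can be moved to the front and
cancelled. -/
theorem Same.runLabelled_eq_of_arity {F : ℕ → Option ErrorChoice} {O O' : List (Loc 𝒢 W × ℕ)}
    (h : Same O O') (hO : ∀ x ∈ O, x.1.arity ≠ 0) (hO' : ∀ x ∈ O', x.1.arity ≠ 0) (ρ : Op W) :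
    runLabelled F O ρ = runLabelled F O' ρ := by
  induction O generalizing O' ρ with
  | nil =>
    rcases O' with _ | ⟨x, O'⟩
    · rfl
    · have := h (x.1.wires ⟨0, Nat.pos_of_ne_zero (hO' x List.mem_cons_self)⟩)
      rw [wireList_cons_of_touches ⟨_, rfl⟩] at this
      cases this
  | cons p R ih =>
    have hp : ∀ a, wireList (p.1.wires a) O' = p :: wireList (p.1.wires a) R := fun a => by
      rw [← h, wireList_cons_of_touches ⟨a, rfl⟩]
    -- Positive arity is used here: a location without wires would leave no trace in the wire
    -- histories.
    have hmem : p ∈ O' := (mem_wireList.1 (by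
      rw [hp ⟨0, Nat.pos_of_ne_zero (hO p List.mem_cons_self)⟩]; exact List.mem_cons_self)).1
    obtain ⟨A, B, rfl, hA⟩ := List.eq_append_cons_of_mem hmem
    have hdisj : ∀ a, wireList (p.1.wires a) A = [] := fun a => by
      have := hp a
      rw [wireList_append] at this
      by_contra hne
      obtain ⟨y, ys, hy⟩ := List.exists_cons_of_ne_nil hne
      rw [hy, List.cons_append, List.cons.injEq] at this
      exact hA (mem_wireList.1 (by rw [hy, this.1]; exact List.mem_cons_self)).1
    have hdisj' : ∀ x ∈ A, ∀ i j, x.1.wires i ≠ p.1.wires j := fun x hx i j hij => by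
      have := mem_wireList.2 ⟨hx, i, hij⟩
      rw [hdisj] at this
      cases this
    have hsame : Same R (A ++ B) := fun w => by
      have := h w
      rw [wireList_append] at this ⊢
      by_cases hw : p.1.Touches w
      · obtain ⟨a, rfl⟩ := hw
        rw [wireList_cons_of_touches ⟨a, rfl⟩, wireList_cons_of_touches ⟨a, rfl⟩, hdisj] at this
        rw [hdisj]
        exact (List.cons.inj this).2
      · rwa [wireList_cons_of_not_touches hw, wireList_cons_of_not_touches hw] at this
    rw [runLabelled_append]
    change runLabelled F R (p.1.exec (F p.2) ρ) =
      runLabelled F B (p.1.exec (F p.2) (runLabelled F A ρ))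
    rw [runLabelled_comm hdisj', ← runLabelled_append]
    refine ih hsame (fun x hx => hO x (List.mem_cons_of_mem _ hx)) (fun x hx => hO' x ?_) _
    rcases List.mem_append.1 hx with hx | hx
    · exact List.mem_append_left _ hx
    · exact List.mem_append_right _ (List.mem_cons_of_mem _ hx)

theorem Same.runLabelled_eq {O O' : List (Loc 𝒢 W × ℕ)} (h : Same O O')
    (F : ℕ → Option ErrorChoice) (ρ : Op W) : runLabelled F O ρ = runLabelled F O' ρ := by
  rw [← runLabelled_trim, ← runLabelled_trim F O']
  refine Same.runLabelled_eq_of_arity (fun w => ?_) (fun x hx => ?_) (fun x hx => ?_) ρ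
  · rw [wireList_trim, wireList_trim, h]
  · simpa using (List.mem_filter.1 hx).2
  · simpa using (List.mem_filter.1 hx).2

end Reorder

/-! ### The encoded circuit is well-formed -/

section WF

variable {𝒢 : GateSet} {V W : Type}

theorem WellFormed.mono {A B : Set W} (h : A ⊆ B) {ls : List (Loc 𝒢 W)} (hls : WellFormed A ls) :
    WellFormed B ls := by
  induction ls generalizing A B with
  | nil => trivial
  | cons l ls ih =>
    cases l with
    | prep w => exact ih (Set.insert_subset_insert h) hls
    | gate g e => exact ⟨fun i => h (hls.1 i), ih h hls.2⟩
    | meas w => exact ⟨h hls.1, hls.2.1, ih h hls.2.2⟩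

theorem WellFormed.append [DecidableEq W] {A : Set W} {ls ls' : List (Loc 𝒢 W)}
    (h : WellFormed A ls)
    (h' : WellFormed (liveAfter A ls) ls')
    (hm : ∀ w ∈ measured ls, ∀ l ∈ ls', ∀ i, l.wires i ≠ w) : WellFormed A (ls ++ ls') := by
  induction ls generalizing A with
  | nil =>
    have : liveAfter A ([] : List (Loc 𝒢 W)) = A := by ext; simp [liveAfter]
    rwa [this] at h'
  | cons l ls ih =>
    rw [liveAfter_cons] at h'
    cases l with
    | prep w =>
      have : liveAfter A [(Loc.prep w : Loc 𝒢 W)] = insert w A := by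
        ext v; simp [liveAfter, or_comm]
      exact ih h (this ▸ h') hm
    | gate g e =>
      have : liveAfter A [(Loc.gate g e : Loc 𝒢 W)] = A := by ext v; simp [liveAfter]
      exact ⟨h.1, ih h.2 (this ▸ h') hm⟩
    | meas w =>
      have : liveAfter A [(Loc.meas w : Loc 𝒢 W)] = A := by ext v; simp [liveAfter]
      refine ⟨h.1, fun l hl => ?_, ih h.2.2 (this ▸ h')
        fun v hv => hm v (Finset.mem_insert_of_mem hv)⟩
      rcases List.mem_append.1 hl with hl | hl
      · exact h.2.1 l hl
      · exact hm w (Finset.mem_insert_self _ _) l hl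

theorem Loc.wires_map {f : V ↪ W} (l : Loc 𝒢 V) :
    ∀ i, ∃ j, (l.map f).wires i = f (l.wires j) := by
  cases l with
  | prep w => exact fun _ => ⟨(0 : Fin 1), rfl⟩
  | gate g e => exact fun i => ⟨i, rfl⟩
  | meas w => exact fun _ => ⟨(0 : Fin 1), rfl⟩

theorem WellFormed.map {f : V ↪ W} {A : Set W} {ls : List (Loc 𝒢 V)}
    (h : WellFormed (f ⁻¹' A) ls) : WellFormed A (ls.map (Loc.map f)) := by
  induction ls generalizing A with
  | nil => trivial
  | cons l ls ih =>
    cases l with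
    | prep w =>
      refine ih (WellFormed.mono (A := insert w (f ⁻¹' A)) (ls := ls) ?_ h)
      rintro v (rfl | hv)
      · exact Or.inl rfl
      · exact Or.inr hv
    | gate g e => exact ⟨h.1, ih h.2⟩
    | meas w =>
      refine ⟨h.1, fun l hl i hi => ?_, ih h.2.2⟩
      obtain ⟨l', hl', rfl⟩ := List.mem_map.1 hl
      obtain ⟨j, hj⟩ := l'.wires_map i
      exact h.2.1 l' hl' j (f.injective (hj.symm.trans hi))

theorem measured_append [DecidableEq W] (ls ls' : List (Loc 𝒢 W)) :
    measured (ls ++ ls') = measured ls ∪ measured ls' := by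
  induction ls with
  | nil => simp [measured]
  | cons l ls ih => cases l <;> simp [measured, ih, Finset.insert_union]

theorem mem_measured [DecidableEq W] {ls : List (Loc 𝒢 W)} {w : W} :
    w ∈ measured ls ↔ Loc.meas w ∈ ls := by
  induction ls with
  | nil => simp [measured]
  | cons l ls ih => cases l <;> simp [measured, ih]

theorem mem_measured_map [DecidableEq V] [DecidableEq W] {f : V ↪ W} {ls : List (Loc 𝒢 V)} {w : W}
    (h : w ∈ measured (ls.map (Loc.map f))) : ∃ v ∈ measured ls, f v = w := by
  obtain ⟨l, hl, h⟩ := List.mem_map.1 (mem_measured.1 h)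
  cases l with
  | prep v => cases h
  | gate g e => cases h
  | meas v => exact ⟨v, mem_measured.2 hl, Loc.meas.inj h⟩

end WF

namespace Scheme

variable {𝒢 : GateSet} {s : Scheme 𝒢} {W : Type}

/-- The 1-ECs at the end of a rectangle. -/
def trailOf (s : Scheme 𝒢) (l : Loc 𝒢 W) : List (Loc 𝒢 (Fin l.arity × s.Q)) :=
  if l.IsMeas then [] else s.ecs l.arity

theorem encodeLoc_eq (l : Loc 𝒢 W) : s.encodeLoc l =
    s.place l.wires (s.gaOf l) ++ s.place l.wires (s.trailOf l) := by
  cases l with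
  | prep w => exact List.map_append ..
  | gate g e => exact List.map_append ..
  | meas w =>
    rw [trailOf, if_pos (show (Loc.meas w : Loc 𝒢 W).IsMeas from trivial)]
    exact (List.append_nil _).symm

theorem place_place {n k : ℕ} (e : Fin n ↪ W) (f : Fin k ↪ Fin n)
    (ls : List (Loc 𝒢 (Fin k × s.Q))) : s.place e (s.place f ls) = s.place (f.trans e) ls := by
  rw [place, place, place, List.map_map]
  refine List.map_congr_left fun l _ => ?_
  cases l <;> rfl

theorem place_ecs {n : ℕ} (e : Fin n ↪ W) : s.place e (s.ecs n) =
    (List.finRange n).flatMap fun a => s.place (oneWire (e a)) s.ec := by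
  rw [ecs, place, List.map_flatMap]
  exact List.flatMap_congr fun a _ => place_place e (oneWire a) s.ec

theorem measured_ec_place (w : W) [DecidableEq W] : measured (s.place (oneWire w) s.ec) = ∅ := by
  refine Finset.eq_empty_of_forall_notMem fun v hv => ?_
  obtain ⟨u, hu, -⟩ := mem_measured_map hv
  rw [s.ec_measured] at hu
  simp at hu

theorem wellFormed_ecs {n : ℕ} (e : Fin n ↪ W) {A : Set (W × s.Q)}
    (hA : ∀ a j, (e a, Sum.inl j) ∈ A) (as : List (Fin n)) :
    WellFormed A (as.flatMap fun a => s.place (oneWire (e a)) s.ec) := by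
  classical
  induction as generalizing A with
  | nil => trivial
  | cons a as ih =>
    rw [List.flatMap_cons]
    refine WellFormed.append (WellFormed.map (s.ec_wf.mono ?_)) (ih fun a j => Or.inl (hA a j)) ?_
    · rintro ⟨i, j | j⟩ h
      · exact hA a j
      · simp at h
    · rw [measured_ec_place]
      simp

theorem measured_trailOf [DecidableEq W] (l : Loc 𝒢 W) :
    measured (s.place l.wires (s.trailOf l)) = ∅ := by
  rw [trailOf]
  split_ifs
  · rfl
  · rw [place_ecs]
    refine Finset.eq_empty_of_forall_notMem fun v hv => ?_
    obtain ⟨a, -, ha⟩ := List.mem_flatMap.1 (mem_measured.1 hv)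
    have := mem_measured.2 ha
    rw [measured_ec_place] at this
    simp at this

theorem touches_encodeLoc {l : Loc 𝒢 W} {p : Loc 𝒢 (W × s.Q)} (hp : p ∈ s.encodeLoc l)
    (i : Fin p.arity) : ∃ a, (p.wires i).1 = l.wires a := by
  rw [encodeLoc_eq] at hp
  rcases List.mem_append.1 hp with hp | hp <;>
  · obtain ⟨l', -, rfl⟩ := List.mem_map.1 hp
    obtain ⟨j, hj⟩ := l'.wires_map i
    exact ⟨(l'.wires j).1, by rw [hj]; rfl⟩

theorem measured_encodeLoc [DecidableEq W] {l : Loc 𝒢 W} {v : W × s.Q}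
    (hv : v ∈ measured (s.encodeLoc l)) : l = Loc.meas v.1 := by
  rw [encodeLoc_eq, measured_append, measured_trailOf, Finset.union_empty] at hv
  obtain ⟨u, hu, rfl⟩ := mem_measured_map hv
  cases l with
  | prep w => rw [show measured (s.gaOf (Loc.prep w)) = ∅ from s.prepGa_measured] at hu; simp at hu
  | gate g e =>
    rw [show measured (s.gaOf (Loc.gate g e)) = ∅ from s.ga_measured g] at hu; simp at hu
  | meas w => rfl

/-- The invariant is that the data qubits of every live logical wire are live; ancillas need not be.
A wire that is measured in a block is never used again, because measurements occur only in the
circuits of logical measurements, after which the whole block is idle. -/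
theorem wellFormed_encode {A : Set W} {L : List (Loc 𝒢 W)} (h : WellFormed A L)
    {B : Set (W × s.Q)} (hB : ∀ w ∈ A, ∀ j, (w, Sum.inl j) ∈ B) : WellFormed B (s.encode L) := by
  classical
  induction L generalizing A B with
  | nil => trivial
  | cons l L ih =>
    rw [encode, List.flatMap_cons]
    have hlive : ∀ a, ¬l.IsPrep → l.wires a ∈ A := fun a hp => by
      cases l with
      | prep w => exact (hp trivial).elim
      | gate g e => exact h.1 a
      | meas w => exact h.1
    have hga : WellFormed B (s.place l.wires (s.gaOf l)) := by
      cases l with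
      | prep w => exact WellFormed.map (s.prepGa_wf.mono (Set.empty_subset _))
      | gate g e =>
        refine WellFormed.map ((s.ga_wf g).mono ?_)
        rintro ⟨i, j | j⟩ hij
        · exact hB _ (hlive i id) j
        · simp at hij
      | meas w =>
        refine WellFormed.map (s.measGa_wf.mono ?_)
        rintro ⟨i, j | j⟩ hij
        · exact hB _ (hlive i id) j
        · simp at hij
    have hdata : ∀ a j, (l.wires a, Sum.inl j) ∈ liveAfter B (s.place l.wires (s.gaOf l)) := by
      intro a j
      by_cases hp : l.IsPrep
      · cases l with
        | prep w => exact Or.inr (List.mem_map.2 ⟨_, s.prepGa_complete j, rfl⟩)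
        | gate g e => exact hp.elim
        | meas w => exact hp.elim
      · exact Or.inl (hB _ (hlive a hp) j)
    have hga' : measured (s.place l.wires (s.gaOf l)) ⊆ measured (s.encodeLoc l) := by
      rw [encodeLoc_eq, measured_append]
      exact Finset.subset_union_left
    have hloc : WellFormed B (s.encodeLoc l) := by
      rw [encodeLoc_eq]
      by_cases hm : l.IsMeas
      · rw [trailOf, if_pos hm]
        exact hga.append trivial (by simp [place])
      · refine hga.append ?_ fun v hv => ?_
        · rw [trailOf, if_neg hm, place_ecs]
          exact wellFormed_ecs _ hdata _
        · have := measured_encodeLoc (hga' hv)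
          rw [this] at hm
          exact (hm trivial).elim
    refine hloc.append (ih h.tail fun w hw j => ?_) fun v hv p hp i hi => ?_
    · rcases hw with hw | hw
      · exact Or.inl (hB w hw j)
      · obtain rfl : Loc.prep w = l := List.mem_singleton.1 hw
        rcases hdata (0 : Fin 1) j with h | h
        · exact Or.inl h
        · refine Or.inr ?_
          rw [encodeLoc_eq]
          exact List.mem_append_left _ h
    · have hl := measured_encodeLoc hv
      subst hl
      obtain ⟨l', hl', hp⟩ := List.mem_flatMap.1 hp
      obtain ⟨a, ha⟩ := touches_encodeLoc hp i
      exact h.2.1 l' hl' a (by rw [← ha, hi])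

theorem wellFormed_level (M₀ : Circuit 𝒢 W) (k : ℕ) : WellFormed ∅ (s.level M₀ k) := by
  induction k with
  | zero => exact M₀.wf
  | succ k ih => exact wellFormed_encode ih fun _ h => h.elim

end Scheme

/-! ### Auxiliary facts on labelled lists and wire histories -/

section Lists

variable {α β : Type*}

theorem zipIdx_flatMap_finRange {n len : ℕ} (f : Fin n → List α) (h : ∀ a, (f a).length = len)
    (k : ℕ) : ((List.finRange n).flatMap f).zipIdx k =
      (List.finRange n).flatMap fun a => (f a).zipIdx (k + a * len) := by
  induction n generalizing k with
  | zero => rfl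
  | succ n ih =>
    rw [List.finRange_succ, List.flatMap_cons, List.flatMap_cons, List.zipIdx_append,
      List.flatMap_map, List.flatMap_map, ih _ (fun a => h a.succ), h]
    congr 1
    · simp
    · refine List.flatMap_congr fun a _ => ?_
      rw [Fin.val_succ]
      congr 1
      ring

theorem flatMap_eq_of_unique {as : List α} (has : as.Nodup) {g : α → List β} {a₀ : α}
    (h₀ : a₀ ∈ as) (h : ∀ a, a ≠ a₀ → g a = []) : as.flatMap g = g a₀ := by
  induction as with
  | nil => cases h₀
  | cons a as ih =>
    obtain ⟨ha, has⟩ := List.nodup_cons.1 has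
    rw [List.flatMap_cons]
    by_cases haa : a = a₀
    · subst haa
      rw [List.flatMap_eq_nil_iff.2 fun b hb => h b fun hba => ha (hba ▸ hb), List.append_nil]
    · rw [h a haa, List.nil_append]
      exact ih has ((List.mem_cons.1 h₀).resolve_left (Ne.symm haa))

end Lists

section WireList

variable {𝒢 : GateSet} {V W : Type} [DecidableEq W]

theorem wireList_flatMap {α : Type*} (w : W) (as : List α) (g : α → List (Loc 𝒢 W × ℕ)) :
    wireList w (as.flatMap g) = as.flatMap fun a => wireList w (g a) := List.filter_flatMap ..

theorem wireList_relabel_eq_nil {f : V ↪ W} {w : W} (h : ∀ v, f v ≠ w) (L : List (Loc 𝒢 V × ℕ)) :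
    wireList w (relabel f L) = [] := by
  refine List.filter_eq_nil_iff.2 fun x hx => ?_
  obtain ⟨y, -, rfl⟩ := List.mem_map.1 hx
  simp only [decide_eq_true_eq]
  rintro ⟨i, hi⟩
  obtain ⟨j, hj⟩ := y.1.wires_map i
  exact h _ (hj.symm.trans hi)

/-- A wire that carries nothing has to be prepared before anything else happens to it. In a circuit,
therefore, no 1-EC precedes the first rectangle on a wire, and no assumption on the initial state of
the blocks is needed. -/
theorem head_isPrep {A : Set W} {L : List (Loc 𝒢 W)} (hL : WellFormed A L) {w : W} (hw : w ∉ A)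
    {n : ℕ} {q : Loc 𝒢 W × ℕ} (hq : (wireList w (L.zipIdx n)).head? = some q) : q.1.IsPrep := by
  induction L generalizing A n with
  | nil => cases hq
  | cons l L ih =>
    rw [List.zipIdx_cons] at hq
    by_cases h : l.Touches w
    · rw [wireList_cons_of_touches h, List.head?_cons, Option.some.injEq] at hq
      subst hq
      obtain ⟨i, rfl⟩ := h
      cases l with
      | prep v => trivial
      | gate g e => exact (hw (hL.1 i)).elim
      | meas v => exact (hw hL.1).elim
    · rw [wireList_cons_of_not_touches h] at hq
      refine ih hL.tail (fun h' => ?_) hq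
      rcases h' with h' | h'
      · exact hw h'
      · obtain rfl : Loc.prep w = l := List.mem_singleton.1 h'
        exact h ⟨(0 : Fin 1), rfl⟩

theorem mem_wireList_zipIdx {L : List (Loc 𝒢 W)} {w : W} {n : ℕ} {q : Loc 𝒢 W × ℕ}
    (h : q ∈ wireList w (L.zipIdx n)) : q.1 ∈ L ∧ q.1.Touches w :=
  ⟨List.fst_mem_of_mem_zipIdx (mem_wireList.1 h).1, (mem_wireList.1 h).2⟩

end WireList

namespace Scheme

variable {𝒢 : GateSet} {s : Scheme 𝒢} {W : Type}

/-! ### The layout of the encoded circuit -/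

/-- The 1-Rec of a location, labelled from `off` on. -/
def stdChunk (s : Scheme 𝒢) (l : Loc 𝒢 W) (off : ℕ) : List (Loc 𝒢 (W × s.Q) × ℕ) :=
  s.gaAt l off ++ if l.IsMeas then [] else
    (List.finRange l.arity).flatMap fun a => s.ecAt (l.wires a) (s.ecOff l off a)

theorem zipIdx_place {n : ℕ} (e : Fin n ↪ W) (ls : List (Loc 𝒢 (Fin n × s.Q))) (off : ℕ) :
    (s.place e ls).zipIdx off = relabel (blocks e) (ls.zipIdx off) := by
  rw [place, List.zipIdx_map]
  rfl

theorem zipIdx_encodeLoc (l : Loc 𝒢 W) (off : ℕ) :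
    (s.encodeLoc l).zipIdx off = s.stdChunk l off := by
  rw [encodeLoc_eq, List.zipIdx_append, zipIdx_place, stdChunk, trailOf]
  congr 1
  split_ifs with hm
  · rfl
  · rw [place_ecs, zipIdx_flatMap_finRange (fun a => s.place (oneWire (l.wires a)) s.ec)
      fun a => List.length_map (as := s.ec) _]
    refine List.flatMap_congr fun a _ => ?_
    rw [zipIdx_place, ecAt, ecOff, place, List.length_map]

open Classical in
/-- The labels of the last 1-ECs on the blocks, after the rectangle of a location. -/
noncomputable def nextLead (s : Scheme 𝒢) (l : Loc 𝒢 W) (off : ℕ) (lead : W → ℕ) : W → ℕ := fun w =>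
  if h : l.Touches w then s.ecOff l off h.choose else lead w

theorem nextLead_wires (l : Loc 𝒢 W) (off : ℕ) (lead : W → ℕ) (a : Fin l.arity) :
    s.nextLead l off lead (l.wires a) = s.ecOff l off a := by
  have h : l.Touches (l.wires a) := ⟨a, rfl⟩
  rw [nextLead, dif_pos h]
  congr 1
  exact l.wires.injective h.choose_spec

theorem nextLead_of_not_touches {l : Loc 𝒢 W} {w : W} (h : ¬l.Touches w) (off : ℕ) (lead : W → ℕ) :
    s.nextLead l off lead w = lead w := dif_neg h

variable [DecidableEq W]

/-- The tags `tg` describe the extended rectangles of the locations in a list, which are labelled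
from `n` on, where bad extended rectangles are those with two faults. -/
def IsTagging (s : Scheme 𝒢) (S : Finset ℕ) (tg : ℕ → Tag W) :
    (W → ℕ) → ℕ → ℕ → List (Loc 𝒢 W) → Prop
  | _, _, _, [] => True
  | lead, off, n, l :: L => (tg n).off = off ∧ (tg n).lead = lead ∧
      (∀ w, (tg n).pend w ↔ ∃ x, (wireList w (L.zipIdx (n + 1))).head? = some x ∧ ¬x.1.IsPrep ∧
        (tg x.2).bad) ∧
      ((tg n).bad ↔ 2 ≤ s.faultCount S l (tg n)) ∧
      IsTagging s S tg (s.nextLead l off lead) (off + (s.encodeLoc l).length) (n + 1) L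

theorem le_of_mem_zipIdx {α : Type*} {L : List α} {n : ℕ} {x : α × ℕ} (h : x ∈ L.zipIdx n) :
    n ≤ x.2 := List.le_snd_of_mem_zipIdx h

variable {S : Finset ℕ} {tg : ℕ → Tag W}

theorem IsTagging.congr {tg' : ℕ → Tag W} {lead : W → ℕ} {off n : ℕ} {L : List (Loc 𝒢 W)}
    (h : s.IsTagging S tg lead off n L) (htg : ∀ i ≥ n, tg' i = tg i) :
    s.IsTagging S tg' lead off n L := by
  induction L generalizing lead off n with
  | nil => trivial
  | cons l L ih =>
    obtain ⟨h₁, h₂, h₃, h₄, h₅⟩ := h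
    have hn := htg n le_rfl
    refine ⟨hn ▸ h₁, hn ▸ h₂, fun w => ?_, hn ▸ h₄, ih h₅ fun i hi => htg i (by omega)⟩
    rw [hn, h₃ w]
    refine exists_congr fun x => and_congr_right fun hx => ?_
    have := le_of_mem_zipIdx (mem_wireList.1 (List.mem_of_head? hx)).1
    rw [htg x.2 (by omega)]

/-- The positions of the pieces are determined from the beginning of the circuit, but badness from
its end: which trailing 1-ECs count depends on the badness of the next locations. Accordingly the
positions are parameters of the induction, while the tail is tagged before the head. -/
theorem exists_isTagging (S : Finset ℕ) (lead : W → ℕ) (off n : ℕ) (L : List (Loc 𝒢 W)) :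
    ∃ tg, s.IsTagging S tg lead off n L := by
  induction L generalizing lead off n with
  | nil => exact ⟨fun _ => ⟨0, lead, False, fun _ => False⟩, trivial⟩
  | cons l L ih =>
    obtain ⟨tg, h⟩ := ih (s.nextLead l off lead) (off + (s.encodeLoc l).length) (n + 1)
    set t : Tag W := ⟨off, lead, 2 ≤ s.faultCount S l ⟨off, lead, False, fun w =>
      ∃ x, (wireList w (L.zipIdx (n + 1))).head? = some x ∧ ¬x.1.IsPrep ∧ (tg x.2).bad⟩,
      fun w => ∃ x, (wireList w (L.zipIdx (n + 1))).head? = some x ∧ ¬x.1.IsPrep ∧ (tg x.2).bad⟩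
      with ht
    have htg : ∀ i ≥ n + 1, Function.update tg n t i = tg i := fun i hi =>
      Function.update_of_ne (by omega) _ _
    refine ⟨Function.update tg n t, ?_⟩
    rw [IsTagging, Function.update_self]
    refine ⟨rfl, rfl, fun w => ?_, Iff.rfl, h.congr htg⟩
    refine exists_congr fun x => and_congr_right fun hx => ?_
    rw [htg x.2 (le_of_mem_zipIdx (mem_wireList.1 (List.mem_of_head? hx)).1)]

theorem IsTagging.bad_iff {lead : W → ℕ} {off n : ℕ} {L : List (Loc 𝒢 W)}
    (h : s.IsTagging S tg lead off n L) : ∀ x ∈ L.zipIdx n,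
      (tg x.2).bad ↔ 2 ≤ s.faultCount S x.1 (tg x.2) := by
  induction L generalizing lead off n with
  | nil => simp
  | cons l L ih =>
    obtain ⟨-, -, -, h₄, h₅⟩ := h
    rw [List.zipIdx_cons]
    exact List.forall_mem_cons.2 ⟨h₄, ih h₅⟩

theorem IsTagging.lead_head {lead : W → ℕ} {off n : ℕ} {L : List (Loc 𝒢 W)}
    (h : s.IsTagging S tg lead off n L) {w : W} {q : Loc 𝒢 W × ℕ}
    (hq : (wireList w (L.zipIdx n)).head? = some q) : (tg q.2).lead w = lead w := by
  induction L generalizing lead off n with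
  | nil => cases hq
  | cons l L ih =>
    obtain ⟨-, h₂, -, -, h₅⟩ := h
    rw [List.zipIdx_cons] at hq
    by_cases hw : l.Touches w
    · rw [wireList_cons_of_touches hw, List.head?_cons, Option.some.injEq] at hq
      rw [← hq, h₂]
    · rw [wireList_cons_of_not_touches hw] at hq
      rw [ih h₅ hq, nextLead_of_not_touches hw]

theorem IsTagging.cons {lead : W → ℕ} {off n : ℕ} {L : List (Loc 𝒢 W)}
    (h : s.IsTagging S tg lead off n L) {A : Set W} (hL : WellFormed A L) (w : W) :
    s.Cons tg w (wireList w (L.zipIdx n)) := by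
  induction L generalizing lead off n A with
  | nil => trivial
  | cons l L ih =>
    obtain ⟨h₁, h₂, h₃, h₄, h₅⟩ := h
    rw [List.zipIdx_cons]
    by_cases hw : l.Touches w
    · rw [wireList_cons_of_touches hw]
      refine ⟨?_, ih h₅ hL.tail⟩
      rcases hq : (wireList w (L.zipIdx (n + 1))).head? with _ | q
      · intro hp
        obtain ⟨x, hx, -⟩ := (h₃ w).1 hp
        rw [hq] at hx
        cases hx
      · refine ⟨fun hm => ?_, (h₃ w).trans ⟨fun ⟨x, hx, h⟩ => ?_, fun h => ⟨q, hq, h⟩⟩,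
          fun hp a ha => ?_⟩
        · obtain ⟨hqL, i, hi⟩ := mem_wireList_zipIdx (List.mem_of_head? hq)
          obtain ⟨j, hj⟩ := hw
          change Loc.IsMeas l at hm
          cases l with
          | prep v => exact hm
          | gate g e => exact hm
          | meas v => exact hL.2.1 _ hqL i (hi.trans hj.symm)
        · rw [hq, Option.some.injEq] at hx
          exact hx ▸ h
        · rw [h₅.lead_head hq, ← ha, nextLead_wires, h₁]
    · rw [wireList_cons_of_not_touches hw]
      exact ih h₅ hL.tail

theorem IsTagging.zipIdx_encode {lead : W → ℕ} {off n : ℕ} {L : List (Loc 𝒢 W)}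
    (h : s.IsTagging S tg lead off n L) : (s.encode L).zipIdx off =
      (L.zipIdx n).flatMap fun x => s.stdChunk x.1 (tg x.2).off := by
  induction L generalizing lead off n with
  | nil => rfl
  | cons l L ih =>
    obtain ⟨h₁, -, -, -, h₅⟩ := h
    rw [List.zipIdx_cons, List.flatMap_cons, ← ih h₅, encode, List.flatMap_cons,
      List.zipIdx_append, zipIdx_encodeLoc, h₁]
    rfl

/-! ### Reordering the encoded circuit -/

theorem wireList_gaAt_eq_nil {l : Loc 𝒢 W} {v : W × s.Q} (h : ¬l.Touches v.1) (off : ℕ) :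
    wireList v (s.gaAt l off) = [] :=
  wireList_relabel_eq_nil (fun u hu => h ⟨u.1, congrArg Prod.fst hu⟩) _

theorem wireList_ecAt_eq_nil {w : W} {v : W × s.Q} (h : w ≠ v.1) (off : ℕ) :
    wireList v (s.ecAt w off) = [] :=
  wireList_relabel_eq_nil (fun _ hu => h (congrArg Prod.fst hu)) _

open Classical in
theorem wireList_ecChunk {n : ℕ} {e : Fin n ↪ W} {offs : Fin n → ℕ} {pend : Fin n → Prop}
    {v : W × s.Q} {a : Fin n} (ha : e a = v.1) :
    wireList v (s.ecChunk e offs pend (List.finRange n)) =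
      if pend a then [] else wireList v (s.ecAt v.1 (offs a)) := by
  rw [ecChunk, wireList_flatMap, flatMap_eq_of_unique (List.nodup_finRange n)
    (List.mem_finRange a), ← ha]
  · split_ifs <;> rfl
  · intro b hb
    split_ifs
    · rfl
    · exact wireList_ecAt_eq_nil (fun hab => hb (e.injective (hab.trans ha.symm))) _

theorem wireList_ecChunk_eq_nil {n : ℕ} {e : Fin n ↪ W} {offs : Fin n → ℕ} {pend : Fin n → Prop}
    {v : W × s.Q} (h : ∀ a, e a ≠ v.1) (as : List (Fin n)) :
    wireList v (s.ecChunk e offs pend as) = [] := by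
  rw [ecChunk, wireList_flatMap]
  refine List.flatMap_eq_nil_iff.2 fun a _ => ?_
  split_ifs
  · rfl
  · exact wireList_ecAt_eq_nil (h a) _

theorem wireList_custChunk_eq_nil {l : Loc 𝒢 W} {t : Tag W} {v : W × s.Q} (h : ¬l.Touches v.1) :
    wireList v (s.custChunk l t) = [] := by
  have h' : ∀ a, l.wires a ≠ v.1 := fun a ha => h ⟨a, ha⟩
  rw [custChunk, wireList_append, wireList_append, wireList_gaAt_eq_nil h, leadChunk, trailChunk]
  have h₀ : wireList v ([] : List (Loc 𝒢 (W × s.Q) × ℕ)) = [] := rfl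
  split_ifs <;> simp only [wireList_ecChunk_eq_nil h', h₀, List.append_nil]

theorem wireList_stdChunk_eq_nil {l : Loc 𝒢 W} {off : ℕ} {v : W × s.Q} (h : ¬l.Touches v.1) :
    wireList v (s.stdChunk l off) = [] := by
  rw [stdChunk, wireList_append, wireList_gaAt_eq_nil h]
  split_ifs
  · rfl
  · rw [wireList_flatMap]
    exact List.flatMap_eq_nil_iff.2 fun a _ => wireList_ecAt_eq_nil (fun ha => h ⟨a, ha⟩) _

theorem wireList_stdChunk {l : Loc 𝒢 W} {off : ℕ} {v : W × s.Q} {a : Fin l.arity}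
    (ha : l.wires a = v.1) : wireList v (s.stdChunk l off) = wireList v (s.gaAt l off) ++
      if l.IsMeas then [] else wireList v (s.ecAt v.1 (s.ecOff l off a)) := by
  rw [stdChunk, wireList_append]
  congr 1
  split_ifs
  · rfl
  · rw [wireList_flatMap, flatMap_eq_of_unique (List.nodup_finRange _) (List.mem_finRange a), ← ha]
    exact fun b hb => wireList_ecAt_eq_nil
      (fun hab => hb (l.wires.injective (hab.trans ha.symm))) _

theorem flatMap_wireList {v : W × s.Q} {f : Loc 𝒢 W × ℕ → List (Loc 𝒢 (W × s.Q) × ℕ)}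
    (hf : ∀ x, ¬x.1.Touches v.1 → wireList v (f x) = []) (O : List (Loc 𝒢 W × ℕ)) :
    wireList v (O.flatMap f) = (wireList v.1 O).flatMap fun x => wireList v (f x) := by
  rw [wireList_flatMap]
  induction O with
  | nil => rfl
  | cons x O ih =>
    by_cases h : x.1.Touches v.1
    · rw [wireList_cons_of_touches h, List.flatMap_cons, List.flatMap_cons, ih]
    · rw [wireList_cons_of_not_touches h, List.flatMap_cons, hf x h, List.nil_append, ih]

open Classical in
/-- What the 1-EC that precedes a bad location does to the wire `v`. -/
noncomputable def preList (s : Scheme 𝒢) (tg : ℕ → Tag W) (v : W × s.Q) :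
    Option (Loc 𝒢 W × ℕ) → List (Loc 𝒢 (W × s.Q) × ℕ)
  | none => []
  | some q => if (tg q.2).bad ∧ ¬q.1.IsPrep then wireList v (s.ecAt v.1 ((tg q.2).lead v.1)) else []

/-- Along one wire a pending 1-EC vanishes from the end of one chunk and reappears at the start of
the next, so the concatenation does not change, except for a 1-EC in front of the very first
location. -/
theorem flatMap_custChunk {v : W × s.Q} {X : List (Loc 𝒢 W × ℕ)} (hX : ∀ x ∈ X, x.1.Touches v.1)
    (h : s.Cons tg v.1 X) : (X.flatMap fun x => wireList v (s.custChunk x.1 (tg x.2))) =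
      s.preList tg v X.head? ++ X.flatMap fun x => wireList v (s.stdChunk x.1 (tg x.2).off) := by
  induction X with
  | nil => rfl
  | cons p R ih =>
    obtain ⟨hE, hR⟩ := h
    obtain ⟨a, ha⟩ := hX p List.mem_cons_self
    rw [List.flatMap_cons, List.flatMap_cons, ih (fun x hx => hX x (List.mem_cons_of_mem _ hx)) hR,
      wireList_stdChunk ha, custChunk, wireList_append, wireList_append, List.head?_cons]
    have h₁ : wireList v (s.leadChunk p.1 (tg p.2)) = s.preList tg v (some p) := by
      rw [leadChunk, preList]
      split_ifs
      · rw [wireList_ecChunk ha, if_neg id, ha]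
      · rfl
    -- The 1-EC between two consecutive locations appears exactly once, either as the trailing 1-EC
    -- of the first or as the leading 1-EC of the second.
    have h₂ : wireList v (s.trailChunk p.1 (tg p.2)) ++ s.preList tg v R.head? =
        if p.1.IsMeas then [] else wireList v (s.ecAt v.1 (s.ecOff p.1 (tg p.2).off a)) := by
      rcases hq : R.head? with _ | q
      · rw [hq] at hE
        rw [trailChunk]
        split_ifs
        · rfl
        · rw [wireList_ecChunk ha, ha, if_neg hE]
          exact List.append_nil _
      · rw [hq] at hE
        obtain ⟨hm, hp, hl⟩ := hE
        rw [trailChunk, if_neg hm, if_neg hm, wireList_ecChunk ha, ha, preList]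
        by_cases hb : (tg q.2).bad ∧ ¬q.1.IsPrep
        · rw [if_pos (hp.2 hb.symm), if_pos hb, hl hb.2 a ha, List.nil_append]
        · rw [if_neg fun h => hb (hp.1 h).symm, if_neg hb, List.append_nil]
    rw [h₁, ← h₂]
    simp only [List.append_assoc]

/-- The custom order of the encoded circuit. -/
theorem same_encode [Fintype W] {O : List (Loc 𝒢 W × ℕ)} {L : List (Loc 𝒢 W)}
    (hO : Same O (L.zipIdx)) (hL : WellFormed ∅ L) {lead : W → ℕ}
    (htg : s.IsTagging S tg lead 0 0 L) :
    Same (O.flatMap fun x => s.custChunk x.1 (tg x.2)) (s.encode L).zipIdx := fun v => by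
  rw [htg.zipIdx_encode, flatMap_wireList (fun x hx => wireList_custChunk_eq_nil hx),
    flatMap_wireList (fun x hx => wireList_stdChunk_eq_nil hx), hO,
    flatMap_custChunk (fun x hx => (mem_wireList.1 hx).2) (htg.cons hL v.1)]
  -- The first location on a wire is a preparation, which has no leading 1-EC.
  have : s.preList tg v (wireList v.1 L.zipIdx).head? = [] := by
    rcases hq : (wireList v.1 L.zipIdx).head? with _ | q
    · rfl
    · exact if_neg fun h => h.2 (head_isPrep hL (Set.notMem_empty _) hq)
  rw [this, List.nil_append]

end Scheme

/-! ### Measured wires do not depend on the order of execution -/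

section

variable {𝒢 : GateSet} {W : Type} [DecidableEq W]

theorem mem_addMeasList {O : List (Loc 𝒢 W × ℕ)} {M : Finset W} {w : W} :
    w ∈ addMeasList M O ↔ w ∈ M ∨ ∃ x ∈ O, x.1 = Loc.meas w := by
  induction O generalizing M with
  | nil => simp [addMeasList]
  | cons x O ih =>
    rw [addMeasList, List.foldl_cons, ← addMeasList, ih, List.exists_mem_cons_iff, ← or_assoc]
    refine or_congr_left ?_
    rcases x with ⟨l, i⟩
    cases l with
    | prep v => simp [Loc.addMeas]
    | gate g e => simp [Loc.addMeas]
    | meas v => simp [Loc.addMeas, or_comm, eq_comm]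

theorem mem_of_touches [Fintype W] {O : List (Loc 𝒢 W × ℕ)} {L : List (Loc 𝒢 W)} (h : Same O L.zipIdx)
    {x : Loc 𝒢 W × ℕ} {w : W} (hw : x.1.Touches w) : x ∈ O ↔ x ∈ L.zipIdx := by
  have h₁ := mem_wireList (w := w) (x := x) (O := O)
  rw [h, mem_wireList] at h₁
  constructor
  · exact fun hx => (h₁.2 ⟨hx, hw⟩).1
  · exact fun hx => (h₁.1 ⟨hx, hw⟩).1

theorem addMeasList_eq [Fintype W] {O : List (Loc 𝒢 W × ℕ)} {L : List (Loc 𝒢 W)}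
    (h : Same O L.zipIdx) : addMeasList ∅ O = measured L := by
  ext w
  rw [mem_addMeasList, mem_measured]
  have hw : ∀ i : ℕ, Loc.Touches w ((Loc.meas w : Loc 𝒢 W), i).1 := fun i => ⟨(0 : Fin 1), rfl⟩
  constructor
  · rintro (h' | ⟨⟨l, i⟩, hx, rfl⟩)
    · simp at h'
    · exact List.fst_mem_of_mem_zipIdx ((mem_of_touches h (hw i)).1 hx)
  · intro hx
    obtain ⟨i, hi, hL⟩ := List.mem_iff_getElem.1 hx
    refine Or.inr ⟨(Loc.meas w, i), (mem_of_touches h (hw i)).2 ?_, rfl⟩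
    rw [List.mem_zipIdx_iff_getElem?, List.getElem?_eq_getElem hi, hL]

end

namespace Scheme

variable {𝒢 : GateSet} {s : Scheme 𝒢} {W : Type} [Fintype W] [DecidableEq W]

/-! ### The outcomes of the encoded circuit -/

theorem sum_decKernel {K Q : Type} [Fintype K] [Fintype Q] [DecidableEq Q]
    {τ : W → K → Matrix Bool (Q → Bool) ℂ} {w : W} (h : ∑ k, (τ w k)ᴴ * τ w k = 1)
    (q q' : Q → Bool) : ∑ a, decKernel τ w a a q q' = if q = q' then 1 else 0 := by
  have := congrFun (congrFun h q') q
  rw [Matrix.sum_apply, one_apply] at this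
  rw [if_congr (eq_comm (a := q)) rfl rfl, ← this]
  simp only [decKernel, mul_apply, conjTranspose_apply]
  rw [Finset.sum_comm]
  exact Finset.sum_congr rfl fun k _ => Finset.sum_congr rfl fun a _ => mul_comm _ _

open Classical in
-- On measured blocks the decoder reproduces the classical decoding of the outcomes; on the other
-- blocks, which do not affect the event, it preserves the trace and is summed out.
theorem sum_decode (hs : s.FaultTolerant) {M : Finset W} {P : (W → Bool) → Prop}
    (hP : ∀ x x', (∀ w ∈ M, x w = x' w) → (P x ↔ P x')) (σ : Op (W × s.Q)) :
    (∑ x, if P x then decode (s.dec' M) σ x x else 0) =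
      ∑ y, if P fun w => s.dec fun q => y (w, q) then σ y y else 0 := by
  set D : (W × s.Q → Bool) → W → Bool := fun y w => s.dec fun q => y (w, q) with hD
  set κ : (W → Bool) → (W × s.Q → Bool) → (W × s.Q → Bool) → ℂ := fun x y y' =>
    ∏ w, decKernel (s.dec' M) w (x w) (x w) (fun q => y (w, q)) fun q => y' (w, q) with hκ
  -- If `x` disagrees with the decoded outcomes on a measured block, the kernel vanishes, so in the
  -- event `x` may be replaced by these outcomes.
  have h₁ : ∀ x y y', (if P x then κ x y y' * σ y y' else 0) =
      if P (D y) then κ x y y' * σ y y' else 0 := by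
    intro x y y'
    by_cases hx : ∀ w ∈ M, x w = D y w
    · rw [if_congr (hP _ _ hx) rfl rfl]
    · push Not at hx
      obtain ⟨w, hw, hne⟩ := hx
      have : κ x y y' = 0 := by
        refine Finset.prod_eq_zero (Finset.mem_univ w) (Finset.sum_eq_zero fun k _ => ?_)
        have : s.dec' M w k (x w) (fun q => y (w, q)) = 0 := by
          rw [dec', if_pos hw]
          rcases k with k | z
          · rfl
          · rw [cdec, single_apply, if_neg]
            rintro ⟨h, rfl⟩
            exact hne h.symm
        rw [this, zero_mul]
      simp [this]
  -- Completeness of the decoder: the kernel, summed over the decoded values, keeps exactly the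
  -- diagonal of the state.
  have h₂ : ∀ y y', ∑ x, κ x y y' = if y = y' then 1 else 0 := by
    intro y y'
    have := Finset.prod_univ_sum (fun _ : W => (Finset.univ : Finset Bool)) fun w a =>
      decKernel (s.dec' M) w a a (fun q => y (w, q)) fun q => y' (w, q)
    rw [Fintype.piFinset_univ] at this
    rw [hκ, ← this]
    simp only [sum_decKernel (complete_dec' hs M _)]
    rw [Finset.prod_ite_zero]
    have : (∀ w ∈ Finset.univ, (fun q => y (w, q)) = fun q => y' (w, q)) ↔ y = y' :=
      ⟨fun h => funext fun p => congrFun (h p.1 (Finset.mem_univ _)) p.2, fun h w _ => by rw [h]⟩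
    simp only [this, Finset.prod_const_one]
  calc (∑ x, if P x then decode (s.dec' M) σ x x else 0) =
        ∑ x, ∑ y, ∑ y', if P x then κ x y y' * σ y y' else 0 := by
        refine Finset.sum_congr rfl fun x _ => ?_
        rw [decode_apply]
        split_ifs
        · rfl
        · simp
    _ = ∑ y, ∑ y', if P (D y) then (∑ x, κ x y y') * σ y y' else 0 := by
        simp only [h₁]
        rw [Finset.sum_comm]
        refine Finset.sum_congr rfl fun y _ => ?_
        rw [Finset.sum_comm]
        refine Finset.sum_congr rfl fun y' _ => ?_
        split_ifs
        · rw [Finset.sum_mul]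
        · simp
    _ = _ := by
        refine Finset.sum_congr rfl fun y _ => ?_
        simp only [h₂]
        split_ifs <;> simp

open Classical in
/-- With faults at `S`, the probability of the event `P` is `c`. -/
def Yields (L : List (Loc 𝒢 W)) (S : Finset ℕ) (P : (W → Bool) → Prop) (c : ℂ) : Prop :=
  ∃ O, Same O L.zipIdx ∧ ∀ ρ σ, ρ ∈ cone Set.univ → ρ.trace = 1 → Reach S O ρ σ →
    (∑ y, if P y then σ y y else 0) = c

/-- A good order of the decoded circuit is refined to an order of the encoded one, chunk by chunk,
and the decoded run obeys the fault relation with the bad locations as faults. The order has to be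
carried along: the reordering that serves one level is expanded at the next, and abstract faults,
unlike true channels, are not known to commute. -/
theorem Yields.encode (hs : s.FaultTolerant) {L : List (Loc 𝒢 W)} (hL : WellFormed ∅ L)
    {S S' : Finset ℕ} {tg : ℕ → Tag W} {lead : W → ℕ} (htg : s.IsTagging S tg lead 0 0 L)
    (hS' : ∀ i < L.length, i ∈ S' ↔ (tg i).bad) {P : (W → Bool) → Prop}
    (hP : ∀ x x', (∀ w ∈ measured L, x w = x' w) → (P x ↔ P x')) {c : ℂ} (h : Yields L S' P c) :
    Yields (s.encode L) S (fun y => P fun w => s.dec fun q => y (w, q)) c := by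
  obtain ⟨O, hO, h⟩ := h
  have hO' : Same (trim O) L.zipIdx := fun w => (wireList_trim w O).trans (hO w)
  have hmem : ∀ x ∈ trim O, x ∈ L.zipIdx := fun x hx =>
    (mem_of_touches hO' ⟨⟨0, Nat.pos_of_ne_zero (by simpa using (List.mem_filter.1 hx).2)⟩, rfl⟩).1 hx
  refine ⟨_, same_encode hO' hL htg, fun ρ σ hρ htr hσ => ?_⟩
  have hR := reach_decode hs (S' := S') (M := ∅) (fun w => ?_) (fun x hx hb => ?_) (fun x hx => ?_)
    (by simp) hρ (fun w x hx hp => ?_) hσ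
  · rw [addMeasList_eq hO'] at hR
    rw [← sum_decode hs hP]
    refine h _ _ (decode_mem_cone _ hρ) ?_ (hR.of_trim (decode_mem_cone _ hρ))
    rw [trace_kmap (complete_decKraus (complete_dec' hs ∅)), htr]
  · rw [hO']
    exact htg.cons hL w
  · rw [htg.bad_iff x (hmem x hx)] at hb
    omega
  · refine hS' _ ?_
    have := List.snd_lt_of_mem_zipIdx (hmem x hx)
    simpa using this
  · rw [hO'] at hx
    exact (hp (head_isPrep hL (Set.notMem_empty _) hx)).elim

/-- Every wire is prepared before use, so the outcome depends on the initial state only through its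
trace. This matters because decoding the initial state of the encoded circuit need not give `|0 ⋯
0⟩`. -/
theorem Yields.of_empty {L : List (Loc 𝒢 W)} (hL : WellFormed ∅ L) {P : (W → Bool) → Prop}
    (hP : ∀ x x', (∀ w ∈ measured L, x w = x' w) → (P x ↔ P x')) {ρ₀ : Op W}
    (hρ₀ : ρ₀.trace = 1) [DecidablePred P] :
    Yields L ∅ P (∑ y, if P y then run L noFault ρ₀ y y else 0) := by
  refine ⟨_, fun _ => rfl, fun ρ σ hρ htr hσ => ?_⟩
  rw [eq_runLabelled_of_reach hσ, runLabelled_zipIdx]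
  have hF : (fun i => noFault (0 + i)) = noFault := rfl
  rw [hF]
  have hforget : forget (∅ : Set W)ᶜ ρ = forget (∅ : Set W)ᶜ ρ₀ := by
    have : ∀ τ : Op W, ∀ x y, forget (∅ : Set W)ᶜ τ x y = τ.trace := fun τ x y => by
      rw [forget_apply, trace]
      refine Finset.sum_congr rfl fun z _ => ?_
      have : ∀ x, mix (∅ : Set W)ᶜ z x = z := fun x => funext fun w => mix_of_mem (by simp) _ _
      rw [this, this, diag_apply]
    ext x y
    rw [this, this, htr, hρ₀]
  convert sum_diag_congr (forget_run hL noFault hforget) (p := P) fun z y => ?_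
  refine hP _ _ fun w hw => mix_of_notMem ?_ _ _
  exact not_not.2 (mem_liveAfter_of_mem_measured hL hw)

end Scheme

namespace Scheme

variable {𝒢 : GateSet} {s : Scheme 𝒢} {W : Type}

theorem cnt_eq (S : Finset ℕ) (off len : ℕ) :
    cnt S off len = (S ∩ Finset.Ico off (off + len)).card := by
  rw [cnt, ← Finset.card_map (addLeftEmbedding off)]
  congr 1
  ext m
  simp only [Finset.mem_map, Finset.mem_filter, Finset.mem_range, addLeftEmbedding_apply,
    Finset.mem_inter, Finset.mem_Ico]
  constructor
  · rintro ⟨i, ⟨hi, hS⟩, rfl⟩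
    exact ⟨hS, by omega, by omega⟩
  · rintro ⟨hS, h₁, h₂⟩
    obtain ⟨i, rfl⟩ := Nat.exists_eq_add_of_le h₁
    exact ⟨i, ⟨by omega, hS⟩, rfl⟩

/-! ### The labels of an extended rectangle -/

/-- The labels of the 1-EC that starts at `off`. -/
def ecSet (s : Scheme 𝒢) (off : ℕ) : Finset ℕ := Finset.Ico off (off + s.ec.length)

/-- The labels of the 1-Ga of a location. -/
def gaSet (s : Scheme 𝒢) (l : Loc 𝒢 W) (off : ℕ) : Finset ℕ :=
  Finset.Ico off (off + (s.gaOf l).length)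

open Classical in
/-- The labels of the 1-ECs that precede a location. -/
noncomputable def leadSet (s : Scheme 𝒢) (l : Loc 𝒢 W) (lead : W → ℕ) : Finset ℕ :=
  if l.IsPrep then ∅ else Finset.univ.biUnion fun a => s.ecSet (lead (l.wires a))

open Classical in
/-- The labels of the 1-ECs that follow a location, except for the pending ones. -/
noncomputable def trailSet (s : Scheme 𝒢) (l : Loc 𝒢 W) (off : ℕ) (pend : W → Prop) : Finset ℕ :=
  if l.IsMeas then ∅ else Finset.univ.biUnion fun a =>
    if pend (l.wires a) then ∅ else s.ecSet (s.ecOff l off a)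

/-- The labels of the extended rectangle of a location, without pending 1-ECs. -/
noncomputable def exSet (s : Scheme 𝒢) (l : Loc 𝒢 W) (off : ℕ) (lead : W → ℕ) (pend : W → Prop) :
    Finset ℕ := s.leadSet l lead ∪ s.gaSet l off ∪ s.trailSet l off pend

theorem mem_leadSet {l : Loc 𝒢 W} {lead : W → ℕ} {m : ℕ} :
    m ∈ s.leadSet l lead ↔ ¬l.IsPrep ∧ ∃ a, m ∈ s.ecSet (lead (l.wires a)) := by
  rw [leadSet]
  split_ifs with h <;> simp [h]

theorem mem_trailSet {l : Loc 𝒢 W} {off : ℕ} {pend : W → Prop} {m : ℕ} :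
    m ∈ s.trailSet l off pend ↔
      ¬l.IsMeas ∧ ∃ a, ¬pend (l.wires a) ∧ m ∈ s.ecSet (s.ecOff l off a) := by
  rw [trailSet]
  split_ifs with h
  · simp [h]
  · simp only [h, not_false_eq_true, true_and, Finset.mem_biUnion, Finset.mem_univ]
    refine exists_congr fun a => ?_
    split_ifs with hp <;> simp [hp]

theorem mem_exSet {l : Loc 𝒢 W} {off : ℕ} {lead : W → ℕ} {pend : W → Prop} {m : ℕ} :
    m ∈ s.exSet l off lead pend ↔
      m ∈ s.leadSet l lead ∨ m ∈ s.gaSet l off ∨ m ∈ s.trailSet l off pend := by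
  rw [exSet, Finset.mem_union, Finset.mem_union, or_assoc]

theorem exSet_subset (l : Loc 𝒢 W) (off : ℕ) (lead : W → ℕ) (pend : W → Prop) :
    s.exSet l off lead pend ⊆ s.exSet l off lead fun _ => False := fun m hm => by
  rw [mem_exSet] at hm ⊢
  refine hm.imp_right (Or.imp_right fun h => ?_)
  rw [mem_trailSet] at h ⊢
  exact ⟨h.1, h.2.imp fun a ha => ⟨id, ha.2⟩⟩

theorem card_ecSet (off : ℕ) : (s.ecSet off).card = s.ec.length := by simp [ecSet]

theorem length_ecs (n : ℕ) : (s.ecs n).length = n * s.ec.length := by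
  rw [ecs, List.length_flatMap]
  simp [place]

theorem card_exSet_le (l : Loc 𝒢 W) (off : ℕ) (lead : W → ℕ) (pend : W → Prop) :
    (s.exSet l off lead pend).card ≤ (if l.IsPrep then 0 else l.arity * s.ec.length) +
      (s.gaOf l).length + if l.IsMeas then 0 else l.arity * s.ec.length := by
  refine (Finset.card_union_le _ _).trans (Nat.add_le_add ((Finset.card_union_le _ _).trans
    (Nat.add_le_add ?_ ?_)) ?_)
  · rw [leadSet]
    split_ifs
    · simp
    · refine Finset.card_biUnion_le.trans ?_
      simp [card_ecSet]
  · simp [gaSet]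
  · rw [trailSet]
    split_ifs
    · simp
    · refine Finset.card_biUnion_le.trans ((Finset.sum_le_sum
        (g := fun _ => s.ec.length) fun a _ => ?_).trans (by simp))
      split_ifs
      · simp
      · exact (card_ecSet _).le

/-- The labels are no more numerous than the locations of the full extended rectangle of that type,
and removing pending 1-ECs only lowers their number. -/
theorem choose_card_exSet_le (l : Loc 𝒢 W) (off : ℕ) (lead : W → ℕ) (pend : W → Prop) :
    (s.exSet l off lead pend).card.choose 2 ≤ s.maxPairs := by
  refine (Nat.choose_le_choose 2 (s.card_exSet_le l off lead pend)).trans ?_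
  have h1 := length_ecs (s := s) 1
  cases l with
  | prep w =>
    refine le_trans (le_of_eq ?_) (le_max_left _ _)
    rw [if_pos (show (Loc.prep w : Loc 𝒢 W).IsPrep from trivial),
      if_neg (show ¬(Loc.prep w : Loc 𝒢 W).IsMeas from id), exRecPrep, recPrep, List.length_append,
      h1, zero_add]
    rfl
  | gate g e =>
    refine le_trans (le_of_eq ?_) ((Finset.le_sup (f := fun g => (s.exRecGate g).length.choose 2)
      (Finset.mem_univ g)).trans ((le_max_right _ _).trans (le_max_right _ _)))
    rw [if_neg (show ¬(Loc.gate g e : Loc 𝒢 W).IsPrep from id),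
      if_neg (show ¬(Loc.gate g e : Loc 𝒢 W).IsMeas from id), exRecGate, recGate,
      List.length_append, List.length_append, length_ecs, ← add_assoc]
    rfl
  | meas w =>
    refine le_trans (le_of_eq ?_) ((le_max_left _ _).trans (le_max_right _ _))
    rw [if_neg (show ¬(Loc.meas w : Loc 𝒢 W).IsPrep from id),
      if_pos (show (Loc.meas w : Loc 𝒢 W).IsMeas from trivial), exRecMeas, recMeas,
      List.length_append, h1, add_zero]
    rfl

theorem length_encodeLoc (l : Loc 𝒢 W) : (s.encodeLoc l).length =
    (s.gaOf l).length + if l.IsMeas then 0 else l.arity * s.ec.length := by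
  rw [encodeLoc_eq, List.length_append, place, place, List.length_map, List.length_map, trailOf]
  split_ifs
  · rfl
  · rw [length_ecs]

theorem mem_ecSet {off m : ℕ} : m ∈ s.ecSet off ↔ off ≤ m ∧ m < off + s.ec.length :=
  Finset.mem_Ico

theorem mem_gaSet {l : Loc 𝒢 W} {off m : ℕ} :
    m ∈ s.gaSet l off ↔ off ≤ m ∧ m < off + (s.gaOf l).length := Finset.mem_Ico

theorem bounds_of_mem_ecOff {l : Loc 𝒢 W} {off m : ℕ} {a : Fin l.arity} (hl : ¬l.IsMeas)
    (h : m ∈ s.ecSet (s.ecOff l off a)) :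
    off + (s.gaOf l).length ≤ m ∧ m < off + (s.encodeLoc l).length := by
  rw [mem_ecSet, ecOff] at h
  rw [length_encodeLoc, if_neg hl]
  have : (a + 1) * s.ec.length ≤ l.arity * s.ec.length := Nat.mul_le_mul_right _ a.2
  rw [add_mul, one_mul] at this
  omega

theorem eq_of_mem_ecOff {l : Loc 𝒢 W} {off m : ℕ} {a b : Fin l.arity}
    (ha : m ∈ s.ecSet (s.ecOff l off a)) (hb : m ∈ s.ecSet (s.ecOff l off b)) : a = b := by
  rw [mem_ecSet, ecOff] at ha hb
  by_contra hab
  rcases lt_or_gt_of_ne (fun h => hab (Fin.ext h)) with h | h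
  · have := Nat.mul_le_mul_right s.ec.length (Nat.succ_le_of_lt h)
    rw [Nat.succ_mul] at this
    omega
  · have := Nat.mul_le_mul_right s.ec.length (Nat.succ_le_of_lt h)
    rw [Nat.succ_mul] at this
    omega

variable [DecidableEq W]

/-- The next location on the wire `w` has the wire as input. -/
def Active (L : List (Loc 𝒢 W)) (n : ℕ) (w : W) : Prop :=
  ∃ x, (wireList w (L.zipIdx n)).head? = some x ∧ ¬x.1.IsPrep

/-- The 1-ECs that have been applied last to the blocks are in different places, before `off`. -/
def LeadOk (s : Scheme 𝒢) (lead : W → ℕ) (off n : ℕ) (L : List (Loc 𝒢 W)) : Prop :=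
  (∀ w, Active L n w → lead w + s.ec.length ≤ off) ∧
    ∀ w w', Active L n w → Active L n w' → w ≠ w' → Disjoint (s.ecSet (lead w)) (s.ecSet (lead w'))

variable {S : Finset ℕ} {tg : ℕ → Tag W} {lead : W → ℕ} {off n : ℕ} {l : Loc 𝒢 W}
  {L : List (Loc 𝒢 W)}

theorem active_cons_of_touches {a : Fin l.arity} (h : ¬l.IsPrep) : Active (l :: L) n (l.wires a) :=
  ⟨(l, n), by rw [List.zipIdx_cons, wireList_cons_of_touches (x := (l, n)) ⟨a, rfl⟩, List.head?_cons], h⟩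

theorem Active.cons_of_not_touches {w : W} (hw : ¬l.Touches w) (h : Active L (n + 1) w) :
    Active (l :: L) n w := by
  rwa [Active, List.zipIdx_cons, wireList_cons_of_not_touches hw]

theorem not_isMeas_of_mem {A : Set W} (hL : WellFormed A (l :: L)) {a : Fin l.arity}
    {q : Loc 𝒢 W × ℕ} (hq : (wireList (l.wires a) (L.zipIdx (n + 1))).head? = some q) :
    ¬l.IsMeas := fun hm => by
  obtain ⟨hqL, i, hi⟩ := mem_wireList_zipIdx (List.mem_of_head? hq)
  cases l with
  | prep v => exact hm
  | gate g e => exact hm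
  | meas v => exact hL.2.1 _ hqL i hi

/-- The trailing 1-ECs of a rectangle take disjoint intervals of fresh labels, and untouched wires
keep theirs. Only active wires are considered, because before a preparation the value of `lead` has
no meaning. -/
theorem LeadOk.tail {A : Set W} (hL : WellFormed A (l :: L)) (h : s.LeadOk lead off n (l :: L)) :
    s.LeadOk (s.nextLead l off lead) (off + (s.encodeLoc l).length) (n + 1) L := by
  have key : ∀ w, Active L (n + 1) w →
      (∃ a, l.wires a = w ∧ s.nextLead l off lead w = s.ecOff l off a ∧ ¬l.IsMeas) ∨
      (Active (l :: L) n w ∧ s.nextLead l off lead w = lead w) := by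
    intro w hw
    by_cases ht : l.Touches w
    · obtain ⟨a, rfl⟩ := ht
      obtain ⟨q, hq, -⟩ := hw
      exact Or.inl ⟨a, rfl, nextLead_wires _ _ _ a, not_isMeas_of_mem hL hq⟩
    · exact Or.inr ⟨hw.cons_of_not_touches ht, nextLead_of_not_touches ht _ _⟩
  constructor
  · intro w hw
    rcases key w hw with ⟨a, -, ha, hm⟩ | ⟨hw', ha⟩
    · rw [ha, length_encodeLoc, if_neg hm, ecOff]
      have : (a + 1) * s.ec.length ≤ l.arity * s.ec.length := Nat.mul_le_mul_right _ a.2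
      rw [add_mul, one_mul] at this
      omega
    · rw [ha]
      exact (h.1 w hw').trans (Nat.le_add_right _ _)
  · intro w w' hw hw' hne
    refine Finset.disjoint_left.2 fun m hm hm' => ?_
    rcases key w hw with ⟨a, hwa, ha, hml⟩ | ⟨hA, ha⟩ <;>
      rcases key w' hw' with ⟨b, hwb, hb, hml'⟩ | ⟨hB, hb⟩ <;> rw [ha] at hm <;> rw [hb] at hm'
    · exact hne (by rw [← hwa, ← hwb, eq_of_mem_ecOff hm hm'])
    · have := bounds_of_mem_ecOff hml hm
      have := h.1 w' hB
      rw [mem_ecSet] at hm'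
      omega
    · have := bounds_of_mem_ecOff hml' hm'
      have := h.1 w hA
      rw [mem_ecSet] at hm
      omega
    · exact Finset.disjoint_left.1 (h.2 w w' hA hB hne) hm hm'

theorem leadOk_of_wellFormed (hL : WellFormed ∅ L) : s.LeadOk lead off n L := by
  have : ∀ w, ¬Active L n w := fun w ⟨x, hx, hp⟩ => hp (head_isPrep hL (Set.notMem_empty _) hx)
  exact ⟨fun w h => (this w h).elim, fun w _ h => (this w h).elim⟩

theorem LeadOk.lt_of_mem_leadSet (h : s.LeadOk lead off n (l :: L)) {m : ℕ}
    (hm : m ∈ s.leadSet l lead) : m < off := by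
  obtain ⟨hp, a, ha⟩ := mem_leadSet.1 hm
  have := h.1 _ (active_cons_of_touches (a := a) hp)
  rw [mem_ecSet] at ha
  omega

theorem le_of_mem_trailSet {pend : W → Prop} {m : ℕ} (hm : m ∈ s.trailSet l off pend) :
    off + (s.gaOf l).length ≤ m ∧ m < off + (s.encodeLoc l).length := by
  obtain ⟨hl, a, -, ha⟩ := mem_trailSet.1 hm
  exact bounds_of_mem_ecOff hl ha

theorem LeadOk.lt_of_mem_exSet (h : s.LeadOk lead off n (l :: L)) {pend : W → Prop} {m : ℕ}
    (hm : m ∈ s.exSet l off lead pend) : m < off + (s.encodeLoc l).length := by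
  rcases mem_exSet.1 hm with hm | hm | hm
  · exact (h.lt_of_mem_leadSet hm).trans_le (Nat.le_add_right _ _)
  · rw [mem_gaSet] at hm
    rw [length_encodeLoc]
    omega
  · exact (le_of_mem_trailSet hm).2

/-- Leading 1-ECs, 1-Ga and trailing 1-ECs occupy disjoint sets of labels, so counting faults piece
by piece counts none twice. -/
theorem card_inter_exSet (h : s.LeadOk lead off n (l :: L)) {t : Tag W} (ht : t.off = off)
    (ht' : t.lead = lead) : s.faultCount S l t = (S ∩ s.exSet l off lead t.pend).card := by
  subst ht ht'
  have h₁ : Disjoint (s.leadSet l t.lead) (s.gaSet l t.off) := Finset.disjoint_left.2 fun m hm hm' => by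
    have := h.lt_of_mem_leadSet hm
    rw [mem_gaSet] at hm'
    omega
  have h₂ : Disjoint (s.leadSet l t.lead ∪ s.gaSet l t.off) (s.trailSet l t.off t.pend) :=
    Finset.disjoint_left.2 fun m hm hm' => by
      have := le_of_mem_trailSet hm'
      rcases Finset.mem_union.1 hm with hm | hm
      · have := h.lt_of_mem_leadSet hm
        omega
      · rw [mem_gaSet] at hm
        omega
  rw [exSet, Finset.inter_union_distrib_left, Finset.card_union_of_disjoint
      (h₂.mono Finset.inter_subset_right Finset.inter_subset_right),
    Finset.inter_union_distrib_left, Finset.card_union_of_disjoint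
      (h₁.mono Finset.inter_subset_right Finset.inter_subset_right), faultCount, gaSet, ← cnt_eq]
  congr 1
  · congr 1
    rw [leadSet]
    split_ifs with hp
    · simp
    · rw [Finset.inter_biUnion, Finset.card_biUnion]
      · exact Finset.sum_congr rfl fun a _ => cnt_eq _ _ _
      · intro a _ b _ hab
        exact (h.2 _ _ (active_cons_of_touches hp) (active_cons_of_touches hp)
          fun h => hab (l.wires.injective h)).mono Finset.inter_subset_right
            Finset.inter_subset_right
  · rw [trailSet]
    split_ifs with hm
    · simp
    · rw [Finset.inter_biUnion, Finset.card_biUnion]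
      · refine Finset.sum_congr rfl fun a _ => ?_
        split_ifs
        · simp
        · exact cnt_eq _ _ _
      · intro a _ b _ hab
        refine Finset.disjoint_left.2 fun m hma hmb => ?_
        have hma := (Finset.mem_inter.1 hma).2
        have hmb := (Finset.mem_inter.1 hmb).2
        split_ifs at hma hmb
        all_goals first | exact absurd hma (Finset.notMem_empty _) | exact absurd hmb (Finset.notMem_empty _) | exact hab (eq_of_mem_ecOff hma hmb)

/-- The labels of the extended rectangle of a location. -/
noncomputable def labels (s : Scheme 𝒢) (tg : ℕ → Tag W) (x : Loc 𝒢 W × ℕ) : Finset ℕ :=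
  s.exSet x.1 (tg x.2).off (tg x.2).lead (tg x.2).pend

theorem IsTagging.faultCount_eq (h : s.IsTagging S tg lead off n L) {A : Set W}
    (hL : WellFormed A L) (hok : s.LeadOk lead off n L) :
    ∀ x ∈ L.zipIdx n, s.faultCount S x.1 (tg x.2) = (S ∩ s.labels tg x).card := by
  induction L generalizing lead off n A with
  | nil => simp
  | cons l L ih =>
    obtain ⟨h₁, h₂, h₃, h₄, h₅⟩ := h
    rw [List.zipIdx_cons]
    refine List.forall_mem_cons.2 ⟨?_, ih h₅ hL.tail (hok.tail hL)⟩
    rw [card_inter_exSet hok h₁ h₂, labels, h₁, h₂]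

/-- A rectangle of the remaining circuit reaches back before `off` only through its leading 1-ECs,
on wires where it comes first. -/
theorem IsTagging.mem_labels (h : s.IsTagging S tg lead off n L) :
    ∀ x ∈ L.zipIdx n, ∀ m ∈ s.labels tg x, off ≤ m ∨
      ∃ w, (wireList w (L.zipIdx n)).head? = some x ∧ ¬x.1.IsPrep ∧ m ∈ s.ecSet (lead w) := by
  induction L generalizing lead off n with
  | nil => simp
  | cons l L ih =>
    obtain ⟨h₁, h₂, h₃, h₄, h₅⟩ := h
    rw [List.zipIdx_cons]
    refine List.forall_mem_cons.2 ⟨fun m hm => ?_, fun x hx m hm => ?_⟩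
    · replace hm : m ∈ s.exSet l off lead (tg n).pend := by
        rw [labels, h₁, h₂] at hm
        exact hm
      rcases mem_exSet.1 hm with hm | hm | hm
      · obtain ⟨hp, a, ha⟩ := mem_leadSet.1 hm
        exact Or.inr ⟨_, by rw [wireList_cons_of_touches (x := (l, n)) ⟨a, rfl⟩, List.head?_cons], hp, ha⟩
      · exact Or.inl (mem_gaSet.1 hm).1
      · exact Or.inl (by have := le_of_mem_trailSet hm; omega)
    · rcases ih h₅ x hx m hm with hm | ⟨w, hw, hp, hm⟩
      · exact Or.inl (by omega)
      · by_cases ht : l.Touches w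
        · obtain ⟨a, rfl⟩ := ht
          rw [nextLead_wires, mem_ecSet, ecOff] at hm
          exact Or.inl (by omega)
        · rw [nextLead_of_not_touches ht] at hm
          exact Or.inr ⟨w, by rwa [wireList_cons_of_not_touches ht], hp, hm⟩

/-- Two extended rectangles can share labels only in a 1-EC between consecutive locations on a wire.
If the later one is bad, this 1-EC is pending for the earlier one and was removed from it. Badness
of the earlier one plays no role. -/
theorem IsTagging.pairwise_disjoint (h : s.IsTagging S tg lead off n L) {A : Set W}
    (hL : WellFormed A L) (hok : s.LeadOk lead off n L) :
    (L.zipIdx n).Pairwise fun x y => (tg y.2).bad → Disjoint (s.labels tg x) (s.labels tg y) := by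
  induction L generalizing lead off n A with
  | nil => simp
  | cons l L ih =>
    have h' := h
    obtain ⟨h₁, h₂, h₃, h₄, h₅⟩ := h
    rw [List.zipIdx_cons]
    refine List.pairwise_cons.2 ⟨fun x hx hb => Finset.disjoint_left.2 fun m hm hm' => ?_,
      ih h₅ hL.tail (hok.tail hL)⟩
    replace hm : m ∈ s.exSet l off lead (tg n).pend := by
      rw [labels, h₁, h₂] at hm
      exact hm
    rcases h₅.mem_labels x hx m hm' with hoff | ⟨w, hw, hp, hmw⟩
    · have := hok.lt_of_mem_exSet hm
      omega
    · by_cases ht : l.Touches w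
      · obtain ⟨a, rfl⟩ := ht
        -- The shared 1-EC is pending, so it is missing from the trailing set of `l`.
        have hpend : (tg n).pend (l.wires a) := (h₃ _).2 ⟨x, hw, hp, hb⟩
        rw [nextLead_wires] at hmw
        have hmeas := not_isMeas_of_mem hL hw
        have hbound := bounds_of_mem_ecOff hmeas hmw
        rcases mem_exSet.1 hm with hm | hm | hm
        · have := hok.lt_of_mem_leadSet hm
          omega
        · rw [mem_gaSet] at hm
          omega
        · obtain ⟨-, b, hb, hm⟩ := mem_trailSet.1 hm
          rw [eq_of_mem_ecOff hm hmw] at hb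
          exact hb hpend
      · have hact : Active (l :: L) n w := Active.cons_of_not_touches ht ⟨x, hw, hp⟩
        rw [nextLead_of_not_touches ht] at hmw
        have hlt := hok.1 w hact
        have hmw' := mem_ecSet.1 hmw
        rcases mem_exSet.1 hm with hm | hm | hm
        · obtain ⟨hlp, a, ha⟩ := mem_leadSet.1 hm
          exact Finset.disjoint_left.1 (hok.2 _ w (active_cons_of_touches (a := a) hlp) hact
            fun h => ht ⟨a, h⟩) ha hmw
        · rw [mem_gaSet] at hm
          omega
        · have := le_of_mem_trailSet hm
          omega

theorem IsTagging.off_lead_eq {S' : Finset ℕ} {tg' : ℕ → Tag W}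
    (h : s.IsTagging S tg lead off n L) (h' : s.IsTagging S' tg' lead off n L) :
    ∀ x ∈ L.zipIdx n, (tg x.2).off = (tg' x.2).off ∧ (tg x.2).lead = (tg' x.2).lead := by
  induction L generalizing lead off n with
  | nil => simp
  | cons l L ih =>
    rw [List.zipIdx_cons]
    exact List.forall_mem_cons.2 ⟨⟨h.1.trans h'.1.symm, h.2.1.trans h'.2.1.symm⟩,
      ih h.2.2.2.2 h'.2.2.2.2⟩

/-- Every bad location comes with a pair of faults, these pairs are disjoint, and there are at most
`maxPairs` candidates for each of them. -/
theorem exists_pairs (hL : WellFormed ∅ L) (lead : W → ℕ) : ∃ X : ℕ → Finset (Finset ℕ),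
    (∀ i, (X i).card ≤ s.maxPairs) ∧ (∀ i, ∀ t ∈ X i, t.card = 2) ∧
      ∀ S tg, s.IsTagging S tg lead 0 0 L → ∃ c : ℕ → Finset ℕ, ∀ i < L.length, (tg i).bad →
        c i ∈ X i ∧ c i ⊆ S ∧ ∀ j < L.length, j ≠ i → (tg j).bad → Disjoint (c i) (c j) := by
  obtain ⟨tg₀, htg₀⟩ := exists_isTagging (s := s) ∅ lead 0 0 L
  -- The candidates must not depend on the fault set. The truncation does, so pairs are taken from
  -- the full extended rectangle; its position does not, so a tagging for the empty fault set may be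
  -- used.
  refine ⟨fun i => if h : i < L.length then
    (s.exSet L[i] (tg₀ i).off (tg₀ i).lead fun _ => False).powersetCard 2 else ∅,
    fun i => ?_, fun i t ht => ?_, fun S tg htg => ?_⟩
  · simp only
    split_ifs
    · rw [Finset.card_powersetCard]
      exact choose_card_exSet_le _ _ _ _
    · simp
  · simp only at ht
    split_ifs at ht
    · exact (Finset.mem_powersetCard.1 ht).2
    · simp at ht
  · have hok : s.LeadOk lead 0 0 L := leadOk_of_wellFormed hL
    have hmem : ∀ i (hi : i < L.length), (L[i], i) ∈ L.zipIdx 0 := fun i hi => by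
      rw [List.mem_zipIdx_iff_getElem?, List.getElem?_eq_getElem hi]
    have hex : ∀ i, ∃ t : Finset ℕ, ∀ hi : i < L.length, (tg i).bad →
        t ⊆ S ∩ s.labels tg (L[i], i) ∧ t.card = 2 := by
      intro i
      by_cases hi : i < L.length ∧ (tg i).bad
      · have h₁ := (htg.bad_iff _ (hmem i hi.1)).1 hi.2
        rw [htg.faultCount_eq hL hok _ (hmem i hi.1)] at h₁
        obtain ⟨t, ht⟩ := Finset.exists_subset_card_eq h₁
        exact ⟨t, fun _ _ => ht⟩
      · exact ⟨∅, fun h₁ h₂ => (hi ⟨h₁, h₂⟩).elim⟩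
    choose c hc using hex
    have hdisj : ∀ i j, i < j → ∀ hj : j < L.length, ∀ hi : i < L.length, (tg i).bad → (tg j).bad →
        Disjoint (c i) (c j) := by
      intro i j hij hj hi hbi hbj
      have hp := List.pairwise_iff_getElem.1 (htg.pairwise_disjoint hL hok) i j (by simpa using hi)
        (by simpa using hj) hij
      simp only [List.getElem_zipIdx, zero_add] at hp
      exact (hp hbj).mono ((hc i hi hbi).1.trans Finset.inter_subset_right)
        ((hc j hj hbj).1.trans Finset.inter_subset_right)
    refine ⟨c, fun i hi hb => ⟨?_, (hc i hi hb).1.trans Finset.inter_subset_left,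
      fun j hj hne hbj => ?_⟩⟩
    · simp only [dif_pos hi]
      refine Finset.mem_powersetCard.2 ⟨((hc i hi hb).1.trans Finset.inter_subset_right).trans ?_,
        (hc i hi hb).2⟩
      have := htg.off_lead_eq htg₀ _ (hmem i hi)
      rw [← this.1, ← this.2]
      exact exSet_subset _ _ _ _
    · rcases lt_or_gt_of_ne hne with h | h
      · exact (hdisj j i h hi hj hbj hb).symm
      · exact hdisj i j h hj hi hb hbj

end Scheme

/-! ### Local stochastic noise -/

section Noise

variable {ι : Type*}

/-- The random set `B` contains a given set of `n` elements with probability at most `ε ^ n`. -/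
def LocallyStochastic (E : Finset ι) (μ : ι → ℝ) (B : ι → Finset ℕ) (ε : ℝ) : Prop :=
  ∀ T : Finset ℕ, (∑ S ∈ E, if T ⊆ B S then μ S else 0) ≤ ε ^ T.card

/-- If all of `T` is bad, then for some choice of one candidate pair per element of `T`, all the
chosen pairs are faulty. There are at most `A ^ |T|` choices, and a choice of disjoint pairs
prescribes `2 |T|` faults, which has probability at most `ε ^ (2 |T|)`. -/
theorem LocallyStochastic.pairs {E : Finset ι} {μ : ι → ℝ} (hμ : ∀ S ∈ E, 0 ≤ μ S)
    {B B' : ι → Finset ℕ} {ε : ℝ} (hB : LocallyStochastic E μ B ε)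
    {X : ℕ → Finset (Finset ℕ)} {A : ℕ} (hX : ∀ i, (X i).card ≤ A) (hX₂ : ∀ i, ∀ t ∈ X i, t.card = 2)
    (h : ∀ S ∈ E, ∃ c : ℕ → Finset ℕ, ∀ i ∈ B' S, c i ∈ X i ∧ c i ⊆ B S ∧
      ∀ j ∈ B' S, j ≠ i → Disjoint (c i) (c j)) :
    LocallyStochastic E μ B' (A * ε ^ 2) := by
  classical
  intro T
  set U : ((i : ℕ) → i ∈ T → Finset ℕ) → Finset ℕ := fun p => T.attach.biUnion fun i => p i i.2
    with hU
  -- Only families of disjoint pairs are kept: overlapping pairs would prescribe fewer than `2 |T|`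
  -- faults.
  set C := (T.pi X).filter fun p => ∀ i j : T, i ≠ j → Disjoint (p i i.2) (p j j.2) with hC
  have hcard : ∀ p ∈ C, (U p).card = 2 * T.card := by
    intro p hp
    obtain ⟨hp, hd⟩ := Finset.mem_filter.1 hp
    rw [hU]
    simp only
    rw [Finset.card_biUnion fun i _ j _ hij => hd i j hij,
      Finset.sum_congr rfl fun (i : T) _ => hX₂ i _ (Finset.mem_pi.1 hp i i.2), Finset.sum_const,
      Finset.card_attach, smul_eq_mul, mul_comm]
  have hle : ∀ S ∈ E, (if T ⊆ B' S then μ S else 0) ≤ ∑ p ∈ C, if U p ⊆ B S then μ S else 0 := by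
    intro S hS
    have hnn : ∀ p ∈ C, (0 : ℝ) ≤ if U p ⊆ B S then μ S else 0 := fun p _ => by
      split_ifs
      · exact hμ S hS
      · exact le_rfl
    split_ifs with hT
    · obtain ⟨c, hc⟩ := h S hS
      have hmem : (fun i (_ : i ∈ T) => c i) ∈ C := by
        refine Finset.mem_filter.2 ⟨Finset.mem_pi.2 fun i hi => (hc i (hT hi)).1, fun i j hij => ?_⟩
        exact (hc i (hT i.2)).2.2 j (hT j.2) fun h => hij (Subtype.ext h.symm)
      refine le_trans (le_of_eq ?_) (Finset.single_le_sum hnn hmem)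
      rw [if_pos]
      exact Finset.biUnion_subset.2 fun i _ => (hc i (hT i.2)).2.1
    · exact Finset.sum_nonneg hnn
  have hCle : (C.card : ℝ) ≤ (A : ℝ) ^ T.card := by
    have : C.card ≤ A ^ T.card := by
      refine (Finset.card_filter_le _ _).trans ?_
      rw [Finset.card_pi]
      exact Finset.prod_le_pow_card _ _ _ fun i _ => hX i
    exact_mod_cast this
  have hε2 : (0 : ℝ) ≤ (ε ^ 2) ^ T.card := pow_nonneg (sq_nonneg ε) _
  calc (∑ S ∈ E, if T ⊆ B' S then μ S else 0)
      ≤ ∑ S ∈ E, ∑ p ∈ C, if U p ⊆ B S then μ S else 0 := Finset.sum_le_sum hle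
    _ = ∑ p ∈ C, ∑ S ∈ E, if U p ⊆ B S then μ S else 0 := Finset.sum_comm
    _ ≤ ∑ p ∈ C, (ε ^ 2) ^ T.card := Finset.sum_le_sum fun p hp => by
        refine (hB (U p)).trans (le_of_eq ?_)
        rw [hcard p hp, pow_mul]
    _ = C.card * (ε ^ 2) ^ T.card := by rw [Finset.sum_const, nsmul_eq_mul]
    _ ≤ (A : ℝ) ^ T.card * (ε ^ 2) ^ T.card := mul_le_mul_of_nonneg_right hCle hε2
    _ = (A * ε ^ 2) ^ T.card := (mul_pow _ _ _).symm

/-- For independent faults the bound is an equality when `T` consists of locations: the remaining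
ones contribute the full binomial sum `(ε + (1 - ε)) ^ (n - |T|) = 1`. -/
theorem locallyStochastic_powerset {n : ℕ} {ε : ℝ} (hε : 0 ≤ ε) :
    LocallyStochastic (Finset.range n).powerset
      (fun S => ε ^ S.card * (1 - ε) ^ (n - S.card)) id ε := by
  intro T
  by_cases hT : T ⊆ Finset.range n
  · rw [← Finset.sum_filter]
    have hset : (Finset.range n).powerset.filter (fun S => T ⊆ id S) =
        (Finset.range n \ T).powerset.image (T ∪ ·) := by
      rw [← Finset.Icc_eq_image_powerset hT]
      ext S
      simp [and_comm]
    have hdisj : ∀ S ∈ (Finset.range n \ T).powerset, Disjoint T S := fun S hS =>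
      (Finset.disjoint_sdiff).mono_right (Finset.mem_powerset.1 hS)
    have hn : (Finset.range n \ T).card = n - T.card := by
      rw [Finset.card_sdiff_of_subset hT, Finset.card_range]
    rw [hset, Finset.sum_image]
    · have h := Finset.sum_pow_mul_eq_add_pow ε (1 - ε) (Finset.range n \ T)
      rw [add_sub_cancel, one_pow, hn] at h
      refine le_of_eq ?_
      calc _ = ∑ S ∈ (Finset.range n \ T).powerset,
            ε ^ T.card * (ε ^ S.card * (1 - ε) ^ (n - T.card - S.card)) := by
            refine Finset.sum_congr rfl fun S hS => ?_
            rw [Finset.card_union_of_disjoint (hdisj S hS), pow_add, Nat.sub_sub, mul_assoc]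
        _ = _ := by rw [← Finset.mul_sum, h, mul_one]
    · intro S hS S' hS' hSS'
      have := congrArg (· \ T) hSS'
      simpa [Finset.union_sdiff_cancel_left (hdisj S hS),
        Finset.union_sdiff_cancel_left (hdisj S' hS')] using this
  · refine le_trans (le_of_eq (Finset.sum_eq_zero fun S hS => if_neg fun h => hT ?_))
      (pow_nonneg hε _)
    exact h.trans (Finset.mem_powerset.1 hS)

end Noise

namespace Scheme

variable {𝒢 : GateSet} {s : Scheme 𝒢} {W : Type} [Fintype W] [DecidableEq W]

/-! ### The threshold theorem -/

/-- Tags for the extended rectangles of a circuit. -/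
noncomputable def tagging (s : Scheme 𝒢) (L : List (Loc 𝒢 W)) (S : Finset ℕ) : ℕ → Tag W :=
  (exists_isTagging (s := s) S (fun _ => 0) 0 0 L).choose

theorem isTagging_tagging (L : List (Loc 𝒢 W)) (S : Finset ℕ) :
    s.IsTagging S (s.tagging L S) (fun _ => 0) 0 0 L :=
  (exists_isTagging S (fun _ => 0) 0 0 L).choose_spec

open Classical in
/-- The locations with bad extended rectangles. -/
noncomputable def badSet (s : Scheme 𝒢) (L : List (Loc 𝒢 W)) (S : Finset ℕ) : Finset ℕ :=
  (Finset.range L.length).filter fun i => (s.tagging L S i).bad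

theorem mem_badSet {L : List (Loc 𝒢 W)} {S : Finset ℕ} {i : ℕ} :
    i ∈ s.badSet L S ↔ i < L.length ∧ (s.tagging L S i).bad := by simp [badSet]

theorem locallyStochastic_badSet {ι : Type*} {E : Finset ι} {μ : ι → ℝ} (hμ : ∀ S ∈ E, 0 ≤ μ S)
    {B : ι → Finset ℕ} {ε : ℝ} (hB : LocallyStochastic E μ B ε) {L : List (Loc 𝒢 W)}
    (hL : WellFormed ∅ L) :
    LocallyStochastic E μ (fun S => s.badSet L (B S)) (s.maxPairs * ε ^ 2) := by
  obtain ⟨X, h₁, h₂, h₃⟩ := exists_pairs (s := s) hL fun _ => 0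
  refine hB.pairs hμ h₁ h₂ fun S _ => ?_
  obtain ⟨c, hc⟩ := h₃ _ _ (isTagging_tagging L (B S))
  refine ⟨c, fun i hi => ?_⟩
  obtain ⟨hi, hb⟩ := mem_badSet.1 hi
  obtain ⟨h₄, h₅, h₆⟩ := hc i hi hb
  exact ⟨h₄, h₅, fun j hj hne => h₆ j (mem_badSet.1 hj).1 hne (mem_badSet.1 hj).2⟩

/-- The faulty locations of `M_0` that a set of faulty locations of `M_k` gives rise to. -/
noncomputable def survivors (s : Scheme 𝒢) (M₀ : Circuit 𝒢 W) : ℕ → Finset ℕ → Finset ℕ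
  | 0, S => S
  | k + 1, S => survivors s M₀ k (s.badSet (s.level M₀ k) S)

/-- The recursion `ε ↦ A ε²` becomes squaring for the quantity `A ε`, whence the exponent `2 ^ k`.
-/
theorem locallyStochastic_survivors {ι : Type*} {E : Finset ι} {μ : ι → ℝ}
    (hμ : ∀ S ∈ E, 0 ≤ μ S) (M₀ : Circuit 𝒢 W) (k : ℕ) {B : ι → Finset ℕ} {ε : ℝ}
    (hB : LocallyStochastic E μ B ε) (hA : (s.maxPairs : ℝ) ≠ 0) :
    LocallyStochastic E μ (fun S => s.survivors M₀ k (B S))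
      ((s.maxPairs * ε) ^ 2 ^ k / s.maxPairs) := by
  induction k generalizing B ε with
  | zero =>
    rw [pow_zero, pow_one, mul_div_cancel_left₀ _ hA]
    exact hB
  | succ k ih =>
    have := ih (locallyStochastic_badSet (s := s) hμ hB (wellFormed_level (s := s) M₀ k))
    rw [show (s.maxPairs : ℝ) * (s.maxPairs * ε ^ 2) = (s.maxPairs * ε) ^ 2 by ring, ← pow_mul,
      ← pow_succ'] at this
    exact this

theorem survivors_subset (M₀ : Circuit 𝒢 W) (k : ℕ) {S : Finset ℕ}
    (hS : S ⊆ Finset.range (s.level M₀ k).length) :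
    s.survivors M₀ k S ⊆ Finset.range M₀.locs.length := by
  induction k generalizing S with
  | zero => exact hS
  | succ k ih => exact ih fun i hi => Finset.mem_range.2 (mem_badSet.1 hi).1

theorem levelDec_congr (M₀ : Circuit 𝒢 W) (k : ℕ) {y y' : s.LevelWire W k → Bool}
    (h : ∀ w ∈ measured (s.level M₀ k), y w = y' w) :
    ∀ w ∈ measured M₀.locs, s.levelDec k y w = s.levelDec k y' w := by
  induction k with
  | zero => exact h
  | succ k ih =>
    refine ih fun w hw => s.dec_measured _ _ fun q hq => h _ ?_
    refine mem_measured.2 (List.mem_flatMap.2 ⟨_, mem_measured.1 hw, ?_⟩)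
    exact List.mem_map.2 ⟨_, mem_measured.1 hq, rfl⟩

theorem trace_zeroState (X : Type) [Fintype X] [DecidableEq X] :
    (pureState (zeroVec X)).trace = 1 := by
  rw [trace, Finset.sum_eq_single fun _ => false]
  · simp [pureState, zeroVec, vecMulVec_apply]
  · intro x _ hx
    have : ¬∀ w, x w = false := fun h => hx (funext h)
    simp [pureState, zeroVec, vecMulVec_apply, this]
  · simp

/-- If all faults die out on the way down, `M_0` is run without faults, and each encoding step
transports this outcome probability up by one level. -/
theorem yields_level (hs : s.FaultTolerant) (M₀ : Circuit 𝒢 W) (x : measured M₀.locs → Bool) (k : ℕ)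
    {S : Finset ℕ} (hS : s.survivors M₀ k S = ∅) :
    Yields (s.level M₀ k) S (fun y => ∀ w : measured M₀.locs, s.levelDec k y w = x w)
      (∑ y : W → Bool, if ∀ w : measured M₀.locs, y w = x w then
        run M₀.locs noFault (pureState (zeroVec W)) y y else 0) := by
  induction k generalizing S with
  | zero =>
    obtain rfl : S = ∅ := hS
    exact Yields.of_empty M₀.wf (P := fun y => ∀ w : measured M₀.locs, y w = x w)
      (fun y y' h => forall_congr' fun w => by rw [h w w.2]) (trace_zeroState W)
  | succ k ih =>
    refine (ih hS).encode hs (wellFormed_level M₀ k) (isTagging_tagging _ S)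
      (fun i hi => mem_badSet.trans (and_iff_right hi)) fun y y' h => forall_congr' fun w => ?_
    rw [levelDec_congr M₀ k h w w.2]

/-- The actual run executes the standard order, but with true error channels its result equals that
of the reordered run, which is one of the abstract runs covered by `yields_level`. -/
theorem outcomeProb_eq_idealDist (hs : s.FaultTolerant) (M₀ : Circuit 𝒢 W) (k : ℕ) {S : Finset ℕ}
    (hS : s.survivors M₀ k S = ∅) (err : ℕ → ErrorChoice) (x : measured M₀.locs → Bool) :
    s.outcomeProb M₀ k (run (s.level M₀ k) (faultsAt S err) (pureState (zeroVec _))) x =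
      idealDist M₀ x := by
  obtain ⟨O, hO, h⟩ := yields_level hs M₀ x k hS
  have hzero : pureState (zeroVec (s.LevelWire W k)) ∈ cone Set.univ :=
    pureState_mem_cone (Set.mem_univ _)
  have hreach := reach_runLabelled (S := S) (F := faultsAt S err)
    (fun i => by rw [faultsAt]; split_ifs <;> simp [*]) (O := O) hzero
  have := h _ _ hzero (trace_zeroState _) hreach
  rw [hO.runLabelled_eq, runLabelled_zipIdx] at this
  have hF : (fun i => faultsAt S err (0 + i)) = faultsAt S err := by simp
  rw [hF] at this
  have hre := congrArg Complex.re this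
  rw [Complex.re_sum, Complex.re_sum] at hre
  rw [outcomeProb, idealDist]
  convert hre using 2
  · split_ifs <;> simp
  · split_ifs <;> simp

theorem re_diag_nonneg {X : Type} [Fintype X] [DecidableEq X] {ρ : Matrix X X ℂ}
    (h : ρ ∈ cone Set.univ) (x : X) : 0 ≤ (ρ x x).re := by
  obtain ⟨r, v, -, rfl⟩ := isMixture_iff.2 h
  rw [Matrix.sum_apply, Complex.re_sum]
  refine Finset.sum_nonneg fun j _ => ?_
  rw [pureState, vecMulVec_apply, Pi.star_apply, RCLike.star_def, Complex.mul_conj,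
    Complex.ofReal_re]
  exact Complex.normSq_nonneg _

theorem outcomeProb_nonneg (M₀ : Circuit 𝒢 W) (k : ℕ) {ρ : Op (s.LevelWire W k)}
    (hρ : ρ ∈ cone Set.univ) (x : measured M₀.locs → Bool) : 0 ≤ s.outcomeProb M₀ k ρ x :=
  Finset.sum_nonneg fun y _ => by
    split_ifs
    · exact re_diag_nonneg hρ y
    · exact le_rfl

theorem sum_outcomeProb (M₀ : Circuit 𝒢 W) (k : ℕ) {ρ : Op (s.LevelWire W k)}
    (hρ : ρ.trace = 1) : ∑ x, s.outcomeProb M₀ k ρ x = 1 := by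
  simp only [outcomeProb]
  rw [Finset.sum_comm]
  have : ∀ y : s.LevelWire W k → Bool, (∑ x : measured M₀.locs → Bool,
      if ∀ w : measured M₀.locs, s.levelDec k y w = x w then (ρ y y).re else 0) = (ρ y y).re := by
    intro y
    rw [Finset.sum_eq_single fun w : measured M₀.locs => s.levelDec k y w]
    · simp
    · intro x _ hx
      exact if_neg fun h => hx (funext fun w => (h w).symm)
    · simp
  simp only [this]
  rw [← Complex.re_sum]
  have h := congrArg Complex.re hρ
  simpa [trace] using h

theorem run_mem_cone (ls : List (Loc 𝒢 W)) (F : ℕ → Option ErrorChoice) {ρ : Op W}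
    (hρ : ρ ∈ cone Set.univ) : run ls F ρ ∈ cone Set.univ := by
  rw [run_eq]
  exact kmap_mem_cone (fun _ _ _ _ => Set.mem_univ _) hρ

theorem sum_abs_sub_le {X : Type*} [Fintype X] {p q : X → ℝ} (hp : ∀ x, 0 ≤ p x) (hq : ∀ x, 0 ≤ q x)
    (hp₁ : ∑ x, p x = 1) (hq₁ : ∑ x, q x = 1) : ∑ x, |p x - q x| ≤ 2 := by
  calc ∑ x, |p x - q x| ≤ ∑ x, (p x + q x) := Finset.sum_le_sum fun x _ => by
        rw [abs_le]
        constructor <;> linarith [hp x, hq x]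
    _ = 2 := by rw [Finset.sum_add_distrib, hp₁, hq₁]; norm_num

/-- Fault sets without survivors contribute no error, all others at most 2. The probability that
some location of `M_0` survives is bounded by the sum over its locations. As the estimate is made
for each fault set separately, the errors may depend on the whole set. -/
theorem computationError_le (hs : s.FaultTolerant) (M₀ : Circuit 𝒢 W) (k : ℕ) {ε : ℝ}
    (hε₀ : 0 ≤ ε) (hε₁ : ε ≤ 1) (hA : (s.maxPairs : ℝ) ≠ 0) (err : Finset ℕ → ℕ → ErrorChoice) :
    s.computationError M₀ k ε err ≤
      2 * M₀.locs.length * ((s.maxPairs * ε) ^ 2 ^ k / s.maxPairs) := by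
  set N := (s.level M₀ k).length with hN
  set μ : Finset ℕ → ℝ := fun S => ε ^ S.card * (1 - ε) ^ (N - S.card) with hμ
  set p : Finset ℕ → (measured M₀.locs → Bool) → ℝ := fun S x => s.outcomeProb M₀ k
    (run (s.level M₀ k) (faultsAt S (err S)) (pureState (zeroVec _))) x with hp
  have hμ₀ : ∀ S, 0 ≤ μ S := fun S =>
    mul_nonneg (pow_nonneg hε₀ _) (pow_nonneg (sub_nonneg.2 hε₁) _)
  have hμ₁ : ∑ S ∈ (Finset.range N).powerset, μ S = 1 := by
    have := Finset.sum_pow_mul_eq_add_pow ε (1 - ε) (Finset.range N)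
    rw [add_sub_cancel, one_pow, Finset.card_range] at this
    exact this
  have hloc := locallyStochastic_survivors (s := s) (fun S _ => hμ₀ S) M₀ k
    (locallyStochastic_powerset (n := N) hε₀) hA
  have hzero : ∀ (X : Type) [Fintype X] [DecidableEq X], pureState (zeroVec X) ∈ cone Set.univ :=
    fun X _ _ => pureState_mem_cone (Set.mem_univ _)
  have htrace : ∀ (X : Type) [Fintype X] [DecidableEq X] (ls : List (Loc 𝒢 X)) (F),
      (run ls F (pureState (zeroVec X))).trace = 1 := fun X _ _ ls F => by
    rw [run_eq, trace_kmap (complete_runKraus ls F), trace_zeroState]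
  have hdist : ∀ S, ∑ x, |p S x - idealDist M₀ x| ≤
      if s.survivors M₀ k S = ∅ then 0 else 2 := by
    intro S
    split_ifs with hS
    · refine le_of_eq (Finset.sum_eq_zero fun x _ => ?_)
      rw [hp]
      simp only
      rw [outcomeProb_eq_idealDist hs M₀ k hS, sub_self, abs_zero]
    · refine sum_abs_sub_le (fun x => ?_) (fun x => ?_) ?_ ?_
      · exact outcomeProb_nonneg _ _ (run_mem_cone _ _ (hzero _)) _
      · exact outcomeProb_nonneg (s := s) M₀ 0 (run_mem_cone _ _ (hzero W)) x
      · exact sum_outcomeProb _ _ (htrace _ _ _)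
      · exact sum_outcomeProb (s := s) M₀ 0 (htrace W _ _)
  -- Union bound: a nonempty set of survivors contains some location of `M_0`.
  have hunion : ∀ S ∈ (Finset.range N).powerset, μ S * (if s.survivors M₀ k S = ∅ then 0 else 2) ≤
      ∑ i ∈ Finset.range M₀.locs.length, 2 * if {i} ⊆ s.survivors M₀ k S then μ S else 0 := by
    intro S hS
    have hnn : ∀ i ∈ Finset.range M₀.locs.length,
        (0 : ℝ) ≤ 2 * if {i} ⊆ s.survivors M₀ k S then μ S else 0 := fun i _ => by
      split_ifs
      · exact mul_nonneg zero_le_two (hμ₀ S)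
      · simp
    split_ifs with hS'
    · rw [mul_zero]
      exact Finset.sum_nonneg hnn
    · obtain ⟨i, hi⟩ := Finset.nonempty_iff_ne_empty.2 hS'
      refine le_trans (le_of_eq ?_) (Finset.single_le_sum hnn
        (survivors_subset M₀ k (Finset.mem_powerset.1 hS) hi))
      rw [if_pos (Finset.singleton_subset_iff.2 hi), mul_comm]
  calc s.computationError M₀ k ε err
      = ∑ x, |∑ S ∈ (Finset.range N).powerset, μ S * (p S x - idealDist M₀ x)| := by
        refine Finset.sum_congr rfl fun x _ => ?_
        simp only [mul_sub]
        rw [Finset.sum_sub_distrib, ← Finset.sum_mul, hμ₁, one_mul]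
        rfl
    _ ≤ ∑ x, ∑ S ∈ (Finset.range N).powerset, μ S * |p S x - idealDist M₀ x| :=
        Finset.sum_le_sum fun x _ => (Finset.abs_sum_le_sum_abs _ _).trans
          (le_of_eq (Finset.sum_congr rfl fun S _ => by rw [abs_mul, abs_of_nonneg (hμ₀ S)]))
    _ = ∑ S ∈ (Finset.range N).powerset, μ S * ∑ x, |p S x - idealDist M₀ x| := by
        rw [Finset.sum_comm]
        exact Finset.sum_congr rfl fun S _ => (Finset.mul_sum _ _ _).symm
    _ ≤ ∑ S ∈ (Finset.range N).powerset, ∑ i ∈ Finset.range M₀.locs.length,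
          2 * if {i} ⊆ s.survivors M₀ k S then μ S else 0 :=
        Finset.sum_le_sum fun S hS =>
          (mul_le_mul_of_nonneg_left (hdist S) (hμ₀ S)).trans (hunion S hS)
    _ = ∑ i ∈ Finset.range M₀.locs.length, 2 * ∑ S ∈ (Finset.range N).powerset,
          if {i} ⊆ s.survivors M₀ k S then μ S else 0 := by
        rw [Finset.sum_comm]
        exact Finset.sum_congr rfl fun i _ => (Finset.mul_sum _ _ _).symm
    _ ≤ ∑ i ∈ Finset.range M₀.locs.length, 2 * ((s.maxPairs * ε) ^ 2 ^ k / s.maxPairs) :=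
        Finset.sum_le_sum fun i _ => mul_le_mul_of_nonneg_left (by
          have := hloc {i}
          rw [Finset.card_singleton, pow_one] at this
          exact this) zero_le_two
    _ = _ := by rw [Finset.sum_const, Finset.card_range, nsmul_eq_mul]; ring

end Scheme
end FTQC

theorem mainTheorem1 (𝒢 : FTQC.GateSet) (s : FTQC.Scheme 𝒢) (hs : s.FaultTolerant)
    (ε : ℝ) (hε₀ : 0 ≤ ε) (hε : ε < 1 / (s.maxPairs : ℝ))
    {W : Type} [Fintype W] [DecidableEq W] (M₀ : FTQC.Circuit 𝒢 W) (δ : ℝ) (hδ : 0 < δ) :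
    ∃ k : ℕ, ∀ err : Finset ℕ → ℕ → FTQC.ErrorChoice, s.computationError M₀ k ε err ≤ δ := by
  -- If `A` were zero, the bound `1 / A` would be zero by convention and no `ε ≥ 0` could lie below
  -- it.
  have hA : (0 : ℝ) < s.maxPairs := one_div_pos.1 (hε₀.trans_lt hε)
  have hA₁ : (1 : ℝ) ≤ s.maxPairs := by exact_mod_cast Nat.cast_pos.1 hA
  have hε₁ : ε ≤ 1 := hε.le.trans ((div_le_one hA).2 hA₁)
  have hlt : s.maxPairs * ε < 1 := by rwa [mul_comm, ← lt_div_iff₀ hA]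
  have hlim : Filter.Tendsto (fun k : ℕ => 2 * (M₀.locs.length : ℝ) *
      ((s.maxPairs * ε) ^ 2 ^ k / s.maxPairs)) Filter.atTop (nhds 0) := by
    -- As `A ε < 1`, its powers tend to zero, in particular along the exponents `2 ^ k`.
    have h := (tendsto_pow_atTop_nhds_zero_of_lt_one (mul_nonneg hA.le hε₀) hlt).comp
      (tendsto_pow_atTop_atTop_of_one_lt (one_lt_two (α := ℕ)))
    simpa using (h.div_const (s.maxPairs : ℝ)).const_mul (2 * (M₀.locs.length : ℝ))
  obtain ⟨k, hk⟩ := (hlim.eventually (gt_mem_nhds hδ)).exists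
  exact ⟨k, fun err => (FTQC.Scheme.computationError_le hs M₀ k hε₀ hε₁ hA.ne' err).trans hk.le⟩
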